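/- Write $\mathbb{T}^2=\mathbb{R}^2/\mathbb{Z}^2$, identify functions and distributions on $\mathbb{T}^2\times\mathbb{R}$ with those on $\mathbb{R}^2\times\mathbb{R}$ that are $\mathbb{Z}^2$-periodic in space, and put $|(x,t)|_{\mathfrak s}=|x|+|t|^{1/2}$. For $\gamma\in(0,1)$ let $C^\gamma(\mathbb{T}^2\times[0,T])$ be the closure of the smooth functions under the norm $\sup_{z\ne z'}|f(z)-f(z')|/|z-z'|_{\mathfrak s}^{\gamma}+\sup_z|f(z)|$. For $\alpha<0$ and $B\subset\mathbb{R}^3$ let $$\|F\|_{C^\alpha(B)}=\sup_{z\in B}\ \sup_{r\in(0,1)}\ \sup_{\rho}\ r^{-\alpha}|\langle F,\rho_z^r\rangle|,\qquad \rho^r_{(x,t)}(y,s)=r^{-4}\rho\big(r^{-1}(y-x),r^{-2}(s-t)\big),$$ where $\rho$ ranges over the smooth functions compactly supported in the open unit ball of $\mathbb{R}^3$ with $|\rho|<1$ and $|\nabla\rho|<1$. Let $C^\alpha(\mathbb{T}^2\times\mathbb{R})$ be the space of spatially periodic distributions in the closure of $C_c^\infty(\mathbb{R}^3)$ under the seminorms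 $\|\cdot\|_{C^\alpha((-N,N+1)^3)}$, $N\in\mathbb{N}$. **Theorem.** There is $p_0$ such that for every even integer $p\ge p_0$ there is $\alpha_0=\alpha_0(p)>0$ such that for all $\alpha\in(-\alpha_0,0)$, all $0<\lambda\le\Lambda$, and all $T,M>0$ there is a constant $C>0$, depending only on these data, with the following property. Let $A:\mathbb{R}^{2}\times\mathbb{R}\to\mathbb{R}^{2\times2}$ be $\mathbb{Z}^3$-periodic, $\theta$-Hölder continuous with respect to $|\cdot|_{\mathfrak s}$ for some $\theta\in(0,1)$, and uniformly elliptic: $\lambda|\zeta|^2\le\zeta\cdot A(z)\zeta$ and $|A(z)|\le\Lambda$ for all $z,\zeta$. Let $\varepsilon\in(0,1]$, $\gamma\in(-\alpha,1)$, $T'\in(0,T]$, and let $X_1,X_2,X_3\in C^\alpha(\mathbb{T}^2\times\mathbb{R})$ satisfy $\|X_i\|_{C^\alpha(\mathbb{T}^2\times(-1,T+1))}<M$ for $i=1,2,3$. If $w\in C^\gamma(\mathbb{T}^2\times[0,T'])$ is a weak solution on $\mathbb{R}^2\times(0,T')$ of $$\partial_t w-\nabla\cdot\big(A(x/\varepsilon,t/\varepsilon^2)\nabla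 w\big)=-w^3+3w^2X_1-3wX_2+X_3,$$ then $$\sup_{0\le t\le T'}\|w(t)\|_{L^p(\mathbb{T}^2)}\le\|w(0)\|_{L^p(\mathbb{T}^2)}+C .$$ Here a weak solution has a weak spatial gradient in $L^2_{\mathrm{loc}}(\mathbb{R}^2\times(0,T'))$ and satisfies the equation tested against every $\varphi\in C_c^\infty(\mathbb{R}^2\times(0,T'))$. The products $w^2X_1$ and $wX_2$ are defined by continuous extension in the second factor: $\langle fX,\varphi\rangle$ is the limit of $\int f g\varphi$ as $g\in C_c^\infty(\mathbb{R}^3)$ converges to $X$ in the above seminorms. -/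

import Mathlib

open MeasureTheory Filter Topology Set
open scoped Distributions ENNReal

noncomputable section

/-- The plane `ℝ²` with its Euclidean norm. -/
abbrev Plane := EuclideanSpace ℝ (Fin 2)

/-- Space-time `ℝ² × ℝ`, with points `z = (x, t)`. Functions and distributions on
`𝕋² × ℝ`, `𝕋² = ℝ²/ℤ²`, are identified with those on `ℝ² × ℝ` that are `ℤ²`-periodic in `x`. -/
abbrev SpaceTime := Plane × ℝ

/-- Test functions `C_c^∞(ℝ² × ℝ)`. -/
abbrev TestFn := 𝓓((⊤ : TopologicalSpace.Opens SpaceTime), ℝ)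

/-- Distributions on `ℝ² × ℝ`. -/
abbrev Distr := 𝓓'((⊤ : TopologicalSpace.Opens SpaceTime), ℝ)

/-- The element of the lattice `ℤ² ⊂ ℝ²` with coordinates `k`. -/
def latticeVec (k : Fin 2 → ℤ) : Plane := WithLp.toLp 2 (fun i => (k i : ℝ))

/-- The parabolic size `|z|_𝔰 = |x| + |t|^{1/2}`. -/
def parabolicSize (z : SpaceTime) : ℝ := ‖z.1‖ + √|z.2|

/-! ### Coefficient fields -/

/-- `A` is a (not necessarily symmetric) matrix field on space-time which is `ℤ³`-periodic,
uniformly elliptic with ellipticity constants `lam ≤ Lam`, and parabolically `θ`-Hölder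
continuous. A `2 × 2` matrix is viewed as a linear map of `ℝ²`. -/
structure IsCoefficientField (θ lam Lam : ℝ) (A : SpaceTime → (Plane →L[ℝ] Plane)) : Prop where
  periodic : ∀ (k : Fin 2 → ℤ) (m : ℤ) (x : Plane) (t : ℝ),
    A (x + latticeVec k, t + m) = A (x, t)
  elliptic : ∀ z ζ, lam * ‖ζ‖ ^ 2 ≤ inner ℝ ζ (A z ζ)
  bounded : ∀ z, ‖A z‖ ≤ Lam
  holder : ∃ H : ℝ, ∀ z z' : SpaceTime, parabolicSize (z - z') ≤ 1 →
    ‖A z - A z'‖ ≤ H * parabolicSize (z - z') ^ θ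

/-- The oscillating coefficients `A(x/ε, t/ε²)`. -/
def oscillating (A : SpaceTime → (Plane →L[ℝ] Plane)) (ε : ℝ) :
    SpaceTime → (Plane →L[ℝ] Plane) :=
  fun z => A (ε⁻¹ • z.1, z.2 / ε ^ 2)

/-! ### Hölder functions of positive exponent on `𝕋² × [0, T]` -/

/-- The slab `ℝ² × [0, T]`. -/
def slab (T : ℝ) : Set SpaceTime := {z | z.2 ∈ Icc 0 T}

/-- The parabolic Hölder norm (seminorm plus supremum norm) on `ℝ² × [0, T]`. -/
def parHolderNorm (γ T : ℝ) (f : SpaceTime → ℝ) : ℝ≥0∞ :=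
  (⨆ z ∈ slab T, ⨆ z' ∈ slab T,
      ENNReal.ofReal (|f z - f z'| / parabolicSize (z - z') ^ γ)) +
    ⨆ z ∈ slab T, ENNReal.ofReal |f z|

/-- `w ∈ C^γ(𝕋² × [0, T])`: `w` is periodic in space and lies in the closure of the smooth
functions with respect to the parabolic Hölder norm. Values outside the slab are irrelevant. -/
structure MemParHolder (γ T : ℝ) (w : SpaceTime → ℝ) : Prop where
  periodic : ∀ (k : Fin 2 → ℤ) (x : Plane), ∀ t ∈ Icc 0 T, w (x + latticeVec k, t) = w (x, t)
  approx : ∀ δ : ℝ≥0∞, 0 < δ → ∃ f : SpaceTime → ℝ, ContDiff ℝ (⊤ : ℕ∞) f ∧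
    (∀ (k : Fin 2 → ℤ) (x : Plane) (t : ℝ), f (x + latticeVec k, t) = f (x, t)) ∧
    parHolderNorm γ T (fun z => w z - f z) < δ

/-! ### Hölder distributions of negative exponent on `𝕋² × ℝ` -/

/-- The class `𝔅¹` of smooth `ρ`, compactly supported in the open Euclidean unit ball of `ℝ³`,
with `|ρ| < 1` and Euclidean norm of the full space-time gradient `< 1` everywhere. -/
def unitBumps : Set TestFn :=
  {ρ | tsupport ρ ⊆ {z : SpaceTime | ‖z.1‖ ^ 2 + z.2 ^ 2 < 1} ∧
    (∀ z, |ρ z| < 1) ∧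
    ∀ z, ‖(fderiv ℝ ρ z).comp (ContinuousLinearMap.inl ℝ Plane ℝ)‖ ^ 2 +
      (fderiv ℝ ρ z (0, 1)) ^ 2 < 1}

/-- `φ` is the parabolic rescaling `ρ_z^r = r^{-4} ρ((· - x)/r, (· - t)/r²)` of `ρ`
around `z = (x, t)`. -/
def IsRescaling (φ ρ : TestFn) (z : SpaceTime) (r : ℝ) : Prop :=
  ∀ y : SpaceTime, φ y = (r ^ 4)⁻¹ * ρ (r⁻¹ • (y.1 - z.1), (y.2 - z.2) / r ^ 2)

/-- The seminorm `‖F‖_{C_𝔰^α(B)}`, `α < 0`: the supremum of `r^{-α} |F(ρ_z^r)|` over `z ∈ B`,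
`r ∈ (0, 1)` and `ρ ∈ 𝔅¹`. It is defined for any functional `F` on test functions. -/
def negHolderNorm (α : ℝ) (B : Set SpaceTime) (F : TestFn → ℝ) : ℝ≥0∞ :=
  ⨆ z ∈ B, ⨆ r ∈ Ioo (0 : ℝ) 1, ⨆ ρ ∈ unitBumps, ⨆ φ ∈ {φ : TestFn | IsRescaling φ ρ z r},
    ENNReal.ofReal (|F φ| / r ^ α)

/-- The box `(-N, N+1)³`. -/
def box (N : ℕ) : Set SpaceTime :=
  {z | (∀ i, z.1 i ∈ Ioo (-(N : ℝ)) (N + 1)) ∧ z.2 ∈ Ioo (-(N : ℝ)) (N + 1)}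

/-- The distribution `X - g`, where `g` is a smooth compactly supported function. -/
def diffFunctional (X : Distr) (g : TestFn) : TestFn → ℝ :=
  fun φ => X φ - ∫ z, g z * φ z

/-- `X ∈ C_𝔰^α(𝕋² × ℝ)`: `X` is a distribution, periodic in space, which lies in the closure of
`C_c^∞(ℝ³)` for the Fréchet topology of the seminorms `‖·‖_{C_𝔰^α((-N, N+1)³)}`. -/
structure MemNegHolder (α : ℝ) (X : Distr) : Prop where
  periodic : ∀ (k : Fin 2 → ℤ) (φ ψ : TestFn),
    (∀ (x : Plane) (t : ℝ), ψ (x, t) = φ (x + latticeVec k, t)) → X ψ = X φ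
  approx : ∀ (N : ℕ) (δ : ℝ≥0∞), 0 < δ →
    ∃ g : TestFn, negHolderNorm α (box N) (diffFunctional X g) < δ

/-- The filter, on smooth compactly supported functions, of convergence to `X` in the Fréchet
topology of `C_𝔰^α`. -/
def approxFilter (α : ℝ) (X : Distr) : Filter TestFn :=
  ⨅ N : ℕ, comap (fun g => negHolderNorm α (box N) (diffFunctional X g)) (𝓝 0)

/-- `⟨f X, φ⟩ = ℓ`, where `f X` is the product of a function and a distribution `X ∈ C_𝔰^α`,
understood as the continuous extension, from smooth `g` to `X`, of the map `g ↦ f g`. -/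
def HasProductPairing (α : ℝ) (f : SpaceTime → ℝ) (X : Distr) (φ : TestFn) (ℓ : ℝ) : Prop :=
  Tendsto (fun g : TestFn => ∫ z, f z * g z * φ z) (approxFilter α X) (𝓝 ℓ)

/-! ### Weak solutions -/

/-- The open slab `ℝ² × (0, T)`. -/
def openSlab (T : ℝ) : Set SpaceTime := {z | z.2 ∈ Ioo 0 T}

/-- `G` is the weak spatial gradient of `w` on `ℝ² × (0, T)`, and is locally square integrable
there. -/
structure IsWeakSpatialGradient (T : ℝ) (w : SpaceTime → ℝ) (G : SpaceTime → Plane) : Prop where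
  memLp : ∀ K : Set SpaceTime, IsCompact K → K ⊆ openSlab T → MemLp G 2 (volume.restrict K)
  integral_eq : ∀ φ : TestFn, tsupport φ ⊆ openSlab T → ∀ v : Plane,
    ∫ z, w z * fderiv ℝ φ z (v, 0) = - ∫ z, inner ℝ (G z) v * φ z

/-- `w` is a weak solution on `ℝ² × (0, T)` of
`∂ₜ w - ∇ · (a ∇ w) = - w³ + 3 w² X₁ - 3 w X₂ + X₃`. -/
def IsWeakSolution (α T : ℝ) (a : SpaceTime → (Plane →L[ℝ] Plane)) (X₁ X₂ X₃ : Distr)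
    (w : SpaceTime → ℝ) : Prop :=
  ∃ G : SpaceTime → Plane, IsWeakSpatialGradient T w G ∧
    ∀ φ : TestFn, tsupport φ ⊆ openSlab T → ∃ ℓ₁ ℓ₂ : ℝ,
      HasProductPairing α (fun z => w z ^ 2) X₁ φ ℓ₁ ∧
      HasProductPairing α w X₂ φ ℓ₂ ∧
      - (∫ z, w z * fderiv ℝ φ z (0, 1)) + ∫ z, fderiv ℝ φ z (a z (G z), 0) =
        - (∫ z, w z ^ 3 * φ z) + 3 * ℓ₁ - 3 * ℓ₂ + X₃ φ

/-- The fundamental domain `[0, 1)²` of `𝕋²`. -/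
def unitCell : Set Plane := {x | ∀ i, x i ∈ Ico (0 : ℝ) 1}

/-- `‖w(t)‖_{L^p(𝕋²)}`. -/
def torusLpNorm (p : ℕ) (w : SpaceTime → ℝ) (t : ℝ) : ℝ≥0∞ :=
  eLpNorm (fun x : Plane => w (x, t)) (p : ℝ≥0∞) (volume.restrict unitCell)

end

noncomputable section

/-! The proof is an energy estimate in which every product with a distribution is paid for by the
good terms. Put `m = p - 1`, `q = p + 2`. Testing the equation with `w ^ m` on a time interval `(a,
b)` bounds `‖w(b)‖_p^p + p (λ m ∫ w^(m-1) |∇w|² + ∫ |w|^q)` by `‖w(a)‖_p^p` plus `p` times the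
pairings of `w^(k+m)`, `k ≤ 2`, with the three distributions.

Pairings. If `X` has regularity `α` and size `M`, its pairing with `F` is at most a constant times
`M (‖F‖_1 + ∑ σ_n^α ω(σ_n))`, where `σ_n` runs over dyadic scales and `ω` is the parabolic `L¹`
modulus of continuity of `F` (`exists_pairing_const`, `exists_productPairing_const`). The products
above have degree at most `q - 1`, one below the good term, so Young's inequality leaves a power of
the scale to spare: the modulus is at most `σ^(1/q) (η (∫ |w|^q + S) + C)` with `η` as small as
desired, where `S σ²` bounds the squared `L²` increments of `w` at scale `σ`
(`exists_product_modulus`). The series converges when `α > -1/q`, which is where `α₀ = 1/(p + 2)`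
comes from.

Increments. Spatial increments are bounded by `∫ |∇w|²`. For a time lag `τ` the equation is tested
with `w - w(· - τ)`; this bounds the squared increment by `τ` times `∫ |∇w|²`, `∫ w⁴`, a constant
and a small multiple of `S` itself. The small multiple is absorbed (`exists_incrBound`), so that `S`
is at most a constant times `∫ |∇w|² + ∫ w⁴ + 1`.

Closing. For `p = 2` the good terms are exactly `∫ |∇w|²` and `∫ w⁴`, hence both are at most `C (1 +
‖w(a)‖_2²)`. Inserted in the inequality for general `p` this gives `‖w(b)‖_p^p ≤ ‖w(a)‖_p^p + C (1 +
‖w(a)‖_2²)` (`exists_cellIntegral_pow_le`). The excess is only quadratic in `‖w(a)‖_p`, so for `p ≥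
3` the right side is at most `(‖w(a)‖_p + c)^p`. The estimates use nothing quantitative about the
coefficients except the ellipticity constants, so they are uniform in `ε` and in the Hölder data.

Two obstacles shape the argument. First, `A(x/ε, t/ε²)` is not `ℤ²`-periodic, since `1/ε` need not
be an integer; the flux is not periodic and the equation does not descend to the torus. In
`WeakFlow.periodic_ineq` a periodic test function is cut into compactly supported pieces, the
inequalities are summed over a large block of cells, and the terms with the gradient of the cutoff
survive only on the rim of the block; the flux in the bulk is replaced by a periodic lower bound
from ellipticity. Second, `w` is not differentiable in time. `WeakFlow.test` therefore translates
the test function in time: the term with `∂ₜ` is the derivative in the shift, and integrating it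
leaves finite differences of `w`, from which convexity of `x^(m+1)` recovers the energy. -/

instance isAddHaarMeasure_spaceTime : (volume : Measure SpaceTime).IsAddHaarMeasure :=
  inferInstanceAs ((volume : Measure Plane).prod (volume : Measure ℝ)).IsAddHaarMeasure

/-! ### Test functions, the reference kernel and its parabolic rescalings. -/

/-- The test function with a given smooth compactly supported underlying function. -/
def TestFn.of (f : SpaceTime → ℝ) (hf : ContDiff ℝ (⊤ : ℕ∞) f) (hc : HasCompactSupport f) :
    TestFn where
  toFun := f
  contDiff' := hf
  hasCompactSupport' := hc
  tsupport_subset' := by simp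

@[simp] lemma TestFn.of_apply (f : SpaceTime → ℝ) (hf : ContDiff ℝ (⊤ : ℕ∞) f)
    (hc : HasCompactSupport f) (z : SpaceTime) : TestFn.of f hf hc z = f z := rfl

lemma TestFn.coe_of (f : SpaceTime → ℝ) (hf : ContDiff ℝ (⊤ : ℕ∞) f)
    (hc : HasCompactSupport f) : (TestFn.of f hf hc : SpaceTime → ℝ) = f := rfl

/-- A reference bump function on space-time. -/
def refBump : ContDiffBump (0 : SpaceTime) := ⟨1 / 4, 1 / 2, by norm_num, by norm_num⟩

/-- The normalised reference kernel. -/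
def kern : SpaceTime → ℝ := refBump.normed volume

lemma kern_nonneg (z) : 0 ≤ kern z := refBump.nonneg_normed z
lemma kern_neg (z) : kern (-z) = kern z := refBump.normed_neg z
lemma contDiff_kern : ContDiff ℝ (⊤ : ℕ∞) kern := refBump.contDiff_normed
lemma hasCompactSupport_kern : HasCompactSupport kern := refBump.hasCompactSupport_normed
lemma integral_kern : ∫ z, kern z = 1 := refBump.integral_normed
lemma tsupport_kern : tsupport kern = Metric.closedBall 0 (1 / 2) := refBump.tsupport_normed_eq
lemma kern_eq_zero {z : SpaceTime} (h : 1 / 2 < ‖z‖) : kern z = 0 := by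
  apply image_eq_zero_of_notMem_tsupport
  rw [tsupport_kern]
  simpa using h

/-- The parabolic rescaling of the reference kernel at scale `r`. -/
def kernS (r : ℝ) (z : SpaceTime) : ℝ := (r ^ 4)⁻¹ * kern (r⁻¹ • z.1, z.2 / r ^ 2)

lemma kernS_nonneg (r : ℝ) (z) : 0 ≤ kernS r z :=
  mul_nonneg (by positivity) (kern_nonneg _)

lemma kernS_neg (r : ℝ) (z : SpaceTime) : kernS r (-z) = kernS r z := by
  unfold kernS
  rw [← kern_neg]
  simp [neg_div]

lemma contDiff_kernS (r : ℝ) : ContDiff ℝ (⊤ : ℕ∞) (kernS r) := by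
  unfold kernS
  apply contDiff_const.mul
  apply contDiff_kern.comp
  fun_prop

lemma kernS_eq_zero {r : ℝ} (hr : 0 < r) {z : SpaceTime} (h : r < ‖z.1‖ ∨ r ^ 2 < |z.2|) :
    kernS r z = 0 := by
  unfold kernS
  rw [kern_eq_zero, mul_zero]
  simp only [Prod.norm_def, norm_smul, norm_div, Real.norm_eq_abs, abs_pow, norm_inv,
    abs_of_pos hr, lt_max_iff]
  rcases h with h | h
  · left
    rw [inv_mul_eq_div, lt_div_iff₀ hr]; linarith
  · right
    have : 0 < r ^ 2 := by positivity
    rw [lt_div_iff₀ this]; linarith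

lemma hasCompactSupport_kernS {r : ℝ} (hr : 0 < r) : HasCompactSupport (kernS r) := by
  apply HasCompactSupport.intro (K := Metric.closedBall 0 r ×ˢ Metric.closedBall 0 (r ^ 2))
    ((isCompact_closedBall _ _).prod (isCompact_closedBall _ _))
  intro z hz
  apply kernS_eq_zero hr
  simp only [mem_prod, mem_closedBall_zero_iff, Real.norm_eq_abs] at hz
  by_contra! h
  exact hz h

lemma integral_kernS {r : ℝ} (hr : 0 < r) : ∫ z, kernS r z = 1 := by
  have hk : Integrable kern := contDiff_kern.continuous.integrable_of_hasCompactSupport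
    hasCompactSupport_kern
  have hi : Integrable (kernS r) := (contDiff_kernS r).continuous.integrable_of_hasCompactSupport
    (hasCompactSupport_kernS hr)
  rw [Measure.volume_eq_prod] at hi hk ⊢
  rw [integral_prod _ hi]
  have h1 : ∀ x : Plane, ∫ t, kernS r (x, t) = (r ^ 4)⁻¹ * r ^ 2 * ∫ t, kern (r⁻¹ • x, t) := by
    intro x
    unfold kernS
    simp only
    rw [integral_const_mul, Measure.integral_comp_div (fun t => kern (r⁻¹ • x, t))]
    rw [abs_of_pos (by positivity)]
    simp [mul_assoc]
  simp_rw [h1]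
  rw [integral_const_mul,
    Measure.integral_comp_inv_smul_of_nonneg _ (fun x : Plane => ∫ t, kern (x, t)) hr.le,
    ← integral_prod _ hk, ← Measure.volume_eq_prod, integral_kern]
  simp
  field_simp

/-- Only the size conditions separate such an `f` from an admissible bump, and they are met after
division by bounds of `f` and of its derivative. -/
lemma exists_mul_mem_unitBumps {f : SpaceTime → ℝ} (hf : ContDiff ℝ (⊤ : ℕ∞) f)
    (hfc : HasCompactSupport f)
    (hs : tsupport f ⊆ {z : SpaceTime | ‖z.1‖ ^ 2 + z.2 ^ 2 < 1}) :
    ∃ c : ℝ, 0 < c ∧ ∃ ρ ∈ unitBumps, ∀ z, ρ z = c * f z := by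
  obtain ⟨B₁, hB₁⟩ := hfc.exists_bound_of_continuous hf.continuous
  have hd : Continuous (fderiv ℝ f) := hf.continuous_fderiv (by simp)
  have hdc : HasCompactSupport (fderiv ℝ f) := hfc.fderiv ℝ
  obtain ⟨B₂, hB₂⟩ := hdc.exists_bound_of_continuous hd
  have h1 : 0 ≤ B₁ := (norm_nonneg _).trans (hB₁ 0)
  have h2 : 0 ≤ B₂ := (norm_nonneg _).trans (hB₂ 0)
  -- This makes `c * B₁ < 1` and `c * B₂ ≤ 1 / 2`, so the squared spatial and temporal parts of the
  -- gradient add up to at most `1 / 2`.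
  set c : ℝ := (1 + B₁ + 2 * B₂)⁻¹ with hc
  have hcpos : 0 < c := by positivity
  have hcm : c * (1 + B₁ + 2 * B₂) = 1 := by rw [hc]; field_simp
  have hcs : ContDiff ℝ (⊤ : ℕ∞) (fun z => c * f z) := contDiff_const.mul hf
  have hcc : HasCompactSupport (fun z => c * f z) := hfc.mul_left
  refine ⟨c, hcpos, TestFn.of _ hcs hcc, ⟨?_, ?_, ?_⟩, fun z => rfl⟩
  · rw [TestFn.coe_of]
    exact tsupport_mul_subset_right.trans hs
  · intro z
    have := hB₁ z
    rw [Real.norm_eq_abs] at this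
    rw [TestFn.of_apply, abs_mul, abs_of_pos hcpos]
    nlinarith
  · intro z
    rw [TestFn.coe_of]
    have hfd : fderiv ℝ (fun z => c * f z) z = c • fderiv ℝ f z := by
      rw [fderiv_const_mul]
      exact hf.differentiable (by simp) z
    rw [hfd]
    have hb := hB₂ z
    have e1 : ‖(c • fderiv ℝ f z).comp (ContinuousLinearMap.inl ℝ Plane ℝ)‖ ≤ c * B₂ := by
      refine (ContinuousLinearMap.opNorm_comp_le _ _).trans ?_
      have : ‖ContinuousLinearMap.inl ℝ Plane ℝ‖ ≤ 1 := ContinuousLinearMap.norm_inl_le_one _ _ _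
      rw [norm_smul, Real.norm_eq_abs, abs_of_pos hcpos]
      calc _ ≤ c * ‖fderiv ℝ f z‖ * 1 := by gcongr
        _ ≤ _ := by rw [mul_one]; gcongr
    have e2 : |(c • fderiv ℝ f z) (0, 1)| ≤ c * B₂ := by
      have : ‖(c • fderiv ℝ f z) (0, 1)‖ ≤ ‖c • fderiv ℝ f z‖ * ‖((0, 1) : SpaceTime)‖ :=
        ContinuousLinearMap.le_opNorm _ _
      rw [norm_smul, Real.norm_eq_abs, Real.norm_eq_abs, abs_of_pos hcpos] at this
      refine this.trans ?_
      simp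
      gcongr
    have e3 : (c • fderiv ℝ f z) (0, 1) ^ 2 ≤ (c * B₂) ^ 2 := by
      rw [← sq_abs]; exact pow_le_pow_left₀ (abs_nonneg _) e2 2
    have e4 := pow_le_pow_left₀ (norm_nonneg _) e1 2
    have : c * B₂ ≤ 1 / 2 := by nlinarith
    have : 0 ≤ c * B₂ := by positivity
    nlinarith

/-- The norm on the product is a maximum, so the support of `kern` has Euclidean radius at most `1 /
√2` and fits into the open unit ball. -/
lemma exists_bump_const : ∃ c : ℝ, 0 < c ∧ ∃ ρ ∈ unitBumps, ∀ z, ρ z = c * kern z := by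
  refine exists_mul_mem_unitBumps contDiff_kern hasCompactSupport_kern ?_
  rw [tsupport_kern]
  intro z hz
  rw [mem_closedBall_zero_iff, Prod.norm_def, max_le_iff] at hz
  have h3 : z.2 ^ 2 ≤ (1 / 2) ^ 2 := by
    rw [← sq_abs]; exact pow_le_pow_left₀ (abs_nonneg _) hz.2 2
  have h4 : ‖z.1‖ ^ 2 ≤ (1 / 2) ^ 2 := pow_le_pow_left₀ (norm_nonneg _) hz.1 2
  simp only [mem_ofPred_eq]
  linarith

/-! ### Averaging operators and the multiscale bound on pairings. -/

/-- `g` is bounded by `M r ^ α` when tested at the points of `Z` against all rescaled bumps. -/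
def TestedBy (α M : ℝ) (Z : Set SpaceTime) (g : SpaceTime → ℝ) : Prop :=
  ∀ z ∈ Z, ∀ r ∈ Ioo (0 : ℝ) 1, ∀ ρ ∈ unitBumps, ∀ φ : TestFn, IsRescaling φ ρ z r →
    |∫ y, g y * φ y| ≤ M * r ^ α

/-- Average of `f` with weight `k`. -/
def avg (k f : SpaceTime → ℝ) (x : SpaceTime) : ℝ := ∫ y, k y * f (x - y)

/-- A multiple of `kern` is an admissible bump and `kern` is even, so testing `g` with the rescaled
bump at `z` is evaluating a convolution at `z`. From here on only averages with `kernS` are used. -/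
lemma exists_tested_const : ∃ c : ℝ, 0 < c ∧ ∀ (α M : ℝ) (Z : Set SpaceTime) (g : SpaceTime → ℝ),
    TestedBy α M Z g → ∀ z ∈ Z, ∀ r ∈ Ioo (0 : ℝ) 1, |avg (kernS r) g z| ≤ c * (M * r ^ α) := by
  obtain ⟨c, hc, ρ, hρ, hρk⟩ := exists_bump_const
  refine ⟨c⁻¹, by positivity, fun α M Z g hg z hz r hr => ?_⟩
  have hcd : ContDiff ℝ (⊤ : ℕ∞) (fun y : SpaceTime => c * kernS r (y - z)) :=
    contDiff_const.mul ((contDiff_kernS r).comp (contDiff_id.sub contDiff_const))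
  have hcc : HasCompactSupport (fun y : SpaceTime => c * kernS r (y - z)) := by
    apply HasCompactSupport.mul_left
    exact (hasCompactSupport_kernS hr.1).comp_homeomorph (Homeomorph.subRight z)
  have := hg z hz r hr ρ hρ (TestFn.of _ hcd hcc) (by
    intro y
    rw [TestFn.of_apply, hρk, kernS]
    simp only [Prod.fst_sub, Prod.snd_sub]
    ring)
  simp only [TestFn.of_apply] at this
  have e : ∫ y, g y * (c * kernS r (y - z)) = c * avg (kernS r) g z := by
    unfold avg
    rw [← integral_const_mul, ← integral_sub_left_eq_self _ volume z]
    congr 1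
    ext y
    rw [show z - y - z = -y by abel, kernS_neg]
    ring
  rw [e, abs_mul, abs_of_pos hc] at this
  rwa [inv_mul_eq_div, le_div_iff₀ hc, mul_comm]

section

open scoped Pointwise

section Averages

variable {k k' f g : SpaceTime → ℝ}

lemma avg_eq_convolution (k f : SpaceTime → ℝ) :
    avg k f = convolution k f (ContinuousLinearMap.mul ℝ ℝ) volume := by
  ext x
  rw [convolution_mul]; rfl

lemma continuous_avg (hk : Continuous k) (hkc : HasCompactSupport k) (hf : Continuous f) :
    Continuous (avg k f) := by
  rw [avg_eq_convolution]
  exact hkc.continuous_convolution_left _ hk hf.locallyIntegrable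

lemma hasCompactSupport_avg (hkc : HasCompactSupport k) (hfc : HasCompactSupport f) :
    HasCompactSupport (avg k f) := by
  rw [avg_eq_convolution]
  exact hkc.convolution _ hfc

lemma hasCompactSupport_uncurry_mul {u : SpaceTime → ℝ} {F : SpaceTime → SpaceTime → ℝ}
    (hk : HasCompactSupport k) (hu : HasCompactSupport u)
    (h : ∀ x y, k y = 0 ∨ u x = 0 → F x y = 0) :
    HasCompactSupport (Function.uncurry F) := by
  apply HasCompactSupport.intro (hu.isCompact.prod hk.isCompact)
  rintro ⟨x, y⟩ hxy
  simp only [mem_prod, not_and_or] at hxy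
  apply h
  rcases hxy with h1 | h1
  · right; exact image_eq_zero_of_notMem_tsupport h1
  · left; exact image_eq_zero_of_notMem_tsupport h1

/-- Averaging with an even kernel is self-adjoint: Fubini, followed by a translation and a
reflection. -/
lemma integral_avg_mul (hk : Continuous k) (hkc : HasCompactSupport k) (hke : ∀ z, k (-z) = k z)
    (hf : Continuous f) (hg : Continuous g) (hgc : HasCompactSupport g) (hfc : HasCompactSupport f) :
    ∫ x, avg k f x * g x = ∫ x, f x * avg k g x := by
  have h1 : ∫ x, avg k f x * g x = ∫ x, ∫ y, k y * f (x - y) * g x := by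
    congr 1; ext x; rw [avg, ← integral_mul_const]
  have h2 : ∫ x, f x * avg k g x = ∫ x, ∫ y, k y * g (x - y) * f x := by
    congr 1; ext x; rw [avg, ← integral_const_mul]; congr 1; ext y; ring
  have h3 := integral_integral_swap_of_hasCompactSupport (μ := volume) (ν := volume)
    (f := fun x y => k y * f (x - y) * g x) (by fun_prop)
    (hasCompactSupport_uncurry_mul hkc hgc (by rintro x y (h | h) <;> simp [h]))
  have h4 := integral_integral_swap_of_hasCompactSupport (μ := volume) (ν := volume)
    (f := fun x y => k y * g (x - y) * f x) (by fun_prop)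
    (hasCompactSupport_uncurry_mul hkc hfc (by rintro x y (h | h) <;> simp [h]))
  rw [h1, h2, h3, h4, ← integral_neg_eq_self]
  congr 1; ext y
  rw [← integral_sub_right_eq_self _ y]
  congr 1; ext x
  rw [hke, sub_neg_eq_add, sub_add_cancel]; ring

lemma avg_comm (hk : Continuous k) (hkc : HasCompactSupport k)
    (hk' : Continuous k') (hkc' : HasCompactSupport k') (hg : Continuous g) :
    avg k (avg k' g) = avg k' (avg k g) := by
  ext x
  have h1 : ∀ (k k' : SpaceTime → ℝ), avg k (avg k' g) x
      = ∫ y, ∫ y', k y * (k' y' * g (x - y - y')) := by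
    intro k k'
    rw [avg]; congr 1; ext y; rw [avg, ← integral_const_mul]
  rw [h1, h1, integral_integral_swap_of_hasCompactSupport (by fun_prop)
    (hasCompactSupport_uncurry_mul hkc' hkc (by rintro x y (h | h) <;> simp [h]))]
  congr 1; ext y; congr 1; ext y'
  rw [sub_right_comm]; ring

/-- Averages with even kernels are self-adjoint and commute, so they can be exchanged between the
two factors. This cancels the cross terms in `exists_pairing_const`. -/
lemma integral_avg_mul_avg_comm (hk : Continuous k) (hkc : HasCompactSupport k)
    (hke : ∀ z, k (-z) = k z)
    (hk' : Continuous k') (hkc' : HasCompactSupport k') (hke' : ∀ z, k' (-z) = k' z)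
    (hf : Continuous f) (hfc : HasCompactSupport f) (hg : Continuous g)
    (hgc : HasCompactSupport g) :
    ∫ x, avg k f x * avg k' g x = ∫ x, avg k' f x * avg k g x := by
  rw [integral_avg_mul hk hkc hke hf (continuous_avg hk' hkc' hg) (hasCompactSupport_avg hkc' hgc)
    hfc, avg_comm hk hkc hk' hkc' hg,
    ← integral_avg_mul hk' hkc' hke' hf (continuous_avg hk hkc hg) (hasCompactSupport_avg hkc hgc)
    hfc]

lemma avg_sub_self (hk : Continuous k) (hkc : HasCompactSupport k) (h1 : ∫ z, k z = 1)
    (hf : Continuous f) (x : SpaceTime) : avg k f x - f x = ∫ y, k y * (f (x - y) - f x) := by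
  have i1 : Integrable fun y => k y * f (x - y) :=
    (by fun_prop : Continuous fun y => k y * f (x - y)).integrable_of_hasCompactSupport
      hkc.mul_right
  have i2 : Integrable k := hk.integrable_of_hasCompactSupport hkc
  simp_rw [mul_sub]
  rw [integral_sub i1 (i2.mul_const _), integral_mul_const, h1, one_mul, avg]

/-- The difference of an average and the function is a convex combination of increments, so Fubini
transfers any bound valid for displacements in the support of the kernel. -/
lemma integral_abs_avg_sub_le (hk : Continuous k) (hkc : HasCompactSupport k)
    (hk0 : ∀ z, 0 ≤ k z) (h1 : ∫ z, k z = 1) (hf : Continuous f) (hfc : HasCompactSupport f)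
    {b : ℝ} (hb : ∀ y, k y ≠ 0 → ∫ x, |f (x - y) - f x| ≤ b) :
    ∫ x, |avg k f x - f x| ≤ b := by
  have i2 : Integrable k := hk.integrable_of_hasCompactSupport hkc
  have hcs : HasCompactSupport (Function.uncurry fun x y => k y * |f (x - y) - f x|) := by
    have hK : IsCompact (tsupport f ∪ (tsupport f + tsupport k)) :=
      hfc.isCompact.union (hfc.isCompact.add hkc.isCompact)
    apply HasCompactSupport.intro (hK.prod hkc.isCompact)
    rintro ⟨x, y⟩ hxy
    simp only [Function.uncurry]
    by_contra hne
    have hy : k y ≠ 0 := by intro h; simp [h] at hne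
    have hy' : y ∈ tsupport k := subset_tsupport _ hy
    apply hxy
    refine ⟨?_, hy'⟩
    by_contra hx
    simp only [mem_union, not_or] at hx
    have e1 : f x = 0 := image_eq_zero_of_notMem_tsupport hx.1
    have e2 : f (x - y) = 0 := by
      by_contra h
      exact hx.2 ⟨x - y, subset_tsupport _ h, y, hy', by simp⟩
    simp [e1, e2] at hne
  have hc : Continuous (Function.uncurry fun x y => k y * |f (x - y) - f x|) := by fun_prop
  have hint : Integrable (Function.uncurry fun x y => k y * |f (x - y) - f x|)
      ((volume : Measure SpaceTime).prod volume) := hc.integrable_of_hasCompactSupport hcs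
  calc ∫ x, |avg k f x - f x| ≤ ∫ x, ∫ y, k y * |f (x - y) - f x| := by
        apply integral_mono_of_nonneg (ae_of_all _ fun x => abs_nonneg _) hint.integral_prod_left
        refine ae_of_all _ fun x => ?_
        simp only
        rw [avg_sub_self hk hkc h1 hf]
        refine (abs_integral_le_integral_abs).trans (le_of_eq ?_)
        congr 1; ext y
        simp only [Function.uncurry]
        rw [abs_mul, abs_of_nonneg (hk0 y)]
    _ = ∫ y, ∫ x, k y * |f (x - y) - f x| := integral_integral_swap_of_hasCompactSupport hc hcs
    _ ≤ ∫ y, k y * b := by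
        apply integral_mono_of_nonneg
          (ae_of_all _ fun y => integral_nonneg fun x => mul_nonneg (hk0 y) (abs_nonneg _))
          (i2.mul_const _)
        refine ae_of_all _ fun y => ?_
        simp only
        rw [integral_const_mul]
        by_cases hy : k y = 0
        · simp [hy]
        · exact mul_le_mul_of_nonneg_left (hb y hy) (hk0 y)
    _ = b := by rw [integral_mul_const, h1, one_mul]

lemma integral_abs_avg_le (hk : Continuous k) (hkc : HasCompactSupport k)
    (hk0 : ∀ z, 0 ≤ k z) (h1 : ∫ z, k z = 1) (hf : Continuous f) (hfc : HasCompactSupport f) :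
    ∫ x, |avg k f x| ≤ ∫ x, |f x| := by
  have i2 : Integrable k := hk.integrable_of_hasCompactSupport hkc
  have hcs : HasCompactSupport (Function.uncurry fun x y => k y * |f (x - y)|) := by
    apply HasCompactSupport.intro ((hfc.isCompact.add hkc.isCompact).prod hkc.isCompact)
    rintro ⟨x, y⟩ hxy
    simp only [Function.uncurry]
    by_contra hne
    have hy : k y ≠ 0 := by intro h; simp [h] at hne
    have hy' : y ∈ tsupport k := subset_tsupport _ hy
    have hx : f (x - y) ≠ 0 := by intro h; simp [h] at hne
    exact hxy ⟨⟨x - y, subset_tsupport _ hx, y, hy', by simp⟩, hy'⟩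
  have hc : Continuous (Function.uncurry fun x y => k y * |f (x - y)|) := by fun_prop
  have hint : Integrable (Function.uncurry fun x y => k y * |f (x - y)|)
      ((volume : Measure SpaceTime).prod volume) := hc.integrable_of_hasCompactSupport hcs
  calc ∫ x, |avg k f x| ≤ ∫ x, ∫ y, k y * |f (x - y)| := by
        apply integral_mono_of_nonneg (ae_of_all _ fun x => abs_nonneg _) hint.integral_prod_left
        refine ae_of_all _ fun x => ?_
        refine (abs_integral_le_integral_abs).trans (le_of_eq ?_)
        congr 1; ext y
        simp only [Function.uncurry]
        rw [abs_mul, abs_of_nonneg (hk0 y)]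
    _ = ∫ y, ∫ x, k y * |f (x - y)| := integral_integral_swap_of_hasCompactSupport hc hcs
    _ = ∫ y, k y * ∫ x, |f x| := by
        congr 1; ext y
        rw [integral_const_mul, integral_sub_right_eq_self (fun x => |f x|)]
    _ = _ := by rw [integral_mul_const, h1, one_mul]

end Averages

/-- The dyadic scales `1/2, 1/4, …`. -/
def scale (n : ℕ) : ℝ := (1 / 2) ^ (n + 1)

lemma scale_pos (n : ℕ) : 0 < scale n := by unfold scale; positivity
lemma scale_succ (n : ℕ) : scale (n + 1) = scale n / 2 := by unfold scale; ring
lemma scale_succ_le (n : ℕ) : scale (n + 1) ≤ scale n := by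
  rw [scale_succ]; linarith [scale_pos n]
lemma scale_le_half (n : ℕ) : scale n ≤ 1 / 2 := by
  unfold scale
  calc ((1 : ℝ) / 2) ^ (n + 1) ≤ (1 / 2) ^ 1 := pow_le_pow_of_le_one (by norm_num) (by norm_num)
        (by omega)
    _ = _ := by norm_num
lemma scale_mem (n : ℕ) : scale n ∈ Ioo (0 : ℝ) 1 :=
  ⟨scale_pos n, by linarith [scale_le_half n]⟩

lemma tendsto_scale : Tendsto scale atTop (𝓝 0) :=
  (tendsto_pow_atTop_nhds_zero_of_lt_one (by norm_num) (by norm_num)).comp (tendsto_add_atTop_nat 1)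

lemma scale_succ_rpow {α : ℝ} (hα : -1 ≤ α) (n : ℕ) : scale (n + 1) ^ α ≤ 2 * scale n ^ α := by
  rw [scale_succ, div_eq_inv_mul, Real.mul_rpow (by norm_num) (scale_pos n).le]
  gcongr
  · exact Real.rpow_nonneg (scale_pos n).le _
  rw [Real.inv_rpow (by norm_num), ← Real.rpow_neg (by norm_num)]
  calc (2 : ℝ) ^ (-α) ≤ 2 ^ (1 : ℝ) := Real.rpow_le_rpow_of_exponent_le (by norm_num) (by linarith)
    _ = 2 := by norm_num

lemma exists_mem_support_of_avg_kernS_ne_zero {f : SpaceTime → ℝ} {n : ℕ} {z : SpaceTime}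
    (h : avg (kernS (scale n)) f z ≠ 0) :
    ∃ y ∈ Function.support f, ‖z.1 - y.1‖ ≤ 1 / 2 ∧ |z.2 - y.2| ≤ 1 / 2 := by
  by_contra! hne
  apply h
  unfold avg
  rw [← integral_zero SpaceTime ℝ]
  congr 1; ext y
  by_cases h1 : kernS (scale n) y = 0
  · simp [h1]
  by_cases h2 : f (z - y) = 0
  · simp [h2]
  exfalso
  have h3 : ¬ (scale n < ‖y.1‖ ∨ scale n ^ 2 < |y.2|) := fun h => h1 (kernS_eq_zero (scale_pos n) h)
  push Not at h3
  have h4 := scale_le_half n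
  have h5 := scale_pos n
  have := hne (z - y) h2 (by simp; linarith)
  simp at this
  nlinarith

/-- Let `P_n` be averaging at scale `scale n`. Then `∫ P_n f · P_n g` tends to `∫ f g`, and because
the averages commute and are self-adjoint, consecutive terms differ by `∫ (P_{n+1} f - P_n f)
(P_{n+1} g + P_n g)`. The first factor is at most `2 * b n` in `L¹`, the second is pointwise of
order `M * scale n ^ α` where the first does not vanish. Only `L¹` regularity of `f` is needed. -/
theorem exists_pairing_const : ∃ C : ℝ, 0 < C ∧ ∀ (α M : ℝ) (Z : Set SpaceTime) (g : TestFn)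
    (f : SpaceTime → ℝ) (b : ℕ → ℝ), -1 ≤ α → 0 ≤ M → TestedBy α M Z g → Continuous f →
    HasCompactSupport f →
    (∀ y ∈ Function.support f, ∀ z : SpaceTime, ‖z.1 - y.1‖ ≤ 1 / 2 → |z.2 - y.2| ≤ 1 / 2 → z ∈ Z) →
    (∀ n, ∀ d : SpaceTime, ‖d.1‖ ≤ scale n → |d.2| ≤ scale n ^ 2 → ∫ z, |f (z + d) - f z| ≤ b n) →
    Summable (fun n => scale n ^ α * b n) →
    |∫ z, f z * g z| ≤ C * M * ((∫ z, |f z|) + ∑' n, scale n ^ α * b n) := by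
  obtain ⟨c, hc, hcg⟩ := exists_tested_const
  refine ⟨12 * c, by positivity, fun α M Z g f b hα hM hg hf hfc hZ hb hs => ?_⟩
  have hgp := hcg α M Z g hg
  have kc : ∀ n, Continuous (kernS (scale n)) := fun n => (contDiff_kernS _).continuous
  have kcs : ∀ n, HasCompactSupport (kernS (scale n)) := fun n => hasCompactSupport_kernS (scale_pos n)
  have ke : ∀ n z, kernS (scale n) (-z) = kernS (scale n) z := fun n z => kernS_neg _ z
  have k0 : ∀ n z, 0 ≤ kernS (scale n) z := fun n z => kernS_nonneg _ z
  have k1 : ∀ n, ∫ z, kernS (scale n) z = 1 := fun n => integral_kernS (scale_pos n)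
  have hgc := g.hasCompactSupport
  have hgc' : Continuous g := g.contDiff.continuous
  set Pf : ℕ → SpaceTime → ℝ := fun n => avg (kernS (scale n)) f with hPf
  set Pg : ℕ → SpaceTime → ℝ := fun n => avg (kernS (scale n)) g with hPg
  have cf : ∀ n, Continuous (Pf n) := fun n => continuous_avg (kc n) (kcs n) hf
  have cg : ∀ n, Continuous (Pg n) := fun n => continuous_avg (kc n) (kcs n) hgc'
  have sf : ∀ n, HasCompactSupport (Pf n) := fun n => hasCompactSupport_avg (kcs n) hfc
  have sg : ∀ n, HasCompactSupport (Pg n) := fun n => hasCompactSupport_avg (kcs n) hgc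
  have ifg : ∀ n m, Integrable fun x => Pf n x * Pg m x := fun n m =>
    ((cf n).mul (cg m)).integrable_of_hasCompactSupport (sf n).mul_right
  have bnn : ∀ n, 0 ≤ b n := fun n => (integral_nonneg fun z => abs_nonneg _).trans
    (hb n 0 (by simp [(scale_pos n).le]) (by simp [(scale_pos n).le]))
  -- The averages of `f` live within `1 / 2` of its support, which is where `g` is known to be
  -- tested.
  have hZn : ∀ n z, Pf n z ≠ 0 → z ∈ Z := by
    intro n z hz
    obtain ⟨y, hy, h1, h2⟩ := exists_mem_support_of_avg_kernS_ne_zero hz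
    exact hZ y hy z h1 h2
  have hdf : ∀ n, ∫ x, |Pf n x - f x| ≤ b n := by
    intro n
    apply integral_abs_avg_sub_le (kc n) (kcs n) (k0 n) (k1 n) hf hfc
    intro y hy
    have h3 : ¬ (scale n < ‖y.1‖ ∨ scale n ^ 2 < |y.2|) :=
      fun h => hy (kernS_eq_zero (scale_pos n) h)
    push Not at h3
    simpa [sub_eq_add_neg] using hb n (-y) (by simpa using h3.1) (by simpa using h3.2)
  -- Displacements at scale `n + 1` are also allowed at scale `n`, so the same `b n` controls both
  -- averages.
  have hdf' : ∀ n, ∫ x, |Pf (n + 1) x - f x| ≤ b n := by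
    intro n
    apply integral_abs_avg_sub_le (kc _) (kcs _) (k0 _) (k1 _) hf hfc
    intro y hy
    have h3 : ¬ (scale (n + 1) < ‖y.1‖ ∨ scale (n + 1) ^ 2 < |y.2|) :=
      fun h => hy (kernS_eq_zero (scale_pos _) h)
    push Not at h3
    have h4 := scale_succ_le n
    have h5 := pow_le_pow_left₀ (scale_pos (n + 1)).le h4 2
    simpa [sub_eq_add_neg] using hb n (-y) (by simpa using h3.1.trans h4)
      (by simpa using h3.2.trans h5)
  have idf : ∀ n, Integrable fun x => |Pf n x - f x| := fun n =>
    (((cf n).sub hf).integrable_of_hasCompactSupport ((sf n).sub hfc)).abs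
  have hdd : ∀ n, ∫ x, |Pf (n + 1) x - Pf n x| ≤ 2 * b n := by
    intro n
    calc ∫ x, |Pf (n + 1) x - Pf n x| ≤ ∫ x, (|Pf (n + 1) x - f x| + |Pf n x - f x|) := by
          apply integral_mono_of_nonneg (ae_of_all _ fun x => abs_nonneg _)
            ((idf _).add (idf _))
          refine ae_of_all _ fun x => ?_
          simp only [Pi.add_apply]
          rw [abs_sub_comm (Pf n x)]
          exact abs_sub_le _ _ _
      _ ≤ _ := by
          rw [integral_add (idf _) (idf _)]
          linarith [hdf n, hdf' n]
  have rpos : ∀ n, 0 < scale n ^ α := fun n => Real.rpow_pos_of_pos (scale_pos n) _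
  have hstep : ∀ n, |(∫ x, Pf (n + 1) x * Pg (n + 1) x) - ∫ x, Pf n x * Pg n x|
      ≤ 6 * c * M * (scale n ^ α * b n) := by
    intro n
    have e1 : (∫ x, Pf (n + 1) x * Pg (n + 1) x) - ∫ x, Pf n x * Pg n x
        = ∫ x, (Pf (n + 1) x - Pf n x) * (Pg (n + 1) x + Pg n x) := by
      have e2 : ∫ x, Pf n x * Pg (n + 1) x = ∫ x, Pf (n + 1) x * Pg n x :=
        integral_avg_mul_avg_comm (kc _) (kcs _) (ke _) (kc _) (kcs _) (ke _) hf hfc hgc' hgc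
      have e3 : (fun x => (Pf (n + 1) x - Pf n x) * (Pg (n + 1) x + Pg n x)) = fun x =>
          (Pf (n + 1) x * Pg (n + 1) x - Pf n x * Pg n x) +
            (Pf (n + 1) x * Pg n x - Pf n x * Pg (n + 1) x) := by ext x; ring
      rw [e3, integral_add (f := fun x => Pf (n + 1) x * Pg (n + 1) x - Pf n x * Pg n x)
        (g := fun x => Pf (n + 1) x * Pg n x - Pf n x * Pg (n + 1) x)
        ((ifg _ _).sub (ifg _ _)) ((ifg _ _).sub (ifg _ _)),
        integral_sub (ifg _ _) (ifg _ _), integral_sub (ifg _ _) (ifg _ _), e2]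
      ring
    rw [e1]
    have idd : Integrable fun x => |Pf (n + 1) x - Pf n x| :=
      (((cf _).sub (cf n)).integrable_of_hasCompactSupport ((sf _).sub (sf n))).abs
    calc |∫ x, (Pf (n + 1) x - Pf n x) * (Pg (n + 1) x + Pg n x)|
        ≤ ∫ x, |(Pf (n + 1) x - Pf n x) * (Pg (n + 1) x + Pg n x)| := abs_integral_le_integral_abs
      -- The factor `3` is `1 + 2`: passing to the next scale costs at most a factor `2` because `α
      -- ≥ -1`.
      _ ≤ ∫ x, |Pf (n + 1) x - Pf n x| * (3 * c * M * scale n ^ α) := by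
          apply integral_mono_of_nonneg (ae_of_all _ fun x => abs_nonneg _) (idd.mul_const _)
          refine ae_of_all _ fun x => ?_
          simp only
          rw [abs_mul]
          by_cases hx : Pf (n + 1) x - Pf n x = 0
          · simp [hx]
          gcongr
          have hxZ : x ∈ Z := by
            by_cases h : Pf n x = 0
            · exact hZn (n + 1) x (by intro h'; simp [h, h'] at hx)
            · exact hZn n x h
          have a1 := hgp x hxZ _ (scale_mem n)
          have a2 := hgp x hxZ _ (scale_mem (n + 1))
          have a3 := scale_succ_rpow hα n
          have a4 : c * (M * scale (n + 1) ^ α) ≤ c * (M * (2 * scale n ^ α)) := by gcongr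
          refine (abs_add_le _ _).trans ?_
          simp only [hPg]
          linarith
      _ ≤ _ := by
          rw [integral_mul_const]
          have := mul_le_mul_of_nonneg_right (hdd n)
            (by have := rpos n; positivity : 0 ≤ 3 * c * M * scale n ^ α)
          linarith
  have h0 : |∫ x, Pf 0 x * Pg 0 x| ≤ 2 * c * M * ∫ x, |f x| := by
    have i0 : Integrable fun x => |Pf 0 x| := ((cf 0).integrable_of_hasCompactSupport (sf 0)).abs
    calc |∫ x, Pf 0 x * Pg 0 x| ≤ ∫ x, |Pf 0 x * Pg 0 x| := abs_integral_le_integral_abs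
      _ ≤ ∫ x, |Pf 0 x| * (2 * c * M) := by
          apply integral_mono_of_nonneg (ae_of_all _ fun x => abs_nonneg _) (i0.mul_const _)
          refine ae_of_all _ fun x => ?_
          simp only
          rw [abs_mul]
          by_cases hx : Pf 0 x = 0
          · simp [hx]
          gcongr
          refine (hgp x (hZn 0 x hx) _ (scale_mem 0)).trans ?_
          have : scale 0 ^ α ≤ 2 := by
            have e : scale 0 = 2⁻¹ := by simp [scale]
            rw [e, Real.inv_rpow (by norm_num), ← Real.rpow_neg (by norm_num)]
            calc (2 : ℝ) ^ (-α) ≤ 2 ^ (1 : ℝ) :=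
                  Real.rpow_le_rpow_of_exponent_le (by norm_num) (by linarith)
              _ = 2 := by norm_num
          calc c * (M * scale 0 ^ α) ≤ c * (M * 2) := by gcongr
            _ = _ := by ring
      _ ≤ _ := by
          rw [integral_mul_const, mul_comm]
          refine mul_le_mul_of_nonneg_left ?_ (by positivity)
          exact integral_abs_avg_le (kc 0) (kcs 0) (k0 0) (k1 0) hf hfc
  have hN : ∀ N, |∫ x, Pf N x * Pg N x|
      ≤ 2 * c * M * (∫ x, |f x|) + ∑ n ∈ Finset.range N, 6 * c * M * (scale n ^ α * b n) := by
    intro N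
    induction N with
    | zero => simpa using h0
    | succ N ih =>
      rw [Finset.sum_range_succ]
      have := hstep N
      have h3 := abs_sub_abs_le_abs_sub (∫ x, Pf (N + 1) x * Pg (N + 1) x) (∫ x, Pf N x * Pg N x)
      linarith
  -- Both averages are moved onto `g`, which is Lipschitz, so that `P_N P_N g` tends to `g`
  -- uniformly while `f` is merely integrable.
  have hlim : Tendsto (fun N : ℕ => ∫ x, Pf N x * Pg N x) atTop (𝓝 (∫ x, f x * g x)) := by
    obtain ⟨B, hB⟩ := hgc.exists_bound_of_continuous hgc'
    obtain ⟨L, hL⟩ := ContDiff.lipschitzWith_of_hasCompactSupport hgc g.contDiff (by simp)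
    have i0 : Integrable fun x => |f x| := (hf.integrable_of_hasCompactSupport hfc).abs
    -- pointwise estimates for averages of `g`
    have key : ∀ N x, |avg (kernS (scale N)) (Pg N) x - g x| ≤ 2 * L * scale N := by
      have step : ∀ N (u : SpaceTime → ℝ), Continuous u → ∀ A,
          (∀ x y : SpaceTime, ‖y‖ ≤ scale N → |u (x - y) - u x| ≤ A) → ∀ x,
          |avg (kernS (scale N)) u x - u x| ≤ A := by
        intro N u hu A hA x
        rw [avg_sub_self (kc N) (kcs N) (k1 N) hu]
        have iK : Integrable (kernS (scale N)) := (kc N).integrable_of_hasCompactSupport (kcs N)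
        calc _ ≤ ∫ y, |kernS (scale N) y * (u (x - y) - u x)| := abs_integral_le_integral_abs
          _ ≤ ∫ y, kernS (scale N) y * A := by
              apply integral_mono_of_nonneg (ae_of_all _ fun x => abs_nonneg _) (iK.mul_const _)
              refine ae_of_all _ fun y => ?_
              simp only
              rw [abs_mul, abs_of_nonneg (k0 N y)]
              by_cases hy : kernS (scale N) y = 0
              · simp [hy]
              have h3 : ¬ (scale N < ‖y.1‖ ∨ scale N ^ 2 < |y.2|) :=
                fun h => hy (kernS_eq_zero (scale_pos N) h)
              push Not at h3
              refine mul_le_mul_of_nonneg_left (hA x y ?_) (k0 N y)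
              rw [Prod.norm_def, Real.norm_eq_abs, max_le_iff]
              refine ⟨h3.1, h3.2.trans ?_⟩
              have := scale_pos N
              have := scale_le_half N
              nlinarith
          _ = A := by rw [integral_mul_const, k1, one_mul]
      have lipg : ∀ N (x y : SpaceTime), ‖y‖ ≤ scale N → |g (x - y) - g x| ≤ L * scale N := by
        intro N x y hy
        have := hL.dist_le_mul (x - y) x
        rw [Real.dist_eq, dist_eq_norm] at this
        refine this.trans ?_
        simp only [sub_sub_cancel_left, norm_neg]
        gcongr
      intro N x
      have a1 : ∀ x, |Pg N x - g x| ≤ L * scale N := step N g hgc' _ (lipg N)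
      have a2 : |avg (kernS (scale N)) (Pg N) x - avg (kernS (scale N)) g x| ≤ L * scale N := by
        have iK : Integrable (kernS (scale N)) := (kc N).integrable_of_hasCompactSupport (kcs N)
        have j1 : Integrable fun y => kernS (scale N) y * Pg N (x - y) :=
          ((kc N).mul ((cg N).comp (by fun_prop))).integrable_of_hasCompactSupport (kcs N).mul_right
        have j2 : Integrable fun y => kernS (scale N) y * g (x - y) :=
          ((kc N).mul (hgc'.comp (by fun_prop))).integrable_of_hasCompactSupport (kcs N).mul_right
        unfold avg
        rw [← integral_sub j1 j2]
        calc _ ≤ ∫ y, |kernS (scale N) y * Pg N (x - y) - kernS (scale N) y * g (x - y)| :=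
              abs_integral_le_integral_abs
          _ ≤ ∫ y, kernS (scale N) y * (L * scale N) := by
              apply integral_mono_of_nonneg (ae_of_all _ fun x => abs_nonneg _) (iK.mul_const _)
              refine ae_of_all _ fun y => ?_
              simp only
              rw [← mul_sub, abs_mul, abs_of_nonneg (k0 N y)]
              exact mul_le_mul_of_nonneg_left (a1 _) (k0 N y)
          _ = _ := by rw [integral_mul_const, k1, one_mul]
      have := abs_sub_le (avg (kernS (scale N)) (Pg N) x) (avg (kernS (scale N)) g x) (g x)
      have := a1 x
      linarith
    have e1 : ∀ N, ∫ x, Pf N x * Pg N x = ∫ x, f x * avg (kernS (scale N)) (Pg N) x := fun N =>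
      integral_avg_mul (kc N) (kcs N) (ke N) hf (cg N) (sg N) hfc
    simp_rw [e1]
    rw [tendsto_iff_norm_sub_tendsto_zero]
    have j1 : ∀ N, Integrable fun x => f x * avg (kernS (scale N)) (Pg N) x := fun N =>
      (hf.mul (continuous_avg (kc N) (kcs N) (cg N))).integrable_of_hasCompactSupport hfc.mul_right
    have j2 : Integrable fun x => f x * g x :=
      (hf.mul hgc').integrable_of_hasCompactSupport hfc.mul_right
    refine squeeze_zero (fun _ => norm_nonneg _)
      (g := fun N => (∫ x, |f x|) * (2 * L * scale N)) (fun N => ?_) ?_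
    · rw [← integral_sub (j1 N) j2, Real.norm_eq_abs, ← integral_mul_const]
      refine (abs_integral_le_integral_abs).trans ?_
      apply integral_mono_of_nonneg (ae_of_all _ fun x => abs_nonneg _) (i0.mul_const _)
      refine ae_of_all _ fun x => ?_
      simp only
      rw [← mul_sub, abs_mul]
      exact mul_le_mul_of_nonneg_left (key N x) (abs_nonneg _)
    · have := (tendsto_scale.const_mul (2 * (L : ℝ))).const_mul (∫ x, |f x|)
      simpa using this
  refine le_of_tendsto hlim.abs (Eventually.of_forall fun N => (hN N).trans ?_)
  have hsN : ∑ n ∈ Finset.range N, scale n ^ α * b n ≤ ∑' n, scale n ^ α * b n :=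
    hs.sum_le_tsum _ fun n _ => mul_nonneg (rpos n).le (bnn n)
  have hs0 : 0 ≤ ∑' n, scale n ^ α * b n := tsum_nonneg fun n => mul_nonneg (rpos n).le (bnn n)
  have hf0 : 0 ≤ ∫ x, |f x| := integral_nonneg fun x => abs_nonneg _
  rw [← Finset.mul_sum]
  have hcM : 0 ≤ c * M := by positivity
  nlinarith [mul_le_mul_of_nonneg_left hsN hcM, mul_nonneg hcM hs0, mul_nonneg hcM hf0]

end

/-! ### Pairings with elements of the negative Hölder space, as limits along `approxFilter`. -/

lemma TestFn.smul_apply (c : ℝ) (φ : TestFn) (z : SpaceTime) : (c • φ) z = c * φ z := rfl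

lemma TestFn.add_apply (φ ψ : TestFn) (z : SpaceTime) : (φ + ψ) z = φ z + ψ z := rfl

lemma ofReal_le_negHolderNorm {α : ℝ} {B : Set SpaceTime} {F : TestFn → ℝ} {z : SpaceTime}
    (hz : z ∈ B) {r : ℝ} (hr : r ∈ Ioo (0 : ℝ) 1) {ρ φ : TestFn} (hρ : ρ ∈ unitBumps)
    (hφ : IsRescaling φ ρ z r) :
    ENNReal.ofReal (|F φ| / r ^ α) ≤ negHolderNorm α B F := by
  unfold negHolderNorm
  refine le_iSup₂_of_le z hz (le_iSup₂_of_le r hr (le_iSup₂_of_le ρ hρ ?_))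
  exact le_iSup₂_of_le (f := fun (φ : TestFn) (_ : φ ∈ {φ | IsRescaling φ ρ z r}) =>
    ENNReal.ofReal (|F φ| / r ^ α)) φ hφ le_rfl

lemma abs_le_of_negHolderNorm_lt {α M : ℝ} {B : Set SpaceTime} {F : TestFn → ℝ}
    (h : negHolderNorm α B F < ENNReal.ofReal M) {z : SpaceTime}
    (hz : z ∈ B) {r : ℝ} (hr : r ∈ Ioo (0 : ℝ) 1) {ρ φ : TestFn} (hρ : ρ ∈ unitBumps)
    (hφ : IsRescaling φ ρ z r) : |F φ| ≤ M * r ^ α := by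
  have h1 := (ofReal_le_negHolderNorm hz hr hρ hφ).trans_lt h
  have h2 : 0 < M := ENNReal.ofReal_pos.1 (pos_of_gt h)
  have h3 := (ENNReal.ofReal_lt_ofReal_iff h2).1 h1
  have h4 := Real.rpow_pos_of_pos hr.1 α
  exact ((div_lt_iff₀ h4).1 h3).le

lemma eventually_negHolderNorm_lt (α : ℝ) (X : Distr) (N : ℕ) {δ : ℝ≥0∞} (hδ : 0 < δ) :
    ∀ᶠ g in approxFilter α X, negHolderNorm α (box N) (diffFunctional X g) < δ :=
  mem_iInf_of_mem N (preimage_mem_comap (Iio_mem_nhds hδ))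

lemma box_subset_box {N N' : ℕ} (h : N ≤ N') : box N ⊆ box N' := by
  have h' : (N : ℝ) ≤ N' := by exact_mod_cast h
  intro z hz
  refine ⟨fun i => ⟨?_, ?_⟩, ⟨?_, ?_⟩⟩
  · linarith [(hz.1 i).1]
  · linarith [(hz.1 i).2]
  · linarith [hz.2.1]
  · linarith [hz.2.2]

lemma negHolderNorm_mono {α : ℝ} {B B' : Set SpaceTime} (h : B ⊆ B') (F : TestFn → ℝ) :
    negHolderNorm α B F ≤ negHolderNorm α B' F := biSup_mono h

/-- The seminorms grow with the box, so the infimum of filters is directed, and density of the test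
functions makes each of them proper. Without this the limits that define products would carry no
information. -/
lemma MemNegHolder.neBot {α : ℝ} {X : Distr} (h : MemNegHolder α X) :
    (approxFilter α X).NeBot := by
  unfold approxFilter
  refine iInf_neBot_of_directed' ?_ ?_
  · intro N N'
    refine ⟨max N N', ?_, ?_⟩
    all_goals
      refine tendsto_iff_comap.1 ?_
      refine tendsto_of_tendsto_of_tendsto_of_le_of_le tendsto_const_nhds tendsto_comap
        (fun _ => zero_le) (fun g => negHolderNorm_mono (box_subset_box (by simp)) _)
  · intro N
    rw [comap_neBot_iff]
    intro t ht
    obtain ⟨δ, hδ, hδt⟩ := (ENNReal.nhds_zero_basis).mem_iff.1 ht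
    obtain ⟨g, hg⟩ := h.approx N δ hδ
    exact ⟨g, hδt hg⟩

/-- One `M` comes from `X` itself and the other from `X - g`, which is eventually small on any given
box. -/
lemma eventually_testedBy {α M : ℝ} {B : Set SpaceTime} {X : Distr}
    (hM : negHolderNorm α B X < ENNReal.ofReal M) (N : ℕ) :
    ∀ᶠ g : TestFn in approxFilter α X, TestedBy α (2 * M) (B ∩ box N) g := by
  filter_upwards [eventually_negHolderNorm_lt α X N (pos_of_gt hM)] with g hg
  intro z hz r hr ρ hρ φ hφ
  have h1 := abs_le_of_negHolderNorm_lt hM hz.1 hr hρ hφ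
  have h2 := abs_le_of_negHolderNorm_lt hg hz.2 hr hρ hφ
  rw [diffFunctional] at h2
  have h3 := abs_sub_abs_le_abs_sub (∫ z, g z * φ z) (X φ)
  rw [abs_sub_comm] at h3
  linarith

/-- Eventually along the filter the approximations are tested by `2 * M` near the support of `F`,
uniformly, so the bound of `exists_pairing_const` passes to the limit. Continuity is asked of the
product `F` only, hence the values of `f` where `φ` vanishes are irrelevant. -/
theorem exists_productPairing_const : ∃ C : ℝ, 0 < C ∧ ∀ (α M T : ℝ) (X : Distr)
    (f F : SpaceTime → ℝ) (φ : TestFn) (ℓ : ℝ) (b : ℕ → ℝ), -1 ≤ α → 0 < M → 0 < T →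
    MemNegHolder α X → negHolderNorm α {z | z.2 ∈ Ioo (-1) (T + 1)} X < ENNReal.ofReal M →
    HasProductPairing α f X φ ℓ → (∀ z, f z * φ z = F z) → Continuous F → HasCompactSupport F →
    (∀ z, F z ≠ 0 → z.2 ∈ Icc 0 T) →
    (∀ n, ∀ d : SpaceTime, ‖d.1‖ ≤ scale n → |d.2| ≤ scale n ^ 2 → ∫ z, |F (z + d) - F z| ≤ b n) →
    Summable (fun n => scale n ^ α * b n) →
    |ℓ| ≤ C * M * ((∫ z, |F z|) + ∑' n, scale n ^ α * b n) := by
  obtain ⟨C, hC, h⟩ := exists_pairing_const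
  refine ⟨2 * C, by positivity, fun α M T X f F φ ℓ b hα hM hT hX hXM hℓ hF hFc hFs hFT hb hs => ?_⟩
  have := hX.neBot
  obtain ⟨R, hR⟩ := hFs.isCompact.isBounded.exists_norm_le
  -- Large enough for the box to contain all points within `1 / 2` of the support of `F`; their
  -- times stay inside `(-1, T + 1)`.
  obtain ⟨N, hN⟩ := exists_nat_gt (R + T + 2)
  refine le_of_tendsto hℓ.abs ?_
  filter_upwards [eventually_testedBy hXM N] with g hg
  have e : ∀ z, f z * g z * φ z = F z * g z := fun z => by rw [← hF]; ring
  simp_rw [e]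
  have := h α (2 * M) _ g F b hα (by positivity) hg hFc hFs ?_ hb hs
  · calc _ ≤ _ := this
      _ = _ := by ring
  intro y hy z h1 h2
  have h3 := hFT y hy
  have h4 := hR y (subset_tsupport _ hy)
  rw [Prod.norm_def, max_le_iff] at h4
  have h5 : ‖z.1‖ ≤ R + 1 / 2 := by
    have := norm_sub_norm_le z.1 y.1
    linarith [h4.1]
  rw [abs_le] at h2
  have h6 : ∀ i, |z.1 i| ≤ ‖z.1‖ := fun i => by
    simpa using PiLp.norm_apply_le z.1 i
  have hR0 : 0 ≤ R := (norm_nonneg _).trans h4.1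
  refine ⟨⟨by linarith [h3.1], by linarith [h3.2]⟩, fun i => ⟨?_, ?_⟩, ⟨?_, ?_⟩⟩
  · linarith [(abs_le.1 (h6 i)).1]
  · linarith [(abs_le.1 (h6 i)).2]
  · linarith [h3.1]
  · linarith [h3.2]

/-! ### The pairing of a distribution with the constant function one. -/

section Density

variable {α : ℝ} {X : Distr}

/-- A test function of small support is a multiple of a single bump rescaled at scale `1 / 2`, so
convergence in the seminorm contains convergence of this one pairing. -/
lemma hasProductPairing_one_of_small {φ : TestFn} (z₀ : SpaceTime)
    (hφ : ∀ z, φ z ≠ 0 → ‖z.1 - z₀.1‖ ≤ 1 / 8 ∧ |z.2 - z₀.2| ≤ 1 / 8) :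
    HasProductPairing α (fun _ => 1) X φ (X φ) := by
  -- The profile of `φ` seen from `z₀` at parabolic scale `1 / 2`: space is stretched by `2`, time
  -- by `4`.
  set f : SpaceTime → ℝ := fun y => φ (z₀.1 + (1 / 2 : ℝ) • y.1, z₀.2 + y.2 / 4) with hf
  have hfs : ∀ y, f y ≠ 0 → ‖y.1‖ ≤ 1 / 4 ∧ |y.2| ≤ 1 / 2 := by
    intro y hy
    have h1 := hφ _ hy
    simp only [add_sub_cancel_left, norm_smul, abs_div] at h1
    norm_num at h1
    constructor <;> linarith [h1.1, h1.2]
  have hsub : Function.support f ⊆ Metric.closedBall (0 : Plane) (1 / 4) ×ˢ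
      Metric.closedBall (0 : ℝ) (1 / 2) := by
    intro y hy
    simpa using hfs y hy
  have hts : tsupport f ⊆ Metric.closedBall (0 : Plane) (1 / 4) ×ˢ
      Metric.closedBall (0 : ℝ) (1 / 2) :=
    closure_minimal hsub (Metric.isClosed_closedBall.prod Metric.isClosed_closedBall)
  have hfc : HasCompactSupport f := ((isCompact_closedBall _ _).prod
    (isCompact_closedBall _ _)).of_isClosed_subset (isClosed_tsupport _) hts
  have hfd : ContDiff ℝ (⊤ : ℕ∞) f := φ.contDiff.comp (by fun_prop)
  obtain ⟨c, hc, ρ, hρ, hρf⟩ := exists_mul_mem_unitBumps hfd hfc (by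
    intro y hy
    have := hts hy
    simp only [mem_prod, mem_closedBall_zero_iff, Real.norm_eq_abs] at this
    have h3 : y.2 ^ 2 ≤ (1 / 2) ^ 2 := by
      rw [← sq_abs]; exact pow_le_pow_left₀ (abs_nonneg _) this.2 2
    have h4 : ‖y.1‖ ^ 2 ≤ (1 / 4) ^ 2 := pow_le_pow_left₀ (norm_nonneg _) this.1 2
    simp only [mem_ofPred_eq]
    linarith)
  -- The `16` is the normalisation `r⁻⁴` at `r = 1 / 2`.
  have hresc : IsRescaling ((16 * c) • φ) ρ z₀ (1 / 2) := by
    intro y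
    rw [hρf, hf]
    simp only [TestFn.smul_apply]
    have e : (z₀.1 + (1 / 2 : ℝ) • ((1 / 2 : ℝ)⁻¹ • (y.1 - z₀.1)),
      z₀.2 + (y.2 - z₀.2) / (1 / 2) ^ 2 / 4) = y := by
      ext1
      · simp only
        rw [smul_smul]; norm_num
      · simp only; ring
    rw [e]; ring
  obtain ⟨N, hN⟩ := exists_nat_gt (‖z₀‖ + 1)
  have hzN : z₀ ∈ box N := by
    have h4 : ‖z₀.1‖ ≤ ‖z₀‖ ∧ |z₀.2| ≤ ‖z₀‖ := ⟨norm_fst_le _, by simpa using norm_snd_le z₀⟩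
    have h6 : ∀ i, |z₀.1 i| ≤ ‖z₀.1‖ := fun i => by
      simpa using PiLp.norm_apply_le z₀.1 i
    refine ⟨fun i => ⟨?_, ?_⟩, ⟨?_, ?_⟩⟩
    · linarith [(abs_le.1 (h6 i)).1]
    · linarith [(abs_le.1 (h6 i)).2]
    · linarith [(abs_le.1 h4.2).1]
    · linarith [(abs_le.1 h4.2).2]
  unfold HasProductPairing
  rw [Metric.tendsto_nhds]
  intro δ hδ
  have hr : (0 : ℝ) < (1 / 2 : ℝ) ^ α := by positivity
  have hδ' : 0 < δ * c / (1 / 2 : ℝ) ^ α := by positivity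
  filter_upwards [eventually_negHolderNorm_lt α X N (ENNReal.ofReal_pos.2 hδ')] with g hg
  have h1 := abs_le_of_negHolderNorm_lt hg hzN (r := 1 / 2) (by norm_num) hρ hresc
  rw [diffFunctional, map_smul, smul_eq_mul] at h1
  have e : ∫ z, g z * ((16 * c) • φ) z = 16 * c * ∫ z, g z * φ z := by
    rw [← integral_const_mul]; congr 1; ext z
    simp only [TestFn.smul_apply]; ring
  rw [e, ← mul_sub, abs_mul, abs_of_pos (by positivity : 0 < 16 * c),
    div_mul_cancel₀ _ hr.ne'] at h1
  rw [Real.dist_eq, abs_sub_comm]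
  simp only [one_mul]
  nlinarith

lemma hasProductPairing_one_add {φ ψ : TestFn} (h1 : HasProductPairing α (fun _ => 1) X φ (X φ))
    (h2 : HasProductPairing α (fun _ => 1) X ψ (X ψ)) :
    HasProductPairing α (fun _ => 1) X (φ + ψ) (X (φ + ψ)) := by
  unfold HasProductPairing at *
  rw [map_add]
  refine (h1.add h2).congr fun g => ?_
  have i : ∀ φ : TestFn, Integrable fun z => 1 * g z * φ z := fun φ =>
    ((continuous_const.mul g.contDiff.continuous).mul
      φ.contDiff.continuous).integrable_of_hasCompactSupport φ.hasCompactSupport.mul_left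
  rw [← integral_add (i φ) (i ψ)]
  congr 1; ext z
  simp only [TestFn.add_apply]; ring

lemma hasProductPairing_one_sum {ι : Type*} (s : Finset ι) (φ : ι → TestFn)
    (h : ∀ i ∈ s, HasProductPairing α (fun _ => 1) X (φ i) (X (φ i))) :
    HasProductPairing α (fun _ => 1) X (∑ i ∈ s, φ i) (X (∑ i ∈ s, φ i)) := by
  classical
  induction s using Finset.induction_on with
  | empty => simpa [HasProductPairing] using tendsto_const_nhds
  | insert a s ha ih =>
    rw [Finset.sum_insert ha]
    exact hasProductPairing_one_add (h a (by simp)) (ih fun i hi => h i (by simp [hi]))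

/-- A smooth step of width `2 δ` around `(i - n + 1) δ`; these sum up to one near the origin. -/
def stepBump (δ : ℝ) (n i : ℕ) (t : ℝ) : ℝ :=
  Real.smoothTransition (t / δ - (i - n)) - Real.smoothTransition (t / δ - ((i + 1 : ℕ) - n))

lemma contDiff_stepBump (δ : ℝ) (n i : ℕ) : ContDiff ℝ (⊤ : ℕ∞) (stepBump δ n i) := by
  unfold stepBump
  exact (Real.smoothTransition.contDiff.comp (by fun_prop)).sub
    (Real.smoothTransition.contDiff.comp (by fun_prop))

lemma abs_sub_le_of_stepBump_ne_zero {δ : ℝ} (hδ : 0 < δ) {n i : ℕ} {t : ℝ}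
    (h : stepBump δ n i t ≠ 0) : |t - (i - n + 1) * δ| ≤ δ := by
  by_contra! hlt
  apply h
  unfold stepBump
  rw [lt_abs] at hlt
  push_cast
  rcases hlt with h1 | h1
  · have : (i - n + 2 : ℝ) < t / δ := by rw [lt_div_iff₀ hδ]; linarith
    rw [Real.smoothTransition.one_of_one_le (by linarith),
      Real.smoothTransition.one_of_one_le (by linarith), sub_self]
  · have : t / δ < (i - n : ℝ) := by rw [div_lt_iff₀ hδ]; linarith
    rw [Real.smoothTransition.zero_of_nonpos (by linarith),
      Real.smoothTransition.zero_of_nonpos (by linarith), sub_self]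

lemma sum_stepBump {δ : ℝ} (hδ : 0 < δ) {n : ℕ} {t : ℝ} (h : |t| ≤ δ * (n - 1)) :
    ∑ i ∈ Finset.range (2 * n), stepBump δ n i t = 1 := by
  unfold stepBump
  rw [Finset.sum_range_sub' (fun i : ℕ => Real.smoothTransition (t / δ - (i - n)))]
  rw [abs_le] at h
  have h1 : t / δ ≤ n - 1 := by rw [div_le_iff₀ hδ]; linarith
  have h2 : -(n - 1 : ℝ) ≤ t / δ := by rw [le_div_iff₀ hδ]; linarith
  push_cast
  rw [Real.smoothTransition.one_of_one_le (by linarith),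
    Real.smoothTransition.zero_of_nonpos (by linarith), sub_zero]

/-- This turns the value of the third distribution on a test function into a limit of integrals, so
that the bound for products applies to it as well. A partition of unity reduces the claim to test
functions of small support. -/
theorem hasProductPairing_one (φ : TestFn) : HasProductPairing α (fun _ => 1) X φ (X φ) := by
  obtain ⟨R, hR⟩ := φ.hasCompactSupport.isCompact.isBounded.exists_norm_le
  obtain ⟨n, hn⟩ := exists_nat_gt (16 * R + 1)
  -- Each piece stays within `1 / 16` of its centre in every coordinate, hence within `√2 / 16 ≤ 1 /
  -- 8` of it in the plane.
  set δ : ℝ := 1 / 16 with hδ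
  have hδ0 : 0 < δ := by norm_num [hδ]
  set a : ℕ × ℕ × ℕ → SpaceTime → ℝ := fun i z =>
    stepBump δ n i.1 (z.1 0) * stepBump δ n i.2.1 (z.1 1) * stepBump δ n i.2.2 z.2 with ha
  have had : ∀ i, ContDiff ℝ (⊤ : ℕ∞) (a i) := fun i =>
    (((contDiff_stepBump _ _ _).comp (by fun_prop)).mul
      ((contDiff_stepBump _ _ _).comp (by fun_prop))).mul
      ((contDiff_stepBump _ _ _).comp (by fun_prop))
  set ψ : ℕ × ℕ × ℕ → TestFn := fun i => TestFn.of (fun z => φ z * a i z)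
    (φ.contDiff.mul (had i)) φ.hasCompactSupport.mul_right with hψ
  set s := Finset.range (2 * n) with hs
  have hsum : φ = ∑ i ∈ s ×ˢ s ×ˢ s, ψ i := by
    ext z
    have e : (∑ i ∈ s ×ˢ s ×ˢ s, ψ i) z = ∑ i ∈ s ×ˢ s ×ˢ s, ψ i z := by
      simp
    rw [e]
    simp only [hψ, TestFn.of_apply]
    rw [← Finset.mul_sum]
    by_cases hz : φ z = 0
    · simp [hz]
    have h4 := hR z (subset_tsupport _ hz)
    rw [Prod.norm_def, max_le_iff] at h4
    have h6 : ∀ i, |z.1 i| ≤ ‖z.1‖ := fun i => by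
      simpa using PiLp.norm_apply_le z.1 i
    have hh : R ≤ δ * (n - 1) := by rw [hδ]; linarith
    have e1 : ∑ i ∈ s ×ˢ s ×ˢ s, a i z = (∑ i ∈ s, stepBump δ n i (z.1 0)) *
        (∑ i ∈ s, stepBump δ n i (z.1 1)) * (∑ i ∈ s, stepBump δ n i z.2) := by
      rw [Finset.sum_product, mul_assoc, Finset.sum_mul]
      refine Finset.sum_congr rfl fun i _ => ?_
      rw [Finset.sum_product, Finset.sum_mul_sum, Finset.mul_sum]
      refine Finset.sum_congr rfl fun j _ => ?_
      rw [Finset.mul_sum]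
      refine Finset.sum_congr rfl fun k _ => ?_
      simp only [ha]; ring
    rw [e1, sum_stepBump hδ0 ((h6 0).trans (h4.1.trans hh)),
      sum_stepBump hδ0 ((h6 1).trans (h4.1.trans hh)),
      sum_stepBump hδ0 ((Real.norm_eq_abs _ ▸ h4.2).trans hh)]
    ring
  rw [hsum]
  refine hasProductPairing_one_sum _ _ fun i _ => ?_
  refine hasProductPairing_one_of_small
    (WithLp.toLp 2 ![(i.1 - n + 1) * δ, (i.2.1 - n + 1) * δ], (i.2.2 - n + 1) * δ) fun z hz => ?_
  simp only [hψ, TestFn.of_apply, ha, mul_ne_zero_iff] at hz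
  obtain ⟨-, ⟨h1, h2⟩, h3⟩ := hz
  replace h1 := abs_sub_le_of_stepBump_ne_zero hδ0 h1
  replace h2 := abs_sub_le_of_stepBump_ne_zero hδ0 h2
  replace h3 := abs_sub_le_of_stepBump_ne_zero hδ0 h3
  refine ⟨?_, h3.trans (by norm_num [hδ])⟩
  rw [EuclideanSpace.norm_eq, Real.sqrt_le_left (by norm_num)]
  simp only [Fin.sum_univ_two, PiLp.sub_apply, Matrix.cons_val_zero, Matrix.cons_val_one,
    Real.norm_eq_abs]
  have a1 := pow_le_pow_left₀ (abs_nonneg _) h1 2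
  have a2 := pow_le_pow_left₀ (abs_nonneg _) h2 2
  refine (add_le_add a1 a2).trans (by norm_num [hδ])

end Density

/-! ### Periodic functions, unit cells and the spatial partition of unity. -/

/-- `F` is `ℤ²`-periodic in space. -/
def Per {β : Type*} (F : SpaceTime → β) : Prop :=
  ∀ (k : Fin 2 → ℤ) (z : SpaceTime), F (z + (latticeVec k, 0)) = F z

/-- The translate of the unit cell by the lattice vector `k`. -/
def cellAt (k : Fin 2 → ℤ) : Set Plane := {x | ∀ i, ⌊x i⌋ = k i}

/-- The square `[-N, N)²`. -/
def bigBox (N : ℕ) : Set Plane := {x | ∀ i, x i ∈ Ico (-(N : ℝ)) N}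

/-- The indices of the unit cells contained in `[-N, N)²`. -/
def boxIndex (N : ℕ) : Finset (Fin 2 → ℤ) := Fintype.piFinset fun _ => Finset.Ico (-(N : ℤ)) N

lemma measurable_coord (i : Fin 2) : Measurable fun x : Plane => x i :=
  (by fun_prop : Continuous fun x : Plane => x i).measurable

lemma measurableSet_cellAt (k) : MeasurableSet (cellAt k) := by
  unfold cellAt
  simp only [ofPred_forall]
  exact MeasurableSet.iInter fun i =>
    (Int.measurable_floor.comp (measurable_coord i)) (measurableSet_singleton (k i))

lemma measurableSet_bigBox (N) : MeasurableSet (bigBox N) := by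
  unfold bigBox
  simp only [ofPred_forall]
  exact MeasurableSet.iInter fun i => measurable_coord i measurableSet_Ico

lemma cellAt_zero : cellAt 0 = unitCell := by
  ext x
  simp only [cellAt, unitCell, mem_ofPred_eq, Pi.zero_apply, Int.floor_eq_zero_iff]

lemma measurableSet_unitCell : MeasurableSet unitCell := cellAt_zero ▸ measurableSet_cellAt 0

lemma iUnion_cellAt (N : ℕ) : ⋃ k ∈ boxIndex N, cellAt k = bigBox N := by
  ext x
  simp only [mem_iUnion, exists_prop, cellAt, bigBox, boxIndex, Fintype.mem_piFinset,
    Finset.mem_Ico, mem_ofPred_eq, mem_Ico]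
  constructor
  · rintro ⟨k, hk, hx⟩ i
    have h1 : (-(N : ℤ) : ℤ) ≤ ⌊x i⌋ := hx i ▸ (hk i).1
    have h2 : ⌊x i⌋ < (N : ℤ) := hx i ▸ (hk i).2
    rw [Int.le_floor] at h1
    rw [Int.floor_lt] at h2
    exact ⟨by exact_mod_cast h1, by exact_mod_cast h2⟩
  · intro h
    refine ⟨fun i => ⌊x i⌋, fun i => ⟨?_, ?_⟩, fun i => rfl⟩
    · rw [Int.le_floor]; exact_mod_cast (h i).1
    · rw [Int.floor_lt]; exact_mod_cast (h i).2

lemma unitCell_subset_bigBox {N : ℕ} (hN : 1 ≤ N) : unitCell ⊆ bigBox N := by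
  have h' : (1 : ℝ) ≤ N := by exact_mod_cast hN
  intro x hx i
  exact ⟨by linarith [(hx i).1], by linarith [(hx i).2]⟩

lemma pairwiseDisjoint_cellAt (s : Set (Fin 2 → ℤ)) (I : Set ℝ) :
    s.PairwiseDisjoint fun k => cellAt k ×ˢ I := by
  intro k _ k' _ hne
  refine disjoint_left.2 fun z hz hz' => hne ?_
  ext i
  rw [← hz.1 i, hz'.1 i]

lemma bigBox_prod (N : ℕ) (I : Set ℝ) :
    bigBox N ×ˢ I = ⋃ k ∈ boxIndex N, cellAt k ×ˢ I := by
  rw [← iUnion_cellAt]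
  ext z
  simp only [mem_prod, mem_iUnion, exists_prop]
  tauto

lemma preimage_add_prod_unitCell (k : Fin 2 → ℤ) (I : Set ℝ) :
    (fun z : SpaceTime => z + (latticeVec k, 0)) ⁻¹' (cellAt k ×ˢ I) = unitCell ×ˢ I := by
  rw [← cellAt_zero]
  ext z
  simp [cellAt, latticeVec]

lemma setLIntegral_cellAt (k : Fin 2 → ℤ) (I : Set ℝ) (F : SpaceTime → ℝ≥0∞) :
    ∫⁻ z in cellAt k ×ˢ I, F z = ∫⁻ z in unitCell ×ˢ I, F (z + (latticeVec k, 0)) := by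
  rw [← preimage_add_prod_unitCell k I]
  exact ((measurePreserving_add_right volume ((latticeVec k, 0) : SpaceTime)).setLIntegral_comp_preimage_emb
    (measurableEmbedding_addRight _) F _).symm

lemma setIntegral_cellAt (k : Fin 2 → ℤ) (I : Set ℝ) (F : SpaceTime → ℝ) :
    ∫ z in cellAt k ×ˢ I, F z = ∫ z in unitCell ×ˢ I, F (z + (latticeVec k, 0)) := by
  rw [← preimage_add_prod_unitCell k I]
  exact ((measurePreserving_add_right volume ((latticeVec k, 0) : SpaceTime)).setIntegral_preimage_emb
    (measurableEmbedding_addRight _) F _).symm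

lemma card_boxIndex (N : ℕ) : (boxIndex N).card = (2 * N) ^ 2 := by
  simp [boxIndex]
  omega

lemma lintegral_biUnion_finset_le {ι : Type*} (s : Finset ι) (A : ι → Set SpaceTime)
    (F : SpaceTime → ℝ≥0∞) : ∫⁻ z in ⋃ i ∈ s, A i, F z ≤ ∑ i ∈ s, ∫⁻ z in A i, F z := by
  classical
  induction s using Finset.induction_on with
  | empty => simp
  | insert a s ha ih =>
    rw [Finset.set_biUnion_insert, Finset.sum_insert ha]
    exact (lintegral_union_le _ _ _).trans (by gcongr)

lemma setLIntegral_bigBox_le {F : SpaceTime → ℝ≥0∞} (hF : Per F) (N : ℕ) (I : Set ℝ) :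
    ∫⁻ z in bigBox N ×ˢ I, F z ≤ ((2 * N) ^ 2 : ℕ) * ∫⁻ z in unitCell ×ˢ I, F z := by
  rw [bigBox_prod]
  refine (lintegral_biUnion_finset_le _ _ F).trans ?_
  simp_rw [setLIntegral_cellAt, hF _ _]
  rw [Finset.sum_const, card_boxIndex, nsmul_eq_mul]

/-- Integrals of a periodic function over a translated set are controlled by the unit cell. -/
lemma setLIntegral_shift_le {F : SpaceTime → ℝ≥0∞} (hF : Per F) (N : ℕ) {E I : Set ℝ}
    {d : SpaceTime} (hd : ‖d.1‖ ≤ 1) (hE : ∀ s ∈ E, s + d.2 ∈ I) :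
    ∫⁻ z in bigBox N ×ˢ E, F (z + d) ≤
      ((2 * (N + 1)) ^ 2 : ℕ) * ∫⁻ z in unitCell ×ˢ I, F z := by
  have hsub : bigBox N ×ˢ E ⊆ (fun z => z + d) ⁻¹' (bigBox (N + 1) ×ˢ I) := by
    rintro ⟨x, s⟩ ⟨hx, hs⟩
    refine ⟨fun i => ?_, hE s hs⟩
    have h6 : |d.1 i| ≤ 1 := by
      have : |d.1 i| ≤ ‖d.1‖ := by simpa using PiLp.norm_apply_le d.1 i
      linarith
    rw [abs_le] at h6
    have := hx i
    simp only [mem_Ico, Prod.fst_add, PiLp.add_apply, Nat.cast_add, Nat.cast_one] at this ⊢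
    constructor <;> linarith
  calc ∫⁻ z in bigBox N ×ˢ E, F (z + d)
      ≤ ∫⁻ z in (fun z => z + d) ⁻¹' (bigBox (N + 1) ×ˢ I), F (z + d) :=
        lintegral_mono_set hsub
    _ = ∫⁻ z in bigBox (N + 1) ×ˢ I, F z :=
        (measurePreserving_add_right volume d).setLIntegral_comp_preimage_emb
          (measurableEmbedding_addRight _) F _
    _ ≤ _ := setLIntegral_bigBox_le hF _ _

/-- The one-dimensional profile of the periodic partition of unity. -/
def chi₁ (s : ℝ) : ℝ := Real.smoothTransition (s + 1) - Real.smoothTransition s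

lemma contDiff_chi₁ : ContDiff ℝ (⊤ : ℕ∞) chi₁ := by
  unfold chi₁
  exact (Real.smoothTransition.contDiff.comp (by fun_prop)).sub Real.smoothTransition.contDiff

lemma monotone_smoothTransition : Monotone Real.smoothTransition := by
  intro x y hxy
  unfold Real.smoothTransition
  have h1 := expNegInvGlue.nonneg x
  have h2 := expNegInvGlue.nonneg (1 - y)
  have h3 : expNegInvGlue x ≤ expNegInvGlue y := expNegInvGlue.monotone hxy
  have h4 : expNegInvGlue (1 - y) ≤ expNegInvGlue (1 - x) := expNegInvGlue.monotone (by linarith)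
  rw [div_le_div_iff₀ (Real.smoothTransition.pos_denom x) (Real.smoothTransition.pos_denom y)]
  nlinarith

lemma chi₁_nonneg (s : ℝ) : 0 ≤ chi₁ s := sub_nonneg.2 (monotone_smoothTransition (by linarith))

lemma chi₁_le_one (s : ℝ) : chi₁ s ≤ 1 := by
  unfold chi₁
  linarith [Real.smoothTransition.le_one (s + 1), Real.smoothTransition.nonneg s]

lemma mem_Ioo_of_chi₁_ne_zero {s : ℝ} (h : chi₁ s ≠ 0) : s ∈ Ioo (-1 : ℝ) 1 := by
  by_contra hs
  apply h
  unfold chi₁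
  rw [mem_Ioo, not_and_or, not_lt, not_lt] at hs
  rcases hs with h | h
  · rw [Real.smoothTransition.zero_of_nonpos (by linarith),
      Real.smoothTransition.zero_of_nonpos (by linarith), sub_zero]
  · rw [Real.smoothTransition.one_of_one_le (by linarith),
      Real.smoothTransition.one_of_one_le (by linarith), sub_self]

lemma sum_chi₁ {s : ℝ} (hs : s ∈ Ico (0 : ℝ) 1) : chi₁ (s + (-1 : ℤ)) + chi₁ s = 1 := by
  unfold chi₁
  push_cast
  rw [Real.smoothTransition.zero_of_nonpos (x := s + -1) (by linarith [hs.2]),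
    Real.smoothTransition.one_of_one_le (x := s + 1) (by linarith [hs.1]),
    show s + -1 + 1 = s by ring]
  ring

/-- The spatial cutoff whose `ℤ²`-translates form a partition of unity. -/
def chi (z : SpaceTime) : ℝ := chi₁ (z.1 0) * chi₁ (z.1 1)

lemma contDiff_chi : ContDiff ℝ (⊤ : ℕ∞) chi :=
  (contDiff_chi₁.comp (by fun_prop)).mul (contDiff_chi₁.comp (by fun_prop))

lemma chi_nonneg (z) : 0 ≤ chi z := mul_nonneg (chi₁_nonneg _) (chi₁_nonneg _)

lemma chi_le_one (z) : chi z ≤ 1 := mul_le_one₀ (chi₁_le_one _) (chi₁_nonneg _) (chi₁_le_one _)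

lemma abs_chi_le_one (z) : |chi z| ≤ 1 := by
  rw [abs_of_nonneg (chi_nonneg z)]; exact chi_le_one z

lemma mem_Ioo_of_chi_ne_zero {z : SpaceTime} (h : chi z ≠ 0) (i : Fin 2) :
    z.1 i ∈ Ioo (-1 : ℝ) 1 := by
  rw [chi, mul_ne_zero_iff] at h
  fin_cases i
  · exact mem_Ioo_of_chi₁_ne_zero h.1
  · exact mem_Ioo_of_chi₁_ne_zero h.2

lemma mem_bigBox_of_chi_ne_zero {z : SpaceTime} (h : chi z ≠ 0) : z.1 ∈ bigBox 1 := by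
  intro i
  have := mem_Ioo_of_chi_ne_zero h i
  exact ⟨by simpa using this.1.le, by simpa using this.2⟩

/-- Only the offsets `-1` and `0` in each coordinate contribute on the unit cell; the double sum
factors and each factor telescopes to one. -/
lemma sum_chi {z : SpaceTime} (hz : z.1 ∈ unitCell) :
    ∑ k ∈ boxIndex 1, chi (z + (latticeVec k, 0)) = 1 := by
  have e : (Finset.Ico (-((1 : ℕ) : ℤ)) ((1 : ℕ) : ℤ)) = {-1, 0} := by decide
  have h0 := sum_chi₁ (hz 0)
  have h1 := sum_chi₁ (hz 1)
  have e2 : ∑ k ∈ boxIndex 1, chi (z + (latticeVec k, 0)) =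
      ∑ k ∈ boxIndex 1, ∏ i, chi₁ (z.1 i + k i) := by
    refine Finset.sum_congr rfl fun k _ => ?_
    simp [chi, latticeVec]
  rw [e2, boxIndex, Finset.sum_prod_piFinset
    (Finset.Ico (-((1 : ℕ) : ℤ)) ((1 : ℕ) : ℤ)) (fun i j => chi₁ (z.1 i + (j : ℤ))), e]
  simp only [Int.reduceNeg, Fin.prod_univ_two]
  rw [Finset.sum_pair (by decide), Finset.sum_pair (by decide)]
  simp only [Int.cast_zero, add_zero]
  rw [h0, h1, one_mul]

/-- Integrating a periodic function against the cutoff gives the integral over the unit cell. -/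
lemma integral_chi_mul {F : SpaceTime → ℝ} (hF : Per F) {I : Set ℝ} (hI : MeasurableSet I)
    (hi : IntegrableOn F (bigBox 1 ×ˢ I)) :
    ∫ z in univ ×ˢ I, chi z * F z = ∫ z in unitCell ×ˢ I, F z := by
  have hmeas : ∀ k, MeasurableSet (cellAt k ×ˢ I) := fun k => (measurableSet_cellAt k).prod hI
  have hi' : IntegrableOn (fun z => chi z * F z) (bigBox 1 ×ˢ I) :=
    hi.bdd_mul contDiff_chi.continuous.aestronglyMeasurable (c := 1)
      (ae_of_all _ fun z => abs_chi_le_one z)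
  have hk : ∀ k ∈ boxIndex 1, cellAt k ×ˢ I ⊆ bigBox 1 ×ˢ I := fun k hk => by
    rw [bigBox_prod]; exact subset_biUnion_of_mem (u := fun k => cellAt k ×ˢ I) hk
  have e1 : ∫ z in univ ×ˢ I, chi z * F z = ∫ z in bigBox 1 ×ˢ I, chi z * F z := by
    refine setIntegral_eq_of_subset_of_forall_sdiff_eq_zero (MeasurableSet.univ.prod hI)
      (prod_mono (subset_univ _) le_rfl) fun z hz => ?_
    have : chi z = 0 := by
      by_contra h
      exact hz.2 ⟨mem_bigBox_of_chi_ne_zero h, hz.1.2⟩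
    rw [this, zero_mul]
  -- The four cells meeting the support of the cutoff are translated back to the unit cell, where
  -- the translated cutoffs add up to one.
  rw [e1, bigBox_prod, integral_biUnion_finset _ (fun k _ => hmeas k)
    (pairwiseDisjoint_cellAt _ _) fun k hk' => hi'.mono_set (hk k hk')]
  simp_rw [setIntegral_cellAt, hF _ _]
  have hic : ∀ k, IntegrableOn (fun z => chi (z + (latticeVec k, 0)) * F z) (unitCell ×ˢ I) :=
    fun k => (hi.mono_set (prod_mono (unitCell_subset_bigBox le_rfl) le_rfl)).bdd_mul
      (contDiff_chi.continuous.comp (by fun_prop)).aestronglyMeasurable (c := 1)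
      (ae_of_all _ fun z => abs_chi_le_one _)
  rw [← integral_finsetSum _ fun k _ => hic k]
  refine setIntegral_congr_fun (measurableSet_unitCell.prod hI) fun z hz => ?_
  rw [← Finset.sum_mul, sum_chi hz.1, one_mul]

/-! ### Weak flows: the equation with its right-hand side recorded as a bound. -/

/-- `B` bounds the `L¹` norm of `F` plus the weighted sum of its dyadic `L¹` moduli of
continuity. -/
def ModBound (α : ℝ) (F : SpaceTime → ℝ) (B : ℝ) : Prop :=
  ∃ (β : ℝ) (b : ℕ → ℝ), (∫ z, |F z|) ≤ β ∧
    (∀ n, ∀ d : SpaceTime, ‖d.1‖ ≤ scale n → |d.2| ≤ scale n ^ 2 → ∫ z, |F (z + d) - F z| ≤ b n) ∧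
    Summable (fun n => scale n ^ α * b n) ∧ β + ∑' n, scale n ^ α * b n ≤ B

/-- Lebesgue measure is translation invariant, so all lattice translates of one localised product
share a single bound. -/
lemma ModBound.translate {α : ℝ} {F : SpaceTime → ℝ} {B : ℝ} (h : ModBound α F B)
    (c : SpaceTime) : ModBound α (fun z => F (z - c)) B := by
  obtain ⟨β, b, h1, h2, h3, h4⟩ := h
  refine ⟨β, b, ?_, fun n d hd hd' => ?_, h3, h4⟩
  · rwa [integral_sub_right_eq_self fun z => |F z|]
  · refine le_trans (le_of_eq ?_) (h2 n d hd hd')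
    rw [← integral_sub_right_eq_self (fun z => |F (z + d) - F z|) c]
    simp_rw [sub_add_eq_add_sub]

/-- The spatial gradient. -/
def sgrad (f : SpaceTime → ℝ) (z : SpaceTime) : Plane :=
  (InnerProductSpace.toDual ℝ Plane).symm
    ((fderiv ℝ f z).comp (ContinuousLinearMap.inl ℝ Plane ℝ))

lemma inner_sgrad (f : SpaceTime → ℝ) (z : SpaceTime) (v : Plane) :
    inner ℝ (sgrad f z) v = fderiv ℝ f z (v, 0) := by
  simp [sgrad, InnerProductSpace.toDual_symm_apply]

lemma continuous_sgrad {f : SpaceTime → ℝ} (hf : ContDiff ℝ (⊤ : ℕ∞) f) : Continuous (sgrad f) :=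
  (LinearIsometryEquiv.continuous _).comp
    ((hf.continuous_fderiv (by simp)).clm_comp continuous_const)

/-- The reduced setting: a periodic weak solution `w` with gradient `G` and flux `H`, whose
equation is only recorded through the bounds on the products with distributions. -/
structure WeakFlow (α γ lam Lam T Q : ℝ) (w : SpaceTime → ℝ) (G H : SpaceTime → Plane) :
    Prop where
  per_w : Per w
  holder : ∃ K, 0 ≤ K ∧ ∀ z z', |w z - w z'| ≤ K * parabolicSize (z - z') ^ γ
  bdd : ∃ K, ∀ z, |w z| ≤ K
  meas_G : Measurable G
  meas_H : Measurable H
  per_G : Per G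
  bound_H : ∀ z, ‖H z‖ ≤ Lam * ‖G z‖
  elliptic : ∀ z, lam * ‖G z‖ ^ 2 ≤ inner ℝ (G z) (H z)
  sqInt : ∀ a b, 0 < a → b < T → IntegrableOn (fun z => ‖G z‖ ^ 2) (unitCell ×ˢ Ioo a b)
  grad : ∀ φ : TestFn, tsupport φ ⊆ openSlab T → ∀ v : Plane,
    ∫ z, w z * fderiv ℝ φ z (v, 0) = - ∫ z, inner ℝ (G z) v * φ z
  weak : ∀ φ : TestFn, tsupport φ ⊆ openSlab T → ∀ B₂ B₁ B₀ : ℝ,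
    ModBound α (fun z => w z ^ 2 * φ z) B₂ → ModBound α (fun z => w z * φ z) B₁ →
    ModBound α φ B₀ →
    - (∫ z, w z * fderiv ℝ φ z (0, 1)) + (∫ z, inner ℝ (sgrad φ z) (H z)) +
      (∫ z, w z ^ 3 * φ z) ≤ Q * (B₂ + B₁ + B₀)

/-! ### Testing a weak flow against spatially periodic functions. -/

lemma Per.sub {β : Type*} {F : SpaceTime → β} (hF : Per F) (k : Fin 2 → ℤ) (z : SpaceTime) :
    F (z - (latticeVec k, 0)) = F z := by
  conv_rhs => rw [show z = z - (latticeVec k, 0) + (latticeVec k, 0) by abel]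
  rw [hF]

lemma integrableOn_bigBox {F : SpaceTime → ℝ} (hF : Per F) {I : Set ℝ}
    (hi : IntegrableOn F (unitCell ×ˢ I)) (N : ℕ) : IntegrableOn F (bigBox N ×ˢ I) := by
  rw [bigBox_prod, integrableOn_finset_iUnion]
  intro k _
  rw [← (measurePreserving_add_right volume ((latticeVec k, 0) : SpaceTime)).integrableOn_comp_preimage
    (measurableEmbedding_addRight _), preimage_add_prod_unitCell]
  exact hi.congr_fun_ae (ae_of_all _ fun z => (hF k z).symm)

lemma integral_strip_translate {I : Set ℝ} (k : Fin 2 → ℤ) (u : SpaceTime → ℝ)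
    {F : SpaceTime → ℝ} (hF : Per F) :
    ∫ z in univ ×ˢ I, u (z - (latticeVec k, 0)) * F z = ∫ z in univ ×ˢ I, u z * F z := by
  have := (measurePreserving_sub_right volume ((latticeVec k, 0) : SpaceTime)).setIntegral_preimage_emb
    (measurableEmbedding_subRight _) (fun z => u z * F z) (univ ×ˢ I)
  rw [← this]
  have e : (fun z : SpaceTime => z - (latticeVec k, 0)) ⁻¹' (univ ×ˢ I) = univ ×ˢ I := by
    ext z; simp
  rw [e]
  simp_rw [hF.sub]

lemma integrableOn_strip {u F : SpaceTime → ℝ} {I : Set ℝ} (hI : MeasurableSet I) {N : ℕ} {C : ℝ}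
    (hu : Measurable u)
    (huN : ∀ z, u z ≠ 0 → z.1 ∈ bigBox N) (huC : ∀ z, |u z| ≤ C)
    (hF : IntegrableOn F (bigBox N ×ˢ I)) : IntegrableOn (fun z => u z * F z) (univ ×ˢ I) := by
  have h1 : IntegrableOn (fun z => u z * F z) (bigBox N ×ˢ I) :=
    hF.bdd_mul hu.aestronglyMeasurable (c := C) (ae_of_all _ fun z => huC z)
  refine IntegrableOn.of_forall_sdiff_eq_zero h1 (MeasurableSet.univ.prod hI) fun z hz => ?_
  have : u z = 0 := by
    by_contra h
    exact hz.2 ⟨huN z h, hz.1.2⟩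
  rw [this, zero_mul]

lemma exists_bigBox (S : Set Plane) (hS : Bornology.IsBounded S) : ∃ N, S ⊆ bigBox N := by
  obtain ⟨R, hR⟩ := hS.exists_norm_le
  obtain ⟨N, hN⟩ := exists_nat_gt R
  refine ⟨N, fun x hx i => ?_⟩
  have h6 : |x i| ≤ ‖x‖ := by simpa using PiLp.norm_apply_le x i
  have := hR x hx
  exact ⟨by linarith [(abs_le.1 h6).1], by linarith [(abs_le.1 h6).2]⟩

/-- The derivative of the smooth step. -/
def dStep : ℝ → ℝ := deriv Real.smoothTransition

lemma continuous_dStep : Continuous dStep :=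
  (Real.smoothTransition.contDiff (n := 1)).continuous_deriv le_rfl

lemma dStep_eq_zero {s : ℝ} (h : s ∉ Icc (0 : ℝ) 1) : dStep s = 0 := by
  rw [mem_Icc, not_and_or, not_le, not_le] at h
  rcases h with h | h
  · have : Real.smoothTransition =ᶠ[𝓝 s] fun _ => 0 := by
      filter_upwards [Iio_mem_nhds h] with t ht
      exact Real.smoothTransition.zero_of_nonpos (le_of_lt ht)
    rw [dStep, this.deriv_eq, deriv_const]
  · have : Real.smoothTransition =ᶠ[𝓝 s] fun _ => 1 := by
      filter_upwards [Ioi_mem_nhds h] with t ht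
      exact Real.smoothTransition.one_of_one_le (le_of_lt ht)
    rw [dStep, this.deriv_eq, deriv_const]

lemma exists_dStep_bound : ∃ C, 0 ≤ C ∧ ∀ s, |dStep s| ≤ C := by
  have hc : HasCompactSupport dStep :=
    HasCompactSupport.intro isCompact_Icc fun s hs => dStep_eq_zero hs
  obtain ⟨C, hC⟩ := hc.exists_bound_of_continuous continuous_dStep
  exact ⟨C, (norm_nonneg _).trans (hC 0), hC⟩

lemma hasDerivAt_smoothTransition (s : ℝ) :
    HasDerivAt Real.smoothTransition (dStep s) s :=
  ((Real.smoothTransition.contDiff (n := 1)).differentiable (by simp) s).hasDerivAt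

lemma hasDerivAt_chi₁ (s : ℝ) : HasDerivAt chi₁ (dStep (s + 1) - dStep s) s := by
  unfold chi₁
  exact ((hasDerivAt_smoothTransition (s + 1)).comp_add_const s 1).sub
    (hasDerivAt_smoothTransition s)

/-- The derivative of `chi₁` is a difference of two neighbouring steps, so a row of translates
telescopes to its two ends. This keeps the contribution of the rim of a block linear in its side. -/
lemma sum_range_deriv_chi₁ (L : ℕ) (s : ℝ) :
    ∑ k ∈ Finset.range L, (dStep (s - k + 1) - dStep (s - k)) =
    dStep (s + 1) - dStep (s + 1 - L) := by
  have h := Finset.sum_range_sub' (fun k : ℕ => dStep (s + 1 - k)) L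
  simp only [Nat.cast_zero, sub_zero] at h
  rw [← h]
  refine Finset.sum_congr rfl fun k _ => ?_
  push_cast
  rw [show s - k + 1 = s + 1 - k by ring, show s + 1 - (k + 1 : ℝ) = s - k by ring]

lemma fderiv_chi (z : SpaceTime) (v : Plane) (τ : ℝ) : fderiv ℝ chi z (v, τ) =
    (dStep (z.1 0 + 1) - dStep (z.1 0)) * chi₁ (z.1 1) * v 0 +
      chi₁ (z.1 0) * (dStep (z.1 1 + 1) - dStep (z.1 1)) * v 1 := by
  have hc : ∀ i : Fin 2, HasFDerivAt (fun z : SpaceTime => z.1 i)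
      ((EuclideanSpace.proj i : Plane →L[ℝ] ℝ).comp (ContinuousLinearMap.fst ℝ Plane ℝ)) z :=
    fun i => ((EuclideanSpace.proj i : Plane →L[ℝ] ℝ).comp
      (ContinuousLinearMap.fst ℝ Plane ℝ)).hasFDerivAt
  have h0 := (hasDerivAt_chi₁ (z.1 0)).comp_hasFDerivAt z (hc 0)
  have h1 := (hasDerivAt_chi₁ (z.1 1)).comp_hasFDerivAt z (hc 1)
  have h : HasFDerivAt chi _ z := h0.mul h1
  rw [h.fderiv]
  simp
  ring

lemma exists_fderiv_chi_bound : ∃ C, 0 ≤ C ∧ ∀ z : SpaceTime, ∀ v : Plane,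
    |fderiv ℝ chi z (v, 0)| ≤ C * ‖v‖ := by
  obtain ⟨C, hC, h⟩ := exists_dStep_bound
  refine ⟨4 * C, by positivity, fun z v => ?_⟩
  rw [fderiv_chi]
  have h6 : ∀ i, |v i| ≤ ‖v‖ := fun i => by simpa using PiLp.norm_apply_le v i
  have hd : ∀ s, |dStep (s + 1) - dStep s| ≤ 2 * C := fun s =>
    (abs_sub _ _).trans (by linarith [h (s + 1), h s])
  have hx : ∀ s, |chi₁ s| ≤ 1 := fun s => by
    rw [abs_of_nonneg (chi₁_nonneg s)]; exact chi₁_le_one s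
  calc _ ≤ |(dStep (z.1 0 + 1) - dStep (z.1 0)) * chi₁ (z.1 1) * v 0| +
      |chi₁ (z.1 0) * (dStep (z.1 1 + 1) - dStep (z.1 1)) * v 1| := abs_add_le _ _
    _ ≤ 2 * C * 1 * ‖v‖ + 1 * (2 * C) * ‖v‖ := by
        rw [abs_mul, abs_mul, abs_mul, abs_mul]
        gcongr
        exacts [hd _, hx _, h6 _, hx _, hd _, h6 _]
    _ = _ := by ring

lemma exists_lattice_add (z : SpaceTime) : ∃ k : Fin 2 → ℤ, (z - (latticeVec k, 0)).1 ∈ unitCell := by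
  refine ⟨fun i => ⌊z.1 i⌋, fun i => ?_⟩
  simp only [latticeVec, Prod.fst_sub, PiLp.sub_apply]
  exact ⟨sub_nonneg.2 (Int.floor_le _), by linarith [Int.lt_floor_add_one (z.1 i)]⟩

lemma norm_le_of_coord {x : Plane} {c : ℝ} (hc : 0 ≤ c) (h : ∀ i, |x i| ≤ c) : ‖x‖ ≤ 2 * c := by
  rw [EuclideanSpace.norm_eq, Real.sqrt_le_left (by positivity)]
  simp only [Fin.sum_univ_two, Real.norm_eq_abs]
  have a1 := pow_le_pow_left₀ (abs_nonneg _) (h 0) 2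
  have a2 := pow_le_pow_left₀ (abs_nonneg _) (h 1) 2
  nlinarith

lemma exists_bound_of_per {E : Type*} [NormedAddCommGroup E] {F : SpaceTime → E} (hF : Per F)
    (hc : Continuous F) {K : Set ℝ} (hK : IsCompact K) :
    ∃ C, 0 ≤ C ∧ ∀ z : SpaceTime, z.2 ∈ K → ‖F z‖ ≤ C := by
  obtain ⟨C, hC⟩ := ((isCompact_closedBall (0 : Plane) 2).prod hK).exists_bound_of_continuousOn
    hc.continuousOn
  refine ⟨max C 0, le_max_right _ _, fun z hz => ?_⟩
  obtain ⟨k, hk⟩ := exists_lattice_add z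
  rw [← hF.sub k]
  refine (hC _ ⟨?_, by simpa using hz⟩).trans (le_max_left _ _)
  rw [mem_closedBall_zero_iff]
  refine (norm_le_of_coord zero_le_one fun i => ?_).trans (by norm_num)
  rw [abs_le]
  exact ⟨by linarith [(hk i).1], (hk i).2.le⟩

lemma Per.sgrad {f : SpaceTime → ℝ} (hf : Per f) : Per (sgrad f) := by
  intro k z
  unfold _root_.sgrad
  have e : (fun z => f (z + (latticeVec k, 0))) = f := funext (hf k)
  rw [← fderiv_comp_add_right, e]

lemma norm_le_of_chi_ne_zero {z : SpaceTime} (h : chi z ≠ 0) : ‖z.1‖ ≤ 2 := by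
  refine (norm_le_of_coord zero_le_one fun i => ?_).trans (by norm_num)
  have := mem_Ioo_of_chi_ne_zero h i
  exact (abs_lt.2 this).le

lemma mem_closedBall_of_norm_sub_le {z c : SpaceTime} {r : ℝ} (h : ‖(z - c).1‖ ≤ r) :
    z.1 ∈ Metric.closedBall c.1 r := by
  rw [mem_closedBall_iff_norm, ← Prod.fst_sub]
  exact h

lemma mem_closedBall_of_chi_ne_zero {z c : SpaceTime} (h : chi (z - c) ≠ 0) :
    z.1 ∈ Metric.closedBall c.1 2 :=
  mem_closedBall_of_norm_sub_le (norm_le_of_chi_ne_zero h)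

lemma volume_unitCell_lt_top : volume unitCell < ∞ := by
  refine lt_of_le_of_lt (measure_mono (t := Metric.closedBall 0 2) ?_) measure_closedBall_lt_top
  intro x hx
  rw [mem_closedBall_zero_iff]
  refine (norm_le_of_coord zero_le_one fun i => ?_).trans (by norm_num)
  rw [abs_le]
  exact ⟨by linarith [(hx i).1], (hx i).2.le⟩

lemma volume_cyl_lt_top (a b : ℝ) : volume (unitCell ×ˢ Ioo a b) < ∞ := by
  rw [Measure.volume_eq_prod, Measure.prod_prod]
  exact ENNReal.mul_lt_top volume_unitCell_lt_top (by simp)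

lemma measurableSet_cyl (a b : ℝ) : MeasurableSet (unitCell ×ˢ Ioo a b) :=
  measurableSet_unitCell.prod measurableSet_Ioo

lemma integrableOn_cyl_of_bound {E : Type*} [NormedAddCommGroup E] {F : SpaceTime → E} {a b C : ℝ}
    (hm : AEStronglyMeasurable F (volume.restrict (unitCell ×ˢ Ioo a b)))
    (hC : ∀ z : SpaceTime, z.2 ∈ Ioo a b → ‖F z‖ ≤ C) : IntegrableOn F (unitCell ×ˢ Ioo a b) := by
  have : IsFiniteMeasure (volume.restrict (unitCell ×ˢ Ioo a b)) :=
    ⟨by simpa using volume_cyl_lt_top a b⟩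
  refine Integrable.of_bound hm C ?_
  filter_upwards [ae_restrict_mem (measurableSet_cyl a b)] with z hz
  exact hC z hz.2

lemma WeakFlow.continuous_w {α γ lam Lam T Q : ℝ} {w : SpaceTime → ℝ} {G H : SpaceTime → Plane}
    (h : WeakFlow α γ lam Lam T Q w G H) (hγ : 0 < γ) : Continuous w := by
  obtain ⟨K, hK, hw⟩ := h.holder
  rw [continuous_iff_continuousAt]
  intro z
  rw [ContinuousAt, tendsto_iff_dist_tendsto_zero]
  refine squeeze_zero (fun _ => dist_nonneg) (fun z' => (Real.dist_eq _ _).le.trans (hw z' z)) ?_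
  have : Continuous fun z' => K * parabolicSize (z' - z) ^ γ := by
    unfold parabolicSize
    exact continuous_const.mul (Continuous.rpow_const (by fun_prop) fun _ => Or.inr hγ.le)
  convert this.tendsto z using 2
  simp [parabolicSize, Real.zero_rpow hγ.ne']

set_option maxHeartbeats 1000000 in
-- A periodic `ψ` is not compactly supported, and the flux `H` is not periodic, so the cells cannot
-- be identified. Testing with `ψ` times each translate of `chi` in an `L × L` block gives `L²`
-- copies of one inequality, apart from the terms `ψ ∇χ · H`. Summed over the block these telescope
-- to its rim and are `O(L)`, so division by `L²` removes them. The bulk flux enters only through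
-- the lower bound `λ μ |G|² - Λ |G| |∇ψ - μ G|`, which is periodic; the weight `μ ≥ 0` is free, so
-- that later uses can take `μ G` close to `∇ψ` or `μ = 0`.
theorem WeakFlow.periodic_ineq {α γ lam Lam T Q : ℝ} {w : SpaceTime → ℝ} {G H : SpaceTime → Plane}
    (h : WeakFlow α γ lam Lam T Q w G H) (hγ : 0 < γ) (hLam : 0 ≤ Lam) {a a' b' b : ℝ} (ha : 0 < a)
    (haa : a < a') (hbb : b' < b) (hb : b < T) {ψ μ : SpaceTime → ℝ}
    (hψ : ContDiff ℝ (⊤ : ℕ∞) ψ) (hψp : Per ψ) (hψs : ∀ z, ψ z ≠ 0 → z.2 ∈ Icc a' b')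
    (hμ : Measurable μ) (hμp : Per μ) {m : ℝ} (hμ0 : ∀ z, 0 ≤ μ z) (hμm : ∀ z, μ z ≤ m)
    {B₂ B₁ B₀ : ℝ} (h2 : ModBound α (fun z => chi z * (w z ^ 2 * ψ z)) B₂)
    (h1 : ModBound α (fun z => chi z * (w z * ψ z)) B₁)
    (h0 : ModBound α (fun z => chi z * ψ z) B₀) :
    - (∫ z in unitCell ×ˢ Ioo a b, w z * fderiv ℝ ψ z (0, 1)) +
      (∫ z in unitCell ×ˢ Ioo a b,
        (lam * μ z * ‖G z‖ ^ 2 - Lam * ‖G z‖ * ‖sgrad ψ z - μ z • G z‖)) +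
      (∫ z in unitCell ×ˢ Ioo a b, w z ^ 3 * ψ z) ≤ Q * (B₂ + B₁ + B₀) := by
  have hwc := h.continuous_w hγ
  set κ : ℕ → ℕ → SpaceTime := fun i j => (latticeVec ![(i : ℤ), (j : ℤ)], 0) with hκ
  set S : Set SpaceTime := univ ×ˢ Ioo a b with hS
  have hSm : MeasurableSet S := MeasurableSet.univ.prod measurableSet_Ioo
  have hIcc : Icc a' b' ⊆ Ioo a b := fun t ht => ⟨by linarith [ht.1], by linarith [ht.2]⟩
  have hψsupp : ∀ z, z ∉ S → ∀ᶠ z' in 𝓝 z, ψ z' = 0 := by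
    intro z hz
    have : z.2 ∉ Icc a' b' := fun h' => hz ⟨mem_univ _, hIcc h'⟩
    have ho : IsOpen ((fun z : SpaceTime => z.2) ⁻¹' (Icc a' b')ᶜ) :=
      isClosed_Icc.isOpen_compl.preimage continuous_snd
    filter_upwards [ho.mem_nhds this] with z' hz'
    by_contra hne
    exact hz' (hψs z' hne)
  have hψ0 : ∀ z, z ∉ S → ψ z = 0 := fun z hz => (hψsupp z hz).self_of_nhds
  have hψd0 : ∀ z, z ∉ S → fderiv ℝ ψ z = 0 := fun z hz => by
    rw [Filter.EventuallyEq.fderiv_eq (f := fun _ => 0) (hψsupp z hz)]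
    simp
  have hcψ : Continuous ψ := hψ.continuous
  have hcdψ : Continuous (fun z => fderiv ℝ ψ z (0, 1)) :=
    (hψ.continuous_fderiv (by simp)).clm_apply continuous_const
  have hcsψ : Continuous (sgrad ψ) := continuous_sgrad hψ
  -- the localised test functions
  have hcd : ∀ i j, ContDiff ℝ (⊤ : ℕ∞) fun z => chi (z - κ i j) * ψ z := fun i j =>
    (contDiff_chi.comp (contDiff_id.sub contDiff_const)).mul hψ
  have hsup : ∀ i j z, chi (z - κ i j) * ψ z ≠ 0 →
      z ∈ Metric.closedBall (κ i j).1 2 ×ˢ Icc a' b' := by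
    intro i j z hz
    rw [mul_ne_zero_iff] at hz
    exact ⟨mem_closedBall_of_chi_ne_zero hz.1, hψs z hz.2⟩
  have hcs : ∀ i j, HasCompactSupport fun z => chi (z - κ i j) * ψ z := fun i j => by
    have hK : IsCompact (Metric.closedBall (κ i j).1 2 ×ˢ Icc a' b') :=
      (isCompact_closedBall _ _).prod isCompact_Icc
    exact HasCompactSupport.intro hK fun z hz => by_contra fun hne => hz (hsup i j z hne)
  set φ : ℕ → ℕ → TestFn := fun i j => TestFn.of _ (hcd i j) (hcs i j) with hφ
  have hφsupp : ∀ i j, tsupport (φ i j) ⊆ openSlab T := by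
    intro i j
    have hcl : IsClosed (Metric.closedBall (κ i j).1 2 ×ˢ Icc a' b') :=
      Metric.isClosed_closedBall.prod isClosed_Icc
    have hsub : Function.support (fun z => chi (z - κ i j) * ψ z) ⊆
      Metric.closedBall (κ i j).1 2 ×ˢ Icc a' b' := hsup i j
    intro z hz
    have := hIcc (closure_minimal hsub hcl hz).2
    exact ⟨by linarith [this.1], by linarith [this.2]⟩
  have hfd : ∀ i j z v, fderiv ℝ (φ i j) z v =
      chi (z - κ i j) * fderiv ℝ ψ z v + ψ z * fderiv ℝ chi (z - κ i j) v := by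
    intro i j z v
    have hchi : HasFDerivAt (fun z => chi (z - κ i j)) (fderiv ℝ chi (z - κ i j)) z := by
      have := (contDiff_chi.differentiable (by simp) (z - κ i j)).hasFDerivAt
      have hs : HasFDerivAt (fun z : SpaceTime => z - κ i j)
        (ContinuousLinearMap.id ℝ SpaceTime) z := (hasFDerivAt_id z).sub_const _
      have h3 := this.comp z hs
      rwa [ContinuousLinearMap.comp_id] at h3
    have hprod := hchi.mul (hψ.differentiable (by simp) z).hasFDerivAt
    have : HasFDerivAt (φ i j) _ z := hprod
    rw [this.fderiv]
    simp
  have hpt : Per (fun z => fderiv ℝ ψ z (0, 1)) := fun k z => by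
    have e : (fun z => ψ (z + (latticeVec k, 0))) = ψ := funext (hψp k)
    simp only
    rw [← fderiv_comp_add_right, e]
  have hwp : ∀ i j z, w (z - κ i j) = w z := fun i j z => h.per_w.sub _ z
  have hψp' : ∀ i j z, ψ (z - κ i j) = ψ z := fun i j z => hψp.sub _ z
  -- By periodicity of `w` and `ψ` the three products are translates of those at the origin, so one
  -- triple of bounds serves all cells.
  have hweak : ∀ i j, - (∫ z, w z * fderiv ℝ (φ i j) z (0, 1)) +
      (∫ z, inner ℝ (sgrad (φ i j) z) (H z)) + (∫ z, w z ^ 3 * φ i j z) ≤ Q * (B₂ + B₁ + B₀) := by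
    intro i j
    refine h.weak (φ i j) (hφsupp i j) B₂ B₁ B₀ ?_ ?_ ?_
    · convert h2.translate (κ i j) using 2 with z
      rw [hwp, hψp']; simp only [hφ, TestFn.of_apply]; ring
    · convert h1.translate (κ i j) using 2 with z
      rw [hwp, hψp']; simp only [hφ, TestFn.of_apply]; ring
    · convert h0.translate (κ i j) using 2 with z
      rw [hψp']; simp only [hφ, TestFn.of_apply]
  -- integrability
  have hGi : ∀ N, IntegrableOn (fun z => ‖G z‖ ^ 2) (bigBox N ×ˢ Ioo a b) := fun N =>
    integrableOn_bigBox (fun k z => by rw [h.per_G]) (h.sqInt a b ha hb) N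
  have hcyl1 : IntegrableOn (fun _ : SpaceTime => (1 : ℝ)) (unitCell ×ˢ Ioo a b) :=
    integrableOn_cyl_of_bound (C := 1) (by fun_prop) (by simp)
  have hper1 : Per (fun z => 1 + ‖G z‖ ^ 2) := fun k z => by simp only; rw [h.per_G]
  have hG1 : ∀ N, IntegrableOn (fun z => 1 + ‖G z‖ ^ 2) (bigBox N ×ˢ Ioo a b) := fun N =>
    integrableOn_bigBox hper1 (hcyl1.add (h.sqInt a b ha hb)) N
  have hGn : ∀ N, IntegrableOn (fun z => ‖G z‖) (bigBox N ×ˢ Ioo a b) := fun N =>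
    (hG1 N).mono' h.meas_G.norm.aestronglyMeasurable
      (ae_of_all _ fun z => by
        rw [norm_norm]; nlinarith [sq_nonneg (‖G z‖ - 1), norm_nonneg (G z)])
  obtain ⟨Cψ, hCψ0, hCψ'⟩ := exists_bound_of_per hψp hcψ (isCompact_Icc (a := a) (b := b))
  obtain ⟨Cs, hCs0, hCs⟩ := exists_bound_of_per hψp.sgrad hcsψ (isCompact_Icc (a := a) (b := b))
  have hCψ : ∀ z, |ψ z| ≤ Cψ := fun z => by
    by_cases hz : z ∈ S
    · exact hCψ' z (Ioo_subset_Icc_self hz.2)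
    · rw [hψ0 z hz, abs_zero]; exact hCψ0
  have hm0 : 0 ≤ m := (hμ0 0).trans (hμm 0)
  have hE : Per (fun z => lam * μ z * ‖G z‖ ^ 2 - Lam * ‖G z‖ * ‖sgrad ψ z - μ z • G z‖) := by
    intro k z
    simp only
    rw [hμp, h.per_G, hψp.sgrad]
  have hEm : Measurable
      (fun z => lam * μ z * ‖G z‖ ^ 2 - Lam * ‖G z‖ * ‖sgrad ψ z - μ z • G z‖) := by
    have := h.meas_G
    have := hcsψ.measurable
    fun_prop
  have hEi : ∀ N, IntegrableOn
      (fun z => lam * μ z * ‖G z‖ ^ 2 - Lam * ‖G z‖ * ‖sgrad ψ z - μ z • G z‖)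
      (bigBox N ×ˢ Ioo a b) := by
    intro N
    refine ((hG1 N).const_mul (|lam| * m + Lam * Cs + Lam * m)).mono' hEm.aestronglyMeasurable ?_
    filter_upwards [ae_restrict_mem ((measurableSet_bigBox N).prod measurableSet_Ioo)] with z hz
    have hs := hCs z (Ioo_subset_Icc_self hz.2)
    have hg := norm_nonneg (G z)
    have h3 : ‖sgrad ψ z - μ z • G z‖ ≤ Cs + m * ‖G z‖ := by
      refine (norm_sub_le _ _).trans ?_
      rw [norm_smul, Real.norm_eq_abs, abs_of_nonneg (hμ0 z)]
      gcongr
      exact hμm z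
    rw [Real.norm_eq_abs]
    refine (abs_sub _ _).trans ?_
    rw [abs_mul, abs_mul, abs_mul, abs_mul, abs_of_nonneg (hμ0 z), abs_of_nonneg hLam,
      abs_of_nonneg (sq_nonneg ‖G z‖), abs_of_nonneg hg,
      abs_of_nonneg (norm_nonneg (sgrad ψ z - μ z • G z))]
    have h5 : |lam| * μ z * ‖G z‖ ^ 2 ≤ |lam| * m * ‖G z‖ ^ 2 := by
      gcongr; exact hμm z
    have h6 : Lam * ‖G z‖ * ‖sgrad ψ z - μ z • G z‖ ≤ Lam * ‖G z‖ * (Cs + m * ‖G z‖) := by gcongr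
    have h7 : Lam * Cs * ‖G z‖ ≤ Lam * Cs * (1 + ‖G z‖ ^ 2) := by
      gcongr; nlinarith [sq_nonneg (‖G z‖ - 1)]
    have h8 : 0 ≤ |lam| * m + Lam * m := by positivity
    nlinarith
  -- a periodic integrand against the shifted cutoff
  have hchim : Measurable chi := contDiff_chi.continuous.measurable
  have hfold : ∀ i j (F : SpaceTime → ℝ), Per F →
      (∀ N, IntegrableOn F (bigBox N ×ˢ Ioo a b)) →
      IntegrableOn (fun z => chi (z - κ i j) * F z) S ∧
      ∫ z in S, chi (z - κ i j) * F z = ∫ z in unitCell ×ˢ Ioo a b, F z := by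
    intro i j F hF hFi
    obtain ⟨N, hN⟩ := exists_bigBox (Metric.closedBall (κ i j).1 2) Metric.isBounded_closedBall
    refine ⟨integrableOn_strip (N := N) (C := 1) measurableSet_Ioo (by fun_prop) (fun z hz => ?_)
      (fun z => abs_chi_le_one _) (hFi N), ?_⟩
    · exact hN (mem_closedBall_of_chi_ne_zero hz)
    · rw [hS, integral_strip_translate _ chi hF, integral_chi_mul hF measurableSet_Ioo (hFi 1)]
  have hcontI : ∀ F : SpaceTime → ℝ, Per F → Continuous F →
      ∀ N, IntegrableOn F (bigBox N ×ˢ Ioo a b) := by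
    intro F hF hFc N
    obtain ⟨C, -, hC⟩ := exists_bound_of_per hF hFc (isCompact_Icc (a := a) (b := b))
    exact integrableOn_bigBox hF (integrableOn_cyl_of_bound hFc.aestronglyMeasurable
      fun z hz => hC z (Ioo_subset_Icc_self hz)) N
  have hp1 : Per (fun z => w z * fderiv ℝ ψ z (0, 1)) := fun k z => by
    have := hpt k z
    simp only at this ⊢
    rw [h.per_w, this]
  have hp3 : Per (fun z => w z ^ 3 * ψ z) := fun k z => by simp only; rw [h.per_w, hψp k z]
  -- The cutoff does not depend on time, so the time derivative falls on `ψ` only.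
  have hT1 : ∀ i j, ∫ z, w z * fderiv ℝ (φ i j) z (0, 1) =
      ∫ z in unitCell ×ˢ Ioo a b, w z * fderiv ℝ ψ z (0, 1) := by
    intro i j
    rw [← (hfold i j _ hp1 (hcontI _ hp1 (hwc.mul hcdψ))).2, setIntegral_eq_integral_of_forall_compl_eq_zero]
    · congr 1; ext z
      rw [hfd, fderiv_chi]
      simp; ring
    · intro z hz; rw [hψd0 z hz]; simp
  have hT3 : ∀ i j, ∫ z, w z ^ 3 * φ i j z = ∫ z in unitCell ×ˢ Ioo a b, w z ^ 3 * ψ z := by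
    intro i j
    rw [← (hfold i j _ hp3 (hcontI _ hp3 ((hwc.pow 3).mul hcψ))).2,
      setIntegral_eq_integral_of_forall_compl_eq_zero]
    · congr 1; ext z
      simp only [hφ, TestFn.of_apply]; ring
    · intro z hz; rw [hψ0 z hz]; simp
  -- the flux term
  obtain ⟨Cχ, hCχ0, hCχ⟩ := exists_fderiv_chi_bound
  have hRi : ∀ i j, IntegrableOn (fun z => ψ z * fderiv ℝ chi (z - κ i j) (H z, 0)) S := by
    intro i j
    obtain ⟨N, hN⟩ := exists_bigBox (Metric.closedBall (κ i j).1 2) Metric.isBounded_closedBall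
    have hind : IntegrableOn (fun z => (Metric.closedBall (κ i j).1 2 ×ˢ (univ : Set ℝ)).indicator
        (fun _ => (1 : ℝ)) z * (Cψ * (Cχ * (Lam * ‖G z‖)))) S := by
      refine integrableOn_strip (N := N) (C := 1) measurableSet_Ioo
        (measurable_const.indicator (Metric.isClosed_closedBall.measurableSet.prod MeasurableSet.univ))
        (fun z hz => ?_) (fun z => ?_) ((((hGn N).const_mul Lam).const_mul Cχ).const_mul Cψ)
      · exact hN (mem_of_indicator_ne_zero hz).1
      · by_cases hz : z ∈ Metric.closedBall (κ i j).1 2 ×ˢ (univ : Set ℝ) <;> simp [hz]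
    refine hind.mono' ?_ (ae_of_all _ fun z => ?_)
    · have c1 : Continuous fun z => fderiv ℝ chi (z - κ i j) :=
        (contDiff_chi.continuous_fderiv (by simp)).comp (by fun_prop)
      have m1 : Measurable fun z => fderiv ℝ chi (z - κ i j) (H z, 0) := by
        simp_rw [fderiv_chi]
        have := h.meas_H
        have e1 := continuous_dStep.measurable
        have e2 := contDiff_chi₁.continuous.measurable
        have e3 : ∀ l : Fin 2, Measurable fun z : SpaceTime => (z - κ i j).1 l := fun l =>
          (by fun_prop : Continuous fun z : SpaceTime => (z - κ i j).1 l).measurable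
        have e4 : ∀ l : Fin 2, Measurable fun z : SpaceTime => H z l := fun l =>
          (measurable_coord l).comp this
        have d1 : ∀ l : Fin 2, Measurable fun z : SpaceTime => dStep ((z - κ i j).1 l) :=
          fun l => e1.comp (e3 l)
        have d2 : ∀ l : Fin 2, Measurable fun z : SpaceTime => dStep ((z - κ i j).1 l + 1) :=
          fun l => e1.comp ((e3 l).add_const 1)
        have d3 : ∀ l : Fin 2, Measurable fun z : SpaceTime => chi₁ ((z - κ i j).1 l) :=
          fun l => e2.comp (e3 l)
        exact ((((d2 0).sub (d1 0)).mul (d3 1)).mul (e4 0)).add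
          (((d3 0).mul ((d2 1).sub (d1 1))).mul (e4 1))
      exact (hcψ.measurable.mul m1).aestronglyMeasurable
    · rw [Real.norm_eq_abs]
      by_cases hz : z ∈ Metric.closedBall (κ i j).1 2 ×ˢ (univ : Set ℝ)
      · rw [indicator_of_mem hz, one_mul, abs_mul]
        gcongr
        · exact hCψ z
        · refine (hCχ _ _).trans ?_
          gcongr
          exact h.bound_H z
      · rw [indicator_of_notMem hz, zero_mul]
        have hne : ∀ᶠ z' in 𝓝 (z - κ i j), chi z' = 0 := by
          have ho : IsOpen {z' : SpaceTime | 2 < ‖z'.1‖} :=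
            isOpen_lt continuous_const (by fun_prop)
          have hmem : (z - κ i j) ∈ {z' : SpaceTime | 2 < ‖z'.1‖} := by
            refine not_le.1 fun hc => hz ⟨mem_closedBall_of_norm_sub_le hc, mem_univ _⟩
          filter_upwards [ho.mem_nhds hmem] with z' hz'
          by_contra hc
          exact absurd (norm_le_of_chi_ne_zero hc) (not_le.2 hz')
        rw [Filter.EventuallyEq.fderiv_eq (f := fun _ => 0) hne]
        simp
  set A := - (∫ z in unitCell ×ˢ Ioo a b, w z * fderiv ℝ ψ z (0, 1)) with hA
  set E := ∫ z in unitCell ×ˢ Ioo a b,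
        (lam * μ z * ‖G z‖ ^ 2 - Lam * ‖G z‖ * ‖sgrad ψ z - μ z • G z‖) with hEdef
  set D := ∫ z in unitCell ×ˢ Ioo a b, w z ^ 3 * ψ z with hD
  have hflux : ∀ i j, E + (∫ z in S, ψ z * fderiv ℝ chi (z - κ i j) (H z, 0)) ≤
      ∫ z, inner ℝ (sgrad (φ i j) z) (H z) := by
    intro i j
    have hx : IntegrableOn (fun z => chi (z - κ i j) * inner ℝ (sgrad ψ z) (H z)) S := by
      obtain ⟨N, hN⟩ := exists_bigBox (Metric.closedBall (κ i j).1 2) Metric.isBounded_closedBall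
      refine integrableOn_strip (N := N) (C := 1) measurableSet_Ioo (by fun_prop) (fun z hz => ?_)
        (fun z => abs_chi_le_one _) ?_
      · exact hN (mem_closedBall_of_chi_ne_zero hz)
      · refine ((hGn N).const_mul (Cs * Lam)).mono'
          (hcsψ.measurable.inner h.meas_H).aestronglyMeasurable ?_
        filter_upwards [ae_restrict_mem ((measurableSet_bigBox N).prod measurableSet_Ioo)] with z hz
        have hs := hCs z (Ioo_subset_Icc_self hz.2)
        refine (norm_inner_le_norm _ _).trans ?_
        rw [mul_assoc]
        exact mul_le_mul hs (h.bound_H z) (norm_nonneg _) hCs0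
    have e1 : ∫ z, inner ℝ (sgrad (φ i j) z) (H z) =
        (∫ z in S, chi (z - κ i j) * inner ℝ (sgrad ψ z) (H z)) +
          ∫ z in S, ψ z * fderiv ℝ chi (z - κ i j) (H z, 0) := by
      rw [← integral_add hx (hRi i j), setIntegral_eq_integral_of_forall_compl_eq_zero]
      · congr 1; ext z
        rw [inner_sgrad, inner_sgrad, hfd]
      · intro z hz
        rw [hψ0 z hz, inner_sgrad, hψd0 z hz]; simp
    rw [e1, hEdef, ← (hfold i j _ hE hEi).2]
    gcongr ?_ + _
    refine setIntegral_mono_on (hfold i j _ hE hEi).1 hx hSm fun z _ => ?_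
    refine mul_le_mul_of_nonneg_left ?_ (chi_nonneg _)
    -- Ellipticity applies to the part `μ G` of the gradient; the remainder is an error controlled
    -- by the upper bound on the flux.
    have e2 : inner ℝ (sgrad ψ z) (H z) =
        μ z * inner ℝ (G z) (H z) + inner ℝ (sgrad ψ z - μ z • G z) (H z) := by
      rw [inner_sub_left, inner_smul_left]; simp
    have e3 := h.elliptic z
    have e4 := abs_le.1 (abs_real_inner_le_norm (sgrad ψ z - μ z • G z) (H z))
    have e5 : ‖sgrad ψ z - μ z • G z‖ * ‖H z‖ ≤ ‖sgrad ψ z - μ z • G z‖ * (Lam * ‖G z‖) := by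
      gcongr; exact h.bound_H z
    have e6 := mul_le_mul_of_nonneg_left e3 (hμ0 z)
    rw [e2]
    nlinarith [e4.1]
  -- the boundary terms grow only linearly
  set u₀ : SpaceTime → ℝ := fun z => |dStep (z.1 0 + 1)| * chi₁ (z.1 1) with hu₀
  set u₁ : SpaceTime → ℝ := fun z => |dStep (z.1 1 + 1)| * chi₁ (z.1 0) with hu₁
  set P : SpaceTime → ℝ := fun z => |ψ z| * (Lam * ‖G z‖) with hP
  have hPp : Per P := fun k z => by simp only [hP]; rw [hψp, h.per_G]
  have hPi : ∀ N, IntegrableOn P (bigBox N ×ˢ Ioo a b) := fun N =>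
    ((hGn N).const_mul Lam).bdd_mul hcψ.abs.aestronglyMeasurable (c := Cψ)
      (ae_of_all _ fun z => by rw [Real.norm_eq_abs, abs_abs]; exact hCψ z)
  -- The cost of one unit of rim in each of the two directions. It does not depend on the position,
  -- because the majorant `P` of the flux, unlike the flux, is periodic.
  set c₀ := ∫ z in S, u₀ z * P z with hc₀
  set c₁ := ∫ z in S, u₁ z * P z with hc₁
  obtain ⟨Cd, hCd0, hCd⟩ := exists_dStep_bound
  have hcu₀ : Continuous u₀ := by
    have := continuous_dStep
    have := contDiff_chi₁.continuous
    fun_prop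
  have hcu₁ : Continuous u₁ := by
    have := continuous_dStep
    have := contDiff_chi₁.continuous
    fun_prop
  have hub : ∀ s t : ℝ, |(|dStep (s + 1)| * chi₁ t)| ≤ Cd := fun s t => by
    rw [abs_mul, abs_abs, abs_of_nonneg (chi₁_nonneg t)]
    exact (mul_le_of_le_one_right (abs_nonneg _) (chi₁_le_one t)).trans (hCd _)
  have hus : ∀ s t : ℝ, |dStep (s + 1)| * chi₁ t ≠ 0 → |s| ≤ 1 ∧ |t| ≤ 1 := by
    intro s t hst
    rw [mul_ne_zero_iff, abs_ne_zero] at hst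
    have h1 : s + 1 ∈ Icc (0 : ℝ) 1 := by
      by_contra hc; exact hst.1 (dStep_eq_zero hc)
    have h2 := mem_Ioo_of_chi₁_ne_zero hst.2
    exact ⟨abs_le.2 ⟨by linarith [h1.1], by linarith [h1.2]⟩, (abs_lt.2 h2).le⟩
  have hus₀ : ∀ z, u₀ z ≠ 0 → ‖z.1‖ ≤ 2 := fun z hz => by
    have := hus _ _ hz
    refine (norm_le_of_coord zero_le_one fun i => ?_).trans (by norm_num)
    fin_cases i
    exacts [this.1, this.2]
  have hus₁ : ∀ z, u₁ z ≠ 0 → ‖z.1‖ ≤ 2 := fun z hz => by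
    have := hus _ _ hz
    refine (norm_le_of_coord zero_le_one fun i => ?_).trans (by norm_num)
    fin_cases i
    exacts [this.2, this.1]
  have hui : ∀ (u : SpaceTime → ℝ), Continuous u → (∀ z, |u z| ≤ Cd) → (∀ z, u z ≠ 0 → ‖z.1‖ ≤ 2) →
      ∀ i j, IntegrableOn (fun z => u (z - κ i j) * P z) S := by
    intro u hu hub hus i j
    obtain ⟨N, hN⟩ := exists_bigBox (Metric.closedBall (κ i j).1 2) Metric.isBounded_closedBall
    refine integrableOn_strip (N := N) (C := Cd) measurableSet_Ioo
      (hu.comp (by fun_prop)).measurable (fun z hz => ?_) (fun z => hub _) (hPi N)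
    exact hN (mem_closedBall_of_norm_sub_le (hus _ hz))
  have hu₀i := hui u₀ hcu₀ (fun z => hub _ _) hus₀
  have hu₁i := hui u₁ hcu₁ (fun z => hub _ _) hus₁
  have hbdry : ∀ L : ℕ, |∑ i ∈ Finset.range L, ∑ j ∈ Finset.range L,
      ∫ z in S, ψ z * fderiv ℝ chi (z - κ i j) (H z, 0)| ≤ L * (2 * (c₀ + c₁)) := by
    intro L
    have hκ0 : ∀ i j (z : SpaceTime), (z - κ i j).1 0 = z.1 0 - i := fun i j z => by
      simp [hκ, latticeVec]
    have hκ1 : ∀ i j (z : SpaceTime), (z - κ i j).1 1 = z.1 1 - j := fun i j z => by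
      simp [hκ, latticeVec]
    -- Summing over `i` telescopes the first component of `∇χ` and leaves the columns `0` and `L`;
    -- summing over `j` does the same for the second component and the rows.
    have hpt : ∀ z, |∑ i ∈ Finset.range L, ∑ j ∈ Finset.range L,
        ψ z * fderiv ℝ chi (z - κ i j) (H z, 0)| ≤
        ∑ j ∈ Finset.range L, ((u₀ (z - κ 0 j) * P z + u₀ (z - κ L j) * P z) +
          (u₁ (z - κ j 0) * P z + u₁ (z - κ j L) * P z)) := by
      intro z
      set x := z.1 0 with hx
      set y := z.1 1 with hy
      have e1 : ∑ i ∈ Finset.range L, ∑ j ∈ Finset.range L,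
          ψ z * fderiv ℝ chi (z - κ i j) (H z, 0) =
          ψ z * ((dStep (x + 1) - dStep (x + 1 - L)) * (∑ j ∈ Finset.range L, chi₁ (y - j)) * H z 0
          + (∑ j ∈ Finset.range L, chi₁ (x - j)) * (dStep (y + 1) - dStep (y + 1 - L)) * H z 1) := by
        rw [← sum_range_deriv_chi₁, ← sum_range_deriv_chi₁]
        rw [Finset.sum_mul_sum, Finset.sum_mul_sum, Finset.sum_mul, Finset.sum_mul,
          ← Finset.sum_add_distrib, Finset.mul_sum]
        refine Finset.sum_congr rfl fun i _ => ?_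
        rw [Finset.sum_mul, Finset.sum_mul, ← Finset.sum_add_distrib, Finset.mul_sum]
        refine Finset.sum_congr rfl fun j _ => ?_
        rw [fderiv_chi, hκ0, hκ1]
      have hc0 : ∀ t : ℝ, 0 ≤ ∑ j ∈ Finset.range L, chi₁ (t - j) := fun t =>
        Finset.sum_nonneg fun j _ => chi₁_nonneg _
      have h6 : ∀ l, |H z l| ≤ Lam * ‖G z‖ := fun l =>
        (by simpa using PiLp.norm_apply_le (H z) l : |H z l| ≤ ‖H z‖).trans (h.bound_H z)
      have hLG : 0 ≤ Lam * ‖G z‖ := by positivity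
      rw [e1, abs_mul]
      calc |ψ z| * |_ + _| ≤ |ψ z| * (((|dStep (x + 1)| + |dStep (x + 1 - L)|) *
            (∑ j ∈ Finset.range L, chi₁ (y - j)) * (Lam * ‖G z‖)) +
            ((∑ j ∈ Finset.range L, chi₁ (x - j)) *
              (|dStep (y + 1)| + |dStep (y + 1 - L)|) * (Lam * ‖G z‖))) := by
            refine mul_le_mul_of_nonneg_left ((abs_add_le _ _).trans ?_) (abs_nonneg _)
            rw [abs_mul, abs_mul, abs_mul, abs_mul, abs_of_nonneg (hc0 y), abs_of_nonneg (hc0 x)]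
            have := hc0 x
            have := hc0 y
            gcongr
            exacts [abs_sub _ _, h6 0, abs_sub _ _, h6 1]
        _ = _ := by
            rw [Finset.sum_add_distrib]
            rw [mul_add]
            simp only [hu₀, hu₁, hP, hκ0, hκ1, Nat.cast_zero, sub_zero]
            rw [← hx, ← hy, Finset.mul_sum, Finset.sum_mul, Finset.sum_mul, Finset.mul_sum,
              Finset.sum_mul, Finset.mul_sum]
            congr 1
            · refine Finset.sum_congr rfl fun j _ => ?_
              rw [show x + 1 - (L : ℝ) = x - L + 1 by ring]; ring
            · refine Finset.sum_congr rfl fun j _ => ?_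
              rw [show y + 1 - (L : ℝ) = y - L + 1 by ring]; ring
    have e2 : ∑ i ∈ Finset.range L, ∑ j ∈ Finset.range L,
        ∫ z in S, ψ z * fderiv ℝ chi (z - κ i j) (H z, 0) =
        ∫ z in S, ∑ i ∈ Finset.range L, ∑ j ∈ Finset.range L,
          ψ z * fderiv ℝ chi (z - κ i j) (H z, 0) := by
      rw [integral_finsetSum _ fun i _ => integrable_finsetSum _ fun j _ => hRi i j]
      refine Finset.sum_congr rfl fun i _ => ?_
      rw [integral_finsetSum _ fun j _ => hRi i j]
    rw [e2]
    have hint : ∀ j, IntegrableOn (fun z => (u₀ (z - κ 0 j) * P z + u₀ (z - κ L j) * P z) +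
          (u₁ (z - κ j 0) * P z + u₁ (z - κ j L) * P z)) S := fun j =>
      ((hu₀i 0 j).add (hu₀i L j)).add ((hu₁i j 0).add (hu₁i j L))
    calc _ ≤ ∫ z in S, |∑ i ∈ Finset.range L, ∑ j ∈ Finset.range L,
          ψ z * fderiv ℝ chi (z - κ i j) (H z, 0)| := abs_integral_le_integral_abs
      _ ≤ ∫ z in S, ∑ j ∈ Finset.range L, ((u₀ (z - κ 0 j) * P z + u₀ (z - κ L j) * P z) +
          (u₁ (z - κ j 0) * P z + u₁ (z - κ j L) * P z)) :=
        integral_mono_of_nonneg (ae_of_all _ fun z => abs_nonneg _)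
          (integrable_finsetSum _ fun j _ => hint j) (ae_of_all _ hpt)
      _ = _ := by
        rw [integral_finsetSum _ fun j _ => hint j]
        have e3 : ∀ j, ∫ z in S, ((u₀ (z - κ 0 j) * P z + u₀ (z - κ L j) * P z) +
          (u₁ (z - κ j 0) * P z + u₁ (z - κ j L) * P z)) = 2 * (c₀ + c₁) := by
          intro j
          have a0 : IntegrableOn (fun z => u₀ (z - κ 0 j) * P z + u₀ (z - κ L j) * P z) S :=
            (hu₀i 0 j).add (hu₀i L j)
          have a1 : IntegrableOn (fun z => u₁ (z - κ j 0) * P z + u₁ (z - κ j L) * P z) S :=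
            (hu₁i j 0).add (hu₁i j L)
          rw [integral_add a0 a1,
            integral_add (hu₀i 0 j) (hu₀i L j), integral_add (hu₁i j 0) (hu₁i j L)]
          simp only [hκ, hS]
          rw [integral_strip_translate _ u₀ hPp, integral_strip_translate _ u₀ hPp,
            integral_strip_translate _ u₁ hPp, integral_strip_translate _ u₁ hPp]
          ring
        simp_rw [e3]
        simp
  -- conclusion
  have hall : ∀ i j, A + E + D - Q * (B₂ + B₁ + B₀) ≤
      - ∫ z in S, ψ z * fderiv ℝ chi (z - κ i j) (H z, 0) := by
    intro i j
    have := hweak i j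
    rw [hT1, hT3] at this
    have := hflux i j
    linarith
  -- A violation by `δ` would persist in each of the `L²` cells and give `L² δ ≤ 2 L (c₀ + c₁)` for
  -- all `L`.
  by_contra! hlt
  set δ := A + E + D - Q * (B₂ + B₁ + B₀) with hδ
  have hδ0 : 0 < δ := by linarith
  have hsum : ∀ L : ℕ, (L : ℝ) * L * δ ≤ L * (2 * (c₀ + c₁)) := by
    intro L
    have h3 : ∑ i ∈ Finset.range L, ∑ j ∈ Finset.range L, δ ≤
        ∑ i ∈ Finset.range L, ∑ j ∈ Finset.range L,
          - ∫ z in S, ψ z * fderiv ℝ chi (z - κ i j) (H z, 0) :=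
      Finset.sum_le_sum fun i _ => Finset.sum_le_sum fun j _ => hall i j
    simp only [Finset.sum_const, Finset.card_range, nsmul_eq_mul, Finset.sum_neg_distrib] at h3
    have h4 := abs_le.1 (hbdry L)
    linarith [h4.1]
  obtain ⟨L, hL⟩ := exists_nat_gt (2 * (c₀ + c₁) / δ)
  rw [div_lt_iff₀ hδ0] at hL
  have h5 := hsum (L + 1)
  push_cast at h5
  have h6 : (0 : ℝ) < L + 1 := by positivity
  have h7 : ((L : ℝ) + 1) * δ ≤ 2 * (c₀ + c₁) := by
    have : (L + 1 : ℝ) * ((L + 1) * δ) ≤ (L + 1) * (2 * (c₀ + c₁)) := by linarith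
    exact le_of_mul_le_mul_left this h6
  linarith

/-! ### Time cutoffs and the `L¹` moduli of localised Hölder functions. -/

/-- A time cutoff supported in `[A, B]`, with `L¹` modulus of continuity at most `4|s|`. -/
structure TimeCut (A B : ℝ) (θ : ℝ → ℝ) : Prop where
  meas : Measurable θ
  nonneg : ∀ t, 0 ≤ θ t
  le_one : ∀ t, θ t ≤ 1
  supp : ∀ t, θ t ≠ 0 → t ∈ Icc A B
  modulus : ∀ s, ∫ t, |θ (t + s) - θ t| ≤ 4 * |s|

lemma TimeCut.mono {A B A' B' : ℝ} {θ : ℝ → ℝ} (h : TimeCut A B θ) (hA : A' ≤ A) (hB : B ≤ B') :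
    TimeCut A' B' θ :=
  ⟨h.meas, h.nonneg, h.le_one, fun t ht => ⟨hA.trans (h.supp t ht).1, (h.supp t ht).2.trans hB⟩,
    h.modulus⟩

lemma TimeCut.abs_le_one {A B : ℝ} {θ : ℝ → ℝ} (h : TimeCut A B θ) (t : ℝ) : |θ t| ≤ 1 := by
  rw [abs_of_nonneg (h.nonneg t)]; exact h.le_one t

lemma TimeCut.translate {A B : ℝ} {θ : ℝ → ℝ} (h : TimeCut A B θ) (r : ℝ) :
    TimeCut (A + r) (B + r) fun t => θ (t - r) := by
  refine ⟨h.meas.comp (measurable_id.sub_const r), fun t => h.nonneg _, fun t => h.le_one _,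
    fun t ht => ?_, fun s => ?_⟩
  · have := h.supp _ ht
    exact ⟨by linarith [this.1], by linarith [this.2]⟩
  · have := integral_sub_right_eq_self (μ := volume) (fun t => |θ (t + s) - θ t|) r
    refine le_trans (le_of_eq ?_) (h.modulus s)
    rw [← this]
    simp_rw [sub_add_eq_add_sub]

lemma TimeCut.integrable {A B : ℝ} {θ : ℝ → ℝ} (h : TimeCut A B θ) : Integrable θ := by
  have h1 : IntegrableOn θ (Icc A B) :=
    Integrable.of_bound (C := 1) h.meas.aestronglyMeasurable
      (ae_of_all _ fun t => h.abs_le_one t)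
  rw [← integrableOn_univ]
  refine IntegrableOn.of_forall_sdiff_eq_zero h1 MeasurableSet.univ fun t ht => ?_
  by_contra hne
  exact ht.2 (h.supp t hne)

/-- Under a shift by `s` the indicator changes only on two intervals of length `2 * |s|` around the
endpoints. -/
lemma timeCut_indicator {A B : ℝ} : TimeCut A B ((Ioo A B).indicator 1) := by
  refine ⟨measurable_one.indicator measurableSet_Ioo, fun t => indicator_nonneg (by simp) t,
    fun t => indicator_le_self' (by simp) t, fun t ht => ?_, fun s => ?_⟩
  · by_contra h
    exact ht (indicator_of_notMem (fun h' => h (Ioo_subset_Icc_self h')) _)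
  · set E : Set ℝ := Icc (A - |s|) (A + |s|) ∪ Icc (B - |s|) (B + |s|) with hE
    have hEm : MeasurableSet E := measurableSet_Icc.union measurableSet_Icc
    have hv : volume E ≤ ENNReal.ofReal (4 * |s|) := by
      refine (measure_union_le _ _).trans (le_of_eq ?_)
      rw [Real.volume_Icc, Real.volume_Icc, ← ENNReal.ofReal_add (by linarith [abs_nonneg s])
        (by linarith [abs_nonneg s])]
      congr 1
      ring
    have hvt : volume E ≠ ∞ := (hv.trans_lt ENNReal.ofReal_lt_top).ne
    have hp : ∀ t, |(Ioo A B).indicator (1 : ℝ → ℝ) (t + s) - (Ioo A B).indicator 1 t| ≤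
        E.indicator 1 t := by
      intro t
      by_cases ht : t ∈ E
      · rw [indicator_of_mem ht]
        simp only [indicator, Pi.one_apply]
        split_ifs <;> simp
      · rw [indicator_of_notMem ht]
        simp only [hE, mem_union, mem_Icc, not_or, not_and_or, not_le] at ht
        have : t + s ∈ Ioo A B ↔ t ∈ Ioo A B := by
          have h1 := neg_abs_le s
          have h2 := le_abs_self s
          simp only [mem_Ioo]
          constructor
          · rintro ⟨h3, h4⟩
            rcases ht with ⟨h5 | h5, h6 | h6⟩ <;> constructor <;> linarith
          · rintro ⟨h3, h4⟩
            rcases ht with ⟨h5 | h5, h6 | h6⟩ <;> constructor <;> linarith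
        simp only [indicator, this]
        split_ifs <;> simp
    calc _ ≤ ∫ t, E.indicator (1 : ℝ → ℝ) t := by
          refine integral_mono_of_nonneg (ae_of_all _ fun t => abs_nonneg _) ?_ (ae_of_all _ hp)
          exact (integrable_indicator_iff hEm).2 (integrableOn_const (C := (1 : ℝ)) hvt)
      _ = (volume E).toReal := by rw [integral_indicator_one hEm]; rfl
      _ ≤ _ := ENNReal.toReal_le_of_le_ofReal (by positivity) hv

/-- A monotone function rising from `0` to `1` has `L¹` translation modulus `|s|` however steep it
is. Hence the bounds for `smoothCut` do not deteriorate as it approaches an indicator. -/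
lemma integral_abs_smoothTransition_shift_le {k : ℝ} (hk : 0 < k) (s : ℝ) :
    Integrable (fun t => Real.smoothTransition (k * (t + s)) - Real.smoothTransition (k * t)) ∧
    ∫ t, |Real.smoothTransition (k * (t + s)) - Real.smoothTransition (k * t)| ≤ |s| := by
  set f : ℝ → ℝ := fun t => Real.smoothTransition (k * t) with hf
  have hfc : Continuous f := Real.smoothTransition.continuous.comp (by fun_prop)
  have hfm : Monotone f := fun x y h => monotone_smoothTransition (by gcongr)
  have key : ∀ s : ℝ, 0 ≤ s → Integrable (fun t => f (t + s) - f t) ∧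
      ∫ t, |f (t + s) - f t| ≤ s := by
    intro s hs
    have hc : Continuous fun t => f (t + s) - f t := by fun_prop
    have hz : ∀ t, t ∉ Ioc (-s - 1) (1 / k) → f (t + s) - f t = 0 := by
      intro t ht
      rw [mem_Ioc, not_and_or, not_lt, not_le] at ht
      rcases ht with h | h
      · simp only [hf]
        rw [Real.smoothTransition.zero_of_nonpos, Real.smoothTransition.zero_of_nonpos, sub_zero]
        all_goals exact mul_nonpos_of_nonneg_of_nonpos hk.le (by linarith)
      · simp only [hf]
        rw [div_lt_iff₀ hk] at h
        rw [Real.smoothTransition.one_of_one_le, Real.smoothTransition.one_of_one_le, sub_self]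
        all_goals nlinarith
    have hle : -s - 1 ≤ 1 / k := by have := one_div_pos.2 hk; linarith
    have hi : Integrable fun t => f (t + s) - f t :=
      hc.integrable_of_hasCompactSupport (HasCompactSupport.intro isCompact_Icc
        fun t ht => hz t fun h => ht (Ioc_subset_Icc_self h))
    refine ⟨hi, ?_⟩
    have e1 : ∫ t, |f (t + s) - f t| = ∫ t in (-s - 1)..(1 / k), (f (t + s) - f t) := by
      rw [intervalIntegral.integral_of_le hle, setIntegral_eq_integral_of_forall_compl_eq_zero hz]
      refine integral_congr_ae (ae_of_all _ fun t => abs_of_nonneg (sub_nonneg.2 (hfm ?_)))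
      linarith
    rw [e1, intervalIntegral.integral_sub
      (Continuous.intervalIntegrable (by fun_prop) _ _) (hfc.intervalIntegrable _ _),
      intervalIntegral.integral_comp_add_right,
      intervalIntegral.integral_interval_sub_interval_comm' (hfc.intervalIntegrable _ _)
        (hfc.intervalIntegrable _ _) (hfc.intervalIntegrable _ _)]
    have h2 : ∫ t in (1 / k)..(1 / k + s), f t ≤ s := by
      calc _ ≤ ∫ t in (1 / k)..(1 / k + s), (1 : ℝ) :=
            intervalIntegral.integral_mono_on (by linarith) (hfc.intervalIntegrable _ _)
              (by simp) fun t _ => Real.smoothTransition.le_one _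
        _ = s := by simp
    have h3 : 0 ≤ ∫ t in (-s - 1)..(-s - 1 + s), f t :=
      intervalIntegral.integral_nonneg (by linarith) fun t _ => Real.smoothTransition.nonneg _
    linarith
  rcases le_total 0 s with h | h
  · rw [abs_of_nonneg h]; exact key s h
  · obtain ⟨h1, h2⟩ := key (-s) (by linarith)
    rw [abs_of_nonpos h]
    have e : ∀ t, f (t + s) - f t = -(f ((t + s) + -s) - f (t + s)) := fun t => by
      rw [add_neg_cancel_right]; ring
    refine ⟨?_, ?_⟩
    · change Integrable fun t => f (t + s) - f t
      simp_rw [e]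
      exact (h1.comp_add_right s).neg
    · change ∫ t, |f (t + s) - f t| ≤ -s
      simp_rw [e, abs_neg]
      rw [integral_add_right_eq_self (fun t => |f (t + -s) - f t|) s]
      exact h2

/-- Smooth cutoffs increasing to the indicator function of `(A, B)`. -/
def smoothCut (A B : ℝ) (n : ℕ) (t : ℝ) : ℝ :=
  Real.smoothTransition ((n + 1) * (t - A)) * Real.smoothTransition ((n + 1) * (B - t))

lemma contDiff_smoothCut (A B : ℝ) (n : ℕ) : ContDiff ℝ (⊤ : ℕ∞) (smoothCut A B n) := by
  unfold smoothCut
  exact (Real.smoothTransition.contDiff.comp (by fun_prop)).mul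
    (Real.smoothTransition.contDiff.comp (by fun_prop))

lemma timeCut_smoothCut (A B : ℝ) (n : ℕ) : TimeCut A B (smoothCut A B n) := by
  have hn : (0 : ℝ) < n + 1 := by positivity
  refine ⟨(contDiff_smoothCut A B n).continuous.measurable, fun t => ?_, fun t => ?_,
    fun t ht => ?_, fun s => ?_⟩
  · exact mul_nonneg (Real.smoothTransition.nonneg _) (Real.smoothTransition.nonneg _)
  · exact mul_le_one₀ (Real.smoothTransition.le_one _) (Real.smoothTransition.nonneg _)
      (Real.smoothTransition.le_one _)
  · rw [smoothCut, mul_ne_zero_iff] at ht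
    refine ⟨?_, ?_⟩
    · by_contra h
      exact ht.1 (Real.smoothTransition.zero_of_nonpos
        (mul_nonpos_of_nonneg_of_nonpos hn.le (by linarith)))
    · by_contra h
      exact ht.2 (Real.smoothTransition.zero_of_nonpos
        (mul_nonpos_of_nonneg_of_nonpos hn.le (by linarith)))
  · obtain ⟨i1, l1⟩ := integral_abs_smoothTransition_shift_le hn s
    obtain ⟨i2, l2⟩ := integral_abs_smoothTransition_shift_le hn (-s)
    set f : ℝ → ℝ := fun t => Real.smoothTransition ((n + 1) * t) with hf
    have j1 : Integrable fun t => |f (t - A + s) - f (t - A)| :=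
      (i1.comp_sub_right A).abs
    have j2 : Integrable fun t => |f (B - t + -s) - f (B - t)| :=
      (i2.comp_sub_left B).abs
    calc _ ≤ ∫ t, (|f (t - A + s) - f (t - A)| + |f (B - t + -s) - f (B - t)|) := by
          refine integral_mono_of_nonneg (ae_of_all _ fun t => abs_nonneg _) (j1.add j2)
            (ae_of_all _ fun t => ?_)
          have hf0 : ∀ t, |f t| ≤ 1 := fun t => by
            rw [abs_of_nonneg (Real.smoothTransition.nonneg _)]
            exact Real.smoothTransition.le_one _
          have e : smoothCut A B n (t + s) - smoothCut A B n t =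
              (f (t - A + s) - f (t - A)) * f (B - t + -s) +
                f (t - A) * (f (B - t + -s) - f (B - t)) := by
            simp only [smoothCut, hf]
            rw [show t + s - A = t - A + s by ring, show B - (t + s) = B - t + -s by ring]
            ring
          simp only [e]
          refine (abs_add_le _ _).trans ?_
          rw [abs_mul, abs_mul]
          exact add_le_add (mul_le_of_le_one_right (abs_nonneg _) (hf0 _))
            (mul_le_of_le_one_left (abs_nonneg _) (hf0 _))
      _ ≤ |s| + |s| := by
          rw [integral_add j1 j2, integral_sub_right_eq_self (fun t => |f (t + s) - f t|),
            integral_sub_left_eq_self (fun t => |f (t + -s) - f t|)]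
          rw [abs_neg] at l2
          exact add_le_add l1 l2
      _ ≤ _ := by linarith [abs_nonneg s]

lemma tendsto_smoothCut (A B t : ℝ) :
    Tendsto (fun n => smoothCut A B n t) atTop (𝓝 ((Ioo A B).indicator 1 t)) := by
  by_cases ht : t ∈ Ioo A B
  · rw [indicator_of_mem ht]
    obtain ⟨N, hN⟩ := exists_nat_gt (1 / (t - A) + 1 / (B - t))
    have h1 : 0 < t - A := by linarith [ht.1]
    have h2 : 0 < B - t := by linarith [ht.2]
    have h3 := one_div_pos.2 h1
    have h4 := one_div_pos.2 h2
    refine tendsto_const_nhds.congr' ?_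
    filter_upwards [eventually_ge_atTop N] with n hn
    have hn' : (N : ℝ) ≤ n := by exact_mod_cast hn
    have g1 : 1 ≤ ((n : ℝ) + 1) * (t - A) := by
      rw [← div_le_iff₀ h1]; linarith
    have g2 : 1 ≤ ((n : ℝ) + 1) * (B - t) := by
      rw [← div_le_iff₀ h2]; linarith
    simp [smoothCut, Real.smoothTransition.one_of_one_le g1, Real.smoothTransition.one_of_one_le g2]
  · rw [indicator_of_notMem ht]
    refine tendsto_const_nhds.congr fun n => ?_
    have hn : (0 : ℝ) < n + 1 := by positivity
    rw [mem_Ioo, not_and_or, not_lt, not_lt] at ht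
    rcases ht with h | h
    · rw [smoothCut, Real.smoothTransition.zero_of_nonpos, zero_mul]
      exact mul_nonpos_of_nonneg_of_nonpos hn.le (by linarith)
    · rw [smoothCut, mul_comm, Real.smoothTransition.zero_of_nonpos, zero_mul]
      exact mul_nonpos_of_nonneg_of_nonpos hn.le (by linarith)

lemma tendsto_integral_abs_smoothCut_sub (A B : ℝ) :
    Tendsto (fun n => ∫ t, |smoothCut A B n t - (Ioo A B).indicator 1 t|) atTop (𝓝 0) := by
  have := tendsto_integral_of_dominated_convergence
    (F := fun n t => |smoothCut A B n t - (Ioo A B).indicator 1 t|) (f := fun _ => (0 : ℝ))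
    (μ := volume) ((Icc A B).indicator 1) (fun n => ?_) ?_ (fun n => ae_of_all _ fun t => ?_)
    (ae_of_all _ fun t => ?_)
  · simpa using this
  · exact (((timeCut_smoothCut A B n).meas.sub
      (measurable_one.indicator measurableSet_Ioo)).abs).aestronglyMeasurable
  · exact (integrable_indicator_iff measurableSet_Icc).2
      (integrableOn_const (C := (1 : ℝ)) (by simp))
  · have h1 := timeCut_smoothCut A B n
    have h2 := timeCut_indicator (A := A) (B := B)
    rw [Real.norm_eq_abs, abs_abs]
    by_cases ht : t ∈ Icc A B
    · rw [indicator_of_mem ht, abs_le, Pi.one_apply]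
      constructor <;> linarith [h1.nonneg t, h1.le_one t, h2.nonneg t, h2.le_one t]
    · have e1 : smoothCut A B n t = 0 := by_contra fun h => ht (h1.supp t h)
      have e2 : (Ioo A B).indicator (1 : ℝ → ℝ) t = 0 := by_contra fun h => ht (h2.supp t h)
      rw [e1, e2, indicator_of_notMem ht]
      simp
  · have := ((tendsto_smoothCut A B t).sub_const ((Ioo A B).indicator 1 t)).abs
    simpa using this

lemma exists_chi_lipschitz : ∃ C, 0 ≤ C ∧ ∀ z d : SpaceTime, |chi (z + d) - chi z| ≤ C * ‖d.1‖ := by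
  obtain ⟨C, hC, h⟩ := exists_dStep_bound
  have hl : ∀ s t, |chi₁ s - chi₁ t| ≤ 2 * C * |s - t| := by
    intro s t
    have := Convex.norm_image_sub_le_of_norm_hasDerivWithin_le (s := univ) (f := chi₁)
      (f' := fun s => dStep (s + 1) - dStep s) (C := 2 * C) (x := t) (y := s)
      (fun x _ => (hasDerivAt_chi₁ x).hasDerivWithinAt)
      (fun x _ => (abs_sub _ _).trans (by linarith [h (x + 1), h x])) convex_univ
      (mem_univ _) (mem_univ _)
    simpa [Real.norm_eq_abs] using this
  refine ⟨4 * C, by positivity, fun z d => ?_⟩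
  have h6 : ∀ i, |d.1 i| ≤ ‖d.1‖ := fun i => by simpa using PiLp.norm_apply_le d.1 i
  have h7 : ∀ i, |chi₁ ((z + d).1 i) - chi₁ (z.1 i)| ≤ 2 * C * ‖d.1‖ := fun i => by
    refine (hl _ _).trans ?_
    have : (z + d).1 i - z.1 i = d.1 i := by simp
    rw [this]
    exact mul_le_mul_of_nonneg_left (h6 i) (by positivity)
  have hx : ∀ s, |chi₁ s| ≤ 1 := fun s => by
    rw [abs_of_nonneg (chi₁_nonneg s)]; exact chi₁_le_one s
  have e : chi (z + d) - chi z = (chi₁ ((z + d).1 0) - chi₁ (z.1 0)) * chi₁ ((z + d).1 1) +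
      chi₁ (z.1 0) * (chi₁ ((z + d).1 1) - chi₁ (z.1 1)) := by
    simp only [chi]; ring
  rw [e]
  refine (abs_add_le _ _).trans ?_
  rw [abs_mul, abs_mul]
  calc _ ≤ 2 * C * ‖d.1‖ * 1 + 1 * (2 * C * ‖d.1‖) := by
        gcongr
        exacts [h7 0, hx _, hx _, h7 1]
    _ = _ := by ring

lemma volume_bigBox_lt_top (N : ℕ) : volume (bigBox N) < ∞ := by
  refine lt_of_le_of_lt (measure_mono (t := Metric.closedBall 0 (2 * N)) ?_)
    measure_closedBall_lt_top
  intro x hx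
  rw [mem_closedBall_zero_iff]
  refine norm_le_of_coord (Nat.cast_nonneg _) fun i => ?_
  rw [abs_le]
  exact ⟨(hx i).1, (hx i).2.le⟩

/-- The product of the indicator function of `[-2, 2)²` and a function of time. -/
def boxMul (f : ℝ → ℝ) (z : SpaceTime) : ℝ := (bigBox 2).indicator 1 z.1 * f z.2

lemma integrable_boxMul {f : ℝ → ℝ} (hf : Integrable f) : Integrable (boxMul f) := by
  have h1 : Integrable ((bigBox 2).indicator (1 : Plane → ℝ)) :=
    (integrable_indicator_iff (measurableSet_bigBox 2)).2
      (integrableOn_const (C := (1 : ℝ)) (volume_bigBox_lt_top 2).ne)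
  exact h1.mul_prod hf

lemma integral_boxMul (f : ℝ → ℝ) :
    ∫ z, boxMul f z = (volume (bigBox 2)).toReal * ∫ t, f t := by
  unfold boxMul
  rw [Measure.volume_eq_prod,
    integral_prod_mul (fun x => (bigBox 2).indicator (1 : Plane → ℝ) x) f,
    integral_indicator_one (measurableSet_bigBox 2)]
  rfl

lemma boxMul_of_mem {f : ℝ → ℝ} {z : SpaceTime} (h : z.1 ∈ bigBox 2) : boxMul f z = f z.2 := by
  rw [boxMul, indicator_of_mem h, Pi.one_apply, one_mul]

lemma boxMul_nonneg {f : ℝ → ℝ} (hf : ∀ t, 0 ≤ f t) (z : SpaceTime) : 0 ≤ boxMul f z :=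
  mul_nonneg (indicator_nonneg (by simp) _) (hf _)

lemma bigBox_one_subset : bigBox 1 ⊆ bigBox 2 := by
  intro x hx i
  have := hx i
  norm_num at this ⊢
  exact ⟨by linarith [this.1], by linarith [this.2]⟩

lemma mem_bigBox_two_of_chi_add {z d : SpaceTime} (hd : ‖d.1‖ ≤ 1) (h : chi (z + d) ≠ 0) :
    z.1 ∈ bigBox 2 := by
  intro i
  have h1 := mem_Ioo_of_chi_ne_zero h i
  have h2 : |d.1 i| ≤ ‖d.1‖ := by simpa using PiLp.norm_apply_le d.1 i
  have h3 : (z + d).1 i = z.1 i + d.1 i := by simp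
  rw [h3] at h1
  have h4 := abs_le.1 (h2.trans hd)
  norm_num
  exact ⟨by linarith [h1.1], by linarith [h1.2]⟩

lemma chi_eq_zero_of_notMem {z d : SpaceTime} (hd : ‖d.1‖ ≤ 1) (h : z.1 ∉ bigBox 2) :
    chi z = 0 ∧ chi (z + d) = 0 :=
  ⟨by_contra fun h' => h (bigBox_one_subset (mem_bigBox_of_chi_ne_zero h')),
    by_contra fun h' => h (mem_bigBox_two_of_chi_add hd h')⟩

lemma parabolicSize_le {d : SpaceTime} {σ : ℝ} (hσ : 0 ≤ σ) (h1 : ‖d.1‖ ≤ σ)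
    (h2 : |d.2| ≤ σ ^ 2) : parabolicSize d ≤ 2 * σ := by
  unfold parabolicSize
  have : √|d.2| ≤ σ := Real.sqrt_le_iff.2 ⟨hσ, h2⟩
  linarith

lemma parabolicSize_nonneg (z : SpaceTime) : 0 ≤ parabolicSize z :=
  add_nonneg (norm_nonneg _) (Real.sqrt_nonneg _)

lemma scale_le_rpow {γ : ℝ} (hγ : γ ≤ 1) (n : ℕ) : scale n ≤ scale n ^ γ := by
  conv_lhs => rw [← Real.rpow_one (scale n)]
  exact Real.rpow_le_rpow_of_exponent_ge (scale_pos n) (scale_mem n).2.le hγ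

lemma scale_rpow_nonneg (n : ℕ) (γ : ℝ) : 0 ≤ scale n ^ γ := Real.rpow_nonneg (scale_pos n).le _

/-- A globally bounded and Hölder continuous function. -/
def HolderBdd (γ K : ℝ) (v : SpaceTime → ℝ) : Prop :=
  Continuous v ∧ (∀ z, |v z| ≤ K) ∧ ∀ z z', |v z - v z'| ≤ K * parabolicSize (z - z') ^ γ

lemma measurable_chi_mul_cut {A B : ℝ} {v : SpaceTime → ℝ} {θ : ℝ → ℝ} (hv : Continuous v)
    (hθ : TimeCut A B θ) : Measurable fun z : SpaceTime => chi z * (v z * θ z.2) :=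
  contDiff_chi.continuous.measurable.mul (hv.measurable.mul (hθ.meas.comp measurable_snd))

lemma abs_chi_mul_cut_le {A B K : ℝ} {v : SpaceTime → ℝ} {θ : ℝ → ℝ} (hv : ∀ z, |v z| ≤ K)
    (hθ : TimeCut A B θ) (z : SpaceTime) :
    |chi z * (v z * θ z.2)| ≤ boxMul (fun t => K * θ t) z := by
  by_cases hz : z.1 ∈ bigBox 2
  · rw [boxMul_of_mem hz, abs_mul, abs_mul, abs_of_nonneg (hθ.nonneg z.2)]
    calc _ ≤ 1 * (K * θ z.2) := by
          gcongr
          · exact mul_nonneg (abs_nonneg _) (hθ.nonneg _)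
          · exact abs_chi_le_one z
          · exact hθ.nonneg _
          · exact hv z
      _ = _ := one_mul _
  · rw [(chi_eq_zero_of_notMem (d := 0) (by simp) hz).1, zero_mul, abs_zero]
    exact boxMul_nonneg (fun t => mul_nonneg ((abs_nonneg (v z)).trans (hv z)) (hθ.nonneg t)) z

lemma integrable_chi_mul_cut {A B K : ℝ} {v : SpaceTime → ℝ} {θ : ℝ → ℝ} (hc : Continuous v)
    (hv : ∀ z, |v z| ≤ K) (hθ : TimeCut A B θ) :
    Integrable fun z : SpaceTime => chi z * (v z * θ z.2) :=
  (integrable_boxMul (hθ.integrable.const_mul K)).mono'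
    (measurable_chi_mul_cut hc hθ).aestronglyMeasurable
    (ae_of_all _ fun z => abs_chi_mul_cut_le hv hθ z)

/-- An increment comes from the time cutoff (at most `4 σ²` in `L¹`), from the Lipschitz function
`chi`, or from the Hölder function `v`; for `γ ≤ 1` all are `O(σ^γ)`. The constant sees only `K` and
the window, so it holds uniformly along smooth approximations. It depends on the Hölder norm and is
used only to secure convergence and finiteness. -/
lemma exists_holder_modulus {γ : ℝ} (hγ0 : 0 < γ) (hγ1 : γ ≤ 1) {K : ℝ} (hK : 0 ≤ K) (A B : ℝ) :
    ∃ C, 0 ≤ C ∧ ∀ (v : SpaceTime → ℝ) (θ : ℝ → ℝ), HolderBdd γ K v → TimeCut A B θ →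
      (∫ z : SpaceTime, |chi z * (v z * θ z.2)|) ≤ C ∧
      ∀ (n : ℕ) (d : SpaceTime), ‖d.1‖ ≤ scale n → |d.2| ≤ scale n ^ 2 →
        ∫ z : SpaceTime, |chi (z + d) * (v (z + d) * θ (z + d).2) - chi z * (v z * θ z.2)| ≤
          C * scale n ^ γ := by
  obtain ⟨C₁, hC₁, hchi⟩ := exists_chi_lipschitz
  set V := (volume (bigBox 2)).toReal with hV
  set W := (volume (Icc A B)).toReal with hW
  set L := C₁ * K + K * 2 ^ γ with hL
  have hL0 : 0 ≤ L := by positivity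
  have hone : Integrable ((Icc A B).indicator (1 : ℝ → ℝ)) :=
    (integrable_indicator_iff measurableSet_Icc).2 (integrableOn_const (C := (1 : ℝ)) (by simp))
  refine ⟨V * (K * W) + V * (K * 4 + L * W), by positivity, fun v θ ⟨hc, hb, hh⟩ hθ => ⟨?_, ?_⟩⟩
  · calc _ ≤ ∫ z, boxMul (fun t => K * (Icc A B).indicator 1 t) z := by
          refine integral_mono_of_nonneg (ae_of_all _ fun z => abs_nonneg _)
            (integrable_boxMul (hone.const_mul K))
            (ae_of_all _ fun z => (abs_chi_mul_cut_le hb hθ z).trans ?_)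
          unfold boxMul
          refine mul_le_mul_of_nonneg_left (mul_le_mul_of_nonneg_left ?_ hK)
            (indicator_nonneg (by simp) _)
          · by_cases ht : z.2 ∈ Icc A B
            · rw [indicator_of_mem ht]; exact hθ.le_one _
            · rw [indicator_of_notMem ht]
              exact (by_contra fun h => ht (hθ.supp _ h) : θ z.2 = 0).le
      _ = V * (K * W) := by
          rw [integral_boxMul, integral_const_mul, integral_indicator_one measurableSet_Icc]
          rfl
      _ ≤ _ := le_add_of_nonneg_right (by positivity)
  · intro n d hd1 hd2
    have hσ := scale_pos n
    have hd1' : ‖d.1‖ ≤ 1 := hd1.trans (scale_mem n).2.le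
    have hs := scale_le_rpow hγ1 n
    have hs0 := scale_rpow_nonneg n γ
    set g : ℝ → ℝ := fun t => K * |θ (t + d.2) - θ t| +
      (L * scale n ^ γ) * (Icc A B).indicator 1 t with hg
    have hΔ : Integrable fun t => |θ (t + d.2) - θ t| :=
      ((hθ.integrable.comp_add_right d.2).sub hθ.integrable).abs
    have hgi : Integrable g := (hΔ.const_mul K).add (hone.const_mul _)
    have hg0 : ∀ t, 0 ≤ g t := fun t => add_nonneg (mul_nonneg hK (abs_nonneg _))
      (mul_nonneg (mul_nonneg hL0 hs0) (indicator_nonneg (by simp) _))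
    have hp : ∀ z : SpaceTime,
        |chi (z + d) * (v (z + d) * θ (z + d).2) - chi z * (v z * θ z.2)| ≤ boxMul g z := by
      intro z
      by_cases hz : z.1 ∈ bigBox 2
      swap
      · obtain ⟨e1, e2⟩ := chi_eq_zero_of_notMem hd1' hz
        rw [e1, e2]
        simpa using boxMul_nonneg hg0 z
      rw [boxMul_of_mem hz]
      have e : chi (z + d) * (v (z + d) * θ (z + d).2) - chi z * (v z * θ z.2) =
          chi (z + d) * (v (z + d) * (θ (z.2 + d.2) - θ z.2)) +
          ((chi (z + d) - chi z) * v (z + d) + chi z * (v (z + d) - v z)) * θ z.2 := by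
        rw [Prod.snd_add]; ring
      rw [e]
      refine (abs_add_le _ _).trans (add_le_add ?_ ?_)
      · rw [abs_mul, abs_mul]
        calc _ ≤ 1 * (K * |θ (z.2 + d.2) - θ z.2|) := by
              gcongr
              exacts [abs_chi_le_one _, hb _]
          _ = _ := one_mul _
      · by_cases ht : z.2 ∈ Icc A B
        swap
        · rw [(by_contra fun h => ht (hθ.supp _ h) : θ z.2 = 0), indicator_of_notMem ht]
          simp
        rw [indicator_of_mem ht, Pi.one_apply, abs_mul]
        have h1 : |(chi (z + d) - chi z) * v (z + d)| ≤ (C₁ * K) * scale n ^ γ := by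
          rw [abs_mul]
          calc _ ≤ (C₁ * scale n ^ γ) * K := by
                gcongr
                · exact (hchi z d).trans (mul_le_mul_of_nonneg_left (hd1.trans hs) hC₁)
                · exact hb _
            _ = _ := by ring
        have h2 : |chi z * (v (z + d) - v z)| ≤ (K * 2 ^ γ) * scale n ^ γ := by
          rw [abs_mul]
          have h3 := hh (z + d) z
          rw [add_sub_cancel_left] at h3
          have h4 : parabolicSize d ^ γ ≤ 2 ^ γ * scale n ^ γ := by
            rw [← Real.mul_rpow (by norm_num) hσ.le]
            exact Real.rpow_le_rpow (parabolicSize_nonneg d) (parabolicSize_le hσ.le hd1 hd2) hγ0.le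
          calc _ ≤ 1 * (K * (2 ^ γ * scale n ^ γ)) := by
                gcongr
                · exact abs_chi_le_one z
                · exact h3.trans (mul_le_mul_of_nonneg_left h4 hK)
            _ = _ := by ring
        calc _ ≤ (C₁ * K * scale n ^ γ + K * 2 ^ γ * scale n ^ γ) * 1 := by
              gcongr
              · exact (abs_add_le _ _).trans (add_le_add h1 h2)
              · exact hθ.abs_le_one _
          _ = _ := by rw [hL]; ring
    calc _ ≤ ∫ z, boxMul g z :=
          integral_mono_of_nonneg (ae_of_all _ fun z => abs_nonneg _) (integrable_boxMul hgi)
            (ae_of_all _ hp)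
      _ = V * (K * (∫ t, |θ (t + d.2) - θ t|) + L * scale n ^ γ * W) := by
          rw [integral_boxMul, hg, integral_add (hΔ.const_mul K) (hone.const_mul _),
            integral_const_mul, integral_const_mul, integral_indicator_one measurableSet_Icc]
          rfl
      _ ≤ V * (K * (4 * scale n ^ γ) + L * scale n ^ γ * W) := by
          gcongr
          refine (hθ.modulus d.2).trans ?_
          have : scale n ^ 2 ≤ scale n := by
            rw [sq]; exact mul_le_of_le_one_left hσ.le (scale_mem n).2.le
          linarith
      _ = V * (K * 4 + L * W) * scale n ^ γ := by ring
      _ ≤ _ := by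
          gcongr
          exact le_add_of_nonneg_left (by positivity)

/-! ### Stability of modulus bounds under `L¹` perturbation. -/

/-- `β` bounds the `L¹` norm of `F` and `b` its dyadic `L¹` moduli of continuity. -/
def ModSeq (F : SpaceTime → ℝ) (β : ℝ) (b : ℕ → ℝ) : Prop :=
  (∫ z, |F z|) ≤ β ∧
    ∀ n, ∀ d : SpaceTime, ‖d.1‖ ≤ scale n → |d.2| ≤ scale n ^ 2 → ∫ z, |F (z + d) - F z| ≤ b n

lemma ModSeq.nonneg {F : SpaceTime → ℝ} {β : ℝ} {b : ℕ → ℝ} (h : ModSeq F β b) (n : ℕ) :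
    0 ≤ b n :=
  (integral_nonneg fun _ => abs_nonneg _).trans
    (h.2 n 0 (by simpa using (scale_pos n).le) (by simpa using sq_nonneg (scale n)))

lemma ModSeq.perturb {F F' : SpaceTime → ℝ} {β β' ε : ℝ} {b b' : ℕ → ℝ} (h : ModSeq F β b)
    (h' : ModSeq F' β' b') (hF : Integrable F) (hF' : Integrable F')
    (hε : ∫ z, |F' z - F z| ≤ ε) : ModSeq F' (β + ε) fun n => min (b n + 2 * ε) (b' n) := by
  have hd : Integrable fun z => |F' z - F z| := (hF'.sub hF).abs
  refine ⟨?_, fun n d h1 h2 => le_min ?_ (h'.2 n d h1 h2)⟩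
  · calc _ ≤ ∫ z, (|F z| + |F' z - F z|) := by
          refine integral_mono hF'.abs (hF.abs.add hd) fun z => ?_
          simp only
          linarith [abs_add_le (F z) (F' z - F z), congrArg abs (add_sub_cancel (F z) (F' z))]
      _ ≤ _ := by rw [integral_add hF.abs hd]; exact add_le_add h.1 hε
  · have hd' : Integrable fun z => |F' (z + d) - F (z + d)| := hd.comp_add_right d
    have hm : Integrable fun z => |F (z + d) - F z| := ((hF.comp_add_right d).sub hF).abs
    calc _ ≤ ∫ z, (|F (z + d) - F z| + (|F' (z + d) - F (z + d)| + |F' z - F z|)) := by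
          refine integral_mono ((hF'.comp_add_right d).sub hF').abs (hm.add (hd'.add hd))
            fun z => ?_
          simp only
          have e : F' (z + d) - F' z =
            (F (z + d) - F z) + ((F' (z + d) - F (z + d)) - (F' z - F z)) := by ring
          rw [e]
          exact (abs_add_le _ _).trans (by gcongr; exact abs_sub _ _)
      _ ≤ b n + (ε + ε) := by
          have hdd : Integrable fun z => |F' (z + d) - F (z + d)| + |F' z - F z| := hd'.add hd
          rw [integral_add hm hdd, integral_add hd' hd,
            integral_add_right_eq_self (fun z => |F' z - F z|) d]
          exact add_le_add (h.2 n d h1 h2) (add_le_add hε hε)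
      _ = _ := by ring

lemma tendsto_tsum_min {α : ℝ} {b b' : ℕ → ℝ} (hb : ∀ n, 0 ≤ b n) (hb' : ∀ n, 0 ≤ b' n)
    (hs' : Summable fun n => scale n ^ α * b' n) {ε : ℕ → ℝ} (hε : Tendsto ε atTop (𝓝 0))
    (hε0 : ∀ j, 0 ≤ ε j) :
    Tendsto (fun j => ∑' n, scale n ^ α * min (b n + 2 * ε j) (b' n)) atTop
      (𝓝 (∑' n, scale n ^ α * min (b n) (b' n))) := by
  refine tendsto_tsum_of_dominated_convergence hs' (fun n => ?_)
    (Eventually.of_forall fun j n => ?_)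
  · have : Tendsto (fun j => b n + 2 * ε j) atTop (𝓝 (b n + 2 * 0)) :=
      (hε.const_mul 2).const_add (b n)
    rw [mul_zero, add_zero] at this
    exact (this.min tendsto_const_nhds).const_mul _
  · have h0 := scale_rpow_nonneg n α
    have h1 : 0 ≤ min (b n + 2 * ε j) (b' n) :=
      le_min (by linarith [hb n, hε0 j]) (hb' n)
    rw [Real.norm_eq_abs, abs_of_nonneg (mul_nonneg h0 h1)]
    exact mul_le_mul_of_nonneg_left (min_le_right _ _) h0

lemma summable_scale_rpow {s : ℝ} (hs : 0 < s) : Summable fun n => scale n ^ s := by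
  have e : ∀ n, scale n ^ s = (1 / 2) ^ s * (((1 : ℝ) / 2) ^ s) ^ n := fun n => by
    unfold scale
    rw [← Real.rpow_natCast, ← Real.rpow_natCast, ← Real.rpow_mul (by norm_num),
      ← Real.rpow_mul (by norm_num), ← Real.rpow_add (by norm_num)]
    congr 1
    push_cast
    ring
  simp_rw [e]
  exact (summable_geometric_of_lt_one (by positivity)
    (Real.rpow_lt_one (by norm_num) (by norm_num) hs)).mul_left _

lemma scale_rpow_mul (n : ℕ) (α γ C : ℝ) :
    scale n ^ α * (C * scale n ^ γ) = C * scale n ^ (α + γ) := by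
  rw [Real.rpow_add (scale_pos n)]; ring

lemma summable_scale_rpow_mul {α γ C : ℝ} (h : 0 < α + γ) :
    Summable fun n => scale n ^ α * (C * scale n ^ γ) := by
  simp_rw [scale_rpow_mul]
  exact (summable_scale_rpow h).mul_left C

/-- Closeness in `L¹` by `ε` raises every `b n` by `2 * ε`, which need not be summable against
`scale n ^ α`. The crude bound `b'`, common to all approximations, caps the tail, and dominated
convergence brings the sum down to that of `min (b n) (b' n)`. Sharp bounds for a limit thus carry
over to its approximations with an arbitrarily small loss. -/
lemma exists_modBound_approx {α : ℝ} {β β' : ℝ} {b b' : ℕ → ℝ} (hb : ∀ n, 0 ≤ b n)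
    (hb' : ∀ n, 0 ≤ b' n) (hs : Summable fun n => scale n ^ α * b n)
    (hs' : Summable fun n => scale n ^ α * b' n) {δ : ℝ} (hδ : 0 < δ) :
    ∃ ε, 0 < ε ∧ ∀ F F' : SpaceTime → ℝ, Integrable F → Integrable F' → ModSeq F β b →
      ModSeq F' β' b' → ∫ z, |F' z - F z| ≤ ε →
      ModBound α F' (β + (∑' n, scale n ^ α * b n) + δ) := by
  have h1 := tendsto_tsum_min hb hb' hs' (ε := fun j : ℕ => 1 / ((j : ℝ) + 1))
    tendsto_one_div_add_atTop_nhds_zero_nat fun j => by positivity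
  have hmono : ∀ n, scale n ^ α * min (b n) (b' n) ≤ scale n ^ α * b n := fun n =>
    mul_le_mul_of_nonneg_left (min_le_left _ _) (scale_rpow_nonneg n α)
  have h2 : ∑' n, scale n ^ α * min (b n) (b' n) ≤ ∑' n, scale n ^ α * b n :=
    Summable.tsum_le_tsum hmono (Summable.of_nonneg_of_le
      (fun n => mul_nonneg (scale_rpow_nonneg n α) (le_min (hb n) (hb' n))) hmono hs) hs
  have h3 := h1.eventually_lt_const (lt_of_le_of_lt h2 (lt_add_of_pos_right _ (half_pos hδ)))
  have h4 := (tendsto_one_div_add_atTop_nhds_zero_nat (𝕜 := ℝ)).eventually_lt_const (half_pos hδ)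
  obtain ⟨j, hj1, hj2⟩ := (h3.and h4).exists
  refine ⟨1 / ((j : ℝ) + 1), by positivity, fun F F' hF hF' hm hm' hε => ?_⟩
  have h5 := hm.perturb hm' hF hF' hε
  refine ⟨_, _, h5.1, h5.2, ?_, by linarith⟩
  refine Summable.of_nonneg_of_le (fun n => mul_nonneg (scale_rpow_nonneg n α) (h5.nonneg n))
    (fun n => mul_le_mul_of_nonneg_left (min_le_right _ _) (scale_rpow_nonneg n α)) hs'

lemma HolderBdd.nonneg {γ K : ℝ} {v : SpaceTime → ℝ} (h : HolderBdd γ K v) : 0 ≤ K :=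
  (abs_nonneg _).trans (h.2.1 0)

lemma HolderBdd.mul {γ K L : ℝ} {v u : SpaceTime → ℝ} (hv : HolderBdd γ K v)
    (hu : HolderBdd γ L u) : HolderBdd γ (2 * (K * L)) fun z => v z * u z := by
  have hK := hv.nonneg
  have hL := hu.nonneg
  refine ⟨hv.1.mul hu.1, fun z => ?_, fun z z' => ?_⟩
  · rw [abs_mul]
    have := mul_le_mul (hv.2.1 z) (hu.2.1 z) (abs_nonneg _) hK
    have := mul_nonneg hK hL
    linarith
  · have hp := Real.rpow_nonneg (parabolicSize_nonneg (z - z')) γ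
    have e : v z * u z - v z' * u z' = (v z - v z') * u z + v z' * (u z - u z') := by ring
    rw [e]
    refine (abs_add_le _ _).trans ?_
    rw [abs_mul, abs_mul]
    calc _ ≤ (K * parabolicSize (z - z') ^ γ) * L + K * (L * parabolicSize (z - z') ^ γ) := by
          gcongr
          exacts [hv.2.2 z z', hu.2.1 z, hv.2.1 z', hu.2.2 z z']
      _ = _ := by ring

lemma HolderBdd.sub {γ K L : ℝ} {v u : SpaceTime → ℝ} (hv : HolderBdd γ K v)
    (hu : HolderBdd γ L u) : HolderBdd γ (K + L) fun z => v z - u z := by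
  refine ⟨hv.1.sub hu.1, fun z => (abs_sub _ _).trans (add_le_add (hv.2.1 z) (hu.2.1 z)),
    fun z z' => ?_⟩
  rw [show v z - u z - (v z' - u z') = (v z - v z') - (u z - u z') by ring, add_mul]
  exact (abs_sub _ _).trans (add_le_add (hv.2.2 z z') (hu.2.2 z z'))

lemma HolderBdd.comp_sub {γ K : ℝ} {v : SpaceTime → ℝ} (hv : HolderBdd γ K v) (c : SpaceTime) :
    HolderBdd γ K fun z => v (z - c) :=
  ⟨hv.1.comp (continuous_id.sub continuous_const), fun z => hv.2.1 _, fun z z' => by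
    simpa using hv.2.2 (z - c) (z' - c)⟩

lemma exists_holderBdd_pow {γ : ℝ} {K : ℝ} (hK : 0 ≤ K) (m : ℕ) : ∃ L, 0 ≤ L ∧
    ∀ v, HolderBdd γ K v → HolderBdd γ L fun z => v z ^ m := by
  induction m with
  | zero =>
    refine ⟨1, zero_le_one, fun v hv => ⟨by simpa using continuous_const, by simp,
      fun z z' => ?_⟩⟩
    simpa using Real.rpow_nonneg (parabolicSize_nonneg (z - z')) γ
  | succ m ih =>
    obtain ⟨L, hL, h⟩ := ih
    refine ⟨2 * (L * K), by positivity, fun v hv => ?_⟩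
    simp_rw [pow_succ]
    exact (h v hv).mul hv

lemma WeakFlow.exists_holderBdd {α γ lam Lam T Q : ℝ} {w : SpaceTime → ℝ} {G H : SpaceTime → Plane}
    (h : WeakFlow α γ lam Lam T Q w G H) (hγ : 0 < γ) : ∃ K, 0 ≤ K ∧ HolderBdd γ K w := by
  obtain ⟨K, hK, hh⟩ := h.holder
  obtain ⟨L, hL⟩ := h.bdd
  refine ⟨max K L, le_max_of_le_left hK, h.continuous_w hγ,
    fun z => (hL z).trans (le_max_right _ _), fun z z' => (hh z z').trans ?_⟩
  exact mul_le_mul_of_nonneg_right (le_max_left _ _)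
    (Real.rpow_nonneg (parabolicSize_nonneg _) _)

/-! ### Time translations and smooth approximations with time cutoffs. -/

section TimeShift

variable {E : Type*} [NormedAddCommGroup E]

lemma preimage_sub_time (r : ℝ) :
    (fun z : SpaceTime => z - (0, r)) ⁻¹' (unitCell ×ˢ univ) = unitCell ×ˢ univ := by
  ext z; simp

lemma integrableOn_timeShift {F : SpaceTime → E} (hF : IntegrableOn F (unitCell ×ˢ univ)) (r : ℝ) :
    IntegrableOn (fun z => F (z - (0, r))) (unitCell ×ˢ univ) := by
  have := (measurePreserving_sub_right volume ((0, r) : SpaceTime)).integrableOn_comp_preimage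
    (measurableEmbedding_subRight _) (f := F) (s := unitCell ×ˢ univ)
  rw [preimage_sub_time] at this
  exact this.2 hF

lemma setIntegral_timeShift (F : SpaceTime → ℝ) (r : ℝ) :
    ∫ z in unitCell ×ˢ univ, F (z - (0, r)) = ∫ z in unitCell ×ˢ univ, F z := by
  have := (measurePreserving_sub_right volume ((0, r) : SpaceTime)).setIntegral_preimage_emb
    (measurableEmbedding_subRight _) F (unitCell ×ˢ univ)
  rwa [preimage_sub_time] at this

lemma setIntegral_univ_eq_cyl {F : SpaceTime → ℝ} {I : Set ℝ} (hF : ∀ z, z.2 ∉ I → F z = 0) :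
    ∫ z in unitCell ×ˢ univ, F z = ∫ z in unitCell ×ˢ I, F z :=
  (setIntegral_eq_of_subset_of_forall_sdiff_eq_zero (measurableSet_unitCell.prod MeasurableSet.univ)
    (prod_mono_right (subset_univ _)) fun z hz => hF z fun h => hz.2 ⟨hz.1.1, h⟩)

lemma integrableOn_univ_of_cyl {F : SpaceTime → E} {I : Set ℝ} (hF : ∀ z, z.2 ∉ I → F z = 0)
    (hi : IntegrableOn F (unitCell ×ˢ I)) : IntegrableOn F (unitCell ×ˢ univ) :=
  IntegrableOn.of_forall_sdiff_eq_zero hi (measurableSet_unitCell.prod MeasurableSet.univ)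
    fun z hz => hF z fun h => hz.2 ⟨hz.1.1, h⟩

lemma setIntegral_timeShift_cyl {F : SpaceTime → ℝ} {a b a₁ b₁ r : ℝ}
    (hF : ∀ z, z.2 ∉ Ioo a₁ b₁ → F z = 0) (ha : a ≤ a₁ + r) (hb : b₁ + r ≤ b) :
    ∫ z in unitCell ×ˢ Ioo a b, F (z - (0, r)) = ∫ z in unitCell ×ˢ Ioo a₁ b₁, F z := by
  rw [← setIntegral_univ_eq_cyl hF, ← setIntegral_timeShift F r]
  refine (setIntegral_univ_eq_cyl fun z hz => hF _ fun h => hz ?_).symm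
  have h' : z.2 - r ∈ Ioo a₁ b₁ := h
  exact ⟨by linarith [h'.1], by linarith [h'.2]⟩

lemma integrableOn_timeShift_cyl {F : SpaceTime → E} {a b a₁ b₁ r : ℝ}
    (hF : ∀ z, z.2 ∉ Ioo a₁ b₁ → F z = 0) (hi : IntegrableOn F (unitCell ×ˢ Ioo a₁ b₁)) :
    IntegrableOn (fun z => F (z - (0, r))) (unitCell ×ˢ Ioo a b) :=
  (integrableOn_timeShift (integrableOn_univ_of_cyl hF hi) r).mono_set
    (prod_mono_right (subset_univ _))

end TimeShift

/-- `u` is a sequence of smooth periodic functions approximating `g` uniformly and with uniform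
Hölder bounds, whose gradients converge to `Γ` in `L²` on the time interval `(a, b)`. -/
structure SmoothApprox (γ a b : ℝ) (g : SpaceTime → ℝ) (Γ : SpaceTime → Plane)
    (u : ℕ → SpaceTime → ℝ) : Prop where
  smooth : ∀ n, ContDiff ℝ (⊤ : ℕ∞) (u n)
  per : ∀ n, Per (u n)
  bdd : ∃ K, 0 ≤ K ∧ HolderBdd γ K g ∧ ∀ n, HolderBdd γ K (u n)
  unif : ∃ ε : ℕ → ℝ, Tendsto ε atTop (𝓝 0) ∧ ∀ n z, |u n z - g z| ≤ ε n
  meas : Measurable Γ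
  supp : ∀ z, z.2 ∉ Ioo a b → Γ z = 0
  sqInt : IntegrableOn (fun z => ‖Γ z‖ ^ 2) (unitCell ×ˢ Ioo a b)
  grad : Tendsto (fun n => ∫ z in unitCell ×ˢ Ioo a b, ‖sgrad (u n) z - Γ z‖ ^ 2) atTop (𝓝 0)

/-- `g` cut off sharply to the times in `(a, b)`. -/
def timeCutOff (a b : ℝ) (g : SpaceTime → ℝ) (z : SpaceTime) : ℝ :=
  g z * (Ioo a b).indicator 1 z.2

/-- A smooth function cut off smoothly to the times in `(a, b)`. -/
def smoothCutOff (a b : ℝ) (n : ℕ) (g : SpaceTime → ℝ) (z : SpaceTime) : ℝ :=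
  g z * smoothCut a b n z.2

lemma contDiff_smoothCutOff {a b : ℝ} {n : ℕ} {g : SpaceTime → ℝ} (hg : ContDiff ℝ (⊤ : ℕ∞) g) :
    ContDiff ℝ (⊤ : ℕ∞) (smoothCutOff a b n g) :=
  hg.mul ((contDiff_smoothCut a b n).comp contDiff_snd)

lemma smoothCutOff_eq_zero {a b : ℝ} {n : ℕ} {g : SpaceTime → ℝ} {z : SpaceTime}
    (h : z.2 ∉ Ioo a b) : smoothCutOff a b n g z = 0 := by
  rw [smoothCutOff]
  have hn : (0 : ℝ) < n + 1 := by positivity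
  rw [mem_Ioo, not_and_or, not_lt, not_lt] at h
  have : smoothCut a b n z.2 = 0 := by
    rcases h with h | h
    · rw [smoothCut, Real.smoothTransition.zero_of_nonpos, zero_mul]
      exact mul_nonpos_of_nonneg_of_nonpos hn.le (by linarith)
    · rw [smoothCut, mul_comm, Real.smoothTransition.zero_of_nonpos, zero_mul]
      exact mul_nonpos_of_nonneg_of_nonpos hn.le (by linarith)
  rw [this, mul_zero]

lemma sgrad_smoothCutOff {a b : ℝ} {n : ℕ} {g : SpaceTime → ℝ} (hg : ContDiff ℝ (⊤ : ℕ∞) g)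
    (z : SpaceTime) : sgrad (smoothCutOff a b n g) z = smoothCut a b n z.2 • sgrad g z := by
  refine ext_inner_right ℝ fun v => ?_
  rw [inner_smul_left, inner_sgrad, inner_sgrad]
  have h1 : HasFDerivAt g (fderiv ℝ g z) z := (hg.differentiable (by simp) z).hasFDerivAt
  have h2 : HasFDerivAt (fun z : SpaceTime => smoothCut a b n z.2) _ z :=
    (((contDiff_smoothCut a b n).differentiable (by simp) z.2).hasDerivAt).comp_hasFDerivAt z
      (ContinuousLinearMap.snd ℝ Plane ℝ).hasFDerivAt
  have h3 : HasFDerivAt (smoothCutOff a b n g) _ z := h1.mul h2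
  rw [h3.fderiv]
  simp

lemma sgrad_comp_sub {f : SpaceTime → ℝ} (c z : SpaceTime) :
    sgrad (fun z => f (z - c)) z = sgrad f (z - c) := by
  unfold sgrad
  rw [fderiv_comp_sub]

/-- The `L¹` distance in time controlling the distance of the two cutoffs. -/
def cutErr (a b K ε : ℝ) (n : ℕ) (t : ℝ) : ℝ :=
  ε * (Ioo a b).indicator 1 t + K * |smoothCut a b n t - (Ioo a b).indicator 1 t|

lemma integrable_smoothCut_sub (a b : ℝ) (n : ℕ) :
    Integrable fun t => |smoothCut a b n t - (Ioo a b).indicator 1 t| :=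
  ((timeCut_smoothCut a b n).integrable.sub timeCut_indicator.integrable).abs

lemma integrable_cutErr (a b K ε : ℝ) (n : ℕ) : Integrable (cutErr a b K ε n) :=
  (timeCut_indicator.integrable.const_mul ε).add ((integrable_smoothCut_sub a b n).const_mul K)

lemma tendsto_integral_cutErr (a b K : ℝ) {ε : ℕ → ℝ} (hε : Tendsto ε atTop (𝓝 0)) :
    Tendsto (fun n => ∫ t, cutErr a b K (ε n) n t) atTop (𝓝 0) := by
  have e : ∀ n, ∫ t, cutErr a b K (ε n) n t = ε n * (∫ t, (Ioo a b).indicator (1 : ℝ → ℝ) t) +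
      K * ∫ t, |smoothCut a b n t - (Ioo a b).indicator 1 t| := fun n => by
    unfold cutErr
    rw [integral_add (timeCut_indicator.integrable.const_mul _)
      ((integrable_smoothCut_sub a b n).const_mul K), integral_const_mul, integral_const_mul]
  simp_rw [e]
  simpa using (hε.mul_const _).add ((tendsto_integral_abs_smoothCut_sub a b).const_mul K)

lemma abs_smoothCutOff_sub_le {a b K ε : ℝ} {n : ℕ} {u g : SpaceTime → ℝ} (z : SpaceTime)
    (hu : |u z| ≤ K) (hε : |u z - g z| ≤ ε) :
    |smoothCutOff a b n u z - timeCutOff a b g z| ≤ cutErr a b K ε n z.2 := by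
  have e : smoothCutOff a b n u z - timeCutOff a b g z =
      (u z - g z) * (Ioo a b).indicator 1 z.2 +
        u z * (smoothCut a b n z.2 - (Ioo a b).indicator 1 z.2) := by
    rw [smoothCutOff, timeCutOff]; ring
  have h1 : |(Ioo a b).indicator (1 : ℝ → ℝ) z.2| = (Ioo a b).indicator 1 z.2 :=
    abs_of_nonneg (timeCut_indicator.nonneg _)
  rw [e, cutErr]
  refine (abs_add_le _ _).trans ?_
  rw [abs_mul, abs_mul, h1]
  exact add_le_add (mul_le_mul_of_nonneg_right hε (timeCut_indicator.nonneg _))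
    (mul_le_mul_of_nonneg_right hu (abs_nonneg _))

/-- A factor depending on time only multiplies the spatial gradient. The error splits into that of
`u n`, with a factor at most one, and the part of `Γ` lost near the ends of the window, which
vanishes by dominated convergence. -/
lemma SmoothApprox.tendsto_grad_cutOff {γ a b : ℝ} {g : SpaceTime → ℝ} {Γ : SpaceTime → Plane}
    {u : ℕ → SpaceTime → ℝ} (h : SmoothApprox γ a b g Γ u) :
    Tendsto (fun n => ∫ z in unitCell ×ˢ Ioo a b,
      ‖sgrad (smoothCutOff a b n (u n)) z - Γ z‖ ^ 2) atTop (𝓝 0) := by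
  have hsq : ∀ n, IntegrableOn (fun z => ‖sgrad (u n) z - Γ z‖ ^ 2) (unitCell ×ˢ Ioo a b) := by
    intro n
    obtain ⟨C, hC, hb⟩ := exists_bound_of_per (h.per n).sgrad (continuous_sgrad (h.smooth n))
      (isCompact_Icc (a := a) (b := b))
    have h1 : IntegrableOn (fun _ : SpaceTime => 2 * C ^ 2) (unitCell ×ˢ Ioo a b) :=
      integrableOn_const (volume_cyl_lt_top a b).ne
    refine Integrable.mono' (h1.add (h.sqInt.const_mul 2)) ?_ ?_
    · exact (((continuous_sgrad (h.smooth n)).measurable.sub h.meas).norm.pow_const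
        2).aestronglyMeasurable
    · filter_upwards [ae_restrict_mem (measurableSet_cyl a b)] with z hz
      have h2 := hb z (Ioo_subset_Icc_self hz.2)
      have h3 := norm_sub_le (sgrad (u n) z) (Γ z)
      rw [Real.norm_eq_abs, abs_of_nonneg (sq_nonneg _)]
      simp only [Pi.add_apply]
      nlinarith [norm_nonneg (sgrad (u n) z - Γ z), norm_nonneg (Γ z), norm_nonneg (sgrad (u n) z),
        sq_nonneg (‖sgrad (u n) z‖ - ‖Γ z‖)]
  have hb2 : ∀ n z, ((1 - smoothCut a b n z.2) ^ 2 * ‖Γ z‖ ^ 2 : ℝ) ≤ ‖Γ z‖ ^ 2 := by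
    intro n z
    have h1 := (timeCut_smoothCut a b n).nonneg z.2
    have h2 := (timeCut_smoothCut a b n).le_one z.2
    refine mul_le_of_le_one_left (sq_nonneg _) ?_
    nlinarith
  have hm2 : ∀ n, Measurable fun z => ((1 - smoothCut a b n z.2) ^ 2 * ‖Γ z‖ ^ 2 : ℝ) := fun n =>
    (((contDiff_smoothCut a b n).continuous.measurable.comp measurable_snd).const_sub 1
      |>.pow_const 2).mul (h.meas.norm.pow_const 2)
  have hi2 : ∀ n, IntegrableOn (fun z => ((1 - smoothCut a b n z.2) ^ 2 * ‖Γ z‖ ^ 2 : ℝ))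
      (unitCell ×ˢ Ioo a b) := fun n =>
    Integrable.mono' h.sqInt (hm2 n).aestronglyMeasurable (ae_of_all _ fun z => by
      rw [Real.norm_eq_abs, abs_of_nonneg (by positivity)]; exact hb2 n z)
  have ht2 : Tendsto (fun n => ∫ z in unitCell ×ˢ Ioo a b,
      ((1 - smoothCut a b n z.2) ^ 2 * ‖Γ z‖ ^ 2 : ℝ)) atTop (𝓝 0) := by
    have := tendsto_integral_of_dominated_convergence
      (μ := volume.restrict (unitCell ×ˢ Ioo a b))
      (F := fun n z => ((1 - smoothCut a b n z.2) ^ 2 * ‖Γ z‖ ^ 2 : ℝ)) (f := fun _ => 0)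
      (fun z => ‖Γ z‖ ^ 2) (fun n => (hm2 n).aestronglyMeasurable) h.sqInt
      (fun n => ae_of_all _ fun z => by
        rw [Real.norm_eq_abs, abs_of_nonneg (by positivity)]; exact hb2 n z) ?_
    · simpa using this
    · filter_upwards [ae_restrict_mem (measurableSet_cyl a b)] with z hz
      have h1 := tendsto_smoothCut a b z.2
      rw [indicator_of_mem hz.2, Pi.one_apply] at h1
      simpa using ((h1.const_sub 1).pow 2).mul_const (‖Γ z‖ ^ 2)
  have hlim := (h.grad.const_mul 2).add (ht2.const_mul 2)
  rw [mul_zero, add_zero] at hlim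
  refine squeeze_zero (fun n => integral_nonneg fun z => sq_nonneg _) (fun n => ?_) hlim
  rw [← integral_const_mul, ← integral_const_mul, ← integral_add ((hsq n).const_mul 2)
    ((hi2 n).const_mul 2)]
  refine integral_mono_of_nonneg (ae_of_all _ fun z => sq_nonneg _)
    (((hsq n).const_mul 2).add ((hi2 n).const_mul 2)) (ae_of_all _ fun z => ?_)
  simp only
  rw [sgrad_smoothCutOff (h.smooth n)]
  set s := smoothCut a b n z.2
  have hs0 : 0 ≤ s := (timeCut_smoothCut a b n).nonneg z.2
  have hs1 : s ≤ 1 := (timeCut_smoothCut a b n).le_one z.2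
  have e : s • sgrad (u n) z - Γ z = s • (sgrad (u n) z - Γ z) - (1 - s) • Γ z := by
    rw [smul_sub, sub_smul, one_smul]; abel
  have h1 : ‖s • sgrad (u n) z - Γ z‖ ≤ ‖sgrad (u n) z - Γ z‖ + (1 - s) * ‖Γ z‖ := by
    rw [e]
    refine (norm_sub_le _ _).trans ?_
    rw [norm_smul, norm_smul, Real.norm_eq_abs, Real.norm_eq_abs, abs_of_nonneg hs0,
      abs_of_nonneg (sub_nonneg.2 hs1)]
    gcongr
    exact mul_le_of_le_one_left (norm_nonneg _) hs1
  calc _ ≤ (‖sgrad (u n) z - Γ z‖ + (1 - s) * ‖Γ z‖) ^ 2 := by gcongr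
    _ ≤ _ := by nlinarith [sq_nonneg (‖sgrad (u n) z - Γ z‖ - (1 - s) * ‖Γ z‖)]

/-! ### The equation in increment form. -/

lemma fderiv_eq_zero_of_time {U : SpaceTime → ℝ} {a b : ℝ} (hs : ∀ z, U z ≠ 0 → z.2 ∈ Icc a b)
    {z : SpaceTime} (hz : z.2 ∉ Icc a b) : fderiv ℝ U z = 0 := by
  have ho : IsOpen ((fun z : SpaceTime => z.2) ⁻¹' (Icc a b)ᶜ) :=
    isClosed_Icc.isOpen_compl.preimage continuous_snd
  have : U =ᶠ[𝓝 z] fun _ => 0 := by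
    filter_upwards [ho.mem_nhds hz] with z' hz'
    by_contra hne
    exact hz' (hs z' hne)
  rw [this.fderiv_eq]
  simp

lemma Per.fderiv {U : SpaceTime → ℝ} (hU : Per U) : Per (fderiv ℝ U) := by
  intro k z
  have e : (fun z => U (z + (latticeVec k, 0))) = U := funext (hU k)
  rw [← fderiv_comp_add_right, e]

/-- The term with `∂ₜ` in the weak formulation is a derivative in the shift of the test function.
Integrating over the shift removes it, so test functions need no regularity in time in the end. -/
lemma hasDerivAt_integral_timeShift {w U : SpaceTime → ℝ} {a b a₁ b₁ K : ℝ} (hw : Continuous w)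
    (hK : ∀ z, |w z| ≤ K) (hU : ContDiff ℝ (⊤ : ℕ∞) U) (hp : Per U)
    (hs : ∀ z, U z ≠ 0 → z.2 ∈ Icc a₁ b₁) (r : ℝ) :
    HasDerivAt (fun r => ∫ z in unitCell ×ˢ Ioo a b, w z * U (z - (0, r)))
      (-∫ z in unitCell ×ˢ Ioo a b, w z * fderiv ℝ (fun z => U (z - (0, r))) z (0, 1)) r := by
  have hcd : Continuous (fderiv ℝ U) := hU.continuous_fderiv (by simp)
  obtain ⟨C, hC, hb⟩ := exists_bound_of_per hp.fderiv hcd (isCompact_Icc (a := a₁) (b := b₁))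
  have hb' : ∀ z, ‖fderiv ℝ U z‖ ≤ C := fun z => by
    by_cases hz : z.2 ∈ Icc a₁ b₁
    · exact hb z hz
    · rw [fderiv_eq_zero_of_time hs hz, norm_zero]; exact hC
  have hn : ‖((0, 1) : SpaceTime)‖ = 1 := by simp [Prod.norm_def]
  have hK0 : 0 ≤ K := (abs_nonneg _).trans (hK 0)
  obtain ⟨C', hC', hb2⟩ := exists_bound_of_per hp hU.continuous (isCompact_Icc (a := a₁) (b := b₁))
  have hb2' : ∀ z, ‖U z‖ ≤ C' := fun z => by
    by_cases hz : z.2 ∈ Icc a₁ b₁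
    · exact hb2 z hz
    · rw [(by_contra fun h => hz (hs z h) : U z = 0), norm_zero]; exact hC'
  have hsh : ∀ r : ℝ, Continuous fun z : SpaceTime => z - (0, r) := fun r =>
    continuous_id.sub continuous_const
  have key := hasDerivAt_integral_of_dominated_loc_of_deriv_le
    (μ := volume.restrict (unitCell ×ˢ Ioo a b)) (s := univ) (x₀ := r)
    (F := fun r z => w z * U (z - (0, r)))
    (F' := fun r z => w z * (-fderiv ℝ U (z - (0, r)) (0, 1))) (bound := fun _ => K * C)
    univ_mem ?_ ?_ ?_ ?_ ?_ ?_
  · have e : -∫ z in unitCell ×ˢ Ioo a b, w z * fderiv ℝ (fun z => U (z - (0, r))) z (0, 1) =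
        ∫ z in unitCell ×ˢ Ioo a b, w z * -(fderiv ℝ U (z - (0, r)) (0, 1)) := by
      rw [← integral_neg]
      refine integral_congr_ae (ae_of_all _ fun z => ?_)
      simp only
      rw [fderiv_comp_sub]
      ring
    rw [e]
    exact key.2
  · exact Eventually.of_forall fun r =>
      (hw.mul (hU.continuous.comp (hsh r))).aestronglyMeasurable
  · refine integrableOn_cyl_of_bound (C := K * C')
      (hw.mul (hU.continuous.comp (hsh r))).aestronglyMeasurable fun z _ => ?_
    rw [norm_mul]
    exact mul_le_mul (hK z) (hb2' _) (norm_nonneg _) hK0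
  · exact (hw.mul ((hcd.comp (hsh r)).clm_apply continuous_const).neg).aestronglyMeasurable
  · refine ae_of_all _ fun z r _ => ?_
    rw [norm_mul, norm_neg]
    refine mul_le_mul (hK z) (((fderiv ℝ U _).le_opNorm _).trans ?_) (norm_nonneg _) hK0
    rw [hn, mul_one]
    exact hb' _
  · exact integrableOn_const (volume_cyl_lt_top a b).ne
  · refine ae_of_all _ fun z r _ => ?_
    have h1 : HasFDerivAt U (fderiv ℝ U (z - (0, r))) (z - (0, r)) :=
      (hU.differentiable (by simp) _).hasFDerivAt
    have h2 : HasDerivAt (fun r : ℝ => z - ((0, r) : SpaceTime)) (-((0 : Plane), (1 : ℝ))) r := by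
      have := ((hasDerivAt_const r (0 : Plane)).prodMk (hasDerivAt_id r)).const_sub z
      simpa using this
    have h3 := (h1.comp_hasDerivAt r h2).const_mul (w z)
    simpa only [map_neg, Function.comp_def] using h3

lemma setIntegral_cyl_le_boxMul {F : SpaceTime → ℝ} {e : ℝ → ℝ} {a b : ℝ} (he : Integrable e)
    (he0 : ∀ t, 0 ≤ e t) (hF : ∀ z, |F z| ≤ e z.2) :
    |∫ z in unitCell ×ˢ Ioo a b, F z| ≤ (volume (bigBox 2)).toReal * ∫ t, e t := by
  rw [← integral_boxMul]
  refine (abs_integral_le_integral_abs).trans ?_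
  calc _ ≤ ∫ z in unitCell ×ˢ Ioo a b, boxMul e z := by
        refine integral_mono_of_nonneg (ae_of_all _ fun z => abs_nonneg _)
          (integrable_boxMul he).integrableOn ?_
        filter_upwards [ae_restrict_mem (measurableSet_cyl a b)] with z hz
        rw [boxMul_of_mem (unitCell_subset_bigBox (by norm_num) hz.1)]
        exact hF z
    _ ≤ _ := setIntegral_le_integral (integrable_boxMul he)
        (ae_of_all _ fun z => boxMul_nonneg he0 z)

set_option maxHeartbeats 3000000 in
/-- The increment form of the equation: a weak flow tested against the time translates of a
function which is a limit of smooth periodic functions, sharply cut off in time. -/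
theorem WeakFlow.test {α γ lam Lam T Q : ℝ} {w : SpaceTime → ℝ} {G H : SpaceTime → Plane}
    (h : WeakFlow α γ lam Lam T Q w G H) (hγ : 0 < γ) (hγ1 : γ ≤ 1) (hαγ : 0 < α + γ)
    (hLam : 0 ≤ Lam) (hQ : 0 ≤ Q) {a b a₁ b₁ r₀ r₁ : ℝ} (ha : 0 < a) (hb : b < T)
    (hr : r₀ ≤ r₁) (h₁ : a < a₁ + r₀) (h₂ : b₁ + r₁ < b)
    {g : SpaceTime → ℝ} {Γ : SpaceTime → Plane} {u : ℕ → SpaceTime → ℝ}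
    (hu : SmoothApprox γ a₁ b₁ g Γ u) {μ : SpaceTime → ℝ} (hμ : Measurable μ) (hμp : Per μ)
    {m : ℝ} (hμ0 : ∀ z, 0 ≤ μ z) (hμm : ∀ z, μ z ≤ m) {β : ℕ → ℝ} {c : ℕ → ℕ → ℝ}
    (hseq : ∀ k < 3, ∀ r ∈ Icc r₀ r₁,
      ModSeq (fun z => chi z * (w z ^ k * timeCutOff a₁ b₁ g (z - (0, r)))) (β k) (c k))
    (hsum : ∀ k < 3, Summable fun n => scale n ^ α * c k n) {R : ℝ}
    (hR : ∀ r ∈ Icc r₀ r₁, Q * (∑ k ∈ Finset.range 3, (β k + ∑' n, scale n ^ α * c k n)) -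
      (∫ z in unitCell ×ˢ Ioo a b,
        (lam * μ z * ‖G z‖ ^ 2 - Lam * ‖G z‖ * ‖Γ (z - (0, r)) - μ z • G z‖)) -
      (∫ z in unitCell ×ˢ Ioo a b, w z ^ 3 * timeCutOff a₁ b₁ g (z - (0, r))) ≤ R) :
    ∫ z in unitCell ×ˢ Ioo a₁ b₁, (w (z + (0, r₁)) - w (z + (0, r₀))) * g z ≤ (r₁ - r₀) * R := by
  obtain ⟨Kw, hKw, hw⟩ := h.exists_holderBdd hγ
  obtain ⟨Ku, hKu, hg, hub⟩ := hu.bdd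
  obtain ⟨ε, hε, hεu⟩ := hu.unif
  have hε0 : ∀ n, 0 ≤ ε n := fun n => (abs_nonneg _).trans (hεu n 0)
  have hcw := hw.1
  set V := (volume (bigBox 2)).toReal with hV
  have hV0 : 0 ≤ V := ENNReal.toReal_nonneg
  set U : ℕ → SpaceTime → ℝ := fun n => smoothCutOff a₁ b₁ n (u n) with hU
  have hUs : ∀ n, ContDiff ℝ (⊤ : ℕ∞) (U n) := fun n => contDiff_smoothCutOff (hu.smooth n)
  have hUp : ∀ n, Per (U n) := fun n k z => by
    simp only [hU, smoothCutOff, hu.per n k z, Prod.snd_add, add_zero]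
  have hU0 : ∀ n z, z.2 ∉ Ioo a₁ b₁ → U n z = 0 := fun n z hz => smoothCutOff_eq_zero hz
  have hUsupp : ∀ n z, U n z ≠ 0 → z.2 ∈ Icc a₁ b₁ := fun n z hz =>
    Ioo_subset_Icc_self (by_contra fun h' => hz (hU0 n z h'))
  set e : ℕ → ℝ → ℝ := fun n => cutErr a₁ b₁ Ku (ε n) n with he
  have hei : ∀ n, Integrable (e n) := fun n => integrable_cutErr _ _ _ _ _
  have he0 : ∀ n t, 0 ≤ e n t := fun n t => add_nonneg
    (mul_nonneg (hε0 n) (timeCut_indicator.nonneg _)) (mul_nonneg hKu (abs_nonneg _))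
  have heU : ∀ n z, |U n z - timeCutOff a₁ b₁ g z| ≤ e n z.2 := fun n z =>
    abs_smoothCutOff_sub_le z ((hub n).2.1 z) (hεu n z)
  have hlim : Tendsto (fun n => ∫ t, e n t) atTop (𝓝 0) := tendsto_integral_cutErr _ _ _ hε
  have heshift : ∀ n (r : ℝ), ∫ t, e n (t - r) = ∫ t, e n t := fun n r =>
    integral_sub_right_eq_self _ r
  -- uniform modulus of continuity
  have hmod : ∀ k : ℕ, ∃ C, 0 ≤ C ∧ ∀ r ∈ Icc r₀ r₁, ∀ n,
      ModSeq (fun z => chi z * (w z ^ k * U n (z - (0, r)))) C (fun j => C * scale j ^ γ) ∧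
      Integrable (fun z => chi z * (w z ^ k * U n (z - (0, r)))) ∧
      Integrable (fun z => chi z * (w z ^ k * timeCutOff a₁ b₁ g (z - (0, r)))) := by
    intro k
    obtain ⟨L, hL, hpow⟩ := exists_holderBdd_pow (γ := γ) hKw k
    have hK2 : 0 ≤ 2 * (L * Ku) := by positivity
    obtain ⟨C, hC, hmod⟩ := exists_holder_modulus hγ hγ1 hK2 (a₁ + r₀) (b₁ + r₁)
    refine ⟨C, hC, fun r hr' n => ?_⟩
    have hv := (hpow w hw).mul ((hub n).comp_sub (0, r))
    have hvg := (hpow w hw).mul (hg.comp_sub (0, r))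
    have hθ : TimeCut (a₁ + r₀) (b₁ + r₁) fun t => smoothCut a₁ b₁ n (t - r) :=
      ((timeCut_smoothCut a₁ b₁ n).translate r).mono (by linarith [hr'.1]) (by linarith [hr'.2])
    have hθg : TimeCut (a₁ + r₀) (b₁ + r₁) fun t => (Ioo a₁ b₁).indicator 1 (t - r) :=
      (timeCut_indicator.translate r).mono (by linarith [hr'.1]) (by linarith [hr'.2])
    have e1 : ∀ z : SpaceTime, chi z * (w z ^ k * U n (z - (0, r))) =
        chi z * ((w z ^ k * u n (z - (0, r))) * smoothCut a₁ b₁ n (z.2 - r)) := fun z => by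
      simp only [hU, smoothCutOff, Prod.snd_sub]; ring
    have e2 : ∀ z : SpaceTime, chi z * (w z ^ k * timeCutOff a₁ b₁ g (z - (0, r))) =
        chi z * ((w z ^ k * g (z - (0, r))) * (Ioo a₁ b₁).indicator 1 (z.2 - r)) := fun z => by
      simp only [timeCutOff, Prod.snd_sub]; ring
    simp_rw [e1, e2]
    obtain ⟨m1, m2⟩ := hmod _ _ hv hθ
    refine ⟨⟨?_, ?_⟩, integrable_chi_mul_cut hv.1 hv.2.1 hθ,
      integrable_chi_mul_cut hvg.1 hvg.2.1 hθg⟩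
    · exact m1
    · exact m2
  choose C hC hmodC using hmod
  -- differentiating in the shift
  set D : ℕ → ℝ → ℝ := fun n r => ∫ z in unitCell ×ˢ Ioo a b, w z * U n (z - (0, r)) with hD
  have hder := fun n r => hasDerivAt_integral_timeShift (a := a) (b := b) hcw hw.2.1 (hUs n)
    (hUp n) (hUsupp n) r
  have hGi : IntegrableOn (fun z => ‖G z‖ ^ 2) (unitCell ×ˢ Ioo a b) := h.sqInt a b ha hb
  have hG0 : 0 ≤ ∫ z in unitCell ×ˢ Ioo a b, ‖G z‖ ^ 2 := integral_nonneg fun z => sq_nonneg _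
  have hΓU : ∀ n, IntegrableOn (fun z => ‖sgrad (U n) z - Γ z‖ ^ 2) (unitCell ×ˢ Ioo a₁ b₁) := by
    intro n
    obtain ⟨C, hC, hb⟩ := exists_bound_of_per (hUp n).sgrad (continuous_sgrad (hUs n))
      (isCompact_Icc (a := a₁) (b := b₁))
    have h1 : IntegrableOn (fun _ : SpaceTime => 2 * C ^ 2) (unitCell ×ˢ Ioo a₁ b₁) :=
      integrableOn_const (volume_cyl_lt_top a₁ b₁).ne
    refine Integrable.mono' (h1.add (hu.sqInt.const_mul 2)) ?_ ?_
    · exact (((continuous_sgrad (hUs n)).measurable.sub hu.meas).norm.pow_const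
        2).aestronglyMeasurable
    · filter_upwards [ae_restrict_mem (measurableSet_cyl a₁ b₁)] with z hz
      have h2 := hb z (Ioo_subset_Icc_self hz.2)
      have h3 := norm_sub_le (sgrad (U n) z) (Γ z)
      rw [Real.norm_eq_abs, abs_of_nonneg (sq_nonneg _)]
      simp only [Pi.add_apply]
      nlinarith [norm_nonneg (sgrad (U n) z - Γ z), norm_nonneg (Γ z), norm_nonneg (sgrad (U n) z),
        sq_nonneg (‖sgrad (U n) z‖ - ‖Γ z‖)]
  have hsupp2 : ∀ n z, z.2 ∉ Ioo a₁ b₁ → ‖sgrad (U n) z - Γ z‖ ^ 2 = 0 := by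
    intro n z hz
    have : sgrad (U n) z = 0 := by
      rw [sgrad_smoothCutOff (hu.smooth n)]
      have h1 : smoothCutOff a₁ b₁ n (fun _ => 1) z = 0 := smoothCutOff_eq_zero hz
      rw [smoothCutOff, one_mul] at h1
      rw [h1, zero_smul]
    rw [this, hu.supp z hz]
    simp
  -- The loss `δ` is divided into a quarter for the three products, a quarter for the cubic term,
  -- and two quarters for Young's inequality between `G` and the error of the gradient.
  have main : ∀ δ > 0, ∀ᶠ n in atTop, ∀ r ∈ Icc r₀ r₁, deriv (D n) r ≤ R + δ := by
    intro δ hδ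
    -- smallness parameters
    obtain ⟨δ', hδ', hδ'Q⟩ : ∃ δ' > 0, Q * (3 * δ') ≤ δ / 4 := by
      refine ⟨δ / (12 * (Q + 1)), by positivity, ?_⟩
      rw [show Q * (3 * (δ / (12 * (Q + 1)))) = (Q / (Q + 1)) * (δ / 4) by field_simp; ring]
      refine mul_le_of_le_one_left (by positivity) ?_
      rw [div_le_one (by positivity)]; linarith
    have happ : ∀ k : ℕ, ∃ η > 0, k < 3 → ∀ F F' : SpaceTime → ℝ, Integrable F → Integrable F' →
        ModSeq F (β k) (c k) → ModSeq F' (C k) (fun j => C k * scale j ^ γ) →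
        ∫ z, |F' z - F z| ≤ η → ModBound α F' (β k + (∑' n, scale n ^ α * c k n) + δ') := by
      intro k
      by_cases hk : k < 3
      · obtain ⟨η, hη, H⟩ := exists_modBound_approx (α := α) (β := β k) (β' := C k)
          (fun n => (hseq k hk r₀ ⟨le_rfl, hr⟩).nonneg n)
          (fun n => mul_nonneg (hC k) (scale_rpow_nonneg n γ)) (hsum k hk)
          (summable_scale_rpow_mul hαγ) hδ'
        exact ⟨η, hη, fun _ => H⟩
      · exact ⟨1, one_pos, fun h' => absurd h' hk⟩
    choose η hη happ using happ
    obtain ⟨κ, hκ, hκG⟩ : ∃ κ > 0, Lam * (κ * ∫ z in unitCell ×ˢ Ioo a b, ‖G z‖ ^ 2) ≤ δ / 4 := by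
      set N := Lam * ∫ z in unitCell ×ˢ Ioo a b, ‖G z‖ ^ 2 with hN
      have hN0 : 0 ≤ N := mul_nonneg hLam hG0
      refine ⟨δ / (4 * (N + 1)), by positivity, ?_⟩
      rw [show Lam * (δ / (4 * (N + 1)) * ∫ z in unitCell ×ˢ Ioo a b, ‖G z‖ ^ 2) =
        (N / (N + 1)) * (δ / 4) by rw [hN]; field_simp]
      refine mul_le_of_le_one_left (by positivity) ?_
      rw [div_le_one (by positivity)]; linarith
    have ev1 : ∀ᶠ n in atTop, Lam * (κ⁻¹ * ∫ z in unitCell ×ˢ Ioo a₁ b₁,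
        ‖sgrad (U n) z - Γ z‖ ^ 2) < δ / 4 := by
      have := (hu.tendsto_grad_cutOff.const_mul κ⁻¹).const_mul Lam
      rw [mul_zero, mul_zero] at this
      exact this.eventually_lt_const (by positivity)
    have ev2 : ∀ᶠ n in atTop, V * (Kw ^ 3 * ∫ t, e n t) < δ / 4 := by
      have := (hlim.const_mul (Kw ^ 3)).const_mul V
      rw [mul_zero, mul_zero] at this
      exact this.eventually_lt_const (by positivity)
    have ev3 : ∀ k : ℕ, ∀ᶠ n in atTop, V * (Kw ^ k * ∫ t, e n t) < η k := by
      intro k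
      have := (hlim.const_mul (Kw ^ k)).const_mul V
      rw [mul_zero, mul_zero] at this
      exact this.eventually_lt_const (hη k)
    filter_upwards [ev1, ev2, ev3 0, ev3 1, ev3 2] with n h1 h2 h30 h31 h32 r hr'
    have hdr : deriv (D n) r = _ := (hder n r).deriv
    set ψ : SpaceTime → ℝ := fun z => U n (z - (0, r)) with hψ
    have hMB : ∀ k < 3, V * (Kw ^ k * ∫ t, e n t) < η k →
        ModBound α (fun z => chi z * (w z ^ k * ψ z))
          (β k + (∑' n, scale n ^ α * c k n) + δ') := by
      intro k hk hlt
      obtain ⟨q1, q2, q3⟩ := hmodC k r hr' n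
      refine happ k hk _ _ q3 q2 (hseq k hk r hr') q1 (le_trans ?_ hlt.le)
      have hsh : Integrable fun t => Kw ^ k * e n (t - r) :=
        ((hei n).comp_sub_right r).const_mul _
      calc _ ≤ ∫ z, boxMul (fun t => Kw ^ k * e n (t - r)) z := by
            refine integral_mono_of_nonneg (ae_of_all _ fun z => abs_nonneg _)
              (integrable_boxMul hsh) (ae_of_all _ fun z => ?_)
            simp only
            by_cases hz : z.1 ∈ bigBox 2
            · rw [boxMul_of_mem hz, ← mul_sub, ← mul_sub, abs_mul, abs_mul, abs_pow]
              calc _ ≤ 1 * (Kw ^ k * e n (z.2 - r)) := by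
                    gcongr
                    · exact abs_chi_le_one z
                    · exact hw.2.1 z
                    · exact heU n (z - (0, r))
                _ = _ := one_mul _
            · rw [(chi_eq_zero_of_notMem (d := 0) (by simp) hz).1]
              simpa using boxMul_nonneg (fun t => mul_nonneg (pow_nonneg hKw k) (he0 n _)) z
        _ = _ := by rw [integral_boxMul, integral_const_mul, heshift]
    have B2 := hMB 2 (by norm_num) h32
    have B1 := hMB 1 (by norm_num) h31
    have B0 := hMB 0 (by norm_num) h30
    simp only [pow_one, pow_zero, one_mul] at B1 B0
    have hψs : ContDiff ℝ (⊤ : ℕ∞) ψ := (hUs n).comp (contDiff_id.sub contDiff_const)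
    have hψp : Per ψ := fun k z => by
      simp only [hψ]
      rw [add_sub_right_comm]
      exact hUp n k _
    have hψsupp : ∀ z, ψ z ≠ 0 → z.2 ∈ Icc (a₁ + r) (b₁ + r) := fun z hz => by
      have h' : z.2 - r ∈ Icc a₁ b₁ := hUsupp n _ hz
      exact ⟨by linarith [h'.1], by linarith [h'.2]⟩
    -- The weight `μ` is kept fixed while the test function is the smooth approximation translated
    -- by `r`; the window `(a, b)` contains all translated supports.
    have key := h.periodic_ineq hγ hLam ha (by linarith [hr'.1] : a < a₁ + r)
      (by linarith [hr'.2] : b₁ + r < b) hb hψs hψp hψsupp hμ hμp hμ0 hμm B2 B1 B0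
    rw [hdr]
    have hRr := hR r hr'
    simp only [Finset.sum_range_succ, Finset.sum_range_zero, zero_add] at hRr
    -- comparison of the cubic terms
    have c1 : |(∫ z in unitCell ×ˢ Ioo a b, w z ^ 3 * ψ z) -
        ∫ z in unitCell ×ˢ Ioo a b, w z ^ 3 * timeCutOff a₁ b₁ g (z - (0, r))| ≤ δ / 4 := by
      have hcb : ∀ F : SpaceTime → ℝ, Measurable F → (∀ z, |F z| ≤ Ku) →
          IntegrableOn (fun z => w z ^ 3 * F z) (unitCell ×ˢ Ioo a b) := by
        intro F hF hFb
        refine integrableOn_cyl_of_bound (C := Kw ^ 3 * Ku)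
          ((hcw.measurable.pow_const 3).mul hF).aestronglyMeasurable fun z _ => ?_
        rw [norm_mul, norm_pow]
        exact mul_le_mul (pow_le_pow_left₀ (norm_nonneg _) (hw.2.1 z) 3) (hFb z) (norm_nonneg _)
          (pow_nonneg hKw 3)
      have hcutle : ∀ {f : SpaceTime → ℝ} {θ : ℝ → ℝ} {A B : ℝ}, (∀ z, |f z| ≤ Ku) →
          TimeCut A B θ → ∀ z : SpaceTime, |f z * θ z.2| ≤ Ku := by
        intro f θ A B hf hθ z
        rw [abs_mul]
        exact (mul_le_of_le_one_right (abs_nonneg _) (hθ.abs_le_one _)).trans (hf z)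
      have hmc : Measurable (timeCutOff a₁ b₁ g) :=
        hg.1.measurable.mul ((measurable_one.indicator measurableSet_Ioo).comp measurable_snd)
      have j1 := hcb ψ hψs.continuous.measurable fun z =>
        hcutle (hub n).2.1 (timeCut_smoothCut a₁ b₁ n) (z - (0, r))
      have j2 := hcb (fun z => timeCutOff a₁ b₁ g (z - (0, r)))
        (hmc.comp (measurable_id.sub_const _)) fun z =>
        hcutle hg.2.1 timeCut_indicator (z - (0, r))
      rw [← integral_sub j1 j2]
      · refine (setIntegral_cyl_le_boxMul (e := fun t => Kw ^ 3 * e n (t - r))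
          (((hei n).comp_sub_right r).const_mul _)
          (fun t => mul_nonneg (pow_nonneg hKw 3) (he0 n _)) fun z => ?_).trans ?_
        · rw [← mul_sub, abs_mul, abs_pow]
          exact mul_le_mul (pow_le_pow_left₀ (abs_nonneg _) (hw.2.1 z) 3) (heU n (z - (0, r)))
            (abs_nonneg _) (pow_nonneg hKw 3)
        · rw [integral_const_mul, heshift]
          exact h2.le
    -- comparison of the gradient terms
    have c2 : (∫ z in unitCell ×ˢ Ioo a b,
        (lam * μ z * ‖G z‖ ^ 2 - Lam * ‖G z‖ * ‖Γ (z - (0, r)) - μ z • G z‖)) ≤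
        (∫ z in unitCell ×ˢ Ioo a b,
          (lam * μ z * ‖G z‖ ^ 2 - Lam * ‖G z‖ * ‖sgrad ψ z - μ z • G z‖)) + δ / 2 := by
      have hΓi : IntegrableOn (fun z : SpaceTime => ‖Γ (z - (0, r))‖ ^ 2) (unitCell ×ˢ Ioo a b) :=
        integrableOn_timeShift_cyl (F := fun z => ‖Γ z‖ ^ 2)
          (fun z hz => by rw [hu.supp z hz]; simp) hu.sqInt
      have hdi : IntegrableOn (fun z : SpaceTime => ‖sgrad (U n) (z - (0, r)) - Γ (z - (0, r))‖ ^ 2)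
          (unitCell ×ˢ Ioo a b) :=
        integrableOn_timeShift_cyl (F := fun z => ‖sgrad (U n) z - Γ z‖ ^ 2) (hsupp2 n) (hΓU n)
      have hdint := setIntegral_timeShift_cyl (F := fun z => ‖sgrad (U n) z - Γ z‖ ^ 2) (hsupp2 n)
        (by linarith [hr'.1] : a ≤ a₁ + r) (by linarith [hr'.2] : b₁ + r ≤ b)
      have hmΓ : Measurable fun z : SpaceTime => Γ (z - (0, r)) :=
        hu.meas.comp (measurable_id.sub_const _)
      have hμG : IntegrableOn (fun z => lam * μ z * ‖G z‖ ^ 2) (unitCell ×ˢ Ioo a b) := by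
        refine hGi.bdd_mul (c := |lam| * m) (hμ.const_mul lam).aestronglyMeasurable
          (ae_of_all _ fun z => ?_)
        rw [norm_mul, Real.norm_eq_abs, Real.norm_eq_abs, abs_of_nonneg (hμ0 z)]
        exact mul_le_mul_of_nonneg_left (hμm z) (abs_nonneg _)
      have i1 : IntegrableOn (fun z => Lam * ‖G z‖ * ‖Γ (z - (0, r)) - μ z • G z‖)
          (unitCell ×ˢ Ioo a b) := by
        have hmaj := (hGi.const_mul (Lam * (1 + m))).add (hΓi.const_mul Lam)
        refine Integrable.mono' hmaj
          (((h.meas_G.norm.const_mul Lam).mul (hmΓ.sub (hμ.smul h.meas_G)).norm)).aestronglyMeasurable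
          (ae_of_all _ fun z => ?_)
        rw [Real.norm_eq_abs, abs_of_nonneg (by positivity)]
        have hn : ‖Γ (z - (0, r)) - μ z • G z‖ ≤ ‖Γ (z - (0, r))‖ + m * ‖G z‖ := by
          refine (norm_sub_le _ _).trans ?_
          rw [norm_smul, Real.norm_eq_abs, abs_of_nonneg (hμ0 z)]
          gcongr
          exact hμm z
        calc _ ≤ Lam * ‖G z‖ * (‖Γ (z - (0, r))‖ + m * ‖G z‖) := by gcongr
          _ = Lam * (‖G z‖ * ‖Γ (z - (0, r))‖ + m * ‖G z‖ ^ 2) := by ring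
          _ ≤ Lam * ((1 + m) * ‖G z‖ ^ 2 + ‖Γ (z - (0, r))‖ ^ 2) := by
              refine mul_le_mul_of_nonneg_left ?_ hLam
              nlinarith [sq_nonneg (‖G z‖ - ‖Γ (z - (0, r))‖), sq_nonneg ‖G z‖,
                sq_nonneg ‖Γ (z - (0, r))‖]
          _ = _ := by simp only [Pi.add_apply]; ring
      have hmaj2 := (hGi.const_mul (Lam * κ)).add (hdi.const_mul (Lam * κ⁻¹))
      have hsψ : ∀ z, sgrad ψ z = sgrad (U n) (z - (0, r)) := fun z => sgrad_comp_sub _ _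
      have hyoung : ∀ z : SpaceTime,
          Lam * ‖G z‖ * ‖sgrad (U n) (z - (0, r)) - Γ (z - (0, r))‖ ≤
          Lam * κ * ‖G z‖ ^ 2 + Lam * κ⁻¹ * ‖sgrad (U n) (z - (0, r)) - Γ (z - (0, r))‖ ^ 2 := by
        intro z
        set x := ‖G z‖
        set y := ‖sgrad (U n) (z - (0, r)) - Γ (z - (0, r))‖
        have : x * y ≤ κ * x ^ 2 + κ⁻¹ * y ^ 2 := by
          have h1 := sq_nonneg (κ * x - y)
          have h2 : κ⁻¹ * (κ * x - y) ^ 2 = κ * x ^ 2 - 2 * (x * y) + κ⁻¹ * y ^ 2 := by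
            field_simp
            ring
          have h3 := mul_nonneg (inv_pos.2 hκ).le h1
          have h4 : 0 ≤ x * y := mul_nonneg (norm_nonneg _) (norm_nonneg _)
          linarith
        calc _ = Lam * (x * y) := by ring
          _ ≤ Lam * (κ * x ^ 2 + κ⁻¹ * y ^ 2) := by gcongr
          _ = _ := by ring
      have i2 : IntegrableOn (fun z => Lam * ‖G z‖ * ‖sgrad ψ z - μ z • G z‖)
          (unitCell ×ˢ Ioo a b) := by
        refine Integrable.mono' (i1.add hmaj2) ?_ (ae_of_all _ fun z => ?_)
        · exact ((h.meas_G.norm.const_mul Lam).mul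
            ((continuous_sgrad hψs).measurable.sub (hμ.smul h.meas_G)).norm).aestronglyMeasurable
        · rw [Real.norm_eq_abs, abs_of_nonneg (by positivity), hsψ]
          have h0 := hyoung z
          have h1 := norm_sub_le_norm_sub_add_norm_sub (sgrad (U n) (z - (0, r))) (Γ (z - (0, r)))
            (μ z • G z)
          have h3 : 0 ≤ Lam * ‖G z‖ := by positivity
          have h4 := mul_le_mul_of_nonneg_left h1 h3
          simp only [Pi.add_apply]
          linarith
      have hmono : ∫ z in unitCell ×ˢ Ioo a b,
          (lam * μ z * ‖G z‖ ^ 2 - Lam * ‖G z‖ * ‖Γ (z - (0, r)) - μ z • G z‖) ≤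
          ∫ z in unitCell ×ˢ Ioo a b,
          ((lam * μ z * ‖G z‖ ^ 2 - Lam * ‖G z‖ * ‖sgrad ψ z - μ z • G z‖) +
            (Lam * κ * ‖G z‖ ^ 2 +
              Lam * κ⁻¹ * ‖sgrad (U n) (z - (0, r)) - Γ (z - (0, r))‖ ^ 2)) := by
        refine integral_mono (hμG.sub i1) ((hμG.sub i2).add hmaj2) fun z => ?_
        simp only [hsψ]
        have h0 := hyoung z
        have h1 := norm_sub_le_norm_sub_add_norm_sub (sgrad (U n) (z - (0, r))) (Γ (z - (0, r)))
          (μ z • G z)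
        have h3 : 0 ≤ Lam * ‖G z‖ := by positivity
        have h4 := mul_le_mul_of_nonneg_left h1 h3
        linarith
      refine hmono.trans ?_
      have hAB : IntegrableOn (fun z => lam * μ z * ‖G z‖ ^ 2 -
        Lam * ‖G z‖ * ‖sgrad ψ z - μ z • G z‖) (unitCell ×ˢ Ioo a b) := hμG.sub i2
      have hmaj3 : IntegrableOn (fun z : SpaceTime => Lam * κ * ‖G z‖ ^ 2 +
        Lam * κ⁻¹ * ‖sgrad (U n) (z - (0, r)) - Γ (z - (0, r))‖ ^ 2) (unitCell ×ˢ Ioo a b) := hmaj2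
      rw [integral_add hAB hmaj3, integral_add (hGi.const_mul _) (hdi.const_mul _),
        integral_const_mul, integral_const_mul, hdint]
      have : Lam * κ * (∫ z in unitCell ×ˢ Ioo a b, ‖G z‖ ^ 2) ≤ δ / 4 := by
        rw [mul_assoc]; exact hκG
      have : Lam * κ⁻¹ * (∫ z in unitCell ×ˢ Ioo a₁ b₁, ‖sgrad (U n) z - Γ z‖ ^ 2) ≤ δ / 4 := by
        rw [mul_assoc]; exact h1.le
      linarith
    have c1' := abs_le.1 c1
    have hQ3 : Q * (β 2 + (∑' n, scale n ^ α * c 2 n) + δ' + (β 1 + (∑' n, scale n ^ α * c 1 n) + δ')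
        + (β 0 + (∑' n, scale n ^ α * c 0 n) + δ')) =
        Q * (β 0 + (∑' n, scale n ^ α * c 0 n) + (β 1 + (∑' n, scale n ^ α * c 1 n)) +
          (β 2 + (∑' n, scale n ^ α * c 2 n))) + Q * (3 * δ') := by ring
    rw [hQ3] at key
    linarith [c1'.1]
  -- integrate in the shift and pass to the limit
  have hDlim : ∀ r ∈ Icc r₀ r₁, Tendsto (fun n => D n r) atTop
      (𝓝 (∫ z in unitCell ×ˢ Ioo a₁ b₁, w (z + (0, r)) * g z)) := by
    intro r hr'
    have hshc : Continuous fun z : SpaceTime => w (z + (0, r)) :=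
      hcw.comp (continuous_id.add continuous_const)
    have e1 : ∀ n, D n r = ∫ z in unitCell ×ˢ Ioo a₁ b₁, w (z + (0, r)) * U n z := fun n => by
      rw [← setIntegral_timeShift_cyl (F := fun z => w (z + (0, r)) * U n z)
        (fun z hz => by rw [hU0 n z hz, mul_zero]) (by linarith [hr'.1] : a ≤ a₁ + r)
        (by linarith [hr'.2] : b₁ + r ≤ b)]
      simp only [hD, sub_add_cancel]
    have hbd : ∀ (F : SpaceTime → ℝ) (K : ℝ), Continuous F → (∀ z, |F z| ≤ K) →
        IntegrableOn (fun z => w (z + (0, r)) * F z) (unitCell ×ˢ Ioo a₁ b₁) := by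
      intro F K hF hFK
      refine integrableOn_cyl_of_bound (C := Kw * K) (hshc.mul hF).aestronglyMeasurable fun z _ => ?_
      rw [norm_mul]
      exact mul_le_mul (hw.2.1 _) (hFK z) (norm_nonneg _) hKw
    rw [tendsto_iff_dist_tendsto_zero]
    have hl2 := (hlim.const_mul Kw).const_mul V
    rw [mul_zero, mul_zero] at hl2
    refine squeeze_zero (fun _ => dist_nonneg) (fun n => ?_) hl2
    rw [Real.dist_eq, e1, ← integral_sub (hbd _ Ku (hUs n).continuous fun z => ?_)
      (hbd _ Ku hg.1 hg.2.1)]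
    · have e2 : ∫ z in unitCell ×ˢ Ioo a₁ b₁, (w (z + (0, r)) * U n z - w (z + (0, r)) * g z) =
          ∫ z in unitCell ×ˢ Ioo a₁ b₁, w (z + (0, r)) * (U n z - timeCutOff a₁ b₁ g z) := by
        refine setIntegral_congr_fun (measurableSet_cyl a₁ b₁) fun z hz => ?_
        simp only [timeCutOff, indicator_of_mem hz.2, Pi.one_apply, mul_one, mul_sub]
      rw [e2]
      refine (setIntegral_cyl_le_boxMul (e := fun t => Kw * e n t) ((hei n).const_mul _)
        (fun t => mul_nonneg hKw (he0 n _)) fun z => ?_).trans ?_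
      · rw [abs_mul]
        exact mul_le_mul (hw.2.1 _) (heU n _) (abs_nonneg _) hKw
      · rw [integral_const_mul]
    · simp only [hU, smoothCutOff, abs_mul]
      exact (mul_le_of_le_one_right (abs_nonneg _)
        ((timeCut_smoothCut a₁ b₁ n).abs_le_one _)).trans ((hub n).2.1 z)
  have hfin : (∫ z in unitCell ×ˢ Ioo a₁ b₁, w (z + (0, r₁)) * g z) -
      (∫ z in unitCell ×ˢ Ioo a₁ b₁, w (z + (0, r₀)) * g z) ≤ (r₁ - r₀) * R := by
    refine le_of_forall_pos_le_add fun δ hδ => ?_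
    -- The `+ 1` covers the case `r₀ = r₁`.
    have hδ'' : 0 < δ / (r₁ - r₀ + 1) := div_pos hδ (by linarith)
    have hle : ∀ᶠ n in atTop, D n r₁ - D n r₀ ≤ (R + δ / (r₁ - r₀ + 1)) * (r₁ - r₀) := by
      filter_upwards [main _ hδ''] with n hn
      refine Convex.image_sub_le_mul_sub_of_deriv_le (convex_Icc r₀ r₁)
        (fun r _ => (hder n r).continuousAt.continuousWithinAt)
        (fun r _ => (hder n r).differentiableAt.differentiableWithinAt)
        (fun r hr' => hn r (interior_subset hr')) r₀ ⟨le_rfl, hr⟩ r₁ ⟨hr, le_rfl⟩ hr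
    have h3 := le_of_tendsto ((hDlim r₁ ⟨hr, le_rfl⟩).sub (hDlim r₀ ⟨le_rfl, hr⟩)) hle
    refine h3.trans ?_
    have : δ / (r₁ - r₀ + 1) * (r₁ - r₀) ≤ δ := by
      rw [div_mul_eq_mul_div, div_le_iff₀ (by linarith)]
      nlinarith
    linarith
  have hbd : ∀ r, IntegrableOn (fun z => w (z + (0, r)) * g z) (unitCell ×ˢ Ioo a₁ b₁) := by
    intro r
    refine integrableOn_cyl_of_bound (C := Kw * Ku)
      ((hcw.comp (continuous_id.add continuous_const)).mul hg.1).aestronglyMeasurable fun z _ => ?_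
    rw [norm_mul]
    exact mul_le_mul (hw.2.1 _) (hg.2.1 z) (norm_nonneg _) hKw
  simp_rw [sub_mul]
  rw [integral_sub (hbd r₁) (hbd r₀), ← sub_mul]
  exact hfin

/-! ### Mollification: smooth approximations of the flow, of its powers and of its increments. -/

/-- Continuity of translations in `L²` of the torus. -/
lemma tendsto_setLIntegral_translate {F : SpaceTime → Plane} (hm : Measurable F) (hp : Per F)
    {a b : ℝ} (hs : ∀ z, z.2 ∉ Ioo a b → F z = 0)
    (hi : IntegrableOn (fun z => ‖F z‖ ^ 2) (unitCell ×ˢ Ioo a b)) :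
    Tendsto (fun y => ∫⁻ z in unitCell ×ˢ univ, ENNReal.ofReal (‖F (z - y) - F z‖ ^ 2)) (𝓝 0)
      (𝓝 0) := by
  -- Restricted to a larger box, `F` is square integrable on the whole space, where translations are
  -- continuous. Translates of the unit cell by less than one stay inside the box.
  set B : Set SpaceTime := bigBox 2 ×ˢ univ with hB
  have hBm : MeasurableSet B := (measurableSet_bigBox 2).prod MeasurableSet.univ
  set f : SpaceTime → Plane := B.indicator F with hf
  have hfm : Measurable f := hm.indicator hBm
  have hfL : MemLp f 2 volume := by
    rw [hf, memLp_indicator_iff_restrict hBm, memLp_two_iff_integrable_sq_norm hm.aestronglyMeasurable]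
    have h1 : Per fun z => ‖F z‖ ^ 2 := fun k z => by simp only [hp k z]
    exact integrableOn_bigBox h1
      (integrableOn_univ_of_cyl (fun z hz => by rw [hs z hz]; simp) hi) 2
  have hpres : ∀ y : SpaceTime, MeasurePreserving (fun z => z - y) volume volume := fun y =>
    measurePreserving_sub_right volume y
  have hfy : ∀ y, MemLp (fun z => f (z - y)) 2 volume := fun y =>
    hfL.comp_measurePreserving (hpres y)
  set g : C(SpaceTime, C(SpaceTime, SpaceTime)) :=
    (ContinuousMap.mk (fun p : SpaceTime × SpaceTime => p.2 - p.1)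
      (continuous_snd.sub continuous_fst)).curry with hg
  have h1 : Tendsto (fun y => (hfy y).toLp (fun z => f (z - y))) (𝓝 0)
      (𝓝 ((hfy 0).toLp (fun z => f (z - 0)))) := by
    have := Filter.Tendsto.compMeasurePreservingLp (μ := volume) (ν := volume) (p := 2)
      (f := fun _ : SpaceTime => hfL.toLp f) (f₀ := hfL.toLp f) (g := fun y => g y) (g₀ := g 0)
      (l := 𝓝 0) tendsto_const_nhds (g.continuous.tendsto 0) (fun y => hpres y) (hpres 0) (by simp)
    exact this
  rw [Lp.tendsto_Lp_iff_tendsto_eLpNorm''] at h1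
  have h2 : Tendsto (fun y => eLpNorm ((fun z => f (z - y)) - fun z => f (z - 0)) 2 volume ^ (2 : ℝ))
      (𝓝 0) (𝓝 0) := by
    have := (ENNReal.continuous_rpow_const (y := 2)).tendsto 0 |>.comp h1
    rwa [ENNReal.zero_rpow_of_pos (by norm_num)] at this
  refine tendsto_of_tendsto_of_tendsto_of_le_of_le' tendsto_const_nhds h2
    (Eventually.of_forall fun _ => zero_le) ?_
  have hball : ∀ᶠ y : SpaceTime in 𝓝 0, ‖y‖ < 1 := by
    have := Metric.ball_mem_nhds (0 : SpaceTime) one_pos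
    filter_upwards [this] with y hy
    simpa using hy
  filter_upwards [hball] with y hy
  have h3 := eLpNorm_nnreal_pow_eq_lintegral (μ := volume) (p := 2) (by norm_num)
    (f := (fun z => f (z - y)) - fun z => f (z - 0))
  norm_num at h3
  have h4 : eLpNorm ((fun z => f (z - y)) - fun z => f (z - 0)) 2 volume ^ (2 : ℝ) =
      ∫⁻ z, ‖f (z - y) - f z‖ₑ ^ 2 := by
    rw [← h3]
    norm_num
  rw [h4]
  refine le_trans ?_ (setLIntegral_le_lintegral (unitCell ×ˢ univ) _)
  refine setLIntegral_mono' (measurableSet_unitCell.prod MeasurableSet.univ) fun z hz => ?_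
  have hy1 : ‖y.1‖ ≤ 1 := (norm_fst_le y).trans hy.le
  have m1 : z ∈ B := ⟨unitCell_subset_bigBox (by norm_num) hz.1, mem_univ _⟩
  have m2 : z - y ∈ B := by
    refine ⟨fun i => ?_, mem_univ _⟩
    have h6 : |y.1 i| ≤ ‖y.1‖ := by simpa using PiLp.norm_apply_le y.1 i
    have h7 : (z - y).1 i = z.1 i - y.1 i := by simp
    have h8 := abs_le.1 (h6.trans hy1)
    have h9 := hz.1 i
    rw [h7]
    norm_num
    exact ⟨by linarith [h9.1], by linarith [h9.2]⟩
  rw [hf, indicator_of_mem m1, indicator_of_mem m2, ← ofReal_norm, ENNReal.ofReal_pow (norm_nonneg _)]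

lemma setIntegral_sq_norm_eq_toReal {F : SpaceTime → Plane} (hm : Measurable F) (S : Set SpaceTime) :
    ∫ z in S, ‖F z‖ ^ 2 = (∫⁻ z in S, ENNReal.ofReal (‖F z‖ ^ 2)).toReal :=
  integral_eq_lintegral_of_nonneg_ae (ae_of_all _ fun _ => sq_nonneg _)
    (hm.norm.pow_const 2).aestronglyMeasurable

lemma abs_avg_le {k f : SpaceTime → ℝ} {K : ℝ} (hk : Integrable k) (hk0 : ∀ z, 0 ≤ k z)
    (h1 : ∫ z, k z = 1) {x : SpaceTime} (hf : ∀ y, |f (x - y)| ≤ K) : |avg k f x| ≤ K := by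
  unfold avg
  calc _ ≤ ∫ y, k y * K := by
        refine (abs_integral_le_integral_abs).trans ?_
        refine integral_mono_of_nonneg (ae_of_all _ fun y => abs_nonneg _) (hk.mul_const K)
          (ae_of_all _ fun y => ?_)
        simp only [abs_mul, abs_of_nonneg (hk0 y)]
        exact mul_le_mul_of_nonneg_left (hf y) (hk0 y)
    _ = K := by rw [integral_mul_const, h1, one_mul]

/-- The mollification of `w` at scale `2⁻ⁿ⁻¹`. -/
def moll (w : SpaceTime → ℝ) (n : ℕ) : SpaceTime → ℝ := avg (kernS (scale n)) w

lemma integrable_kernS {r : ℝ} (hr : 0 < r) : Integrable (kernS r) :=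
  (contDiff_kernS r).continuous.integrable_of_hasCompactSupport (hasCompactSupport_kernS hr)

lemma contDiff_moll {w : SpaceTime → ℝ} (hw : Continuous w) (n : ℕ) :
    ContDiff ℝ (⊤ : ℕ∞) (moll w n) := by
  rw [moll, avg_eq_convolution]
  exact (hasCompactSupport_kernS (scale_pos n)).contDiff_convolution_left _
    (contDiff_kernS _) hw.locallyIntegrable

lemma per_moll {w : SpaceTime → ℝ} (hw : Per w) (n : ℕ) : Per (moll w n) := fun k z => by
  unfold moll avg
  refine integral_congr_ae (ae_of_all _ fun y => ?_)
  simp only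
  rw [add_sub_right_comm, hw]

lemma parabolicSize_le_of_kernS {n : ℕ} {y : SpaceTime} (h : kernS (scale n) y ≠ 0) :
    ‖y.1‖ ≤ scale n ∧ |y.2| ≤ scale n ^ 2 := by
  by_contra hcon
  rw [not_and_or, not_le, not_le] at hcon
  exact h (kernS_eq_zero (scale_pos n) hcon)

lemma HolderBdd.moll {γ K : ℝ} {w : SpaceTime → ℝ} (hw : HolderBdd γ K w) (n : ℕ) :
    HolderBdd γ K (moll w n) := by
  have hk := integrable_kernS (scale_pos n)
  have hk1 := integral_kernS (scale_pos n)
  have hi : ∀ z, Integrable fun y => kernS (scale n) y * w (z - y) := fun z =>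
    ((contDiff_kernS _).continuous.mul (hw.1.comp (continuous_const.sub
      continuous_id))).integrable_of_hasCompactSupport (hasCompactSupport_kernS (scale_pos n)).mul_right
  refine ⟨(contDiff_moll hw.1 n).continuous, fun z => abs_avg_le hk (kernS_nonneg _) hk1
    fun y => hw.2.1 _, fun z z' => ?_⟩
  have e : _root_.moll w n z - _root_.moll w n z' =
      avg (kernS (scale n)) (fun y => w y - w (y - (z - z'))) z := by
    unfold _root_.moll avg
    rw [← integral_sub (hi z) (hi z')]
    refine integral_congr_ae (ae_of_all _ fun y => ?_)
    simp only
    rw [show z - y - (z - z') = z' - y by abel]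
    ring
  rw [e]
  refine abs_avg_le hk (kernS_nonneg _) hk1 fun y => ?_
  have := hw.2.2 (z - y) (z - y - (z - z'))
  rwa [sub_sub_cancel] at this

lemma HolderBdd.abs_moll_sub_le {γ K : ℝ} (hγ : 0 < γ) {w : SpaceTime → ℝ} (hw : HolderBdd γ K w)
    (n : ℕ) (z : SpaceTime) : |_root_.moll w n z - w z| ≤ K * (2 * scale n) ^ γ := by
  have hk := integrable_kernS (scale_pos n)
  unfold _root_.moll
  rw [avg_sub_self (contDiff_kernS _).continuous (hasCompactSupport_kernS (scale_pos n))
    (integral_kernS (scale_pos n)) hw.1]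
  calc _ ≤ ∫ y, kernS (scale n) y * (K * (2 * scale n) ^ γ) := by
        refine (abs_integral_le_integral_abs).trans ?_
        refine integral_mono_of_nonneg (ae_of_all _ fun y => abs_nonneg _) (hk.mul_const _)
          (ae_of_all _ fun y => ?_)
        simp only [abs_mul, abs_of_nonneg (kernS_nonneg _ y)]
        by_cases hy : kernS (scale n) y = 0
        · rw [hy]; simp
        refine mul_le_mul_of_nonneg_left ?_ (kernS_nonneg _ y)
        have h1 := hw.2.2 (z - y) z
        obtain ⟨h2, h3⟩ := parabolicSize_le_of_kernS hy
        have h4 : parabolicSize (z - y - z) ≤ 2 * scale n := by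
          rw [show z - y - z = -y by abel]
          exact parabolicSize_le (scale_pos n).le (by simpa using h2) (by simpa using h3)
        refine h1.trans (mul_le_mul_of_nonneg_left ?_ hw.nonneg)
        exact Real.rpow_le_rpow (parabolicSize_nonneg _) h4 hγ.le
    _ = _ := by rw [integral_mul_const, integral_kernS (scale_pos n), one_mul]

/-- At times further than `scale n ^ 2` from `0` and `T` the reflected kernel centred at `z` is an
admissible test function, so the derivative passes from the kernel to the weak gradient. -/
lemma WeakFlow.inner_sgrad_moll {α γ lam Lam T Q : ℝ} {w : SpaceTime → ℝ}
    {G H : SpaceTime → Plane} (h : WeakFlow α γ lam Lam T Q w G H) (hγ : 0 < γ) {n : ℕ}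
    {z : SpaceTime} (h0 : scale n ^ 2 < z.2) (hT : z.2 + scale n ^ 2 < T) (v : Plane) :
    inner ℝ (sgrad (moll w n) z) v = ∫ y, kernS (scale n) y * inner ℝ (G (z - y)) v := by
  set k := kernS (scale n) with hk
  have hks : ContDiff ℝ (⊤ : ℕ∞) k := contDiff_kernS _
  have hkc : HasCompactSupport k := hasCompactSupport_kernS (scale_pos n)
  have hcw := h.continuous_w hγ
  have hder := hkc.hasFDerivAt_convolution_left (μ := volume) (𝕜 := ℝ) (ContinuousLinearMap.mul ℝ ℝ)
    (hks.of_le (by exact_mod_cast le_top)) hcw.locallyIntegrable z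
  have hkd : Continuous (fderiv ℝ k) := hks.continuous_fderiv (by simp)
  set φf : SpaceTime → ℝ := fun y => k (z - y) with hφf
  have hφs : ContDiff ℝ (⊤ : ℕ∞) φf := hks.comp (contDiff_const.sub contDiff_id)
  have hφ0 : ∀ y, φf y ≠ 0 → ‖y.1 - z.1‖ ≤ scale n ∧ |y.2 - z.2| ≤ scale n ^ 2 := fun y hy => by
    have := parabolicSize_le_of_kernS hy
    rw [norm_sub_rev, abs_sub_comm]
    exact this
  have hKc : IsCompact (Metric.closedBall z.1 (scale n) ×ˢ
      Icc (z.2 - scale n ^ 2) (z.2 + scale n ^ 2)) := (isCompact_closedBall _ _).prod isCompact_Icc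
  have hφK : ∀ y, φf y ≠ 0 → y ∈ Metric.closedBall z.1 (scale n) ×ˢ
      Icc (z.2 - scale n ^ 2) (z.2 + scale n ^ 2) := fun y hy => by
    obtain ⟨h1, h2⟩ := hφ0 y hy
    rw [abs_le] at h2
    exact ⟨by rw [mem_closedBall_iff_norm]; exact h1, by linarith [h2.1], by linarith [h2.2]⟩
  have hφc : HasCompactSupport φf := HasCompactSupport.intro hKc fun y hy =>
    by_contra fun hne => hy (hφK y hne)
  have hts : tsupport φf ⊆ openSlab T := by
    refine (closure_minimal (fun y hy => hφK y hy) hKc.isClosed).trans fun y hy => ?_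
    exact ⟨by linarith [hy.2.1], by linarith [hy.2.2]⟩
  have hgrad := h.grad (TestFn.of φf hφs hφc) (by rw [TestFn.coe_of]; exact hts) v
  rw [TestFn.coe_of] at hgrad
  have e1 : ∀ y, fderiv ℝ φf y (v, 0) = -(fderiv ℝ k (z - y) (v, 0)) := fun y => by
    have h1 : HasFDerivAt k (fderiv ℝ k (z - y)) (z - y) :=
      (hks.differentiable (by simp) _).hasFDerivAt
    have h2 : HasFDerivAt φf _ y := h1.comp y ((hasFDerivAt_id y).const_sub z)
    rw [h2.fderiv]
    simp
  have e2 : inner ℝ (sgrad (moll w n) z) v = ∫ t, fderiv ℝ k t (v, 0) * w (z - t) := by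
    rw [inner_sgrad, moll, avg_eq_convolution, hder.fderiv]
    have hi : Integrable fun t => (fderiv ℝ k t (v, 0) * w (z - t)) := by
      refine Continuous.integrable_of_hasCompactSupport ?_ ?_
      · exact (hkd.clm_apply continuous_const).mul
          (hcw.comp (continuous_const.sub continuous_id))
      · exact HasCompactSupport.mul_right (hkc.fderiv_apply (𝕜 := ℝ) (v, 0))
    rw [convolution_def, ContinuousLinearMap.integral_apply]
    · rfl
    · exact ((hkc.fderiv ℝ).convolutionExists_left _ hkd hcw.locallyIntegrable z)
  have e3 := integral_sub_left_eq_self (μ := volume) (fun t => fderiv ℝ k t (v, 0) * w (z - t)) z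
  have e4 := integral_sub_left_eq_self (μ := volume) (fun y => k y * inner ℝ (G (z - y)) v) z
  rw [e2, ← e3, ← e4]
  simp only [sub_sub_cancel]
  have e5 : ∫ y, fderiv ℝ k (z - y) (v, 0) * w y = - ∫ y, w y * fderiv ℝ φf y (v, 0) := by
    rw [← integral_neg]
    refine integral_congr_ae (ae_of_all _ fun y => ?_)
    simp only [e1]
    ring
  rw [e5, hgrad, neg_neg]
  refine integral_congr_ae (ae_of_all _ fun y => ?_)
  simp only [hφf]
  ring

/-- A vector field cut off sharply to the times in `(a, b)`. -/
def timeCutVec (a b : ℝ) (G : SpaceTime → Plane) : SpaceTime → Plane :=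
  {z : SpaceTime | z.2 ∈ Ioo a b}.indicator G

lemma timeCutVec_of_mem {a b : ℝ} {G : SpaceTime → Plane} {z : SpaceTime} (h : z.2 ∈ Ioo a b) :
    timeCutVec a b G z = G z := indicator_of_mem (s := {z : SpaceTime | z.2 ∈ Ioo a b}) h _

lemma timeCutVec_of_notMem {a b : ℝ} {G : SpaceTime → Plane} {z : SpaceTime}
    (h : z.2 ∉ Ioo a b) : timeCutVec a b G z = 0 :=
  indicator_of_notMem (s := {z : SpaceTime | z.2 ∈ Ioo a b}) h _

lemma measurable_timeCutVec {a b : ℝ} {G : SpaceTime → Plane} (h : Measurable G) :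
    Measurable (timeCutVec a b G) :=
  h.indicator (measurable_snd measurableSet_Ioo)

lemma per_timeCutVec {a b : ℝ} {G : SpaceTime → Plane} (h : Per G) : Per (timeCutVec a b G) := by
  intro k z
  by_cases hz : z.2 ∈ Ioo a b
  · rw [timeCutVec_of_mem hz, timeCutVec_of_mem (by simpa using hz), h]
  · rw [timeCutVec_of_notMem hz, timeCutVec_of_notMem (by simpa using hz)]

lemma sqInt_timeCutVec {a b : ℝ} {G : SpaceTime → Plane}
    (h : IntegrableOn (fun z => ‖G z‖ ^ 2) (unitCell ×ˢ Ioo a b)) :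
    IntegrableOn (fun z => ‖timeCutVec a b G z‖ ^ 2) (unitCell ×ˢ Ioo a b) :=
  IntegrableOn.congr_fun h (fun z hz => by simp only [timeCutVec_of_mem hz.2])
    (measurableSet_cyl a b)

/-- Jensen's inequality for the probability density `k`, when the average `p` is known only through
its inner products. The identity is paired with `p - F z` itself and half of `‖p - F z‖²` is
absorbed. In `ℝ≥0∞` the case of an infinite right side is trivial, which supplies the integrability
otherwise needed. -/
lemma ofReal_sq_norm_sub_le_lintegral {k : SpaceTime → ℝ} (hk : Integrable k) (hk0 : ∀ y, 0 ≤ k y)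
    (h1 : ∫ y, k y = 1) {F : SpaceTime → Plane} (hF : Measurable F) {p : Plane} {z : SpaceTime}
    (hp : ∀ v, inner ℝ p v = ∫ y, k y * inner ℝ (F (z - y)) v) :
    ENNReal.ofReal (‖p - F z‖ ^ 2) ≤
      ∫⁻ y, ENNReal.ofReal (k y) * ENNReal.ofReal (‖F (z - y) - F z‖ ^ 2) := by
  set m : SpaceTime → ℝ := fun y => k y * ‖F (z - y) - F z‖ ^ 2 with hm
  have e1 : ∫⁻ y, ENNReal.ofReal (k y) * ENNReal.ofReal (‖F (z - y) - F z‖ ^ 2) =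
      ∫⁻ y, ENNReal.ofReal (m y) := by
    simp_rw [hm, ENNReal.ofReal_mul (hk0 _)]
  have hm0 : ∀ y, 0 ≤ m y := fun y => mul_nonneg (hk0 y) (sq_nonneg _)
  have hFm : Measurable fun y => F (z - y) := hF.comp (measurable_const.sub measurable_id)
  have hmm : AEStronglyMeasurable m volume :=
    hk.aestronglyMeasurable.mul (((hFm.sub_const _).norm.pow_const 2).aestronglyMeasurable)
  rw [e1]
  by_cases htop : ∫⁻ y, ENNReal.ofReal (m y) = ∞
  · rw [htop]; exact le_top
  have hmi : Integrable m :=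
    ⟨hmm, (hasFiniteIntegral_iff_ofReal (ae_of_all _ hm0)).2 (lt_top_iff_ne_top.2 htop)⟩
  rw [← ofReal_integral_eq_lintegral_ofReal hmi (ae_of_all _ hm0)]
  refine ENNReal.ofReal_le_ofReal ?_
  set X := p - F z with hX
  have i1 : Integrable fun y => k y * inner ℝ (F (z - y) - F z) X := by
    refine Integrable.mono' ((hmi.add (hk.mul_const (‖X‖ ^ 2)))) ?_ (ae_of_all _ fun y => ?_)
    · exact hk.aestronglyMeasurable.mul ((hFm.sub_const _).inner measurable_const).aestronglyMeasurable
    · rw [norm_mul, Real.norm_eq_abs, Real.norm_eq_abs, abs_of_nonneg (hk0 y)]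
      simp only [hm, Pi.add_apply]
      rw [← mul_add]
      refine mul_le_mul_of_nonneg_left ((abs_real_inner_le_norm _ _).trans ?_) (hk0 y)
      nlinarith [sq_nonneg (‖F (z - y) - F z‖ - ‖X‖), sq_nonneg ‖F (z - y) - F z‖, sq_nonneg ‖X‖]
  have e2 : ‖X‖ ^ 2 = ∫ y, k y * inner ℝ (F (z - y) - F z) X := by
    have i2 : Integrable fun y => k y * inner ℝ (F z) X := hk.mul_const _
    have e3 : ∀ y, k y * inner ℝ (F (z - y)) X =
        k y * inner ℝ (F (z - y) - F z) X + k y * inner ℝ (F z) X := fun y => by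
      rw [inner_sub_left]; ring
    have e4 := hp X
    simp_rw [e3] at e4
    rw [integral_add i1 i2, integral_mul_const, h1, one_mul] at e4
    rw [← real_inner_self_eq_norm_sq]
    nth_rw 1 [hX]
    rw [inner_sub_left, e4]
    ring
  have i3 : Integrable fun y => (1 / 2) * m y + k y * ((1 / 2) * ‖X‖ ^ 2) :=
    (hmi.const_mul _).add (hk.mul_const _)
  have h3 : ‖X‖ ^ 2 ≤ ∫ y, ((1 / 2) * m y + k y * ((1 / 2) * ‖X‖ ^ 2)) := by
    nth_rw 1 [e2]
    refine integral_mono i1 i3 fun y => ?_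
    simp only [hm]
    have h4 := real_inner_le_norm (F (z - y) - F z) X
    nlinarith [hk0 y, mul_le_mul_of_nonneg_left h4 (hk0 y),
      mul_nonneg (hk0 y) (sq_nonneg (‖F (z - y) - F z‖ - ‖X‖))]
  rw [integral_add (hmi.const_mul _) (hk.mul_const _), integral_const_mul, integral_mul_const, h1]
    at h3
  linarith

/-- Hölder continuity gives the uniform convergence. For the gradients, Jensen bounds the squared
error by an average over the kernel of squared translation errors of `G`, and these vanish by
`tendsto_setLIntegral_translate`. -/
lemma WeakFlow.smoothApprox {α γ lam Lam T Q : ℝ} {w : SpaceTime → ℝ} {G H : SpaceTime → Plane}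
    (h : WeakFlow α γ lam Lam T Q w G H) (hγ : 0 < γ) {a b : ℝ} (ha : 0 < a) (hb : b < T) :
    SmoothApprox γ a b w (timeCutVec a b G) (moll w) := by
  obtain ⟨K, hK, hw⟩ := h.exists_holderBdd hγ
  refine ⟨contDiff_moll hw.1, per_moll h.per_w, ⟨K, hK, hw, hw.moll⟩,
    ⟨fun n => K * (2 * scale n) ^ γ, ?_, fun n z => hw.abs_moll_sub_le hγ n z⟩,
    measurable_timeCutVec h.meas_G, fun z hz => timeCutVec_of_notMem hz,
    sqInt_timeCutVec (h.sqInt a b ha hb), ?_⟩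
  · have h1 : Tendsto (fun n => 2 * scale n) atTop (𝓝 (2 * 0)) := tendsto_scale.const_mul 2
    rw [mul_zero] at h1
    have h2 := (Real.continuousAt_rpow_const 0 γ (Or.inr hγ.le)).tendsto.comp h1
    rw [Real.zero_rpow hγ.ne'] at h2
    simpa using h2.const_mul K
  -- The gradient is cut off to a larger window, so that at small scales the averaging at times in
  -- `(a, b)` sees only true values of `G`.
  · set a' := a / 2 with ha'
    set b' := (b + T) / 2 with hb'
    have ha'0 : 0 < a' := by positivity
    have hb'T : b' < T := by rw [hb']; linarith
    set F := timeCutVec a' b' G with hF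
    have hFm : Measurable F := measurable_timeCutVec h.meas_G
    have hTC := tendsto_setLIntegral_translate hFm (per_timeCutVec h.per_G)
      (fun z hz => timeCutVec_of_notMem hz) (sqInt_timeCutVec (h.sqInt a' b' ha'0 hb'T))
    have hmeas : ∀ n, Measurable fun z => sgrad (moll w n) z - timeCutVec a b G z := fun n =>
      (continuous_sgrad (contDiff_moll hw.1 n)).measurable.sub (measurable_timeCutVec h.meas_G)
    simp_rw [fun n => setIntegral_sq_norm_eq_toReal (hmeas n) (unitCell ×ˢ Ioo a b)]
    rw [← ENNReal.toReal_zero]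
    refine (ENNReal.tendsto_toReal ENNReal.zero_ne_top).comp ?_
    rw [ENNReal.tendsto_nhds_zero]
    intro δ hδ
    have h1 := (ENNReal.tendsto_nhds_zero.1 hTC) δ hδ
    obtain ⟨ρ, hρ, hball⟩ := Metric.eventually_nhds_iff.1 h1
    have hs2 : Tendsto (fun n => scale n ^ 2) atTop (𝓝 0) := by
      simpa using tendsto_scale.pow 2
    filter_upwards [tendsto_scale.eventually_lt_const hρ, hs2.eventually_lt_const hρ,
      hs2.eventually_lt_const ha'0, hs2.eventually_lt_const (sub_pos.2 hb'T)] with n n1 n2 n3 n4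
    set k := kernS (scale n) with hk
    have hki : Integrable k := integrable_kernS (scale_pos n)
    have hpt : ∀ z ∈ unitCell ×ˢ Ioo a b,
        ENNReal.ofReal (‖sgrad (moll w n) z - timeCutVec a b G z‖ ^ 2) ≤
        ∫⁻ y, ENNReal.ofReal (k y) * ENNReal.ofReal (‖F (z - y) - F z‖ ^ 2) := by
      intro z hz
      have hz2 := hz.2
      have e1 : timeCutVec a b G z = F z := by
        rw [timeCutVec_of_mem hz.2, hF, timeCutVec_of_mem
          ⟨by linarith [hz2.1], by linarith [hz2.2]⟩]
      rw [e1]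
      refine ofReal_sq_norm_sub_le_lintegral hki (kernS_nonneg _) (integral_kernS (scale_pos n))
        hFm fun v => ?_
      rw [h.inner_sgrad_moll hγ (by linarith [hz2.1]) (by linarith [hz2.2])]
      refine integral_congr_ae (ae_of_all _ fun y => ?_)
      simp only
      by_cases hy : kernS (scale n) y = 0
      · rw [hk, hy]; simp
      · have h3 := abs_le.1 (parabolicSize_le_of_kernS hy).2
        have : (z - y).2 ∈ Ioo a' b' := by
          rw [Prod.snd_sub]
          exact ⟨by linarith [hz2.1], by linarith [hz2.2]⟩
        rw [hF, timeCutVec_of_mem this]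
    have hmeas2 : Measurable (Function.uncurry fun (z y : SpaceTime) =>
        ENNReal.ofReal (k y) * ENNReal.ofReal (‖F (z - y) - F z‖ ^ 2)) := by
      have hkm : Measurable k := (contDiff_kernS _).continuous.measurable
      exact ((hkm.comp measurable_snd).ennreal_ofReal).mul
        ((((hFm.comp (measurable_fst.sub measurable_snd)).sub
          (hFm.comp measurable_fst)).norm.pow_const 2).ennreal_ofReal)
    calc _ ≤ ∫⁻ z in unitCell ×ˢ Ioo a b,
          ∫⁻ y, ENNReal.ofReal (k y) * ENNReal.ofReal (‖F (z - y) - F z‖ ^ 2) :=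
          setLIntegral_mono' (measurableSet_cyl a b) hpt
      _ ≤ ∫⁻ z in unitCell ×ˢ univ,
          ∫⁻ y, ENNReal.ofReal (k y) * ENNReal.ofReal (‖F (z - y) - F z‖ ^ 2) :=
          lintegral_mono_set (prod_mono_right (subset_univ _))
      _ = ∫⁻ y, ∫⁻ z in unitCell ×ˢ univ,
          ENNReal.ofReal (k y) * ENNReal.ofReal (‖F (z - y) - F z‖ ^ 2) :=
          lintegral_lintegral_swap hmeas2.aemeasurable
      _ = ∫⁻ y, ENNReal.ofReal (k y) * ∫⁻ z in unitCell ×ˢ univ,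
          ENNReal.ofReal (‖F (z - y) - F z‖ ^ 2) := by
          refine lintegral_congr fun y => ?_
          rw [lintegral_const_mul']
          exact ENNReal.ofReal_ne_top
      _ ≤ ∫⁻ y, ENNReal.ofReal (k y) * δ := by
          refine lintegral_mono fun y => ?_
          by_cases hy : kernS (scale n) y = 0
          · rw [hk, hy]; simp
          · refine mul_le_mul_right (hball ?_) _
            obtain ⟨h3, h4⟩ := parabolicSize_le_of_kernS hy
            rw [dist_zero_right, Prod.norm_def]
            exact max_lt (lt_of_le_of_lt h3 n1) (lt_of_le_of_lt h4 n2)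
      _ = δ := by
          rw [lintegral_mul_const _ (contDiff_kernS (scale n)).continuous.measurable.ennreal_ofReal,
            ← ofReal_integral_eq_lintegral_ofReal hki (ae_of_all _ (kernS_nonneg _)),
            integral_kernS (scale_pos n), ENNReal.ofReal_one, one_mul]

lemma exists_pow_lipschitz {K : ℝ} (hK : 0 ≤ K) (m : ℕ) : ∃ C, 0 ≤ C ∧
    ∀ x y : ℝ, |x| ≤ K → |y| ≤ K → |x ^ m - y ^ m| ≤ C * |x - y| := by
  induction m with
  | zero => exact ⟨0, le_rfl, fun x y _ _ => by simp⟩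
  | succ m ih =>
    obtain ⟨C, hC, h⟩ := ih
    refine ⟨C * K + K ^ m, by positivity, fun x y hx hy => ?_⟩
    rw [show x ^ (m + 1) - y ^ (m + 1) = (x ^ m - y ^ m) * x + y ^ m * (x - y) by ring, add_mul]
    refine (abs_add_le _ _).trans ?_
    rw [abs_mul, abs_mul, abs_pow]
    refine add_le_add ?_ (mul_le_mul_of_nonneg_right (pow_le_pow_left₀ (abs_nonneg _) hy m)
      (abs_nonneg _))
    calc _ ≤ (C * |x - y|) * K := by
          gcongr
          exact h x y hx hy
      _ = _ := by ring

lemma sgrad_pow {u : SpaceTime → ℝ} (hu : ContDiff ℝ (⊤ : ℕ∞) u) (m : ℕ) (z : SpaceTime) :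
    sgrad (fun z => u z ^ m) z = (m * u z ^ (m - 1)) • sgrad u z := by
  refine ext_inner_right ℝ fun v => ?_
  rw [inner_smul_left, inner_sgrad, inner_sgrad]
  have h1 : HasFDerivAt u (fderiv ℝ u z) z := (hu.differentiable (by simp) z).hasFDerivAt
  have h2 : HasFDerivAt (fun z => u z ^ m) _ z := (hasDerivAt_pow m (u z)).comp_hasFDerivAt z h1
  rw [h2.fderiv]
  simp

lemma sgrad_sub {u v : SpaceTime → ℝ} (hu : ContDiff ℝ (⊤ : ℕ∞) u) (hv : ContDiff ℝ (⊤ : ℕ∞) v)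
    (z : SpaceTime) : sgrad (fun z => u z - v z) z = sgrad u z - sgrad v z := by
  refine ext_inner_right ℝ fun x => ?_
  rw [inner_sub_left, inner_sgrad, inner_sgrad, inner_sgrad]
  have h1 : HasFDerivAt u (fderiv ℝ u z) z := (hu.differentiable (by simp) z).hasFDerivAt
  have h2 : HasFDerivAt v (fderiv ℝ v z) z := (hv.differentiable (by simp) z).hasFDerivAt
  have h3 : HasFDerivAt (fun z => u z - v z) _ z := h1.sub h2
  rw [h3.fderiv]
  simp

lemma sq_norm_add_le {E : Type*} [NormedAddCommGroup E] (x y : E) :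
    ‖x + y‖ ^ 2 ≤ 2 * ‖x‖ ^ 2 + 2 * ‖y‖ ^ 2 := by
  have h := norm_add_le x y
  nlinarith [sq_nonneg (‖x‖ - ‖y‖), norm_nonneg (x + y)]

lemma sq_norm_sub_le {E : Type*} [NormedAddCommGroup E] (x y : E) :
    ‖x - y‖ ^ 2 ≤ 2 * ‖x‖ ^ 2 + 2 * ‖y‖ ^ 2 := by
  have h := sq_norm_add_le x (-y)
  rwa [norm_neg, ← sub_eq_add_neg] at h

lemma integrableOn_sq_sgrad_sub {a b : ℝ} {u : SpaceTime → ℝ} {Γ : SpaceTime → Plane}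
    (hu : ContDiff ℝ (⊤ : ℕ∞) u) (hp : Per u) (hm : Measurable Γ)
    (hi : IntegrableOn (fun z => ‖Γ z‖ ^ 2) (unitCell ×ˢ Ioo a b)) :
    IntegrableOn (fun z => ‖sgrad u z - Γ z‖ ^ 2) (unitCell ×ˢ Ioo a b) := by
  obtain ⟨C, hC, hb⟩ := exists_bound_of_per hp.sgrad (continuous_sgrad hu)
    (isCompact_Icc (a := a) (b := b))
  have h1 : IntegrableOn (fun _ : SpaceTime => 2 * C ^ 2) (unitCell ×ˢ Ioo a b) :=
    integrableOn_const (volume_cyl_lt_top a b).ne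
  refine Integrable.mono' (h1.add (hi.const_mul 2)) ?_ ?_
  · exact (((continuous_sgrad hu).measurable.sub hm).norm.pow_const 2).aestronglyMeasurable
  · filter_upwards [ae_restrict_mem (measurableSet_cyl a b)] with z hz
    have h2 := hb z (Ioo_subset_Icc_self hz.2)
    have h3 := sq_norm_sub_le (sgrad u z) (Γ z)
    rw [Real.norm_eq_abs, abs_of_nonneg (sq_nonneg _)]
    simp only [Pi.add_apply]
    nlinarith [pow_le_pow_left₀ (norm_nonneg _) h2 2]

/-- The chain rule survives the limit: the factor from the power converges uniformly and stays
bounded, while the gradients converge in `L²`. -/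
lemma SmoothApprox.pow {γ a b : ℝ} {g : SpaceTime → ℝ} {Γ : SpaceTime → Plane}
    {u : ℕ → SpaceTime → ℝ} (h : SmoothApprox γ a b g Γ u) (m : ℕ) :
    SmoothApprox γ a b (fun z => g z ^ m) (fun z => (m * g z ^ (m - 1)) • Γ z)
      (fun n z => u n z ^ m) := by
  obtain ⟨K, hK, hg, hu⟩ := h.bdd
  obtain ⟨ε, hε, hεu⟩ := h.unif
  obtain ⟨L, hL, hpow⟩ := exists_holderBdd_pow (γ := γ) hK m
  obtain ⟨C, hC, hlip⟩ := exists_pow_lipschitz hK m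
  obtain ⟨C', hC', hlip'⟩ := exists_pow_lipschitz hK (m - 1)
  have hε0 : ∀ n, 0 ≤ ε n := fun n => (abs_nonneg _).trans (hεu n 0)
  have hbd : ∀ z, |m * g z ^ (m - 1)| ≤ m * K ^ (m - 1) := fun z => by
    rw [abs_mul, abs_pow, Nat.abs_cast]
    exact mul_le_mul_of_nonneg_left (pow_le_pow_left₀ (abs_nonneg _) (hg.2.1 z) _) (by positivity)
  have hmeas : Measurable fun z => (m * g z ^ (m - 1)) • Γ z :=
    ((hg.1.measurable.pow_const _).const_mul _).smul h.meas
  have hsq : IntegrableOn (fun z => ‖(m * g z ^ (m - 1)) • Γ z‖ ^ 2) (unitCell ×ˢ Ioo a b) := by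
    refine Integrable.mono' (h.sqInt.const_mul ((m * K ^ (m - 1)) ^ 2))
      (hmeas.norm.pow_const 2).aestronglyMeasurable (ae_of_all _ fun z => ?_)
    rw [Real.norm_eq_abs, abs_of_nonneg (sq_nonneg _), norm_smul, mul_pow, Real.norm_eq_abs]
    gcongr
    exact hbd z
  refine ⟨fun n => (h.smooth n).pow m, fun n k z => by simp only [h.per n k z],
    ⟨L, hL, hpow g hg, fun n => hpow _ (hu n)⟩, ⟨fun n => C * ε n, ?_, fun n z => ?_⟩, hmeas,
    fun z hz => by simp only [h.supp z hz, smul_zero], hsq, ?_⟩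
  · simpa using hε.const_mul C
  · exact (hlip _ _ ((hu n).2.1 z) (hg.2.1 z)).trans (mul_le_mul_of_nonneg_left (hεu n z) hC)
  · set D := ∫ z in unitCell ×ˢ Ioo a b, ‖Γ z‖ ^ 2 with hD
    have hi1 := fun n => integrableOn_sq_sgrad_sub (h.smooth n) (h.per n) h.meas h.sqInt
    have hlim : Tendsto (fun n => (2 * (m * K ^ (m - 1)) ^ 2) *
        (∫ z in unitCell ×ˢ Ioo a b, ‖sgrad (u n) z - Γ z‖ ^ 2) +
        (2 * (m * (C' * ε n)) ^ 2) * D) atTop (𝓝 0) := by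
      have h1 := h.grad.const_mul (2 * (m * K ^ (m - 1)) ^ 2)
      have h2 := ((((hε.const_mul C').const_mul (m : ℝ)).pow 2).const_mul 2).mul_const D
      simpa using h1.add h2
    refine squeeze_zero (fun n => integral_nonneg fun z => sq_nonneg _) (fun n => ?_) hlim
    rw [hD, ← integral_const_mul, ← integral_const_mul, ← integral_add ((hi1 n).const_mul _)
      (h.sqInt.const_mul _)]
    refine integral_mono_of_nonneg (ae_of_all _ fun z => sq_nonneg _)
      (((hi1 n).const_mul _).add (h.sqInt.const_mul _)) (ae_of_all _ fun z => ?_)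
    simp only
    rw [sgrad_pow (h.smooth n)]
    have e : (m * u n z ^ (m - 1)) • sgrad (u n) z - (m * g z ^ (m - 1)) • Γ z =
        (m * u n z ^ (m - 1)) • (sgrad (u n) z - Γ z) +
          (m * (u n z ^ (m - 1) - g z ^ (m - 1))) • Γ z := by
      rw [smul_sub, mul_sub, sub_smul]; abel
    rw [e]
    refine (sq_norm_add_le _ _).trans ?_
    rw [norm_smul, norm_smul, mul_pow, mul_pow, ← mul_assoc, ← mul_assoc, Real.norm_eq_abs,
      Real.norm_eq_abs, abs_mul, abs_mul, Nat.abs_cast, abs_pow]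
    gcongr
    · exact (hu n).2.1 z
    · exact (hlip' _ _ ((hu n).2.1 z) (hg.2.1 z)).trans (mul_le_mul_of_nonneg_left (hεu n z) hC')

lemma setIntegral_timeShift_le {F : SpaceTime → ℝ} {a b a₀ b₀ h : ℝ} (hF0 : ∀ z, 0 ≤ F z)
    (hF : IntegrableOn F (unitCell ×ˢ Ioo a₀ b₀)) (ha : a₀ ≤ a - h) (hb : b - h ≤ b₀) :
    IntegrableOn (fun z => F (z - (0, h))) (unitCell ×ˢ Ioo a b) ∧
    ∫ z in unitCell ×ˢ Ioo a b, F (z - (0, h)) ≤ ∫ z in unitCell ×ˢ Ioo a₀ b₀, F z := by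
  set A : Set SpaceTime := {z | z.2 ∈ Ioo a₀ b₀} with hA
  set F' := A.indicator F with hF'
  have hz : ∀ z, z.2 ∉ Ioo a₀ b₀ → F' z = 0 := fun z hz => indicator_of_notMem (s := A) hz _
  have hz1 : ∀ z, z.2 ∈ Ioo a₀ b₀ → F' z = F z := fun z hz => indicator_of_mem (s := A) hz _
  have hF'0 : ∀ z, 0 ≤ F' z := fun z => indicator_nonneg (fun z _ => hF0 z) z
  have hi : IntegrableOn F' (unitCell ×ˢ Ioo a₀ b₀) :=
    hF.congr_fun (fun z hz => (hz1 z hz.2).symm) (measurableSet_cyl _ _)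
  have hu := integrableOn_timeShift (integrableOn_univ_of_cyl hz hi) h
  have hsub : unitCell ×ˢ Ioo a b ⊆ unitCell ×ˢ (univ : Set ℝ) := prod_mono_right (subset_univ _)
  have he : EqOn (fun z : SpaceTime => F' (z - (0, h))) (fun z => F (z - (0, h)))
      (unitCell ×ˢ Ioo a b) := fun z hzz => by
    have h1 := hzz.2
    exact hz1 _ (show z.2 - h ∈ Ioo a₀ b₀ from ⟨by linarith [h1.1], by linarith [h1.2]⟩)
  refine ⟨(hu.mono_set hsub).congr_fun he (measurableSet_cyl _ _), ?_⟩
  rw [← setIntegral_congr_fun (measurableSet_cyl _ _) he]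
  calc _ ≤ ∫ z in unitCell ×ˢ univ, F' (z - (0, h)) :=
        setIntegral_mono_set hu (ae_of_all _ fun z => hF'0 _) hsub.eventuallyLE
    _ = ∫ z in unitCell ×ˢ univ, F' z := setIntegral_timeShift F' h
    _ = ∫ z in unitCell ×ˢ Ioo a₀ b₀, F' z := setIntegral_univ_eq_cyl hz
    _ = _ := setIntegral_congr_fun (measurableSet_cyl _ _) fun z h1 => hz1 z h1.2

/-- Makes the time increment of the flow an admissible function in `WeakFlow.test`. Both errors are
dominated by the error for `w` on the window extended to the left by `h`. -/
lemma WeakFlow.smoothApprox_increment {α γ lam Lam T Q : ℝ} {w : SpaceTime → ℝ}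
    {G H : SpaceTime → Plane} (hf : WeakFlow α γ lam Lam T Q w G H) (hγ : 0 < γ) {a b h : ℝ}
    (hh : 0 ≤ h) (ha : 0 < a - h) (hb : b < T) :
    SmoothApprox γ a b (fun z => w z - w (z - (0, h)))
      (timeCutVec a b fun z => G z - G (z - (0, h)))
      (fun n z => moll w n z - moll w n (z - (0, h))) := by
  have hA := hf.smoothApprox hγ ha hb
  obtain ⟨K, hK, hg, hu⟩ := hA.bdd
  obtain ⟨ε, hε, hεu⟩ := hA.unif
  have hshift : Continuous fun z : SpaceTime => z - (0, h) := continuous_id.sub continuous_const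
  have hGm : Measurable fun z => G z - G (z - (0, h)) :=
    hf.meas_G.sub (hf.meas_G.comp hshift.measurable)
  have hGi := hf.sqInt (a - h) b ha hb
  have hcyl : unitCell ×ˢ Ioo a b ⊆ unitCell ×ˢ Ioo (a - h) b :=
    prod_mono_right (Ioo_subset_Ioo_left (by linarith))
  have hsm : ∀ n, ContDiff ℝ (⊤ : ℕ∞) fun z => moll w n (z - (0, h)) := fun n =>
    (hA.smooth n).comp (contDiff_id.sub contDiff_const)
  have hGs := setIntegral_timeShift_le (F := fun z => ‖G z‖ ^ 2) (a := a) (b := b)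
    (fun z => sq_nonneg _) hGi le_rfl (by linarith : b - h ≤ b)
  refine ⟨fun n => (hA.smooth n).sub (hsm n), fun n k z => ?_,
    ⟨K + K, by positivity, hg.sub (hg.comp_sub _), fun n => (hu n).sub ((hu n).comp_sub _)⟩,
    ⟨fun n => ε n + ε n, by simpa using hε.add hε, fun n z => ?_⟩, measurable_timeCutVec hGm,
    fun z hz => timeCutVec_of_notMem hz, sqInt_timeCutVec ?_, ?_⟩
  · simp only [add_sub_right_comm, hA.per n k z, hA.per n k (z - (0, h))]
  · rw [show moll w n z - moll w n (z - (0, h)) - (w z - w (z - (0, h))) =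
      (moll w n z - w z) - (moll w n (z - (0, h)) - w (z - (0, h))) by ring]
    exact (abs_sub _ _).trans (add_le_add (hεu n _) (hεu n _))
  · have h1 : IntegrableOn (fun z => ‖G z‖ ^ 2) (unitCell ×ˢ Ioo a b) := hGi.mono_set hcyl
    refine Integrable.mono' ((h1.const_mul 2).add (hGs.1.const_mul 2))
      (hGm.norm.pow_const 2).aestronglyMeasurable (ae_of_all _ fun z => ?_)
    rw [Real.norm_eq_abs, abs_of_nonneg (sq_nonneg _)]
    exact sq_norm_sub_le _ _
  · set E : ℕ → SpaceTime → ℝ := fun n z => ‖sgrad (moll w n) z - timeCutVec (a - h) b G z‖ ^ 2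
      with hE
    have hEi : ∀ n, IntegrableOn (E n) (unitCell ×ˢ Ioo (a - h) b) := fun n =>
      integrableOn_sq_sgrad_sub (hA.smooth n) (hA.per n) hA.meas hA.sqInt
    have hEs := fun n => setIntegral_timeShift_le (F := E n) (a := a) (b := b)
      (fun z => sq_nonneg _) (hEi n) le_rfl (by linarith : b - h ≤ b)
    have hlim := hA.grad.const_mul 4
    rw [mul_zero] at hlim
    refine squeeze_zero (fun n => integral_nonneg fun z => sq_nonneg _) (fun n => ?_) hlim
    have hEi' : IntegrableOn (E n) (unitCell ×ˢ Ioo a b) := (hEi n).mono_set hcyl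
    calc _ ≤ ∫ z in unitCell ×ˢ Ioo a b, (2 * E n z + 2 * E n (z - (0, h))) := by
          refine integral_mono_of_nonneg (ae_of_all _ fun z => sq_nonneg _)
            ((hEi'.const_mul 2).add ((hEs n).1.const_mul 2)) ?_
          filter_upwards [ae_restrict_mem (measurableSet_cyl a b)] with z hz
          have h1 := hz.2
          simp only [hE]
          rw [timeCutVec_of_mem hz.2, timeCutVec_of_mem ⟨by linarith [h1.1], h1.2⟩,
            timeCutVec_of_mem (show z.2 - h ∈ Ioo (a - h) b from
              ⟨by linarith [h1.1], by linarith [h1.2]⟩), sgrad_sub (hA.smooth n) (hsm n),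
            sgrad_comp_sub, sub_sub_sub_comm]
          exact sq_norm_sub_le _ _
      _ = 2 * (∫ z in unitCell ×ˢ Ioo a b, E n z) +
          2 * ∫ z in unitCell ×ˢ Ioo a b, E n (z - (0, h)) := by
          rw [integral_add (hEi'.const_mul 2) ((hEs n).1.const_mul 2), integral_const_mul,
            integral_const_mul]
      _ ≤ 2 * (∫ z in unitCell ×ˢ Ioo (a - h) b, E n z) +
          2 * ∫ z in unitCell ×ˢ Ioo (a - h) b, E n z := by
          have h1 := setIntegral_mono_set (hEi n) (ae_of_all _ fun z => sq_nonneg _)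
            hcyl.eventuallyLE
          have h2 := (hEs n).2
          linarith
      _ = _ := by ring

/-! ### Spatial increments. -/

lemma sq_intervalIntegral_le {f : ℝ → ℝ} (hf : Continuous f) :
    (∫ t in (0 : ℝ)..1, f t) ^ 2 ≤ ∫ t in (0 : ℝ)..1, f t ^ 2 := by
  set c := ∫ t in (0 : ℝ)..1, f t with hc
  have h1 : 0 ≤ ∫ t in (0 : ℝ)..1, (f t - c) ^ 2 :=
    intervalIntegral.integral_nonneg zero_le_one fun t _ => sq_nonneg _
  have e : ∀ t, (f t - c) ^ 2 = f t ^ 2 - 2 * c * f t + c ^ 2 := fun t => by ring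
  have i1 : IntervalIntegrable (fun t => f t ^ 2) volume 0 1 := (hf.pow 2).intervalIntegrable _ _
  have i2 : IntervalIntegrable (fun t => 2 * c * f t) volume 0 1 :=
    (continuous_const.mul hf).intervalIntegrable _ _
  simp_rw [e] at h1
  rw [intervalIntegral.integral_add (i1.sub i2) (by simp), intervalIntegral.integral_sub i1 i2,
    intervalIntegral.integral_const_mul, intervalIntegral.integral_const, ← hc] at h1
  simp at h1
  nlinarith

/-- The fundamental theorem of calculus along the segment, then Cauchy-Schwarz. The segment may
leave the unit cell; the `16` counts the cells of a box containing all its translates. -/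
lemma setLIntegral_sq_increment_le {u : SpaceTime → ℝ} (hu : ContDiff ℝ (⊤ : ℕ∞) u) (hp : Per u)
    {y : Plane} (hy : ‖y‖ ≤ 1) (a b : ℝ) :
    ∫⁻ z in unitCell ×ˢ Ioo a b, ENNReal.ofReal ((u (z + (y, 0)) - u z) ^ 2) ≤
      ENNReal.ofReal (16 * ‖y‖ ^ 2) *
        ∫⁻ z in unitCell ×ˢ Ioo a b, ENNReal.ofReal (‖sgrad u z‖ ^ 2) := by
  have hsg := continuous_sgrad hu
  have hcy : ∀ z : SpaceTime, Continuous fun t : ℝ => z + t • ((y, 0) : SpaceTime) := fun z => by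
    fun_prop
  have hpt : ∀ z : SpaceTime, ENNReal.ofReal ((u (z + (y, 0)) - u z) ^ 2) ≤
      ENNReal.ofReal (‖y‖ ^ 2) *
        ∫⁻ t in Ioc (0 : ℝ) 1, ENNReal.ofReal (‖sgrad u (z + t • (y, 0))‖ ^ 2) := by
    intro z
    have hd : ∀ t : ℝ, HasDerivAt (fun t : ℝ => u (z + t • ((y, 0) : SpaceTime)))
        (inner ℝ (sgrad u (z + t • (y, 0))) y) t := by
      intro t
      rw [inner_sgrad]
      have h1 : HasFDerivAt u (fderiv ℝ u (z + t • (y, 0))) (z + t • ((y, 0) : SpaceTime)) :=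
        (hu.differentiable (by simp) _).hasFDerivAt
      have h2 : HasDerivAt (fun t : ℝ => z + t • ((y, 0) : SpaceTime)) (y, 0) t := by
        simpa using ((hasDerivAt_id t).smul_const ((y, 0) : SpaceTime)).const_add z
      exact h1.comp_hasDerivAt t h2
    have hcd : Continuous fun t : ℝ => inner ℝ (sgrad u (z + t • (y, 0))) y :=
      (hsg.comp (hcy z)).inner continuous_const
    have h1 := intervalIntegral.integral_eq_sub_of_hasDerivAt (a := 0) (b := 1)
      (fun t _ => hd t) (hcd.intervalIntegrable _ _)
    simp only [one_smul, zero_smul, add_zero] at h1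
    have hc2 : Continuous fun t : ℝ => ‖y‖ ^ 2 * ‖sgrad u (z + t • (y, 0))‖ ^ 2 :=
      continuous_const.mul ((hsg.comp (hcy z)).norm.pow 2)
    have h2 : (u (z + (y, 0)) - u z) ^ 2 ≤
        ∫ t in (0 : ℝ)..1, ‖y‖ ^ 2 * ‖sgrad u (z + t • (y, 0))‖ ^ 2 := by
      rw [← h1]
      refine (sq_intervalIntegral_le hcd).trans ?_
      refine intervalIntegral.integral_mono_on zero_le_one ((hcd.pow 2).intervalIntegrable _ _)
        (hc2.intervalIntegrable _ _) fun t _ => ?_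
      have := abs_real_inner_le_norm (sgrad u (z + t • (y, 0))) y
      rw [← sq_abs, ← mul_pow]
      rw [mul_comm] at this
      exact pow_le_pow_left₀ (abs_nonneg _) this 2
    refine (ENNReal.ofReal_le_ofReal h2).trans (le_of_eq ?_)
    rw [intervalIntegral.integral_of_le zero_le_one, ofReal_integral_eq_lintegral_ofReal
      ((hc2.intervalIntegrable 0 1).1) (ae_of_all _ fun t => by positivity)]
    simp_rw [ENNReal.ofReal_mul (sq_nonneg ‖y‖)]
    rw [lintegral_const_mul' _ _ ENNReal.ofReal_ne_top]
  have hm : Measurable (Function.uncurry fun (z : SpaceTime) (t : ℝ) =>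
      ENNReal.ofReal (‖sgrad u (z + t • ((y, 0) : SpaceTime))‖ ^ 2)) := by
    have : Continuous fun p : SpaceTime × ℝ => ‖sgrad u (p.1 + p.2 • ((y, 0) : SpaceTime))‖ ^ 2 :=
      (hsg.comp (by fun_prop)).norm.pow 2
    exact this.measurable.ennreal_ofReal
  have hper : Per fun z => ENNReal.ofReal (‖sgrad u z‖ ^ 2) := fun k z => by
    simp only [hp.sgrad k z]
  calc _ ≤ ∫⁻ z in unitCell ×ˢ Ioo a b, ENNReal.ofReal (‖y‖ ^ 2) *
        ∫⁻ t in Ioc (0 : ℝ) 1, ENNReal.ofReal (‖sgrad u (z + t • (y, 0))‖ ^ 2) :=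
        lintegral_mono fun z => hpt z
    _ = ENNReal.ofReal (‖y‖ ^ 2) * ∫⁻ t in Ioc (0 : ℝ) 1, ∫⁻ z in unitCell ×ˢ Ioo a b,
        ENNReal.ofReal (‖sgrad u (z + t • (y, 0))‖ ^ 2) := by
        rw [lintegral_const_mul' _ _ ENNReal.ofReal_ne_top,
          lintegral_lintegral_swap hm.aemeasurable]
    _ ≤ ENNReal.ofReal (‖y‖ ^ 2) * ∫⁻ _ in Ioc (0 : ℝ) 1,
        ((2 * (1 + 1)) ^ 2 : ℕ) * ∫⁻ z in unitCell ×ˢ Ioo a b,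
          ENNReal.ofReal (‖sgrad u z‖ ^ 2) := by
        refine mul_le_mul_right (setLIntegral_mono' measurableSet_Ioc fun t ht => ?_) _
        refine le_trans ?_ (setLIntegral_shift_le hper 1 (E := Ioo a b) (d := t • (y, 0)) ?_ ?_)
        · exact lintegral_mono_set (prod_mono_left (unitCell_subset_bigBox le_rfl))
        · rw [Prod.smul_fst, norm_smul, Real.norm_eq_abs, abs_of_pos ht.1]
          exact mul_le_one₀ ht.2 (norm_nonneg _) hy
        · intro s hs
          simpa using hs
    _ = _ := by
        rw [setLIntegral_const, Real.volume_Ioc, sub_zero, ENNReal.ofReal_one, mul_one, ← mul_assoc,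
          mul_comm (16 : ℝ), ENNReal.ofReal_mul (sq_nonneg _)]
        norm_num

/-- Spatial increments of a weak flow are controlled by its gradient. -/
lemma WeakFlow.space_increment_le {α γ lam Lam T Q : ℝ} {w : SpaceTime → ℝ}
    {G H : SpaceTime → Plane} (hf : WeakFlow α γ lam Lam T Q w G H) (hγ : 0 < γ) {a b : ℝ}
    (ha : 0 < a) (hb : b < T) {y : Plane} (hy : ‖y‖ ≤ 1) :
    ∫ z in unitCell ×ˢ Ioo a b, (w (z + (y, 0)) - w z) ^ 2 ≤
      32 * ‖y‖ ^ 2 * ∫ z in unitCell ×ˢ Ioo a b, ‖G z‖ ^ 2 := by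
  have hA := hf.smoothApprox hγ ha hb
  obtain ⟨K, hK, hg, hu⟩ := hA.bdd
  obtain ⟨ε, hε, hεu⟩ := hA.unif
  have hshift : Continuous fun z : SpaceTime => z + (y, 0) := continuous_id.add continuous_const
  have hGi := hf.sqInt a b ha hb
  set D := ∫ z in unitCell ×ˢ Ioo a b, ‖G z‖ ^ 2 with hD
  set u := moll w with hu'
  have hreal : ∀ n, ∫ z in unitCell ×ˢ Ioo a b, (u n (z + (y, 0)) - u n z) ^ 2 ≤
      16 * ‖y‖ ^ 2 * ∫ z in unitCell ×ˢ Ioo a b, ‖sgrad (u n) z‖ ^ 2 := by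
    intro n
    have hcu := (hA.smooth n).continuous
    have hi : IntegrableOn (fun z => ‖sgrad (u n) z‖ ^ 2) (unitCell ×ˢ Ioo a b) := by
      simpa using integrableOn_sq_sgrad_sub (a := a) (b := b) (Γ := fun _ => 0) (hA.smooth n)
        (hA.per n) measurable_const (by simp)
    have hi2 : IntegrableOn (fun z => (u n (z + (y, 0)) - u n z) ^ 2) (unitCell ×ˢ Ioo a b) := by
      refine integrableOn_cyl_of_bound (C := (K + K) ^ 2)
        (((hcu.comp hshift).sub hcu).pow 2).aestronglyMeasurable fun z _ => ?_
      rw [norm_pow]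
      exact pow_le_pow_left₀ (norm_nonneg _) ((norm_sub_le _ _).trans
        (add_le_add ((hu n).2.1 _) ((hu n).2.1 _))) 2
    have h1 := setLIntegral_sq_increment_le (hA.smooth n) (hA.per n) hy a b
    rw [← ofReal_integral_eq_lintegral_ofReal hi2 (ae_of_all _ fun z => sq_nonneg _),
      ← ofReal_integral_eq_lintegral_ofReal hi (ae_of_all _ fun z => sq_nonneg _),
      ← ENNReal.ofReal_mul (by positivity)] at h1
    refine (ENNReal.ofReal_le_ofReal_iff (mul_nonneg (by positivity)
      (integral_nonneg fun z => sq_nonneg _))).1 h1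
  -- Splitting off `G` with a factor `2` is what turns `16` into `32`; the other part disappears in
  -- the limit.
  have hGn : ∀ n, ∫ z in unitCell ×ˢ Ioo a b, ‖sgrad (u n) z‖ ^ 2 ≤
      2 * (∫ z in unitCell ×ˢ Ioo a b, ‖sgrad (u n) z - timeCutVec a b G z‖ ^ 2) + 2 * D := by
    intro n
    have hi1 := integrableOn_sq_sgrad_sub (hA.smooth n) (hA.per n) hA.meas hA.sqInt
    rw [hD, ← integral_const_mul, ← integral_const_mul, ← integral_add (hi1.const_mul 2)
      (hGi.const_mul 2)]
    refine integral_mono_of_nonneg (ae_of_all _ fun z => sq_nonneg _)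
      ((hi1.const_mul 2).add (hGi.const_mul 2)) ?_
    filter_upwards [ae_restrict_mem (measurableSet_cyl a b)] with z hz
    rw [timeCutVec_of_mem hz.2]
    have := sq_norm_add_le (sgrad (u n) z - G z) (G z)
    rwa [sub_add_cancel] at this
  have hlim1 : Tendsto (fun n => 16 * ‖y‖ ^ 2 *
      (2 * (∫ z in unitCell ×ˢ Ioo a b, ‖sgrad (u n) z - timeCutVec a b G z‖ ^ 2) + 2 * D)) atTop
      (𝓝 (32 * ‖y‖ ^ 2 * D)) := by
    have := ((hA.grad.const_mul 2).add_const (2 * D)).const_mul (16 * ‖y‖ ^ 2)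
    rw [mul_zero, zero_add] at this
    convert this using 2
    ring
  have hptlim : ∀ z, Tendsto (fun n => u n z) atTop (𝓝 (w z)) := fun z => by
    rw [tendsto_iff_dist_tendsto_zero]
    exact squeeze_zero (fun _ => dist_nonneg) (fun n => (Real.dist_eq _ _).le.trans (hεu n z)) hε
  have hlim2 : Tendsto (fun n => ∫ z in unitCell ×ˢ Ioo a b, (u n (z + (y, 0)) - u n z) ^ 2) atTop
      (𝓝 (∫ z in unitCell ×ˢ Ioo a b, (w (z + (y, 0)) - w z) ^ 2)) := by
    refine tendsto_integral_of_dominated_convergence (fun _ => (K + K) ^ 2) (fun n => ?_)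
      (integrableOn_const (volume_cyl_lt_top a b).ne) (fun n => ae_of_all _ fun z => ?_)
      (ae_of_all _ fun z => ((hptlim _).sub (hptlim z)).pow 2)
    · exact ((((hA.smooth n).continuous.comp hshift).sub
        (hA.smooth n).continuous).pow 2).aestronglyMeasurable
    · rw [norm_pow]
      exact pow_le_pow_left₀ (norm_nonneg _) ((norm_sub_le _ _).trans
        (add_le_add ((hu n).2.1 _) ((hu n).2.1 _))) 2
  exact le_of_tendsto_of_tendsto hlim2 hlim1 (Eventually.of_forall fun n => (hreal n).trans
    (mul_le_mul_of_nonneg_left (hGn n) (by positivity)))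

/-! ### Young inequalities and the moduli of continuity of products. -/

/-- A three-term Young inequality. -/
lemma exists_young_three {q : ℕ} (hq : 2 ≤ q) {η : ℝ} (hη : 0 < η) : ∃ C, 0 ≤ C ∧
    ∀ V δ σ : ℝ, 0 < V → 0 ≤ δ → δ ≤ V → 0 < σ →
      V ^ (q - 2) * δ ≤ σ ^ (1 / (q : ℝ)) * (η * (δ ^ 2 / σ ^ 2) + η * V ^ q + C) := by
  have hq0 : (0 : ℝ) < q := by positivity
  have hq2 : (2 : ℝ) ≤ q := by exact_mod_cast hq
  set θ : ℝ := 1 / q with hθ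
  have hθ0 : 0 < θ := by positivity
  have hθq : θ * q = 1 := by rw [hθ]; field_simp
  have hθ1 : θ ≤ 1 / 2 := by rw [hθ]; gcongr
  -- The weights produce `(δ² / σ²)^(θ/2)` and `(V^q)^((q-1-θ)/q)`, whose product is `δ^θ V^(q-1-θ)
  -- / σ^θ`. The weight left for the constant is `θ / 2 + θ ^ 2 > 0`, and this room is what allows
  -- `η` to be arbitrary.
  set w₁ : ℝ := θ / 2 with hw1
  set w₂ : ℝ := (q - 1 - θ) / q with hw2
  set w₃ : ℝ := 1 - w₁ - w₂ with hw3
  have h1 : 0 ≤ w₁ := by positivity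
  have h2 : 0 ≤ w₂ := div_nonneg (by linarith) hq0.le
  have h3 : 0 < w₃ := by
    have : w₃ = θ / 2 + θ ^ 2 := by
      rw [hw3, hw1, hw2, hθ]; field_simp; ring
    rw [this]; positivity
  -- The value for which the powers of `η` in the geometric mean cancel.
  set p₃ : ℝ := η ^ (-(w₁ + w₂) / w₃) with hp3
  have hp30 : 0 ≤ p₃ := Real.rpow_nonneg hη.le _
  refine ⟨p₃, hp30, fun V δ σ hV hδ hδV hσ => ?_⟩
  have hσθ := Real.rpow_pos_of_pos hσ θ
  rcases hδ.eq_or_lt with rfl | hδ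
  · simp only [mul_zero]
    positivity
  have hw2q : q * w₂ = q - 1 - θ := by rw [hw2]; field_simp
  have e1 : (η * (δ ^ 2 / σ ^ 2)) ^ w₁ = η ^ w₁ * (δ ^ θ / σ ^ θ) := by
    rw [Real.mul_rpow hη.le (by positivity), Real.div_rpow (by positivity) (by positivity),
      ← Real.rpow_natCast, ← Real.rpow_natCast, ← Real.rpow_mul hδ.le, ← Real.rpow_mul hσ.le, hw1]
    push_cast
    rw [mul_div_cancel₀ θ two_ne_zero]
  have e2 : (η * V ^ q) ^ w₂ = η ^ w₂ * V ^ ((q : ℝ) - 1 - θ) := by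
    rw [Real.mul_rpow hη.le (by positivity), ← Real.rpow_natCast, ← Real.rpow_mul hV.le, hw2q]
  have e3 : p₃ ^ w₃ = η ^ (-(w₁ + w₂)) := by
    rw [hp3, ← Real.rpow_mul hη.le, div_mul_cancel₀ _ h3.ne']
  have key := Real.geom_mean_le_arith_mean3_weighted h1 h2 h3.le
    (by positivity : 0 ≤ η * (δ ^ 2 / σ ^ 2)) (by positivity : 0 ≤ η * V ^ q) hp30
    (by rw [hw3]; ring)
  have e4 : η ^ w₁ * η ^ w₂ * η ^ (-(w₁ + w₂)) = 1 := by
    rw [← Real.rpow_add hη, ← Real.rpow_add hη, add_neg_cancel, Real.rpow_zero]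
  rw [e1, e2, e3] at key
  have e5 : η ^ w₁ * (δ ^ θ / σ ^ θ) * (η ^ w₂ * V ^ ((q : ℝ) - 1 - θ)) * η ^ (-(w₁ + w₂)) =
      δ ^ θ / σ ^ θ * V ^ ((q : ℝ) - 1 - θ) := by
    linear_combination (δ ^ θ / σ ^ θ * V ^ ((q : ℝ) - 1 - θ)) * e4
  rw [e5] at key
  have h4 : δ ^ θ / σ ^ θ * V ^ ((q : ℝ) - 1 - θ) ≤ η * (δ ^ 2 / σ ^ 2) + η * V ^ q + p₃ := by
    have g1 : w₁ ≤ 1 := by linarith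
    have g2 : w₂ ≤ 1 := by linarith
    have g3 : w₃ ≤ 1 := by linarith
    have t1 := mul_le_of_le_one_left (by positivity : 0 ≤ η * (δ ^ 2 / σ ^ 2)) g1
    have t2 := mul_le_of_le_one_left (by positivity : 0 ≤ η * V ^ q) g2
    have t3 := mul_le_of_le_one_left hp30 g3
    linarith
  -- Since `δ ≤ V`, all but the power `θ` of `δ` may be traded for powers of `V`; the remaining `δ ^
  -- θ` yields the gain `σ ^ θ`.
  have h5 : V ^ (q - 2) * δ ≤ σ ^ θ * (δ ^ θ / σ ^ θ * V ^ ((q : ℝ) - 1 - θ)) := by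
    have e6 : σ ^ θ * (δ ^ θ / σ ^ θ * V ^ ((q : ℝ) - 1 - θ)) =
        δ ^ θ * V ^ ((q : ℝ) - 1 - θ) := by field_simp
    rw [e6]
    have e7 : (V ^ (q - 2) : ℝ) = V ^ ((q : ℝ) - 2) := by
      rw [← Real.rpow_natCast, Nat.cast_sub hq]; norm_num
    have e8 : δ = δ ^ θ * δ ^ (1 - θ) := by
      rw [← Real.rpow_add hδ]; norm_num
    have e9 : V ^ ((q : ℝ) - 1 - θ) = V ^ ((q : ℝ) - 2) * V ^ (1 - θ) := by
      rw [← Real.rpow_add hV]; congr 1; ring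
    rw [e7, e9]
    nth_rw 1 [e8]
    have h6 : δ ^ (1 - θ) ≤ V ^ (1 - θ) := Real.rpow_le_rpow hδ.le hδV (by linarith)
    calc _ = δ ^ θ * (V ^ ((q : ℝ) - 2) * δ ^ (1 - θ)) := by ring
      _ ≤ _ := by gcongr
  exact h5.trans (mul_le_mul_of_nonneg_left h4 hσθ.le)

/-- Compare `V` with `ε⁻¹`: below it the constant dominates, above it one more power of `V` pays for
the factor `ε`. -/
lemma pow_pred_le_young {q : ℕ} (hq : 1 ≤ q) {ε V : ℝ} (hε : 0 < ε) (hV : 0 ≤ V) :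
    V ^ (q - 1) ≤ ε * V ^ q + ε⁻¹ ^ (q - 1) := by
  obtain ⟨p, rfl⟩ : ∃ p, q = p + 1 := ⟨q - 1, by omega⟩
  simp only [Nat.add_sub_cancel]
  rcases le_total (ε * V) 1 with h | h
  · have h1 : V ≤ ε⁻¹ := by
      rw [← one_div, le_div_iff₀ hε, mul_comm]
      exact h
    have := pow_le_pow_left₀ hV h1 p
    have : 0 ≤ ε * V ^ (p + 1) := by positivity
    linarith
  · have h1 : V ^ p ≤ (ε * V) * V ^ p := le_mul_of_one_le_left (by positivity) h
    have h2 : 0 ≤ ε⁻¹ ^ p := by positivity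
    rw [pow_succ]
    linarith

/-- Young's inequality for the boundary terms. -/
lemma exists_young_boundary {q : ℕ} (hq : 2 ≤ q) {η : ℝ} (hη : 0 < η) : ∃ C, 0 ≤ C ∧
    ∀ V σ : ℝ, 0 ≤ V → 0 < σ → σ ≤ 1 →
      V ^ (q - 1) ≤ σ ^ (1 / (q : ℝ)) * (η * V ^ q + C / σ ^ 2) := by
  have hq0 : (0 : ℝ) < q := by positivity
  refine ⟨η⁻¹ ^ (q - 1), by positivity, fun V σ hV hσ hσ1 => ?_⟩
  set s := σ ^ (1 / (q : ℝ)) with hs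
  have hs0 : 0 < s := Real.rpow_pos_of_pos hσ _
  have hsq : s ^ q = σ := by
    rw [hs, ← Real.rpow_natCast, ← Real.rpow_mul hσ.le, one_div_mul_cancel hq0.ne', Real.rpow_one]
  -- Applied with `η * s` in place of `ε`. Since `s ^ q = σ`, the constant becomes `η⁻¹ ^ (q - 1) *
  -- (s / σ)`, and `s / σ ≤ s / σ ^ 2` suffices.
  have h1 := pow_pred_le_young (q := q) (by omega) (mul_pos hη hs0) hV
  have h2 : ((η * s)⁻¹ ^ (q - 1) : ℝ) = η⁻¹ ^ (q - 1) * (s / σ) := by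
    rw [mul_inv, mul_pow]
    congr 1
    obtain ⟨p, rfl⟩ : ∃ p, q = p + 1 := ⟨q - 1, by omega⟩
    rw [← hsq]
    simp only [Nat.add_sub_cancel]
    rw [inv_pow, pow_succ]
    field_simp
  have h3 : s / σ ≤ s / σ ^ 2 := by
    gcongr
    rw [sq]
    exact mul_le_of_le_one_left hσ.le hσ1
  rw [h2] at h1
  calc _ ≤ η * s * V ^ q + η⁻¹ ^ (q - 1) * (s / σ) := h1
    _ ≤ η * s * V ^ q + η⁻¹ ^ (q - 1) * (s / σ ^ 2) := by gcongr
    _ = _ := by ring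

lemma abs_pow_sub_pow_le_of_abs_le {V x x' : ℝ} (hx : |x| ≤ V) (hx' : |x'| ≤ V) (k : ℕ) :
    |x ^ k - x' ^ k| ≤ k * V ^ (k - 1) * |x - x'| := by
  have hV : 0 ≤ V := (abs_nonneg _).trans hx
  induction k with
  | zero => simp
  | succ k ih =>
    rw [show x ^ (k + 1) - x' ^ (k + 1) = (x ^ k - x' ^ k) * x + x' ^ k * (x - x') by ring]
    refine (abs_add_le _ _).trans ?_
    rw [abs_mul, abs_mul, abs_pow]
    have h1 : |x ^ k - x' ^ k| * |x| ≤ (k * V ^ (k - 1) * |x - x'|) * V := by gcongr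
    have h2 : |x'| ^ k * |x - x'| ≤ V ^ k * |x - x'| := by gcongr
    rcases Nat.eq_zero_or_pos k with rfl | hk
    · simp
    · have e : V ^ (k - 1) * V = V ^ k := by rw [← pow_succ]; congr 1; omega
      have h3 : (k * V ^ (k - 1) * |x - x'|) * V = k * V ^ k * |x - x'| := by rw [← e]; ring
      rw [h3] at h1
      push_cast
      linarith

lemma abs_mul_pow_sub_le {V x x' y y' : ℝ} (hV : 1 ≤ V) (hx : |x| ≤ V) (hx' : |x'| ≤ V)
    (hy : |y| ≤ V) (hy' : |y'| ≤ V) {q k m : ℕ} (hkm : k + m ≤ q - 1) :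
    |x ^ k * y ^ m - x' ^ k * y' ^ m| ≤ q * V ^ (q - 2) * (|x - x'| + |y - y'|) := by
  have hV0 : 0 ≤ V := by linarith
  rw [show x ^ k * y ^ m - x' ^ k * y' ^ m =
    (x ^ k - x' ^ k) * y ^ m + x' ^ k * (y ^ m - y' ^ m) by ring, mul_add]
  refine (abs_add_le _ _).trans (add_le_add ?_ ?_)
  · rw [abs_mul, abs_pow]
    rcases Nat.eq_zero_or_pos k with rfl | hk
    · simp; positivity
    calc _ ≤ (k * V ^ (k - 1) * |x - x'|) * V ^ m := by
          gcongr
          exact abs_pow_sub_pow_le_of_abs_le hx hx' k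
      _ = k * V ^ (k - 1 + m) * |x - x'| := by rw [pow_add]; ring
      _ ≤ q * V ^ (q - 2) * |x - x'| := by
          gcongr <;> first | assumption | omega
  · rw [abs_mul, abs_pow]
    rcases Nat.eq_zero_or_pos m with rfl | hm
    · simp; positivity
    calc _ ≤ V ^ k * (m * V ^ (m - 1) * |y - y'|) := by
          gcongr
          exact abs_pow_sub_pow_le_of_abs_le hy hy' m
      _ = m * V ^ (k + (m - 1)) * |y - y'| := by rw [pow_add]; ring
      _ ≤ q * V ^ (q - 2) * |y - y'| := by
          gcongr <;> first | assumption | omega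

lemma abs_mul_pow_le {V x y : ℝ} (hV : 1 ≤ V) (hx : |x| ≤ V) (hy : |y| ≤ V) {q k m : ℕ}
    (hkm : k + m ≤ q - 1) : |x ^ k * y ^ m| ≤ V ^ (q - 1) := by
  have hV0 : 0 ≤ V := by linarith
  rw [abs_mul, abs_pow, abs_pow]
  calc _ ≤ V ^ k * V ^ m := by gcongr
    _ = V ^ (k + m) := (pow_add _ _ _).symm
    _ ≤ _ := pow_le_pow_right₀ hV hkm

/-- The translate of `[-2, 2)²` by at most one fits into `[-3, 3)²`, which consists of `36` unit
cells. -/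
lemma integral_bigBox_shift_le {F : SpaceTime → ℝ} (hF : Per F) (hF0 : ∀ z, 0 ≤ F z)
    (hm : Measurable F) (hi : IntegrableOn F (unitCell ×ˢ univ)) {e : SpaceTime} (he : ‖e.1‖ ≤ 1) :
    IntegrableOn (fun z => F (z + e)) (bigBox 2 ×ˢ univ) ∧
    ∫ z in bigBox 2 ×ˢ univ, F (z + e) ≤ 36 * ∫ z in unitCell ×ˢ univ, F z := by
  have hp : Per fun z => ENNReal.ofReal (F z) := fun k z => by simp only [hF k z]
  have h1 := setLIntegral_shift_le hp 2 (E := univ) (I := univ) he fun s _ => mem_univ _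
  norm_num at h1
  rw [← ofReal_integral_eq_lintegral_ofReal hi (ae_of_all _ hF0)] at h1
  have hm' : Measurable fun z => F (z + e) := hm.comp (measurable_id.add_const _)
  have hint : IntegrableOn (fun z => F (z + e)) (bigBox 2 ×ˢ univ) :=
    ⟨hm'.aestronglyMeasurable, (hasFiniteIntegral_iff_ofReal (ae_of_all _ fun z => hF0 _)).2
      (h1.trans_lt (ENNReal.mul_lt_top (by simp) ENNReal.ofReal_lt_top))⟩
  refine ⟨hint, ?_⟩
  rw [← ofReal_integral_eq_lintegral_ofReal hint (ae_of_all _ fun z => hF0 _)] at h1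
  rw [show (36 : ℝ≥0∞) = ENNReal.ofReal 36 by norm_num, ← ENNReal.ofReal_mul (by norm_num)] at h1
  exact (ENNReal.ofReal_le_ofReal_iff (mul_nonneg (by norm_num)
    (integral_nonneg fun z => hF0 z))).1 h1

lemma five_pow_le (q : ℕ) {x₁ x₂ x₃ x₄ : ℝ} (h₁ : 0 ≤ x₁) (h₂ : 0 ≤ x₂) (h₃ : 0 ≤ x₃)
    (h₄ : 0 ≤ x₄) : (1 + x₁ + x₂ + x₃ + x₄) ^ q ≤
      5 ^ q * ((1 + x₁ ^ q) + (1 + x₂ ^ q) + (1 + x₃ ^ q) + (1 + x₄ ^ q)) := by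
  set m := max 1 (max (max x₁ x₂) (max x₃ x₄)) with hm
  have hm1 : 1 ≤ m := le_max_left _ _
  have a1 : x₁ ≤ m := (le_max_left _ _).trans ((le_max_left _ _).trans (le_max_right _ _))
  have a2 : x₂ ≤ m := (le_max_right _ _).trans ((le_max_left _ _).trans (le_max_right _ _))
  have a3 : x₃ ≤ m := (le_max_left _ _).trans ((le_max_right _ _).trans (le_max_right _ _))
  have a4 : x₄ ≤ m := (le_max_right _ _).trans ((le_max_right _ _).trans (le_max_right _ _))
  have b1 := pow_nonneg h₁ q
  have b2 := pow_nonneg h₂ q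
  have b3 := pow_nonneg h₃ q
  have b4 := pow_nonneg h₄ q
  calc _ ≤ (5 * m) ^ q := by
        apply pow_le_pow_left₀ (by positivity); linarith
    _ = 5 ^ q * m ^ q := mul_pow _ _ _
    _ ≤ _ := by
        gcongr
        rcases max_choice 1 (max (max x₁ x₂) (max x₃ x₄)) with h | h
        · rw [hm, h, one_pow]; linarith
        · rcases max_choice (max x₁ x₂) (max x₃ x₄) with h' | h'
          · rcases max_choice x₁ x₂ with h'' | h'' <;> rw [hm, h, h', h''] <;> linarith
          · rcases max_choice x₃ x₄ with h'' | h'' <;> rw [hm, h, h', h''] <;> linarith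

lemma three_pow_le (q : ℕ) {x₁ x₂ : ℝ} (h₁ : 0 ≤ x₁) (h₂ : 0 ≤ x₂) :
    (1 + x₁ + x₂) ^ q ≤ 5 ^ q * ((1 + x₁ ^ q) + (1 + x₂ ^ q)) := by
  set m := max 1 (max x₁ x₂) with hm
  have hm1 : 1 ≤ m := le_max_left _ _
  have a1 : x₁ ≤ m := (le_max_left _ _).trans (le_max_right _ _)
  have a2 : x₂ ≤ m := (le_max_right _ _).trans (le_max_right _ _)
  have b1 := pow_nonneg h₁ q
  have b2 := pow_nonneg h₂ q
  calc _ ≤ (5 * m) ^ q := by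
        apply pow_le_pow_left₀ (by positivity); linarith
    _ = 5 ^ q * m ^ q := mul_pow _ _ _
    _ ≤ _ := by
        gcongr
        rcases max_choice 1 (max x₁ x₂) with h | h
        · rw [hm, h, one_pow]; linarith
        · rcases max_choice x₁ x₂ with h' | h' <;> rw [hm, h, h'] <;> linarith

/-- `1 + |w|^q` on the time interval `(a, b)`. -/
def powCut (w : SpaceTime → ℝ) (q : ℕ) (a b : ℝ) (z : SpaceTime) : ℝ :=
  (Ioo a b).indicator 1 z.2 * (1 + |w z| ^ q)

/-- The squared increment of `w` by `d`, when both points lie in the time interval `(a, b)`. -/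
def incrCut (w : SpaceTime → ℝ) (a b : ℝ) (d z : SpaceTime) : ℝ :=
  (Ioo a b).indicator 1 z.2 * (Ioo a b).indicator 1 (z.2 + d.2) * (w (z + d) - w z) ^ 2

/-- The squared increments of `w` in `L²` at parabolic scale `σ` are at most `S σ²`. -/
def IncrBound (w : SpaceTime → ℝ) (a b S : ℝ) : Prop :=
  ∀ n (d : SpaceTime), ‖d.1‖ ≤ scale n → |d.2| ≤ scale n ^ 2 →
    ∫ z in unitCell ×ˢ univ, incrCut w a b d z ≤ S * scale n ^ 2

lemma timeInd_cases (a b t : ℝ) : (Ioo a b).indicator (1 : ℝ → ℝ) t = 0 ∧ t ∉ Ioo a b ∨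
    (Ioo a b).indicator (1 : ℝ → ℝ) t = 1 ∧ t ∈ Ioo a b := by
  by_cases h : t ∈ Ioo a b
  · right; exact ⟨indicator_of_mem h _, h⟩
  · left; exact ⟨indicator_of_notMem h _, h⟩

lemma timeInd_nonneg (a b t : ℝ) : 0 ≤ (Ioo a b).indicator (1 : ℝ → ℝ) t :=
  timeCut_indicator.nonneg t

lemma powCut_nonneg (w : SpaceTime → ℝ) (q : ℕ) (a b : ℝ) (z : SpaceTime) : 0 ≤ powCut w q a b z :=
  mul_nonneg (timeInd_nonneg _ _ _) (by positivity)

lemma powCut_of_mem {w : SpaceTime → ℝ} {q : ℕ} {a b : ℝ} {z : SpaceTime} (h : z.2 ∈ Ioo a b) :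
    powCut w q a b z = 1 + |w z| ^ q := by
  rw [powCut, indicator_of_mem h, Pi.one_apply, one_mul]

lemma incrCut_nonneg (w : SpaceTime → ℝ) (a b : ℝ) (d z : SpaceTime) : 0 ≤ incrCut w a b d z :=
  mul_nonneg (mul_nonneg (timeInd_nonneg _ _ _) (timeInd_nonneg _ _ _)) (sq_nonneg _)

lemma incrCut_of_mem {w : SpaceTime → ℝ} {a b : ℝ} {d z : SpaceTime} (h : z.2 ∈ Ioo a b)
    (h' : z.2 + d.2 ∈ Ioo a b) : incrCut w a b d z = |w (z + d) - w z| ^ 2 := by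
  rw [incrCut, indicator_of_mem h, indicator_of_mem h', Pi.one_apply, Pi.one_apply, one_mul,
    one_mul, sq_abs]

lemma measurable_timeInd (a b c : ℝ) :
    Measurable fun z : SpaceTime => (Ioo a b).indicator (1 : ℝ → ℝ) (z.2 + c) :=
  (measurable_one.indicator measurableSet_Ioo).comp (measurable_snd.add_const c)

lemma measurable_powCut {w : SpaceTime → ℝ} (hw : Continuous w) (q : ℕ) (a b : ℝ) :
    Measurable (powCut w q a b) := by
  have := measurable_timeInd a b 0
  simp only [add_zero] at this
  exact this.mul ((hw.measurable.abs.pow_const q).const_add 1)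

lemma measurable_incrCut {w : SpaceTime → ℝ} (hw : Continuous w) (a b : ℝ) (d : SpaceTime) :
    Measurable (incrCut w a b d) := by
  have := measurable_timeInd a b 0
  simp only [add_zero] at this
  exact (this.mul (measurable_timeInd a b d.2)).mul
    (((hw.measurable.comp (measurable_id.add_const d)).sub hw.measurable).pow_const 2)

lemma per_powCut {w : SpaceTime → ℝ} (hw : Per w) (q : ℕ) (a b : ℝ) : Per (powCut w q a b) :=
  fun k z => by simp only [powCut, hw k z, Prod.snd_add, add_zero]

lemma per_incrCut {w : SpaceTime → ℝ} (hw : Per w) (a b : ℝ) (d : SpaceTime) :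
    Per (incrCut w a b d) := fun k z => by
  simp only [incrCut, hw k z, Prod.snd_add, add_zero, add_right_comm z, hw k (z + d)]

lemma integrableOn_powCut {w : SpaceTime → ℝ} (hw : Continuous w) {B : ℝ} (hB : ∀ z, |w z| ≤ B)
    (q : ℕ) (a b : ℝ) : IntegrableOn (powCut w q a b) (unitCell ×ˢ univ) := by
  refine integrableOn_univ_of_cyl (I := Ioo a b) (fun z hz => ?_)
    (integrableOn_cyl_of_bound (C := 1 + B ^ q) (measurable_powCut hw q a b).aestronglyMeasurable
      fun z hz => ?_)
  · rw [powCut, indicator_of_notMem hz, zero_mul]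
  · rw [powCut_of_mem hz, Real.norm_eq_abs, abs_of_nonneg (by positivity)]
    gcongr
    exact hB z

lemma integrableOn_incrCut {w : SpaceTime → ℝ} (hw : Continuous w) {B : ℝ} (hB : ∀ z, |w z| ≤ B)
    (a b : ℝ) (d : SpaceTime) : IntegrableOn (incrCut w a b d) (unitCell ×ˢ univ) := by
  refine integrableOn_univ_of_cyl (I := Ioo a b) (fun z hz => ?_)
    (integrableOn_cyl_of_bound (C := (B + B) ^ 2)
      (measurable_incrCut hw a b d).aestronglyMeasurable fun z hz => ?_)
  · rw [incrCut, indicator_of_notMem hz, zero_mul, zero_mul]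
  · have h1 : |w (z + d) - w z| ≤ B + B := (abs_sub _ _).trans (add_le_add (hB _) (hB _))
    rw [Real.norm_eq_abs, abs_of_nonneg (incrCut_nonneg _ _ _ _ _), incrCut]
    rcases timeInd_cases a b z.2 with ⟨e, _⟩ | ⟨e, _⟩ <;>
    rcases timeInd_cases a b (z.2 + d.2) with ⟨e', _⟩ | ⟨e', _⟩ <;> rw [e, e', ← sq_abs] <;>
    nlinarith [pow_le_pow_left₀ (abs_nonneg _) h1 2, sq_nonneg (B + B)]

lemma integral_powCut {w : SpaceTime → ℝ} (hw : Continuous w) {B : ℝ} (hB : ∀ z, |w z| ≤ B)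
    (q : ℕ) {a b : ℝ} (hab : a ≤ b) : ∫ z in unitCell ×ˢ univ, powCut w q a b z =
      (volume unitCell).toReal * (b - a) + ∫ z in unitCell ×ˢ Ioo a b, |w z| ^ q := by
  rw [setIntegral_univ_eq_cyl (I := Ioo a b) fun z hz => by
    rw [powCut, indicator_of_notMem hz, zero_mul], setIntegral_congr_fun (measurableSet_cyl a b)
    (g := fun z => 1 + |w z| ^ q) fun z hz => powCut_of_mem hz.2, integral_add]
  · congr 1
    rw [setIntegral_const, smul_eq_mul, mul_one, Measure.real, Measure.volume_eq_prod,
      Measure.prod_prod, Real.volume_Ioo, ENNReal.toReal_mul, ENNReal.toReal_ofReal (by linarith)]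
  · exact integrableOn_const (volume_cyl_lt_top a b).ne
  · refine integrableOn_cyl_of_bound (C := B ^ q) (hw.abs.pow q).aestronglyMeasurable fun z _ => ?_
    rw [norm_pow, Real.norm_eq_abs, abs_abs]
    exact pow_le_pow_left₀ (abs_nonneg _) (hB z) q

lemma setIntegral_boxMul (f : ℝ → ℝ) :
    ∫ z in bigBox 2 ×ˢ univ, f z.2 = ∫ z, boxMul f z := by
  refine (setIntegral_congr_fun (g := boxMul f) ((measurableSet_bigBox 2).prod MeasurableSet.univ)
    fun z hz => (boxMul_of_mem hz.1).symm).trans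
    (setIntegral_eq_integral_of_forall_compl_eq_zero fun z hz => ?_)
  have : z.1 ∉ bigBox 2 := fun h => hz ⟨h, mem_univ _⟩
  simp only [boxMul, indicator_of_notMem this, zero_mul]

lemma integrableOn_boxMul {f : ℝ → ℝ} (hf : Integrable f) :
    IntegrableOn (fun z : SpaceTime => f z.2) (bigBox 2 ×ˢ univ) :=
  (integrable_boxMul hf).integrableOn.congr_fun (fun _ hz => boxMul_of_mem hz.1)
    ((measurableSet_bigBox 2).prod MeasurableSet.univ)

/-- The localised product `χ wᵏ w(· + (0, c))ᵐ`, cut off to the times in `(a, b)`. -/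
def prodCut (w : SpaceTime → ℝ) (k m : ℕ) (c a b : ℝ) (z : SpaceTime) : ℝ :=
  chi z * (w z ^ k * (w (z + (0, c)) ^ m * (Ioo a b).indicator 1 z.2))

set_option maxHeartbeats 2000000 in
/-- Moduli of continuity of products of a function, in terms of its `Lᵠ` norm and its `L²` moduli
of continuity. -/
theorem exists_product_modulus {q : ℕ} (hq : 2 ≤ q) {T : ℝ} (hT : 0 ≤ T) {η : ℝ} (hη : 0 < η) :
    ∃ C, 0 ≤ C ∧ ∀ (w : SpaceTime → ℝ) (B a b c a' b' S : ℝ) (k m : ℕ), Continuous w → Per w →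
      (∀ z, |w z| ≤ B) → a ≤ b → b - a ≤ T → k + m ≤ q - 1 → 0 ≤ S → IncrBound w a b S →
      Ioo a' b' ⊆ Ioo a b → (∀ t ∈ Ioo a' b', t + c ∈ Ioo a b) →
      ModSeq (prodCut w k m c a' b')
        (η * (∫ z in unitCell ×ˢ Ioo a b, |w z| ^ q) + C)
        (fun n => scale n ^ (1 / (q : ℝ)) *
          (η * ((∫ z in unitCell ×ˢ Ioo a b, |w z| ^ q) + S) + C)) := by
  obtain ⟨C₁, hC₁, hchi⟩ := exists_chi_lipschitz
  set V₂ := (volume (bigBox 2)).toReal with hV₂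
  set V₁ := (volume unitCell).toReal with hV₁
  have hV₁0 : 0 ≤ V₁ := ENNReal.toReal_nonneg
  have hV₂0 : 0 ≤ V₂ := ENNReal.toReal_nonneg
  -- The divisor collects the losses to come: `144 = 4 * 36` from four translates over the enlarged
  -- box, `C₁ + 2 * q + 1` from the pieces of an increment, and `5 ^ q` from the `q`-th power of a
  -- sum of five terms.
  set η₀ := η / (144 * (C₁ + 2 * q + 1) * 5 ^ q) with hη₀
  have hden : 0 < 144 * (C₁ + 2 * q + 1) * 5 ^ q := by positivity
  have hη₀0 : 0 < η₀ := div_pos hη hden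
  have hη₀e : 144 * (C₁ + 2 * q + 1) * 5 ^ q * η₀ = η := by
    rw [hη₀]; field_simp
  have h5 : (1 : ℝ) ≤ 5 ^ q := one_le_pow₀ (by norm_num)
  have hη₁ : 144 * 5 ^ q * η₀ ≤ η := by
    rw [← hη₀e]
    have : (0 : ℝ) ≤ 144 * 5 ^ q * η₀ := by positivity
    nlinarith [mul_nonneg this hC₁, mul_nonneg this (Nat.cast_nonneg q : (0 : ℝ) ≤ q)]
  have hη₂ : 72 * q * η₀ ≤ η := by
    rw [← hη₀e]
    have h1 : (0 : ℝ) ≤ q * η₀ := by positivity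
    have h2 : (0 : ℝ) ≤ (C₁ + q + 1) * 5 ^ q * η₀ := by positivity
    nlinarith [mul_le_mul_of_nonneg_right h5 h1]
  obtain ⟨C₃, hC₃, hY3⟩ := exists_young_three hq hη₀0
  obtain ⟨C₄, hC₄, hYb⟩ := exists_young_boundary hq hη₀0
  set C₂ : ℝ := C₁ * η₀⁻¹ ^ (q - 1) + 2 * q * C₃ with hC₂
  have hC₂0 : 0 ≤ C₂ := by positivity
  set C₅ := η₀⁻¹ ^ (q - 1) with hC₅
  have hC₅0 : 0 ≤ C₅ := by positivity
  refine ⟨η * (V₁ * T) + V₂ * (C₂ + C₅) * T + 4 * C₄ * V₂, by positivity, ?_⟩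
  intro w B a b c a' b' S k m hw hp hB hab hbT hkm hS hincr hJ hJc
  set K := ∫ z in unitCell ×ˢ Ioo a b, |w z| ^ q with hK
  have hK0 : 0 ≤ K := integral_nonneg fun z => by positivity
  set N := powCut w q a b with hN
  have hN0 : ∀ z, 0 ≤ N z := powCut_nonneg w q a b
  have hNint : ∫ z in unitCell ×ˢ univ, N z ≤ V₁ * T + K := by
    rw [hN, integral_powCut hw hB q hab]
    gcongr
  -- The sum of `1 + |w| ^ q` over the four points that enter an increment of the product.
  set M : SpaceTime → SpaceTime → ℝ := fun d z =>
    N (z + 0) + N (z + (0, c)) + N (z + d) + N (z + (d + (0, c))) with hM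
  have hNsh : ∀ e : SpaceTime, ‖e.1‖ ≤ 1 → IntegrableOn (fun z => N (z + e)) (bigBox 2 ×ˢ univ) ∧
      ∫ z in bigBox 2 ×ˢ univ, N (z + e) ≤ 36 * (V₁ * T + K) := fun e he => by
    obtain ⟨h1, h2⟩ := integral_bigBox_shift_le (per_powCut hp q a b) hN0
      (measurable_powCut hw q a b) (integrableOn_powCut hw hB q a b) he
    exact ⟨h1, h2.trans (mul_le_mul_of_nonneg_left hNint (by norm_num))⟩
  have hMint : ∀ d : SpaceTime, ‖d.1‖ ≤ 1 → IntegrableOn (M d) (bigBox 2 ×ˢ univ) ∧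
      ∫ z in bigBox 2 ×ˢ univ, M d z ≤ 144 * (V₁ * T + K) := by
    intro d hd
    obtain ⟨i1, l1⟩ := hNsh 0 (by simp)
    obtain ⟨i2, l2⟩ := hNsh (0, c) (by simp)
    obtain ⟨i3, l3⟩ := hNsh d hd
    obtain ⟨i4, l4⟩ := hNsh (d + (0, c)) (by simpa using hd)
    refine ⟨((i1.add i2).add i3).add i4, ?_⟩
    have i12 : IntegrableOn (fun z => N (z + 0) + N (z + (0, c))) (bigBox 2 ×ˢ univ) := i1.add i2
    have i123 : IntegrableOn (fun z => N (z + 0) + N (z + (0, c)) + N (z + d)) (bigBox 2 ×ˢ univ) :=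
      i12.add i3
    simp only [hM]
    rw [integral_add i123 i4, integral_add i12 i3, integral_add i1 i2]
    linarith
  set I : ℝ → ℝ := (Ioo a b).indicator 1 with hI
  have hIi : Integrable I := timeCut_indicator.integrable
  have hIint : ∫ z in bigBox 2 ×ˢ univ, I z.2 ≤ V₂ * T := by
    rw [setIntegral_boxMul, integral_boxMul, hI, integral_indicator_one measurableSet_Ioo,
      Real.volume_real_Ioo_of_le hab]
    gcongr
  have hbox : MeasurableSet (bigBox 2 ×ˢ (univ : Set ℝ)) :=
    (measurableSet_bigBox 2).prod MeasurableSet.univ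
  -- the size of a single product
  have hVM : ∀ d z : SpaceTime, z.2 ∈ Ioo a b → z.2 + c ∈ Ioo a b → z.2 + d.2 ∈ Ioo a b →
      z.2 + d.2 + c ∈ Ioo a b →
      (1 + |w z| + |w (z + (0, c))| + |w (z + d)| + |w (z + d + (0, c))|) ^ q ≤
        5 ^ q * M d z := by
    intro d z h1 h2 h3 h4
    have e1 : N (z + 0) = 1 + |w z| ^ q := by rw [add_zero]; exact powCut_of_mem h1
    have e2 : N (z + (0, c)) = 1 + |w (z + (0, c))| ^ q := powCut_of_mem h2
    have e3 : N (z + d) = 1 + |w (z + d)| ^ q := powCut_of_mem h3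
    have e4 : N (z + (d + (0, c))) = 1 + |w (z + d + (0, c))| ^ q := by
      rw [← add_assoc]; exact powCut_of_mem h4
    simp only [hM]
    rw [e1, e2, e3, e4]
    exact five_pow_le q (abs_nonneg _) (abs_nonneg _) (abs_nonneg _) (abs_nonneg _)
  have hUM : ∀ (d : SpaceTime) (z e : SpaceTime), (e = 0 ∨ e = d) → (z + e).2 ∈ Ioo a b →
      (z + e).2 + c ∈ Ioo a b →
      (1 + |w (z + e)| + |w (z + e + (0, c))|) ^ q ≤ 5 ^ q * M d z := by
    intro d z e he h1 h2
    have e1 : N (z + e) = 1 + |w (z + e)| ^ q := powCut_of_mem h1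
    have e2 : N (z + e + (0, c)) = 1 + |w (z + e + (0, c))| ^ q := powCut_of_mem h2
    refine (three_pow_le q (abs_nonneg (w (z + e))) (abs_nonneg (w (z + e + (0, c))))).trans
      (mul_le_mul_of_nonneg_left ?_ (by positivity))
    rw [← e1, ← e2]
    simp only [hM]
    have g1 := hN0 (z + 0)
    have g2 := hN0 (z + (0, c))
    have g3 := hN0 (z + d)
    have g4 := hN0 (z + (d + (0, c)))
    rcases he with rfl | rfl
    · simp only [add_zero] at *; linarith
    · rw [add_assoc]; linarith
  set J : ℝ → ℝ := (Ioo a' b').indicator 1 with hJdef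
  have hJcases := timeInd_cases a' b'
  have hM0 : ∀ d z, 0 ≤ M d z := fun d z => by
    simp only [hM]
    linarith [hN0 (z + 0), hN0 (z + (0, c)), hN0 (z + d), hN0 (z + (d + (0, c)))]
  have hI0 : ∀ t, 0 ≤ I t := timeInd_nonneg a b
  have hout : ∀ (d z : SpaceTime), ‖d.1‖ ≤ 1 → z ∉ bigBox 2 ×ˢ (univ : Set ℝ) →
      prodCut w k m c a' b' z = 0 ∧ prodCut w k m c a' b' (z + d) = 0 := by
    intro d z hd hz
    obtain ⟨e1, e2⟩ := chi_eq_zero_of_notMem hd fun h => hz ⟨h, mem_univ _⟩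
    simp only [prodCut, e1, e2, zero_mul, and_self]
  refine ⟨?_, fun n d hd1 hd2 => ?_⟩
  · -- the `L¹` norm
    have hpt : ∀ z, |prodCut w k m c a' b' z| ≤ η₀ * (5 ^ q * M 0 z) + C₅ * I z.2 := by
      intro z
      rcases hJcases z.2 with ⟨e, _⟩ | ⟨e, hz⟩
      · have h1 := hM0 0 z
        have h2 := hI0 z.2
        simp only [prodCut, e, mul_zero, abs_zero]
        positivity
      · have hzI := hJ hz
        have hU := hUM 0 z 0 (Or.inl rfl) (by rwa [add_zero]) (by rw [add_zero]; exact hJc _ hz)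
        rw [add_zero] at hU
        set U := 1 + |w z| + |w (z + (0, c))| with hUdef
        have hU1 : 1 ≤ U := by
          have := abs_nonneg (w z)
          have := abs_nonneg (w (z + (0, c)))
          rw [hUdef]; linarith
        have e' : I z.2 = 1 := indicator_of_mem hzI _
        rw [prodCut, e, e', mul_one, mul_one, abs_mul]
        have h1 : |w z ^ k * w (z + (0, c)) ^ m| ≤ U ^ (q - 1) :=
          abs_mul_pow_le hU1 (by rw [hUdef]; linarith [abs_nonneg (w (z + (0, c)))])
            (by rw [hUdef]; linarith [abs_nonneg (w z)]) hkm
        have h2 := pow_pred_le_young (q := q) (by omega) hη₀0 (by linarith : 0 ≤ U)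
        calc _ ≤ 1 * U ^ (q - 1) := by
              gcongr
              exact abs_chi_le_one z
          _ ≤ η₀ * U ^ q + C₅ := by rw [one_mul]; exact h2
          _ ≤ _ := by gcongr
    obtain ⟨i1, l1⟩ := hMint 0 (by simp)
    have i2 : IntegrableOn (fun z => η₀ * (5 ^ q * M 0 z)) (bigBox 2 ×ˢ univ) :=
      (i1.const_mul _).const_mul _
    have i3 : IntegrableOn (fun z : SpaceTime => C₅ * I z.2) (bigBox 2 ×ˢ univ) :=
      (integrableOn_boxMul hIi).const_mul _
    rw [← setIntegral_eq_integral_of_forall_compl_eq_zero (s := bigBox 2 ×ˢ univ)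
      (f := fun z => |prodCut w k m c a' b' z|)
      fun z hz => by rw [(hout 0 z (by simp) hz).1, abs_zero]]
    calc _ ≤ ∫ z in bigBox 2 ×ˢ univ, (η₀ * (5 ^ q * M 0 z) + C₅ * I z.2) :=
          integral_mono_of_nonneg (ae_of_all _ fun z => abs_nonneg _) (i2.add i3)
            (ae_of_all _ hpt)
      _ = η₀ * (5 ^ q * ∫ z in bigBox 2 ×ˢ univ, M 0 z) +
          C₅ * ∫ z in bigBox 2 ×ˢ univ, I z.2 := by
          rw [integral_add i2 i3, integral_const_mul, integral_const_mul, integral_const_mul]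
      _ ≤ η₀ * (5 ^ q * (144 * (V₁ * T + K))) + C₅ * (V₂ * T) := by gcongr
      _ = (144 * 5 ^ q * η₀) * (V₁ * T + K) + C₅ * (V₂ * T) := by ring
      _ ≤ η * (V₁ * T + K) + C₅ * (V₂ * T) := by gcongr
      _ ≤ _ := by
          have h1 : 0 ≤ V₂ * C₂ * T := by positivity
          have h2 : 0 ≤ C₄ * V₂ := by positivity
          linarith
  · set σ := scale n with hσdef
    have hσ : 0 < σ := scale_pos n
    have hσ1 : σ ≤ 1 := (scale_mem n).2.le
    set s := σ ^ (1 / (q : ℝ)) with hs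
    have hs0 : 0 < s := Real.rpow_pos_of_pos hσ _
    have hq1 : 1 / (q : ℝ) ≤ 1 := by
      rw [div_le_one (by positivity)]
      exact_mod_cast (by omega : 1 ≤ q)
    have hσs : σ ≤ s := scale_le_rpow hq1 n
    have hd1' : ‖d.1‖ ≤ 1 := hd1.trans hσ1
    set D₁ := incrCut w a b d with hD₁
    set f := prodCut w k m c a' b' with hf
    -- Four contributions: powers of `w`, squared increments with weight `1 / σ ^ 2`, a constant,
    -- and the points where the time cutoff jumps. The last carries the weight `C₄ / σ ^ 2`, which
    -- is harmless because the cutoff has `L¹` modulus at most `4 * σ ^ 2`.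
    have hpt : ∀ z, |f (z + d) - f z| ≤ s * ((η₀ * (C₁ + 2 * q + 1) * 5 ^ q) * M d z +
        (q * η₀ / σ ^ 2) * (D₁ (z + 0) + D₁ (z + (0, c))) + C₂ * I z.2 +
        (C₄ / σ ^ 2) * |J (z.2 + d.2) - J z.2|) := by
      intro z
      have hD0 : ∀ z, 0 ≤ D₁ z := incrCut_nonneg w a b d
      have t1 := hM0 d z
      have t2 := hD0 (z + 0)
      have t3 := hD0 (z + (0, c))
      have t4 := hI0 z.2
      -- points with exactly one end in the time window
      have hone : ∀ e : SpaceTime, (e = 0 ∨ e = d) → (z + e).2 ∈ Ioo a' b' →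
          |J (z.2 + d.2) - J z.2| = 1 → |f (z + e)| ≤
          s * ((η₀ * (C₁ + 2 * q + 1) * 5 ^ q) * M d z +
            (q * η₀ / σ ^ 2) * (D₁ (z + 0) + D₁ (z + (0, c))) + C₂ * I z.2 +
            (C₄ / σ ^ 2) * |J (z.2 + d.2) - J z.2|) := by
        intro e he hze hJ1
        have hU := hUM d z e he (hJ hze) (hJc _ hze)
        set U := 1 + |w (z + e)| + |w (z + e + (0, c))| with hUdef
        have n1 := abs_nonneg (w (z + e))
        have n2 := abs_nonneg (w (z + e + (0, c)))
        have hU1 : 1 ≤ U := by rw [hUdef]; linarith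
        have h1 : |w (z + e) ^ k * w (z + e + (0, c)) ^ m| ≤ U ^ (q - 1) :=
          abs_mul_pow_le hU1 (by rw [hUdef]; linarith) (by rw [hUdef]; linarith) hkm
        have h2 := hYb U σ (by linarith) hσ hσ1
        have e1 : J (z + e).2 = 1 := indicator_of_mem hze _
        rw [hf, prodCut, ← hJdef, e1, mul_one, abs_mul, hJ1, mul_one]
        calc _ ≤ 1 * U ^ (q - 1) := by
              gcongr
              exact abs_chi_le_one _
          _ ≤ s * (η₀ * U ^ q + C₄ / σ ^ 2) := by rw [one_mul]; exact h2
          _ ≤ s * (η₀ * (5 ^ q * M d z) + C₄ / σ ^ 2) := by gcongr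
          _ ≤ _ := by
              refine mul_le_mul_of_nonneg_left ?_ hs0.le
              have g1 : 0 ≤ (q * η₀ / σ ^ 2) * (D₁ (z + 0) + D₁ (z + (0, c))) := by positivity
              have g2 : 0 ≤ C₂ * I z.2 := by positivity
              have g3 : 0 ≤ η₀ * (C₁ + 2 * q) * 5 ^ q * M d z := by positivity
              linarith
      have hfJ0 : ∀ z : SpaceTime, J z.2 = 0 → f z = 0 := fun z hz => by
        rw [hf, prodCut, ← hJdef, hz, mul_zero, mul_zero, mul_zero]
      rcases hJcases z.2 with ⟨e, hz⟩ | ⟨e, hz⟩ <;>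
      rcases hJcases (z.2 + d.2) with ⟨e', hz'⟩ | ⟨e', hz'⟩
      · rw [hfJ0 z e, hfJ0 (z + d) e', sub_zero, abs_zero]
        positivity
      · rw [hfJ0 z e, sub_zero]
        refine hone d (Or.inr rfl) hz' ?_
        rw [hJdef, e, e']; norm_num
      · rw [hfJ0 (z + d) e', zero_sub, abs_neg]
        have := hone 0 (Or.inl rfl) (by rwa [add_zero]) (by rw [hJdef, e, e']; norm_num)
        simp only [add_zero] at this ⊢
        exact this
      · have hzI := hJ hz
        have hzI' := hJ hz'
        have hzc := hJc _ hz
        have hzc' := hJc _ hz'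
        have hVq := hVM d z hzI hzc hzI' hzc'
        have n1 := abs_nonneg (w z)
        have n2 := abs_nonneg (w (z + (0, c)))
        have n3 := abs_nonneg (w (z + d))
        have n4 := abs_nonneg (w (z + d + (0, c)))
        set V := 1 + |w z| + |w (z + (0, c))| + |w (z + d)| + |w (z + d + (0, c))| with hVdef
        have hV1 : 1 ≤ V := by rw [hVdef]; linarith
        have hV0 : 0 < V := by linarith
        set δ₁ := |w (z + d) - w z| with hδ₁
        set δ₂ := |w (z + d + (0, c)) - w (z + (0, c))| with hδ₂
        have hδ₁V : δ₁ ≤ V := (abs_sub _ _).trans (by rw [hVdef]; linarith)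
        have hδ₂V : δ₂ ≤ V := (abs_sub _ _).trans (by rw [hVdef]; linarith)
        have e1 : D₁ (z + 0) = δ₁ ^ 2 := by rw [add_zero]; exact incrCut_of_mem hzI hzI'
        have e2 : D₁ (z + (0, c)) = δ₂ ^ 2 := by
          rw [hD₁, incrCut_of_mem hzc (by
            rw [Prod.snd_add]; convert hzc' using 1; ring), add_right_comm]
        have e3 : I z.2 = 1 := indicator_of_mem hzI _
        have hx : |w z| ≤ V := by rw [hVdef]; linarith
        have hy : |w (z + (0, c))| ≤ V := by rw [hVdef]; linarith
        have hx' : |w (z + d)| ≤ V := by rw [hVdef]; linarith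
        have hy' : |w (z + d + (0, c))| ≤ V := by rw [hVdef]; linarith
        have eJ : J (z.2) = 1 := e
        have eJ' : J (z + d).2 = 1 := e'
        -- With both ends in the window only `chi` and the two factors of the product vary; the
        -- cutoff in space gains a full `σ ≤ s`.
        have h1 : |f (z + d) - f z| ≤ C₁ * s * V ^ (q - 1) +
            q * (V ^ (q - 2) * δ₁ + V ^ (q - 2) * δ₂) := by
          rw [hf, prodCut, prodCut, ← hJdef, eJ, eJ', mul_one, mul_one]
          set P := w z ^ k * w (z + (0, c)) ^ m with hP
          set P' := w (z + d) ^ k * w (z + d + (0, c)) ^ m with hP'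
          rw [show chi (z + d) * P' - chi z * P =
            (chi (z + d) - chi z) * P + chi (z + d) * (P' - P) by ring]
          refine (abs_add_le _ _).trans (add_le_add ?_ ?_)
          · rw [abs_mul]
            have g1 : |chi (z + d) - chi z| ≤ C₁ * s := (hchi z d).trans
              (mul_le_mul_of_nonneg_left (hd1.trans hσs) hC₁)
            exact mul_le_mul g1 (abs_mul_pow_le hV1 hx hy hkm) (abs_nonneg _) (by positivity)
          · rw [abs_mul]
            have g1 := abs_mul_pow_sub_le hV1 hx' hx hy' hy hkm
            calc _ ≤ 1 * (q * V ^ (q - 2) * (δ₁ + δ₂)) := by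
                  gcongr
                  exact abs_chi_le_one _
              _ = _ := by ring
        have h2 := pow_pred_le_young (q := q) (by omega) hη₀0 hV0.le
        have h3 := hY3 V δ₁ σ hV0 (abs_nonneg _) hδ₁V hσ
        have h4 := hY3 V δ₂ σ hV0 (abs_nonneg _) hδ₂V hσ
        have hqn : (0 : ℝ) ≤ q := Nat.cast_nonneg q
        have hMM : 0 ≤ M d z := t1
        calc _ ≤ _ := h1
          _ ≤ C₁ * s * (η₀ * V ^ q + C₅) +
              q * (s * (η₀ * (δ₁ ^ 2 / σ ^ 2) + η₀ * V ^ q + C₃) +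
                s * (η₀ * (δ₂ ^ 2 / σ ^ 2) + η₀ * V ^ q + C₃)) := by gcongr
          _ = s * ((C₁ + 2 * q) * η₀ * V ^ q + (q * η₀ / σ ^ 2) * (δ₁ ^ 2 + δ₂ ^ 2) + C₂) := by
              rw [hC₂, hC₅]; ring
          _ ≤ s * ((C₁ + 2 * q) * η₀ * (5 ^ q * M d z) +
              (q * η₀ / σ ^ 2) * (δ₁ ^ 2 + δ₂ ^ 2) + C₂) := by gcongr
          _ ≤ _ := by
              rw [e1, e2, e3]
              refine mul_le_mul_of_nonneg_left ?_ hs0.le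
              have g1 : 0 ≤ C₄ / σ ^ 2 * |J (z.2 + d.2) - J z.2| := by positivity
              have g2 : 0 ≤ η₀ * 5 ^ q * M d z := by positivity
              linarith
    obtain ⟨i1, l1⟩ := hMint d hd1'
    have hDsh : ∀ e : SpaceTime, ‖e.1‖ ≤ 1 →
        IntegrableOn (fun z => D₁ (z + e)) (bigBox 2 ×ˢ univ) ∧
        ∫ z in bigBox 2 ×ˢ univ, D₁ (z + e) ≤ 36 * (S * σ ^ 2) := fun e he => by
      obtain ⟨h1, h2⟩ := integral_bigBox_shift_le (per_incrCut hp a b d) (incrCut_nonneg w a b d)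
        (measurable_incrCut hw a b d) (integrableOn_incrCut hw hB a b d) he
      exact ⟨h1, h2.trans (mul_le_mul_of_nonneg_left (hincr n d hd1 hd2) (by norm_num))⟩
    obtain ⟨i2, l2⟩ := hDsh 0 (by simp)
    obtain ⟨i3, l3⟩ := hDsh (0, c) (by simp)
    have hJi : Integrable J := timeCut_indicator.integrable
    have hΔ : Integrable fun t => |J (t + d.2) - J t| := ((hJi.comp_add_right d.2).sub hJi).abs
    have i4 := integrableOn_boxMul hIi
    have i5 := integrableOn_boxMul hΔ
    have l5 : ∫ z : SpaceTime in bigBox 2 ×ˢ univ, |J (z.2 + d.2) - J z.2| ≤ V₂ * (4 * σ ^ 2) := by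
      rw [setIntegral_boxMul (fun t => |J (t + d.2) - J t|), integral_boxMul]
      gcongr
      exact (timeCut_indicator.modulus d.2).trans (by linarith)
    set A := η₀ * (C₁ + 2 * q + 1) * 5 ^ q with hA
    have j1 : IntegrableOn (fun z => A * M d z) (bigBox 2 ×ˢ univ) := i1.const_mul _
    have j2' : IntegrableOn (fun z => D₁ (z + 0) + D₁ (z + (0, c))) (bigBox 2 ×ˢ univ) := i2.add i3
    have j2 : IntegrableOn (fun z => (q * η₀ / σ ^ 2) * (D₁ (z + 0) + D₁ (z + (0, c))))
        (bigBox 2 ×ˢ univ) := j2'.const_mul _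
    have j4 : IntegrableOn (fun z : SpaceTime => C₂ * I z.2) (bigBox 2 ×ˢ univ) := i4.const_mul _
    have j5 : IntegrableOn (fun z : SpaceTime => (C₄ / σ ^ 2) * |J (z.2 + d.2) - J z.2|)
        (bigBox 2 ×ˢ univ) := i5.const_mul _
    have j12 : IntegrableOn (fun z => A * M d z +
        (q * η₀ / σ ^ 2) * (D₁ (z + 0) + D₁ (z + (0, c)))) (bigBox 2 ×ˢ univ) := j1.add j2
    have j124 : IntegrableOn (fun z => A * M d z +
        (q * η₀ / σ ^ 2) * (D₁ (z + 0) + D₁ (z + (0, c))) + C₂ * I z.2) (bigBox 2 ×ˢ univ) :=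
      j12.add j4
    have jall : IntegrableOn (fun z => A * M d z +
        (q * η₀ / σ ^ 2) * (D₁ (z + 0) + D₁ (z + (0, c))) + C₂ * I z.2 +
        (C₄ / σ ^ 2) * |J (z.2 + d.2) - J z.2|) (bigBox 2 ×ˢ univ) := j124.add j5
    rw [← setIntegral_eq_integral_of_forall_compl_eq_zero (s := bigBox 2 ×ˢ univ)
      (f := fun z => |f (z + d) - f z|)
      fun z hz => by
        obtain ⟨h1, h2⟩ := hout d z hd1' hz
        rw [h1, h2, sub_zero, abs_zero]]
    refine (integral_mono_of_nonneg (ae_of_all _ fun z => abs_nonneg _)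
      (jall.const_mul s) (ae_of_all _ hpt)).trans ?_
    rw [integral_const_mul, integral_add j124 j5, integral_add j12 j4, integral_add j1 j2,
      integral_const_mul, integral_const_mul, integral_const_mul, integral_const_mul,
      integral_add i2 i3]
    refine mul_le_mul_of_nonneg_left ?_ hs0.le
    have hq0 : (0 : ℝ) ≤ q := Nat.cast_nonneg q
    -- The powers of `σ` cancel against the bound `S * σ ^ 2` on squared increments and against the
    -- modulus of the time cutoff.
    calc _ ≤ A * (144 * (V₁ * T + K)) + (q * η₀ / σ ^ 2) * (36 * (S * σ ^ 2) + 36 * (S * σ ^ 2)) +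
          C₂ * (V₂ * T) + (C₄ / σ ^ 2) * (V₂ * (4 * σ ^ 2)) := by
          have hA0 : 0 ≤ A := by positivity
          gcongr
      _ = (144 * (C₁ + 2 * q + 1) * 5 ^ q * η₀) * (V₁ * T + K) + (72 * q * η₀) * S +
          C₂ * (V₂ * T) + 4 * C₄ * V₂ := by
          rw [hA]; field_simp; ring
      _ ≤ η * (V₁ * T + K) + η * S + C₂ * (V₂ * T) + 4 * C₄ * V₂ := by
          rw [hη₀e]
          gcongr
      _ ≤ _ := by
          have : 0 ≤ V₂ * C₅ * T := by positivity
          linarith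

/-! ### Time increments and the `L²` moduli of a weak flow. -/

/-- A time translation exchanges the two ends of an increment, so only backward lags have to be
estimated. -/
lemma integral_incrCut_neg (w : SpaceTime → ℝ) (a b ζ : ℝ) :
    ∫ z in unitCell ×ˢ univ, incrCut w a b (0, ζ) z =
      ∫ z in unitCell ×ˢ univ, incrCut w a b (0, -ζ) z := by
  rw [← setIntegral_timeShift (incrCut w a b (0, ζ)) ζ]
  refine integral_congr_ae (ae_of_all _ fun z => ?_)
  have h1 : z - (0, ζ) + (0, ζ) = z := sub_add_cancel _ _
  have h2 : z + (0, -ζ) = z - ((0 : Plane), ζ) := by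
    rw [sub_eq_add_neg, Prod.neg_mk, neg_zero]
  have h3 : (z - ((0 : Plane), ζ)).2 = z.2 - ζ := rfl
  simp only [incrCut, h1, h2, h3, sub_add_cancel, ← sub_eq_add_neg]
  ring

/-- Space-time `L²` moduli of continuity follow from purely spatial and purely temporal ones. -/
lemma incrBound_of_space_time {w : SpaceTime → ℝ} (hw : Continuous w) {B : ℝ}
    (hB : ∀ z, |w z| ≤ B) {a b D Θ : ℝ} (hΘ : 0 ≤ Θ) (hD : 0 ≤ D)
    (hspace : ∀ y : Plane, ‖y‖ ≤ 1 →
      ∫ z in unitCell ×ˢ Ioo a b, (w (z + (y, 0)) - w z) ^ 2 ≤ 32 * ‖y‖ ^ 2 * D)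
    (htime : ∀ h, 0 < h → a + h < b →
      ∫ z in unitCell ×ˢ Ioo (a + h) b, (w z - w (z - (0, h))) ^ 2 ≤ h * Θ) :
    IncrBound w a b (64 * D + 2 * Θ) := by
  have hneg : ∀ h, 0 < h → ∫ z in unitCell ×ˢ univ, incrCut w a b (0, -h) z ≤ h * Θ := by
    intro h hh
    rw [setIntegral_univ_eq_cyl (I := Ioo (a + h) b) fun z hz => ?_]
    · by_cases hab : a + h < b
      · refine (le_of_eq (setIntegral_congr_fun (measurableSet_cyl _ _) fun z hz => ?_)).trans
          (htime h hh hab)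
        have h1 := hz.2
        have h2 : z + (0, -h) = z - ((0 : Plane), h) := by
          rw [sub_eq_add_neg, Prod.neg_mk, neg_zero]
        have h3 : z.2 - h ∈ Ioo a b := ⟨by linarith [h1.1], by linarith [h1.2]⟩
        have h4 : z.2 ∈ Ioo a b := ⟨by linarith [h1.1], h1.2⟩
        rw [incrCut_of_mem h4 h3, h2, sq_abs]
        ring
      · rw [Ioo_eq_empty hab, prod_empty, setIntegral_empty]
        positivity
    · rcases timeInd_cases a b z.2 with ⟨e, e'⟩ | ⟨e, e'⟩
      · rw [incrCut, e, zero_mul, zero_mul]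
      · rcases timeInd_cases a b (z.2 + -h) with ⟨f, f'⟩ | ⟨f, f'⟩
        · rw [incrCut, f, mul_zero, zero_mul]
        · exact absurd ⟨by linarith [f'.1], e'.2⟩ hz
  have htm : ∀ ζ : ℝ, ∫ z in unitCell ×ˢ univ, incrCut w a b (0, ζ) z ≤ |ζ| * Θ := by
    intro ζ
    rcases lt_trichotomy ζ 0 with h | h | h
    · have := hneg (-ζ) (by linarith)
      rwa [neg_neg, ← abs_of_neg h] at this
    · have : ∀ z, incrCut w a b (0, ζ) z = 0 := fun z => by
        rw [incrCut, h, show z + ((0 : Plane), (0 : ℝ)) = z from add_zero z, sub_self]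
        ring
      rw [integral_congr_ae (ae_of_all _ this), integral_zero]
      positivity
    · rw [integral_incrCut_neg, abs_of_pos h]
      exact hneg ζ h
  intro n d hd1 hd2
  have hs1 : scale n ≤ 1 := (scale_mem n).2.le
  have hd1' : ‖d.1‖ ≤ 1 := hd1.trans hs1
  set P : SpaceTime → ℝ := fun z => (Ioo a b).indicator 1 z.2 * (w (z + (d.1, 0)) - w z) ^ 2
    with hP
  have hPm : Measurable P := by
    have := measurable_timeInd a b 0
    simp only [add_zero] at this
    exact this.mul (((hw.measurable.comp (measurable_id.add_const _)).sub hw.measurable).pow_const 2)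
  have hP0 : ∀ z, z.2 ∉ Ioo a b → P z = 0 := fun z hz => by
    rw [hP]; simp only; rw [indicator_of_notMem hz, zero_mul]
  have hPe : ∀ z : SpaceTime, z.2 ∈ Ioo a b → P z = (w (z + (d.1, 0)) - w z) ^ 2 := fun z hz => by
    rw [hP]; simp only; rw [indicator_of_mem hz, Pi.one_apply, one_mul]
  have hPi : IntegrableOn P (unitCell ×ˢ univ) := by
    refine integrableOn_univ_of_cyl hP0 (integrableOn_cyl_of_bound (C := (B + B) ^ 2)
      hPm.aestronglyMeasurable fun z hz => ?_)
    rw [hPe z hz, norm_pow]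
    exact pow_le_pow_left₀ (norm_nonneg _) ((norm_sub_le _ _).trans (add_le_add (hB _) (hB _))) 2
  have hPI : ∫ z in unitCell ×ˢ univ, P (z - (0, -d.2)) ≤ 32 * ‖d.1‖ ^ 2 * D := by
    rw [setIntegral_timeShift, setIntegral_univ_eq_cyl hP0,
      setIntegral_congr_fun (measurableSet_cyl _ _) fun z hz => hPe z (mem_prod.1 hz).2]
    exact hspace _ hd1'
  -- The increment is split at `z + (0, d.2)`, whose time lies in the window because that of `z + d`
  -- does: first a step in time, then one in space.
  have hpt : ∀ z, incrCut w a b d z ≤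
      2 * P (z - (0, -d.2)) + 2 * incrCut w a b (0, d.2) z := by
    intro z
    have e1 : z - ((0 : Plane), -d.2) = z + (0, d.2) := by
      rw [sub_eq_add_neg, Prod.neg_mk, neg_zero, neg_neg]
    have e2 : z + ((0 : Plane), d.2) + (d.1, (0 : ℝ)) = z + d := by
      ext1
      · show z.1 + 0 + d.1 = z.1 + d.1
        rw [add_zero]
      · show z.2 + d.2 + 0 = z.2 + d.2
        rw [add_zero]
    have e3 : (z + ((0 : Plane), d.2)).2 = z.2 + d.2 := rfl
    rw [e1]
    simp only [hP, incrCut, e2, e3]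
    rcases timeInd_cases a b z.2 with ⟨e, e'⟩ | ⟨e, e'⟩ <;>
    rcases timeInd_cases a b (z.2 + d.2) with ⟨f, f'⟩ | ⟨f, f'⟩ <;> rw [e, f] <;>
    nlinarith [sq_nonneg (w (z + d) - w (z + (0, d.2)) - (w (z + (0, d.2)) - w z)),
      sq_nonneg (w (z + d) - w (z + (0, d.2)))]
  have i1 : IntegrableOn (fun z => 2 * P (z - (0, -d.2))) (unitCell ×ˢ univ) :=
    (integrableOn_timeShift hPi _).const_mul 2
  have i2 : IntegrableOn (fun z => 2 * incrCut w a b (0, d.2) z) (unitCell ×ˢ univ) :=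
    (integrableOn_incrCut hw hB a b _).const_mul 2
  have hfin : ∫ z in unitCell ×ˢ univ, incrCut w a b d z ≤
      2 * (32 * ‖d.1‖ ^ 2 * D) + 2 * (|d.2| * Θ) := by
    calc _ ≤ ∫ z in unitCell ×ˢ univ, (2 * P (z - (0, -d.2)) + 2 * incrCut w a b (0, d.2) z) :=
          integral_mono (integrableOn_incrCut hw hB a b _) (i1.add i2) hpt
      _ = 2 * (∫ z in unitCell ×ˢ univ, P (z - (0, -d.2))) +
          2 * ∫ z in unitCell ×ˢ univ, incrCut w a b (0, d.2) z := by
          rw [integral_add i1 i2, integral_const_mul, integral_const_mul]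
      _ ≤ _ := by linarith [htm d.2]
  have h1 : ‖d.1‖ ^ 2 * D ≤ scale n ^ 2 * D :=
    mul_le_mul_of_nonneg_right (pow_le_pow_left₀ (norm_nonneg _) hd1 2) hD
  have h2 : |d.2| * Θ ≤ scale n ^ 2 * Θ := mul_le_mul_of_nonneg_right hd2 hΘ
  linarith

set_option maxHeartbeats 2000000 in
/-- Time increments of a weak flow over a lag `τ` are of order `√τ` in `L²`. -/
lemma WeakFlow.time_increment_le {α γ lam Lam T Q : ℝ} {w : SpaceTime → ℝ}
    {G H : SpaceTime → Plane} (hf : WeakFlow α γ lam Lam T Q w G H) (hγ : 0 < γ) (hγ1 : γ ≤ 1)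
    (hαγ : 0 < α + γ) (hLam : 0 ≤ Lam) (hQ : 0 ≤ Q) {a b τ : ℝ} (ha : 0 < a) (hb : b < T)
    (hτ : 0 < τ) {β : ℕ → ℝ} {c : ℕ → ℕ → ℝ}
    (hseq : ∀ k < 3, ∀ r ∈ Icc (-τ) 0, ModSeq (fun z => chi z * (w z ^ k *
      timeCutOff (a + τ) b (fun z => w z - w (z - (0, τ))) (z - (0, r)))) (β k) (c k))
    (hsum : ∀ k < 3, Summable fun n => scale n ^ α * c k n) :
    ∫ z in unitCell ×ˢ Ioo (a + τ) b, (w z - w (z - (0, τ))) ^ 2 ≤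
      τ * (Q * (∑ k ∈ Finset.range 3, (β k + ∑' n, scale n ^ α * c k n)) +
        2 * Lam * (∫ z in unitCell ×ˢ Ioo a b, ‖G z‖ ^ 2) +
        4 * ∫ z in unitCell ×ˢ Ioo a b, |w z| ^ 4) := by
  obtain ⟨K, hK0, hK⟩ := hf.exists_holderBdd hγ
  set a' := a / 2 with ha'
  set b' := (b + T) / 2 with hb'
  set g : SpaceTime → ℝ := fun z => w z - w (z - (0, τ)) with hg
  set Γ := timeCutVec (a + τ) b fun z => G z - G (z - (0, τ)) with hΓ
  set V := timeCutVec a b G with hV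
  set v := timeCutOff a b w with hv
  have hVm : Measurable V := measurable_timeCutVec hf.meas_G
  have hV0 : ∀ z, z.2 ∉ Ioo a b → ‖V z‖ ^ 2 = 0 := fun z hz => by
    rw [hV, timeCutVec_of_notMem hz, norm_zero]; norm_num
  have hVi : IntegrableOn (fun z => ‖V z‖ ^ 2) (unitCell ×ˢ univ) :=
    integrableOn_univ_of_cyl hV0 (sqInt_timeCutVec (hf.sqInt a b ha hb))
  have hVI : ∫ z in unitCell ×ˢ univ, ‖V z‖ ^ 2 = ∫ z in unitCell ×ˢ Ioo a b, ‖G z‖ ^ 2 := by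
    rw [setIntegral_univ_eq_cyl hV0]
    refine setIntegral_congr_fun (measurableSet_cyl _ _) fun z hz => ?_
    rw [hV, timeCutVec_of_mem (mem_prod.1 hz).2]
  have hve : ∀ {z : SpaceTime}, z.2 ∈ Ioo a b → v z = w z := fun {z} hz => by
    rw [hv, timeCutOff, indicator_of_mem hz, Pi.one_apply, mul_one]
  have hvm : Measurable v := by
    have := measurable_timeInd a b 0
    simp only [add_zero] at this
    exact hK.1.measurable.mul this
  have hv0 : ∀ z, z.2 ∉ Ioo a b → |v z| ^ 4 = 0 := fun z hz => by
    rw [hv, timeCutOff, indicator_of_notMem hz, mul_zero, abs_zero]; norm_num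
  have hvi : IntegrableOn (fun z => |v z| ^ 4) (unitCell ×ˢ univ) := by
    refine integrableOn_univ_of_cyl hv0 (integrableOn_cyl_of_bound (C := K ^ 4)
      (hvm.abs.pow_const 4).aestronglyMeasurable fun z hz => ?_)
    rw [hve hz, norm_pow, Real.norm_eq_abs, abs_abs]
    exact pow_le_pow_left₀ (abs_nonneg _) (hK.2.1 z) 4
  have hvI : ∫ z in unitCell ×ˢ univ, |v z| ^ 4 = ∫ z in unitCell ×ˢ Ioo a b, |w z| ^ 4 := by
    rw [setIntegral_univ_eq_cyl hv0]
    refine setIntegral_congr_fun (measurableSet_cyl _ _) fun z hz => ?_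
    rw [hve (mem_prod.1 hz).2]
  have hsub : unitCell ×ˢ Ioo a' b' ⊆ unitCell ×ˢ (univ : Set ℝ) := prod_mono_right (subset_univ _)
  set D := ∫ z in unitCell ×ˢ Ioo a b, ‖G z‖ ^ 2 with hD
  set K₄ := ∫ z in unitCell ×ˢ Ioo a b, |w z| ^ 4 with hK₄
  have hshift : ∀ z : SpaceTime, ∀ r, z - ((0 : Plane), r) - (0, τ) = z - (0, r + τ) :=
    fun z r => by rw [sub_sub, Prod.mk_add_mk, add_zero]
  -- For shifts in `[-τ, 0]` the three times involved all lie in `(a, b)`, so each gradient is paid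
  -- for by the energy on that window.
  have hgrad : ∀ r ∈ Icc (-τ) 0, ∫ z in unitCell ×ˢ Ioo a' b', ‖G z‖ * ‖Γ (z - (0, r))‖ ≤
      2 * D := by
    intro r hr
    have i2 := integrableOn_timeShift hVi r
    have i3 := integrableOn_timeShift hVi (r + τ)
    have j2 : IntegrableOn (fun z => 1 / 2 * ‖V (z - (0, r))‖ ^ 2) (unitCell ×ˢ univ) :=
      i2.const_mul _
    have j3 : IntegrableOn (fun z => 1 / 2 * ‖V (z - (0, r + τ))‖ ^ 2) (unitCell ×ˢ univ) :=
      i3.const_mul _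
    have j12 : IntegrableOn (fun z => ‖V z‖ ^ 2 + 1 / 2 * ‖V (z - (0, r))‖ ^ 2)
        (unitCell ×ˢ univ) := hVi.add j2
    have j123 : IntegrableOn (fun z => ‖V z‖ ^ 2 + 1 / 2 * ‖V (z - (0, r))‖ ^ 2 +
        1 / 2 * ‖V (z - (0, r + τ))‖ ^ 2) (unitCell ×ˢ univ) := j12.add j3
    calc _ ≤ ∫ z in unitCell ×ˢ Ioo a' b', (‖V z‖ ^ 2 + 1 / 2 * ‖V (z - (0, r))‖ ^ 2 +
          1 / 2 * ‖V (z - (0, r + τ))‖ ^ 2) := by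
          refine integral_mono_of_nonneg (ae_of_all _ fun z => by positivity)
            (j123.mono_set hsub) (ae_of_all _ fun z => ?_)
          simp only
          by_cases hz : (z - ((0 : Plane), r)).2 ∈ Ioo (a + τ) b
          · have hz' : z.2 - r ∈ Ioo (a + τ) b := hz
            have m0 : z.2 ∈ Ioo a b := ⟨by linarith [hz'.1, hr.1], by linarith [hz'.2, hr.2]⟩
            have m1 : (z - ((0 : Plane), r)).2 ∈ Ioo a b := ⟨by linarith [hz.1], hz.2⟩
            have m2 : (z - ((0 : Plane), r + τ)).2 ∈ Ioo a b :=
              show z.2 - (r + τ) ∈ Ioo a b from ⟨by linarith [hz'.1], by linarith [hz'.2]⟩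
            rw [hΓ, timeCutVec_of_mem hz, hshift, hV, timeCutVec_of_mem m0, timeCutVec_of_mem m1,
              timeCutVec_of_mem m2]
            have t1 := norm_sub_le (G (z - (0, r))) (G (z - (0, r + τ)))
            nlinarith [sq_nonneg (‖G z‖ - ‖G (z - (0, r))‖), sq_nonneg (‖G z‖ - ‖G (z - (0, r + τ))‖),
              mul_le_mul_of_nonneg_left t1 (norm_nonneg (G z))]
          · rw [hΓ, timeCutVec_of_notMem hz, norm_zero, mul_zero]
            positivity
      _ ≤ ∫ z in unitCell ×ˢ univ, (‖V z‖ ^ 2 + 1 / 2 * ‖V (z - (0, r))‖ ^ 2 +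
          1 / 2 * ‖V (z - (0, r + τ))‖ ^ 2) :=
          setIntegral_mono_set j123 (ae_of_all _ fun z => by positivity) hsub.eventuallyLE
      _ = 2 * D := by
          rw [integral_add j12 j3, integral_add hVi j2, integral_const_mul, integral_const_mul,
            setIntegral_timeShift (fun z => ‖V z‖ ^ 2), setIntegral_timeShift (fun z => ‖V z‖ ^ 2),
            hVI]
          ring
  have hcub : ∀ r ∈ Icc (-τ) 0,
      -∫ z in unitCell ×ˢ Ioo a' b', w z ^ 3 * timeCutOff (a + τ) b g (z - (0, r)) ≤ 4 * K₄ := by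
    intro r hr
    have i2 := integrableOn_timeShift hvi r
    have i3 := integrableOn_timeShift hvi (r + τ)
    have j1 : IntegrableOn (fun z => 2 * |v z| ^ 4) (unitCell ×ˢ univ) := hvi.const_mul _
    have j12 : IntegrableOn (fun z => 2 * |v z| ^ 4 + |v (z - (0, r))| ^ 4)
        (unitCell ×ˢ univ) := j1.add i2
    have j123 : IntegrableOn (fun z => 2 * |v z| ^ 4 + |v (z - (0, r))| ^ 4 +
        |v (z - (0, r + τ))| ^ 4) (unitCell ×ˢ univ) := j12.add i3
    calc _ ≤ ‖∫ z in unitCell ×ˢ Ioo a' b', w z ^ 3 * timeCutOff (a + τ) b g (z - (0, r))‖ :=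
          neg_le_abs _
      _ ≤ ∫ z in unitCell ×ˢ Ioo a' b', ‖w z ^ 3 * timeCutOff (a + τ) b g (z - (0, r))‖ :=
          norm_integral_le_integral_norm _
      _ ≤ ∫ z in unitCell ×ˢ Ioo a' b', (2 * |v z| ^ 4 + |v (z - (0, r))| ^ 4 +
        |v (z - (0, r + τ))| ^ 4) := by
          refine integral_mono_of_nonneg (ae_of_all _ fun z => norm_nonneg _)
            (j123.mono_set hsub) (ae_of_all _ fun z => ?_)
          simp only
          rw [norm_mul, norm_pow, Real.norm_eq_abs, Real.norm_eq_abs, timeCutOff]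
          by_cases hz : (z - ((0 : Plane), r)).2 ∈ Ioo (a + τ) b
          · have hz' : z.2 - r ∈ Ioo (a + τ) b := hz
            have m0 : z.2 ∈ Ioo a b := ⟨by linarith [hz'.1, hr.1], by linarith [hz'.2, hr.2]⟩
            have m1 : (z - ((0 : Plane), r)).2 ∈ Ioo a b := ⟨by linarith [hz.1], hz.2⟩
            have m2 : (z - ((0 : Plane), r + τ)).2 ∈ Ioo a b :=
              show z.2 - (r + τ) ∈ Ioo a b from ⟨by linarith [hz'.1], by linarith [hz'.2]⟩
            rw [indicator_of_mem hz, Pi.one_apply, mul_one, hg]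
            simp only
            rw [hshift, hve m0, hve m1, hve m2]
            have t1 := abs_sub (w (z - (0, r))) (w (z - (0, r + τ)))
            have hy : ∀ x y : ℝ, 0 ≤ x → 0 ≤ y → x ^ 3 * y ≤ x ^ 4 + y ^ 4 := by
              intro x y hx hy
              rcases le_total x y with h | h
              · have := mul_le_mul_of_nonneg_right (pow_le_pow_left₀ hx h 3) hy
                nlinarith [pow_nonneg hx 4]
              · have := mul_le_mul_of_nonneg_left h (pow_nonneg hx 3)
                nlinarith [pow_nonneg hy 4]
            have y1 := hy _ _ (abs_nonneg (w z)) (abs_nonneg (w (z - (0, r))))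
            have y2 := hy _ _ (abs_nonneg (w z)) (abs_nonneg (w (z - (0, r + τ))))
            have y3 := mul_le_mul_of_nonneg_left t1 (pow_nonneg (abs_nonneg (w z)) 3)
            linarith
          · rw [indicator_of_notMem hz, mul_zero, abs_zero, mul_zero]
            positivity
      _ ≤ ∫ z in unitCell ×ˢ univ, (2 * |v z| ^ 4 + |v (z - (0, r))| ^ 4 +
        |v (z - (0, r + τ))| ^ 4) :=
          setIntegral_mono_set j123 (ae_of_all _ fun z => by positivity) hsub.eventuallyLE
      _ = 4 * K₄ := by
          rw [integral_add j12 i3, integral_add j1 i2, integral_const_mul,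
            setIntegral_timeShift (fun z => |v z| ^ 4), setIntegral_timeShift (fun z => |v z| ^ 4),
            hvI]
          ring
  -- The test function is the increment `w - w(· - τ)` and the shift runs from `-τ` to `0`, so the
  -- finite difference on the left is the same increment and their product is its square. With `μ =
  -- 0` no coercivity is used and the whole gradient term counts as an error.
  have ht := hf.test hγ hγ1 hαγ hLam hQ (a := a') (b := b') (a₁ := a + τ) (b₁ := b) (r₀ := -τ)
    (r₁ := 0) (by positivity) (by rw [hb']; linarith) (by linarith) (by rw [ha']; linarith)
    (by rw [hb']; linarith) (hf.smoothApprox_increment hγ hτ.le (by linarith) hb)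
    (μ := fun _ => 0) measurable_const (fun _ _ => rfl) (m := 0) (fun _ => le_rfl) (fun _ => le_rfl)
    hseq hsum (R := Q * (∑ k ∈ Finset.range 3, (β k + ∑' n, scale n ^ α * c k n)) +
        2 * Lam * D + 4 * K₄) (fun r hr => by
      have e : ∫ z in unitCell ×ˢ Ioo a' b', (lam * 0 * ‖G z‖ ^ 2 -
          Lam * ‖G z‖ * ‖Γ (z - (0, r)) - (0 : ℝ) • G z‖) =
          -(Lam * ∫ z in unitCell ×ˢ Ioo a' b', ‖G z‖ * ‖Γ (z - (0, r))‖) := by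
        rw [← integral_const_mul, ← integral_neg]
        refine integral_congr_ae (ae_of_all _ fun z => ?_)
        simp only
        rw [zero_smul, sub_zero]
        ring
      rw [e]
      have := mul_le_mul_of_nonneg_left (hgrad r hr) hLam
      linarith [hcub r hr])
  refine (le_of_eq ?_).trans (ht.trans (le_of_eq ?_))
  · refine setIntegral_congr_fun (measurableSet_cyl _ _) fun z _ => ?_
    have e1 : z + ((0 : Plane), (0 : ℝ)) = z := add_zero z
    have e2 : z + ((0 : Plane), -τ) = z - (0, τ) := by
      rw [sub_eq_add_neg, Prod.neg_mk, neg_zero]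
    simp only [e1, e2]
    ring
  · ring

lemma ModSeq.sub {F F' : SpaceTime → ℝ} {β β' : ℝ} {b b' : ℕ → ℝ} (h : ModSeq F β b)
    (h' : ModSeq F' β' b') (hF : Integrable F) (hF' : Integrable F') :
    ModSeq (fun z => F z - F' z) (β + β') fun n => b n + b' n := by
  refine ⟨?_, fun n d h1 h2 => ?_⟩
  · calc _ ≤ ∫ z, (|F z| + |F' z|) :=
          integral_mono (hF.sub hF').abs (hF.abs.add hF'.abs) fun z => abs_sub _ _
      _ = (∫ z, |F z|) + ∫ z, |F' z| := integral_add hF.abs hF'.abs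
      _ ≤ _ := add_le_add h.1 h'.1
  · have i1 : Integrable fun z => |F (z + d) - F z| := ((hF.comp_add_right d).sub hF).abs
    have i2 : Integrable fun z => |F' (z + d) - F' z| := ((hF'.comp_add_right d).sub hF').abs
    calc _ ≤ ∫ z, (|F (z + d) - F z| + |F' (z + d) - F' z|) := by
          refine integral_mono_of_nonneg (ae_of_all _ fun z => abs_nonneg _) (i1.add i2)
            (ae_of_all _ fun z => ?_)
          simp only
          rw [show F (z + d) - F' (z + d) - (F z - F' z) =
            (F (z + d) - F z) - (F' (z + d) - F' z) by ring]
          exact abs_sub _ _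
      _ = (∫ z, |F (z + d) - F z|) + ∫ z, |F' (z + d) - F' z| := integral_add i1 i2
      _ ≤ _ := add_le_add (h.2 n d h1 h2) (h'.2 n d h1 h2)

lemma timeInd_sub (a b r t : ℝ) : (Ioo a b).indicator (1 : ℝ → ℝ) (t - r) =
    (Ioo (a + r) (b + r)).indicator 1 t := by
  rcases timeInd_cases a b (t - r) with ⟨e, h⟩ | ⟨e, h⟩ <;>
  rcases timeInd_cases (a + r) (b + r) t with ⟨e', h'⟩ | ⟨e', h'⟩
  · rw [e, e']
  · exact absurd ⟨by linarith [h'.1], by linarith [h'.2]⟩ h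
  · exact absurd ⟨by linarith [h.1], by linarith [h.2]⟩ h'
  · rw [e, e']

lemma sub_time_eq (z : SpaceTime) (r : ℝ) : z - ((0 : Plane), r) = z + (0, -r) := by
  rw [sub_eq_add_neg, Prod.neg_mk, neg_zero]

lemma chi_mul_timeCutOff_pow (w : SpaceTime → ℝ) (k m : ℕ) (a b r : ℝ) (z : SpaceTime) :
    chi z * (w z ^ k * timeCutOff a b (fun z => w z ^ m) (z - (0, r))) =
      prodCut w k m (-r) (a + r) (b + r) z := by
  rw [timeCutOff, prodCut, show (z - ((0 : Plane), r)).2 = z.2 - r from rfl, timeInd_sub,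
    sub_time_eq]

lemma chi_mul_timeCutOff_increment (w : SpaceTime → ℝ) (k : ℕ) (a b r τ : ℝ) (z : SpaceTime) :
    chi z * (w z ^ k * timeCutOff a b (fun z => w z - w (z - (0, τ))) (z - (0, r))) =
      prodCut w k 1 (-r) (a + r) (b + r) z - prodCut w k 1 (-r - τ) (a + r) (b + r) z := by
  rw [timeCutOff, prodCut, prodCut, show (z - ((0 : Plane), r)).2 = z.2 - r from rfl, timeInd_sub,
    sub_time_eq, sub_time_eq, add_assoc z,
    show ((0 : Plane), -r) + (0, -τ) = (0, -r - τ) by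
      rw [Prod.mk_add_mk, add_zero, ← sub_eq_add_neg], pow_one, pow_one]
  ring

lemma integrable_prodCut {w : SpaceTime → ℝ} (hw : Continuous w) {B : ℝ} (hB : ∀ z, |w z| ≤ B)
    (k m : ℕ) (c a b : ℝ) : Integrable (prodCut w k m c a b) := by
  have := integrable_chi_mul_cut (A := a) (B := b) (K := B ^ k * B ^ m)
    (v := fun z => w z ^ k * w (z + (0, c)) ^ m) (θ := (Ioo a b).indicator 1)
    (by fun_prop) (fun z => by
      have hB0 : 0 ≤ B := (abs_nonneg _).trans (hB z)
      rw [abs_mul, abs_pow, abs_pow]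
      gcongr
      exacts [hB _, hB _]) timeCut_indicator
  refine this.congr (ae_of_all _ fun z => ?_)
  simp only [prodCut]
  ring

lemma tsum_scale_rpow_mul (α s X : ℝ) :
    ∑' n, scale n ^ α * (scale n ^ s * X) = X * ∑' n, scale n ^ (α + s) := by
  rw [← tsum_mul_left]
  refine tsum_congr fun n => ?_
  rw [Real.rpow_add (scale_pos n)]
  ring

lemma summable_scale_rpow_mul' {α s : ℝ} (h : 0 < α + s) (X : ℝ) :
    Summable fun n => scale n ^ α * (scale n ^ s * X) := by
  simpa only [mul_comm X] using summable_scale_rpow_mul (C := X) h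

/-- A non-uniform bound on the time increments of a weak flow. -/
lemma WeakFlow.exists_time_increment_le {α γ lam Lam T Q : ℝ} {w : SpaceTime → ℝ}
    {G H : SpaceTime → Plane} (hf : WeakFlow α γ lam Lam T Q w G H) (hγ : 0 < γ) (hγ1 : γ ≤ 1)
    (hαγ : 0 < α + γ) (hLam : 0 ≤ Lam) (hQ : 0 ≤ Q) {a b : ℝ} (ha : 0 < a) (hb : b < T) :
    ∃ Θ, 0 ≤ Θ ∧ ∀ τ, 0 < τ → a + τ < b →
      ∫ z in unitCell ×ˢ Ioo (a + τ) b, (w z - w (z - (0, τ))) ^ 2 ≤ τ * Θ := by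
  obtain ⟨K, hK0, hK⟩ := hf.exists_holderBdd hγ
  choose L hL0 hL using fun k => exists_holderBdd_pow (γ := γ) hK0 k
  have hM : ∀ k, 0 ≤ 2 * (L k * (K + K)) := fun k => by have := hL0 k; positivity
  choose C hC0 hC using fun k => exists_holder_modulus hγ hγ1 (hM k) a b
  -- The moduli come from the Hölder norm of `w`, so this bound is not uniform in `w`; it only
  -- provides the finite starting point for the absorption in `exists_incrBound`.
  refine ⟨Q * (∑ k ∈ Finset.range 3, (C k + ∑' n, scale n ^ α * (C k * scale n ^ γ))) +
        2 * Lam * (∫ z in unitCell ×ˢ Ioo a b, ‖G z‖ ^ 2) +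
        4 * ∫ z in unitCell ×ˢ Ioo a b, |w z| ^ 4, ?_, fun τ hτ hab => ?_⟩
  · have h1 : 0 ≤ ∫ z in unitCell ×ˢ Ioo a b, ‖G z‖ ^ 2 := integral_nonneg fun z => by positivity
    have h2 : 0 ≤ ∫ z in unitCell ×ˢ Ioo a b, |w z| ^ 4 := integral_nonneg fun z => by positivity
    have h3 : ∀ k, 0 ≤ ∑' n, scale n ^ α * (C k * scale n ^ γ) := fun k => tsum_nonneg fun n =>
      mul_nonneg (scale_rpow_nonneg _ _) (mul_nonneg (hC0 k) (scale_rpow_nonneg _ _))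
    have h4 := Finset.sum_nonneg (s := Finset.range 3) fun k _ => add_nonneg (hC0 k) (h3 k)
    positivity
  · refine hf.time_increment_le hγ hγ1 hαγ hLam hQ ha hb hτ (β := C)
      (c := fun k n => C k * scale n ^ γ) (fun k _ r hr => ?_)
      fun k _ => summable_scale_rpow_mul hαγ
    have hg : HolderBdd γ (K + K) fun z : SpaceTime =>
        w (z - (0, r)) - w (z - (0, r) - (0, τ)) :=
      (hK.sub (hK.comp_sub (0, τ))).comp_sub (0, r)
    have := hC k _ _ ((hL k w hK).mul hg)
      (((timeCut_indicator (A := a + τ) (B := b)).translate r).mono (A' := a) (B' := b)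
        (by linarith [hr.1]) (by linarith [hr.2]))
    refine ⟨(le_of_eq ?_).trans this.1, fun n d h1 h2 => (le_of_eq ?_).trans (this.2 n d h1 h2)⟩
    · refine integral_congr_ae (ae_of_all _ fun z => ?_)
      simp only [timeCutOff, Prod.snd_sub]
      rw [mul_assoc]
    · refine integral_congr_ae (ae_of_all _ fun z => ?_)
      simp only [timeCutOff, Prod.snd_sub, mul_assoc]

set_option maxHeartbeats 1000000 in
/-- The time increments of a weak flow, in terms of its moduli of continuity. -/
lemma exists_time_increment_le_incr {α : ℝ} (hα : 0 < α + 1 / 4) {Lam T Q : ℝ} (hLam : 0 ≤ Lam)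
    (hT : 0 ≤ T) (hQ : 0 ≤ Q) {η : ℝ} (hη : 0 < η) :
    ∃ C, 0 ≤ C ∧ ∀ (γ lam T' : ℝ) (w : SpaceTime → ℝ) (G H : SpaceTime → Plane), 0 < γ → γ ≤ 1 →
      0 < α + γ → T' ≤ T → WeakFlow α γ lam Lam T' Q w G H → ∀ a b S, 0 < a → a ≤ b → b < T' →
      0 ≤ S → IncrBound w a b S → ∀ τ, 0 < τ → a + τ < b →
      ∫ z in unitCell ×ˢ Ioo (a + τ) b, (w z - w (z - (0, τ))) ^ 2 ≤
        τ * (2 * Lam * (∫ z in unitCell ×ˢ Ioo a b, ‖G z‖ ^ 2) +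
          4 * (∫ z in unitCell ×ˢ Ioo a b, |w z| ^ 4) +
          (η * ((∫ z in unitCell ×ˢ Ioo a b, |w z| ^ 4) + S) + C)) := by
  set Z := ∑' n, scale n ^ (α + 1 / 4) with hZ
  have hZ0 : 0 ≤ Z := tsum_nonneg fun n => scale_rpow_nonneg _ _
  -- The factor with which the three moduli enter: three products, two terms in each increment, the
  -- `L¹` norm and the dyadic sum. The `+ 1` keeps it positive.
  set N := 6 * Q * (1 + Z) + 1 with hN
  have hN0 : 0 < N := by positivity
  -- The products `w ^ k` times one further factor have degree at most `3`.
  obtain ⟨C, hC0, hC⟩ := exists_product_modulus (q := 4) (by norm_num) hT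
    (η := η / N) (by positivity)
  refine ⟨N * C, by positivity, fun γ lam T' w G H hγ hγ1 hαγ hT' hf a b S ha hab hb hS hI τ hτ
    hτb => ?_⟩
  obtain ⟨K, hK0, hK⟩ := hf.exists_holderBdd hγ
  set K₄ := ∫ z in unitCell ×ˢ Ioo a b, |w z| ^ 4 with hK₄
  have hK₄0 : 0 ≤ K₄ := integral_nonneg fun z => by positivity
  set X := η / N * (K₄ + S) + C with hX
  have hX0 : 0 ≤ X := by positivity
  have key := hf.time_increment_le hγ hγ1 hαγ hLam hQ ha hb hτ
    (β := fun _ => (η / N * K₄ + C) + (η / N * K₄ + C))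
    (c := fun _ n => scale n ^ (1 / 4 : ℝ) * (X + X)) (fun k hk r hr => by
      simp only [chi_mul_timeCutOff_increment]
      have h1 := hC w K a b (-r) (a + τ + r) (b + r) S k 1 hK.1 hf.per_w hK.2.1 hab (by linarith)
        (by omega) hS hI (fun t ht => ⟨by linarith [ht.1, hr.1], by linarith [ht.2, hr.2]⟩)
        (fun t ht => ⟨by linarith [ht.1, hr.1], by linarith [ht.2, hr.2]⟩)
      have h2 := hC w K a b (-r - τ) (a + τ + r) (b + r) S k 1 hK.1 hf.per_w hK.2.1 hab
        (by linarith) (by omega) hS hI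
        (fun t ht => ⟨by linarith [ht.1, hr.1], by linarith [ht.2, hr.2]⟩)
        (fun t ht => ⟨by linarith [ht.1, hr.1], by linarith [ht.2, hr.2]⟩)
      have := h1.sub h2 (integrable_prodCut hK.1 hK.2.1 _ _ _ _ _)
        (integrable_prodCut hK.1 hK.2.1 _ _ _ _ _)
      simp only [← mul_add] at this
      simpa [hX] using this)
    (fun k _ => summable_scale_rpow_mul' hα _)
  refine key.trans (mul_le_mul_of_nonneg_left ?_ hτ.le)
  rw [tsum_scale_rpow_mul, Finset.sum_const, Finset.card_range, nsmul_eq_mul, ← hZ]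
  have h1 : η / N * K₄ + C ≤ X := by
    have : 0 ≤ η / N * S := by positivity
    rw [hX]; linarith
  have h2 : N * X = η * (K₄ + S) + N * C := by rw [hX]; field_simp
  have h3 : Q * (((3 : ℕ) : ℝ) * ((η / N * K₄ + C) + (η / N * K₄ + C) + (X + X) * Z)) ≤ N * X := by
    calc _ ≤ Q * (((3 : ℕ) : ℝ) * (X + X + (X + X) * Z)) := by gcongr
      _ = 6 * Q * (1 + Z) * X := by push_cast; ring
      _ ≤ N * X := by rw [hN]; linarith
  linarith

/-- The `L²` moduli of continuity of a weak flow are controlled by its energy. -/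
theorem exists_incrBound {α : ℝ} (hα : 0 < α + 1 / 4) {Lam T Q : ℝ} (hLam : 0 ≤ Lam)
    (hT : 0 ≤ T) (hQ : 0 ≤ Q) :
    ∃ C, 0 ≤ C ∧ ∀ (γ lam T' : ℝ) (w : SpaceTime → ℝ) (G H : SpaceTime → Plane), 0 < γ → γ ≤ 1 →
      0 < α + γ → T' ≤ T → WeakFlow α γ lam Lam T' Q w G H → ∀ a b, 0 < a → a ≤ b → b < T' →
      IncrBound w a b (C * ((∫ z in unitCell ×ˢ Ioo a b, ‖G z‖ ^ 2) +
        (∫ z in unitCell ×ˢ Ioo a b, |w z| ^ 4) + 1)) := by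
  obtain ⟨C, hC0, hC⟩ := exists_time_increment_le_incr hα hLam hT hQ (η := 1 / 4) (by norm_num)
  refine ⟨64 + 4 * (2 * Lam + 16 + 5 + C + 1), by positivity,
    fun γ lam T' w G H hγ hγ1 hαγ hT' hf a b ha hab hb => ?_⟩
  obtain ⟨K, hK0, hK⟩ := hf.exists_holderBdd hγ
  set D := ∫ z in unitCell ×ˢ Ioo a b, ‖G z‖ ^ 2 with hD
  set K₄ := ∫ z in unitCell ×ˢ Ioo a b, |w z| ^ 4 with hK₄
  have hK₄0 : 0 ≤ K₄ := integral_nonneg fun z => by positivity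
  have hD0 : 0 ≤ D := integral_nonneg fun z => by positivity
  -- All admissible constants in the time-increment bound. Absorption is done on the infimum of this
  -- set, which is finite by the non-uniform bound.
  set 𝒳 : Set ℝ := {Θ | 0 ≤ Θ ∧ ∀ τ, 0 < τ → a + τ < b →
      ∫ z in unitCell ×ˢ Ioo (a + τ) b, (w z - w (z - (0, τ))) ^ 2 ≤ τ * Θ} with hX
  have hinc : ∀ Θ ∈ 𝒳, IncrBound w a b (64 * D + 2 * Θ) := fun Θ hΘ =>
    incrBound_of_space_time hK.1 hK.2.1 hΘ.1 hD0
      (fun y hy => hf.space_increment_le hγ ha hb hy) hΘ.2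
  set A := 2 * Lam * D + 4 * K₄ + (1 / 4 * (K₄ + 64 * D) + C) with hA
  have hA0 : 0 ≤ A := by positivity
  -- An admissible `Θ` makes `64 * D + 2 * Θ` a bound on the increments, of which a quarter returns:
  -- a contraction with factor `1 / 2`.
  have hstep : ∀ Θ ∈ 𝒳, A + Θ / 2 ∈ 𝒳 := fun Θ hΘ => by
    have := hΘ.1
    refine ⟨by positivity, fun τ hτ hτb => ?_⟩
    refine (hC γ lam T' w G H hγ hγ1 hαγ hT' hf a b (64 * D + 2 * Θ) ha hab hb (by positivity)
      (hinc Θ hΘ) τ hτ hτb).trans (le_of_eq ?_)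
    rw [hA]; ring
  obtain ⟨Θ₀, hΘ₀⟩ := hf.exists_time_increment_le hγ hγ1 hαγ hLam hQ ha hb
  have hne : 𝒳.Nonempty := ⟨Θ₀, hΘ₀⟩
  have hbdd : BddBelow 𝒳 := ⟨0, fun Θ hΘ => hΘ.1⟩
  have hinf : sInf 𝒳 ≤ 2 * A := by
    refine le_of_forall_pos_le_add fun ε hε => ?_
    obtain ⟨Θ, hΘ, hlt⟩ := exists_lt_of_csInf_lt hne (lt_add_of_pos_right (sInf 𝒳) hε)
    have := csInf_le hbdd (hstep Θ hΘ)
    linarith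
  -- The `+ 1` leaves room to pick an element of the set without showing that the infimum is
  -- attained.
  obtain ⟨Θ, hΘ, hlt⟩ := exists_lt_of_csInf_lt hne (show sInf 𝒳 < 2 * A + 1 by linarith)
  intro n d h1 h2
  refine (hinc Θ hΘ n d h1 h2).trans (mul_le_mul_of_nonneg_right ?_ (sq_nonneg _))
  nlinarith [mul_nonneg hLam hK₄0, mul_nonneg hC0 hK₄0, mul_nonneg hC0 hD0]

/-! ### The energy inequality for powers. -/

/-- The tangent line inequality for the convex function `x ^ (m + 1)`, obtained from Bernoulli's
inequality for `|y| / |x|`. It replaces the chain rule in time. -/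
lemma sub_mul_pow_ge {m : ℕ} (hm : Odd m) (x y : ℝ) :
    x ^ (m + 1) - y ^ (m + 1) ≤ (m + 1) * ((x - y) * x ^ m) := by
  have he : Even (m + 1) := hm.add_odd odd_one
  have h1 : y * x ^ m ≤ |y| * |x| ^ m := by
    rw [← abs_pow, ← abs_mul]; exact le_abs_self _
  have h2 : |x| ^ (m + 1) + (m + 1) * (|y| * |x| ^ m - |x| ^ (m + 1)) ≤ |y| ^ (m + 1) := by
    rcases (abs_nonneg x).eq_or_lt with h | h
    · rw [← h, zero_pow (by omega), zero_pow (by rintro rfl; simp at hm)]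
      simp only [mul_zero, sub_zero, add_zero]
      positivity
    · have := one_add_mul_sub_le_pow (a := |y| / |x|) (n := m + 1)
        (by have : 0 ≤ |y| / |x| := by positivity
            linarith)
      have := mul_le_mul_of_nonneg_left this (pow_pos h (m + 1)).le
      rw [div_pow, mul_div_cancel₀ _ (pow_pos h (m + 1)).ne'] at this
      refine le_trans (le_of_eq ?_) this
      push_cast
      field_simp
      ring
  rw [he.pow_abs, he.pow_abs] at h2
  have h3 : (m + 1 : ℝ) * (y * x ^ m) ≤ (m + 1) * (|y| * |x| ^ m) :=
    mul_le_mul_of_nonneg_left h1 (by positivity)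
  rw [pow_succ x] at *
  nlinarith

/-- Fubini's theorem on a time cylinder. -/
lemma setIntegral_cyl_eq {v : SpaceTime → ℝ} (hv : Continuous v) {B : ℝ} (hB : ∀ z, |v z| ≤ B)
    {a b : ℝ} (hab : a ≤ b) : ∫ z in unitCell ×ˢ Ioo a b, v z =
      ∫ t in a..b, ∫ x in unitCell, v (x, t) := by
  have hi : IntegrableOn v (unitCell ×ˢ Ioo a b) :=
    integrableOn_cyl_of_bound hv.aestronglyMeasurable fun z _ => hB z
  rw [intervalIntegral.integral_of_le hab, integral_Ioc_eq_integral_Ioo]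
  rw [Measure.volume_eq_prod, IntegrableOn, ← Measure.prod_restrict] at *
  rw [integral_prod_symm _ hi]

/-- The integral of a function over the torus at a fixed time. -/
def cellIntegral (v : SpaceTime → ℝ) (t : ℝ) : ℝ := ∫ x in unitCell, v (x, t)

lemma HolderBdd.abs_cellIntegral_sub_le {γ K : ℝ} {v : SpaceTime → ℝ} (hv : HolderBdd γ K v)
    (s t : ℝ) : |cellIntegral v s - cellIntegral v t| ≤
      (volume unitCell).toReal * (K * √|s - t| ^ γ) := by
  have : IsFiniteMeasure (volume.restrict unitCell) := ⟨by simpa using volume_unitCell_lt_top⟩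
  have hi : ∀ t, IntegrableOn (fun x : Plane => v (x, t)) unitCell := fun t =>
    Integrable.of_bound (hv.1.comp (by fun_prop)).aestronglyMeasurable K
      (ae_of_all _ fun x => hv.2.1 _)
  rw [cellIntegral, cellIntegral, ← integral_sub (hi s) (hi t), ← Real.norm_eq_abs]
  refine (norm_setIntegral_le_of_norm_le_const volume_unitCell_lt_top (C := K * √|s - t| ^ γ)
    fun x _ => ?_).trans (le_of_eq ?_)
  · refine (hv.2.2 _ _).trans (le_of_eq ?_)
    simp [parabolicSize]
  · rw [mul_comm]; rfl

lemma tendsto_sqrt_rpow {γ : ℝ} (hγ : 0 < γ) : Tendsto (fun r : ℝ => √|r| ^ γ) (𝓝 0) (𝓝 0) := by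
  have : Continuous fun r : ℝ => √|r| ^ γ :=
    (Real.continuous_sqrt.comp continuous_abs).rpow_const fun _ => Or.inr hγ.le
  have h := this.tendsto 0
  simpa [Real.zero_rpow hγ.ne'] using h

lemma HolderBdd.continuous_cellIntegral {γ K : ℝ} (hγ : 0 < γ) {v : SpaceTime → ℝ}
    (hv : HolderBdd γ K v) : Continuous (cellIntegral v) := by
  rw [continuous_iff_continuousAt]
  intro t
  rw [ContinuousAt, tendsto_iff_dist_tendsto_zero]
  have h0 : Tendsto (fun s => s - t) (𝓝 t) (𝓝 0) := by
    have : Continuous fun s : ℝ => s - t := by fun_prop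
    simpa using this.tendsto t
  have := (((tendsto_sqrt_rpow hγ).comp h0).const_mul K).const_mul (volume unitCell).toReal
  rw [mul_zero, mul_zero] at this
  exact squeeze_zero (fun _ => dist_nonneg) (fun s => hv.abs_cellIntegral_sub_le s t) this

/-- Time difference quotients of `∫ v` over a time interval converge to the difference of the
boundary values. -/
lemma HolderBdd.eventually_cellIntegral_sub_le {γ K : ℝ} (hγ : 0 < γ) {v : SpaceTime → ℝ}
    (hv : HolderBdd γ K v) {a b : ℝ} (hab : a ≤ b) {δ : ℝ} (hδ : 0 < δ) : ∀ᶠ h in 𝓝[>] 0,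
    h * (cellIntegral v b - cellIntegral v a - δ) ≤
      ∫ z in unitCell ×ˢ Ioo a b, (v z - v (z - (0, h))) := by
  set F := cellIntegral v with hF
  have hFc : Continuous F := hv.continuous_cellIntegral hγ
  have hb := Metric.continuous_iff.1 hFc b (δ / 2) (by positivity)
  have ha := Metric.continuous_iff.1 hFc a (δ / 2) (by positivity)
  obtain ⟨r₁, hr₁, hb⟩ := hb
  obtain ⟨r₂, hr₂, ha⟩ := ha
  filter_upwards [Ioo_mem_nhdsGT (lt_min hr₁ hr₂)] with h hh
  have hh0 : 0 < h := hh.1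
  have hi : ∀ c d, IntervalIntegrable F volume c d := fun c d => hFc.intervalIntegrable c d
  have e1 : ∫ z in unitCell ×ˢ Ioo a b, (v z - v (z - (0, h))) =
      (∫ t in a..b, F t) - ∫ t in a..b, F (t - h) := by
    have hc2 : Continuous fun z : SpaceTime => v (z - (0, h)) := hv.1.comp (by fun_prop)
    rw [integral_sub (integrableOn_cyl_of_bound hv.1.aestronglyMeasurable fun z _ => hv.2.1 z)
      (integrableOn_cyl_of_bound hc2.aestronglyMeasurable fun z _ => hv.2.1 _),
      setIntegral_cyl_eq hv.1 hv.2.1 hab, setIntegral_cyl_eq hc2 (fun z => hv.2.1 _) hab]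
    simp [hF, cellIntegral]
  -- After cancellation only two layers of width `h` at the ends remain, where continuity in time
  -- applies.
  have e2 : (∫ t in a..b, F t) - ∫ t in a..b, F (t - h) =
      (∫ t in (b - h)..b, F t) - ∫ t in (a - h)..a, F t := by
    rw [intervalIntegral.integral_comp_sub_right F h,
      ← intervalIntegral.integral_add_adjacent_intervals (hi a (b - h)) (hi (b - h) b),
      ← intervalIntegral.integral_add_adjacent_intervals (hi (a - h) a) (hi a (b - h))]
    ring
  have e3 : h * (F b - δ / 2) ≤ ∫ t in (b - h)..b, F t := by
    have := intervalIntegral.integral_mono_on (a := b - h) (b := b) (by linarith)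
      (intervalIntegrable_const (c := F b - δ / 2)) (hi (b - h) b) fun t ht => by
        have := hb t (by rw [Real.dist_eq, abs_lt]; constructor <;>
          linarith [ht.1, ht.2, hh.2, min_le_left r₁ r₂])
        rw [Real.dist_eq, abs_lt] at this
        linarith [this.1]
    rwa [intervalIntegral.integral_const, smul_eq_mul, sub_sub_cancel] at this
  have e4 : ∫ t in (a - h)..a, F t ≤ h * (F a + δ / 2) := by
    have := intervalIntegral.integral_mono_on (a := a - h) (b := a) (by linarith)
      (hi (a - h) a) (intervalIntegrable_const (c := F a + δ / 2)) fun t ht => by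
        have := ha t (by rw [Real.dist_eq, abs_lt]; constructor <;>
          linarith [ht.1, ht.2, hh.2, min_le_right r₁ r₂])
        rw [Real.dist_eq, abs_lt] at this
        linarith [this.2]
    rwa [intervalIntegral.integral_const, smul_eq_mul, sub_sub_cancel] at this
  rw [e1, e2]
  linarith

/-- Products of an `L²` field with small translations of another one. -/
lemma eventually_integral_mul_translate_le {V Γ : SpaceTime → Plane} (hV : Measurable V)
    (hΓm : Measurable Γ) (hΓp : Per Γ) {a b a' b' : ℝ}
    (hVi : IntegrableOn (fun z => ‖V z‖ ^ 2) (unitCell ×ˢ Ioo a' b'))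
    (hs : ∀ z, z.2 ∉ Ioo a b → Γ z = 0)
    (hΓi : IntegrableOn (fun z => ‖Γ z‖ ^ 2) (unitCell ×ˢ Ioo a b)) {δ : ℝ} (hδ : 0 < δ) :
    ∀ᶠ r : ℝ in 𝓝 0,
      IntegrableOn (fun z => ‖V z‖ * ‖Γ (z - (0, r)) - Γ z‖) (unitCell ×ˢ Ioo a' b') ∧
      ∫ z in unitCell ×ˢ Ioo a' b', ‖V z‖ * ‖Γ (z - (0, r)) - Γ z‖ ≤ δ := by
  set D := ∫ z in unitCell ×ˢ Ioo a' b', ‖V z‖ ^ 2 with hD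
  have hD0 : 0 ≤ D := integral_nonneg fun z => by positivity
  set ε := δ / (2 * (D + 1)) with hε
  have hε0 : 0 < ε := by positivity
  have hεD : ε * D ≤ δ / 2 := by
    rw [hε, div_mul_eq_mul_div, div_le_div_iff₀ (by positivity) (by norm_num)]
    nlinarith
  have h0 : Tendsto (fun r : ℝ => ((0 : Plane), r)) (𝓝 0) (𝓝 0) := by
    have : Continuous fun r : ℝ => ((0 : Plane), r) := by fun_prop
    exact this.tendsto 0
  have ht := ((tendsto_setLIntegral_translate hΓm hΓp hs hΓi).comp h0).eventually
    (gt_mem_nhds (show (0 : ℝ≥0∞) < ENNReal.ofReal (2 * ε * δ) by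
      rw [ENNReal.ofReal_pos]; positivity))
  filter_upwards [ht] with r hr
  simp only [Function.comp_apply] at hr
  have hΓ0 : ∀ z, z.2 ∉ Ioo a b → ‖Γ z‖ ^ 2 = 0 := fun z hz => by rw [hs z hz]; simp
  have hiu : IntegrableOn (fun z => ‖Γ z‖ ^ 2) (unitCell ×ˢ univ) := integrableOn_univ_of_cyl hΓ0 hΓi
  have hΔm : Measurable fun z => Γ (z - (0, r)) - Γ z :=
    (hΓm.comp (measurable_id.sub_const _)).sub hΓm
  have hiΔ : IntegrableOn (fun z => ‖Γ (z - (0, r)) - Γ z‖ ^ 2) (unitCell ×ˢ univ) := by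
    refine Integrable.mono' (((integrableOn_timeShift hiu r).const_mul 2).add (hiu.const_mul 2))
      (hΔm.norm.pow_const 2).aestronglyMeasurable (ae_of_all _ fun z => ?_)
    rw [norm_pow, norm_norm]
    exact sq_norm_sub_le _ _
  have hsub : unitCell ×ˢ Ioo a' b' ⊆ unitCell ×ˢ (univ : Set ℝ) := prod_mono_right (subset_univ _)
  have hΔ : ∫ z in unitCell ×ˢ univ, ‖Γ (z - (0, r)) - Γ z‖ ^ 2 ≤ 2 * ε * δ := by
    rw [setIntegral_sq_norm_eq_toReal hΔm]
    exact ENNReal.toReal_le_of_le_ofReal (by positivity) hr.le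
  have hΔ' : ∫ z in unitCell ×ˢ Ioo a' b', ‖Γ (z - (0, r)) - Γ z‖ ^ 2 ≤ 2 * ε * δ :=
    (setIntegral_mono_set hiΔ (ae_of_all _ fun z => by positivity) hsub.eventuallyLE).trans hΔ
  have j1 : IntegrableOn (fun z => ε * ‖V z‖ ^ 2) (unitCell ×ˢ Ioo a' b') := hVi.const_mul _
  have j2 : IntegrableOn (fun z => 1 / (4 * ε) * ‖Γ (z - (0, r)) - Γ z‖ ^ 2)
    (unitCell ×ˢ Ioo a' b') := (hiΔ.mono_set hsub).const_mul _
  have j12 : IntegrableOn (fun z => ε * ‖V z‖ ^ 2 + 1 / (4 * ε) * ‖Γ (z - (0, r)) - Γ z‖ ^ 2)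
    (unitCell ×ˢ Ioo a' b') := j1.add j2
  have hpt : ∀ z, ‖V z‖ * ‖Γ (z - (0, r)) - Γ z‖ ≤
      ε * ‖V z‖ ^ 2 + 1 / (4 * ε) * ‖Γ (z - (0, r)) - Γ z‖ ^ 2 := fun z => by
    have h1 := sq_nonneg (2 * ε * ‖V z‖ - ‖Γ (z - (0, r)) - Γ z‖)
    have h2 : 0 ≤ 1 / (4 * ε) * (2 * ε * ‖V z‖ - ‖Γ (z - (0, r)) - Γ z‖) ^ 2 := by positivity
    have h3 : 1 / (4 * ε) * (2 * ε * ‖V z‖ - ‖Γ (z - (0, r)) - Γ z‖) ^ 2 =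
      ε * ‖V z‖ ^ 2 + 1 / (4 * ε) * ‖Γ (z - (0, r)) - Γ z‖ ^ 2 -
        ‖V z‖ * ‖Γ (z - (0, r)) - Γ z‖ := by field_simp; ring
    linarith
  have hint : IntegrableOn (fun z => ‖V z‖ * ‖Γ (z - (0, r)) - Γ z‖) (unitCell ×ˢ Ioo a' b') := by
    refine Integrable.mono' (j1.add j2) (hV.norm.mul hΔm.norm).aestronglyMeasurable
      (ae_of_all _ fun z => ?_)
    rw [Real.norm_eq_abs, abs_of_nonneg (by positivity)]
    exact hpt z
  refine ⟨hint, ?_⟩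
  calc _ ≤ ∫ z in unitCell ×ˢ Ioo a' b',
        (ε * ‖V z‖ ^ 2 + 1 / (4 * ε) * ‖Γ (z - (0, r)) - Γ z‖ ^ 2) :=
        integral_mono hint j12 hpt
    _ = ε * D + 1 / (4 * ε) * ∫ z in unitCell ×ˢ Ioo a' b', ‖Γ (z - (0, r)) - Γ z‖ ^ 2 := by
        rw [integral_add j1 j2, integral_const_mul, integral_const_mul]
    _ ≤ δ / 2 + 1 / (4 * ε) * (2 * ε * δ) := by gcongr
    _ = δ := by field_simp; ring

set_option maxHeartbeats 2000000 in
/-- The energy inequality for the power `w ^ (m + 1)`, in terms of the moduli of continuity of the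
products of `w ^ k` with time translations of `w ^ m`. -/
theorem WeakFlow.energy_le {α γ lam Lam T Q : ℝ} {w : SpaceTime → ℝ}
    {G H : SpaceTime → Plane} (hf : WeakFlow α γ lam Lam T Q w G H) (hγ : 0 < γ) (hγ1 : γ ≤ 1)
    (hαγ : 0 < α + γ) (hLam : 0 ≤ Lam) (hQ : 0 ≤ Q) {m : ℕ} (hm : Odd m) {a b κ : ℝ} (ha : 0 < a)
    (hab : a ≤ b) (hb : b < T) (hκ : 0 < κ) {β : ℕ → ℝ} {c : ℕ → ℕ → ℝ}
    (hseq : ∀ k < 3, ∀ r ∈ Icc (-κ) 0, ModSeq (fun z => chi z * (w z ^ k *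
      timeCutOff a b (fun z => w z ^ m) (z - (0, r)))) (β k) (c k))
    (hsum : ∀ k < 3, Summable fun n => scale n ^ α * c k n) :
    cellIntegral (fun z => w z ^ (m + 1)) b + (m + 1) *
      (lam * m * (∫ z in unitCell ×ˢ Ioo a b, w z ^ (m - 1) * ‖G z‖ ^ 2) +
        ∫ z in unitCell ×ˢ Ioo a b, |w z| ^ (m + 3)) ≤
    cellIntegral (fun z => w z ^ (m + 1)) a +
      (m + 1) * (Q * (∑ k ∈ Finset.range 3, (β k + ∑' n, scale n ^ α * c k n))) := by
  obtain ⟨K, hK0, hK⟩ := hf.exists_holderBdd hγ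
  obtain ⟨L, hL0, hL⟩ := exists_holderBdd_pow (γ := γ) hK0 (m + 1)
  obtain ⟨L₃, hL₃0, hL₃⟩ := exists_holderBdd_pow (γ := γ) hK0 3
  have hme : Even (m - 1) := by
    obtain ⟨j, rfl⟩ := hm
    simp
  set X₀ := ∑ k ∈ Finset.range 3, (β k + ∑' n, scale n ^ α * c k n) with hX₀
  set E := ∫ z in unitCell ×ˢ Ioo a b, w z ^ (m - 1) * ‖G z‖ ^ 2 with hE
  set P := ∫ z in unitCell ×ˢ Ioo a b, |w z| ^ (m + 3) with hP
  set a' := a / 2 with ha'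
  set b' := (b + T) / 2 with hb'
  have haa' : a' < a := by rw [ha']; linarith
  have hbb' : b < b' := by rw [hb']; linarith
  set V := timeCutVec a b G with hV
  set Γ : SpaceTime → Plane := fun z => (m * w z ^ (m - 1)) • V z with hΓ
  -- With this weight `μ • G` equals the gradient `Γ` of the test function exactly, so the error in
  -- `WeakFlow.test` is only the effect of translating `Γ` in time. It is nonnegative because `m` is
  -- odd.
  set μ := timeCutOff a b fun z => m * w z ^ (m - 1) with hμ
  have hμV : ∀ z, μ z • G z = Γ z := fun z => by
    rw [hμ, hΓ, hV, timeCutOff]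
    simp only
    by_cases hz : z.2 ∈ Ioo a b
    · rw [indicator_of_mem hz, timeCutVec_of_mem hz, Pi.one_apply, mul_one]
    · rw [indicator_of_notMem hz, timeCutVec_of_notMem hz, mul_zero, zero_smul, smul_zero]
  have hμm : Measurable μ := by
    have := measurable_timeInd a b 0
    simp only [add_zero] at this
    exact ((hK.1.measurable.pow_const _).const_mul _).mul this
  have hμp : Per μ := fun k z => by
    simp only [hμ, timeCutOff, hf.per_w k z, Prod.snd_add, add_zero]
  have hμ0 : ∀ z, 0 ≤ μ z := fun z =>
    mul_nonneg (mul_nonneg (Nat.cast_nonneg _) (hme.pow_nonneg _)) (timeInd_nonneg _ _ _)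
  have hμK : ∀ z, μ z ≤ m * K ^ (m - 1) := fun z => by
    have h1 : w z ^ (m - 1) ≤ K ^ (m - 1) := by
      rw [← hme.pow_abs]; exact pow_le_pow_left₀ (abs_nonneg _) (hK.2.1 z) _
    have h2 := hme.pow_nonneg (w z)
    rw [hμ, timeCutOff]
    rcases timeInd_cases a b z.2 with ⟨e, _⟩ | ⟨e, _⟩ <;> rw [e]
    · rw [mul_zero]; positivity
    · rw [mul_one]; gcongr
  have hA := (hf.smoothApprox hγ ha hb).pow m
  have hVp : Per V := per_timeCutVec hf.per_G
  have hΓp : Per Γ := fun k z => by simp only [hΓ, hf.per_w k z, hVp k z]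
  have hGi := hf.sqInt a' b' (by positivity) (by rw [hb']; linarith)
  set V₁ := (volume (unitCell ×ˢ Ioo a b)).toReal with hV₁
  refine le_of_forall_pos_le_add fun ε hε => ?_
  -- Chosen to cover `Lam * δ` from the translated gradient, `δ` from the translated cubic factor,
  -- both multiplied by `m + 1`, and `δ` from the boundary values.
  set δ := ε / ((m + 1) * (Lam + 1) + 1) with hδ
  have hδ0 : 0 < δ := by positivity
  have hev1 := eventually_integral_mul_translate_le (a := a) (b := b) hf.meas_G (Γ := Γ) hA.meas hΓp
    hGi hA.supp hA.sqInt hδ0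
  have hev2 : ∀ᶠ r : ℝ in 𝓝 0, V₁ * (L₃ * √|r| ^ γ * K ^ m) < δ := by
    have := (((tendsto_sqrt_rpow hγ).const_mul L₃).mul_const (K ^ m)).const_mul V₁
    rw [mul_zero, zero_mul, mul_zero] at this
    exact this.eventually (gt_mem_nhds hδ0)
  obtain ⟨ρ, hρ0, hρ⟩ := Metric.eventually_nhds_iff.1 (hev1.and hev2)
  have hev3 := (hL w hK).eventually_cellIntegral_sub_le hγ hab hδ0
  obtain ⟨h, hh3, hh⟩ := (hev3.and (Ioo_mem_nhdsGT
    (show 0 < min κ (min ρ (a / 2)) by positivity))).exists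
  have hh0 : 0 < h := hh.1
  have hhκ : h < κ := hh.2.trans_le (min_le_left _ _)
  have hhρ : h < ρ := hh.2.trans_le ((min_le_right _ _).trans (min_le_left _ _))
  have hha : h < a / 2 := hh.2.trans_le ((min_le_right _ _).trans (min_le_right _ _))
  have hshift : Continuous fun z : SpaceTime => z - ((0 : Plane), h) := by fun_prop
  -- The shift runs over `[-h, 0]` with `h` small, so that the right side is `h` times the energy
  -- dissipation up to `O(δ)`.
  have ht := hf.test hγ hγ1 hαγ hLam hQ (a := a') (b := b') (a₁ := a) (b₁ := b) (r₀ := -h)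
    (r₁ := 0) (by positivity) (by rw [hb']; linarith) (by linarith) (by rw [ha']; linarith)
    (by linarith) hA hμm hμp hμ0 hμK
    (fun k hk r hr => hseq k hk r ⟨by linarith [hr.1], hr.2⟩) hsum
    (R := Q * X₀ - lam * m * E - P + (Lam + 1) * δ) (fun r hr => by
      have hr' : dist r 0 < ρ := by
        rw [Real.dist_eq, sub_zero, abs_lt]
        constructor <;> linarith [hr.1, hr.2]
      obtain ⟨⟨hi1, hle1⟩, hle2⟩ := hρ hr'
      have hμi : IntegrableOn (fun z => μ z * ‖G z‖ ^ 2) (unitCell ×ˢ Ioo a' b') := by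
        refine Integrable.mono' (hGi.const_mul (m * K ^ (m - 1)))
          (hμm.mul (hf.meas_G.norm.pow_const 2)).aestronglyMeasurable (ae_of_all _ fun z => ?_)
        rw [norm_mul, Real.norm_eq_abs, abs_of_nonneg (hμ0 z), norm_pow, norm_norm]
        exact mul_le_mul_of_nonneg_right (hμK z) (by positivity)
      have e1 : ∫ z in unitCell ×ˢ Ioo a' b', μ z * ‖G z‖ ^ 2 = m * E := by
        have h0 : ∀ z, z.2 ∉ Ioo a b → μ z * ‖G z‖ ^ 2 = 0 := fun z hz => by
          rw [hμ, timeCutOff, indicator_of_notMem hz, mul_zero, zero_mul]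
        rw [hE, ← integral_const_mul]
        have h1 := setIntegral_timeShift_cyl (r := 0) h0 (show a' ≤ a + 0 by linarith)
          (show b + 0 ≤ b' by linarith)
        have h2 : ∀ z : SpaceTime, z - ((0 : Plane), (0 : ℝ)) = z := sub_zero
        simp only [h2] at h1
        rw [h1]
        refine setIntegral_congr_fun (measurableSet_cyl _ _) fun z hz => ?_
        simp only [hμ, timeCutOff]
        rw [indicator_of_mem (mem_prod.1 hz).2, Pi.one_apply]
        ring
      have e2 : ∫ z in unitCell ×ˢ Ioo a' b',
          (lam * μ z * ‖G z‖ ^ 2 - Lam * ‖G z‖ * ‖Γ (z - (0, r)) - μ z • G z‖) =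
          lam * (m * E) - Lam * ∫ z in unitCell ×ˢ Ioo a' b', ‖G z‖ * ‖Γ (z - (0, r)) - Γ z‖ := by
        rw [← e1, ← integral_const_mul, ← integral_const_mul,
          ← integral_sub (hμi.const_mul lam) (hi1.const_mul Lam)]
        refine integral_congr_ae (ae_of_all _ fun z => ?_)
        simp only [hμV]
        ring
      have e3 : P - δ ≤ ∫ z in unitCell ×ˢ Ioo a' b',
          w z ^ 3 * timeCutOff a b (fun z => w z ^ m) (z - (0, r)) := by
        set F : SpaceTime → ℝ := fun z =>
          w (z + (0, r)) ^ 3 * timeCutOff a b (fun z => w z ^ m) z with hF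
        have h0 : ∀ z, z.2 ∉ Ioo a b → F z = 0 := fun z hz => by
          rw [hF]; simp only [timeCutOff]
          rw [indicator_of_notMem hz, mul_zero, mul_zero]
        have h1 := setIntegral_timeShift_cyl (r := r) h0 (show a' ≤ a + r by linarith [hr.1])
          (show b + r ≤ b' by linarith [hr.2])
        simp only [hF, sub_add_cancel] at h1
        rw [h1]
        have hcs : Continuous fun z : SpaceTime => w (z + (0, r)) ^ 3 * w z ^ m :=
          ((hK.1.comp (by fun_prop)).pow 3).mul (hK.1.pow m)
        have hb3 : ∀ z : SpaceTime, |w z| ^ (m + 3) - L₃ * √|r| ^ γ * K ^ m ≤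
            w (z + (0, r)) ^ 3 * w z ^ m := fun z => by
          have q1 := (hL₃ w hK).2.2 (z + (0, r)) z
          rw [add_sub_cancel_left, show parabolicSize ((0 : Plane), r) = √|r| by
            simp [parabolicSize]] at q1
          have q2 : |w z| ^ m ≤ K ^ m := pow_le_pow_left₀ (abs_nonneg _) (hK.2.1 z) m
          have q3 : |w z| ^ (m + 3) = w z ^ 3 * w z ^ m := by
            rw [Even.pow_abs (hm.add_odd (by decide)), pow_add, mul_comm]
          have q4 : |(w (z + (0, r)) ^ 3 - w z ^ 3) * w z ^ m| ≤ L₃ * √|r| ^ γ * K ^ m := by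
            rw [abs_mul, abs_pow]
            exact mul_le_mul q1 q2 (by positivity) ((abs_nonneg _).trans q1)
          have q5 := neg_le_of_abs_le q4
          rw [sub_mul] at q5
          rw [q3]
          linarith
        have hiP : IntegrableOn (fun z => |w z| ^ (m + 3)) (unitCell ×ˢ Ioo a b) :=
          integrableOn_cyl_of_bound (C := K ^ (m + 3)) (hK.1.abs.pow _).aestronglyMeasurable
            fun z _ => by
              rw [norm_pow, Real.norm_eq_abs, abs_abs]
              exact pow_le_pow_left₀ (abs_nonneg _) (hK.2.1 z) _
        have hic : IntegrableOn (fun _ : SpaceTime => L₃ * √|r| ^ γ * K ^ m)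
            (unitCell ×ˢ Ioo a b) := integrableOn_const (volume_cyl_lt_top a b).ne
        have hiw : IntegrableOn (fun z : SpaceTime => w (z + (0, r)) ^ 3 * w z ^ m)
            (unitCell ×ˢ Ioo a b) :=
          integrableOn_cyl_of_bound (C := K ^ 3 * K ^ m) hcs.aestronglyMeasurable fun z _ => by
            rw [norm_mul, norm_pow, norm_pow]
            exact mul_le_mul (pow_le_pow_left₀ (norm_nonneg _) (hK.2.1 _) _)
              (pow_le_pow_left₀ (norm_nonneg _) (hK.2.1 z) _) (by positivity) (by positivity)
        have hcongr : ∫ z in unitCell ×ˢ Ioo a b,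
            w (z + (0, r)) ^ 3 * timeCutOff a b (fun z => w z ^ m) z =
            ∫ z in unitCell ×ˢ Ioo a b, w (z + (0, r)) ^ 3 * w z ^ m := by
          refine setIntegral_congr_fun (measurableSet_cyl _ _) fun z hz => ?_
          simp only [timeCutOff]
          rw [indicator_of_mem (mem_prod.1 hz).2, Pi.one_apply, mul_one]
        rw [hcongr]
        calc P - δ ≤ P - V₁ * (L₃ * √|r| ^ γ * K ^ m) := by linarith
          _ = ∫ z in unitCell ×ˢ Ioo a b, (|w z| ^ (m + 3) - L₃ * √|r| ^ γ * K ^ m) := by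
              rw [integral_sub hiP hic, setIntegral_const, smul_eq_mul]
              rfl
          _ ≤ _ := integral_mono (hiP.sub hic) hiw hb3
      have hle1' := mul_le_mul_of_nonneg_left hle1 hLam
      rw [e2]
      linarith)
  -- Convexity bounds differences of `w ^ (m + 1)` by differences of `w` tested with `w ^ m`.
  -- Division by `h` then yields the energy at the endpoints.
  have hconv : ∫ z in unitCell ×ˢ Ioo a b, (w z ^ (m + 1) - w (z - (0, h)) ^ (m + 1)) ≤
      (m + 1) * ∫ z in unitCell ×ˢ Ioo a b, (w (z + (0, 0)) - w (z + (0, -h))) * w z ^ m := by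
    rw [← integral_const_mul]
    have c1 : Continuous fun z : SpaceTime => w z ^ (m + 1) - w (z - (0, h)) ^ (m + 1) :=
      (hK.1.pow _).sub ((hK.1.comp hshift).pow _)
    have c2 : Continuous fun z : SpaceTime =>
        ((m : ℝ) + 1) * ((w (z + (0, 0)) - w (z + (0, -h))) * w z ^ m) :=
      continuous_const.mul (((hK.1.comp (by fun_prop)).sub (hK.1.comp (by fun_prop))).mul
        (hK.1.pow m))
    refine integral_mono (integrableOn_cyl_of_bound (C := L + L) c1.aestronglyMeasurable
      fun z _ => ?_) (integrableOn_cyl_of_bound (C := (m + 1) * ((K + K) * K ^ m))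
      c2.aestronglyMeasurable fun z _ => ?_) fun z => ?_
    · exact (norm_sub_le _ _).trans (add_le_add ((hL w hK).2.1 _) ((hL w hK).2.1 _))
    · rw [norm_mul, norm_mul, Real.norm_of_nonneg (by positivity), norm_pow]
      exact mul_le_mul_of_nonneg_left (mul_le_mul ((norm_sub_le _ _).trans
        (add_le_add (hK.2.1 _) (hK.2.1 _))) (pow_le_pow_left₀ (norm_nonneg _) (hK.2.1 z) _)
        (by positivity) (by positivity)) (by positivity)
    · have e1 : z + ((0 : Plane), (0 : ℝ)) = z := add_zero z
      simp only [e1, ← sub_time_eq]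
      exact sub_mul_pow_ge hm _ _
  have hm0 : (0 : ℝ) ≤ m + 1 := by positivity
  have h4 := hh3.trans (hconv.trans (mul_le_mul_of_nonneg_left ht hm0))
  rw [sub_neg_eq_add, zero_add, mul_left_comm] at h4
  have h5 := le_of_mul_le_mul_left h4 hh0
  have h6 : ((m + 1) * (Lam + 1) + 1) * δ = ε := by rw [hδ]; field_simp
  linarith

/-- Integrals over time cylinders depend continuously on the initial time. -/
lemma tendsto_setIntegral_cyl_left {f : SpaceTime → ℝ} {a b κ : ℝ} (hκ : 0 < κ)
    (hf : IntegrableOn f (unitCell ×ˢ Ioo (a - κ) b)) :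
    Tendsto (fun n : ℕ => ∫ z in unitCell ×ˢ Ioo (a - κ / (n + 1)) b, f z) atTop
      (𝓝 (∫ z in unitCell ×ˢ Ioo a b, f z)) := by
  have hanti : Antitone fun n : ℕ => unitCell ×ˢ Ioo (a - κ / ((n : ℝ) + 1)) b := by
    intro n n' h
    refine prod_mono_right (Ioo_subset_Ioo_left ?_)
    have : κ / ((n' : ℝ) + 1) ≤ κ / ((n : ℝ) + 1) := by gcongr
    linarith
  have ht := tendsto_setIntegral_of_antitone (μ := volume) (f := f)
    (fun n => measurableSet_cyl _ _) hanti ⟨0, by simpa using hf⟩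
  have hset : (⋂ n : ℕ, unitCell ×ˢ Ioo (a - κ / ((n : ℝ) + 1)) b) = unitCell ×ˢ Ico a b := by
    ext z
    simp only [mem_iInter, mem_prod, mem_Ioo, mem_Ico]
    constructor
    · intro h
      refine ⟨(h 0).1, ?_, (h 0).2.2⟩
      have hl : Tendsto (fun n : ℕ => a - κ / ((n : ℝ) + 1)) atTop (𝓝 (a - 0)) :=
        tendsto_const_nhds.sub (tendsto_const_nhds.div_atTop
          (tendsto_atTop_add_const_right _ _ tendsto_natCast_atTop_atTop))
      rw [sub_zero] at hl
      exact le_of_tendsto' hl fun n => (h n).2.1.le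
    · rintro ⟨h1, h2, h3⟩ n
      have : 0 < κ / ((n : ℝ) + 1) := by positivity
      exact ⟨h1, by linarith, h3⟩
  rw [hset] at ht
  convert ht using 2
  refine setIntegral_congr_set ?_
  rw [Measure.volume_eq_prod]
  exact Measure.set_prod_ae_eq (ae_eq_refl _) Ioo_ae_eq_Ico

lemma WeakFlow.integrableOn_pow {α γ lam Lam T Q : ℝ} {w : SpaceTime → ℝ}
    {G H : SpaceTime → Plane} (hf : WeakFlow α γ lam Lam T Q w G H) (hγ : 0 < γ) (q : ℕ)
    (a b : ℝ) : IntegrableOn (fun z => |w z| ^ q) (unitCell ×ˢ Ioo a b) := by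
  obtain ⟨K, hK0, hK⟩ := hf.exists_holderBdd hγ
  refine integrableOn_cyl_of_bound (C := K ^ q) (hK.1.abs.pow _).aestronglyMeasurable fun z _ => ?_
  rw [norm_pow, Real.norm_eq_abs, abs_abs]
  exact pow_le_pow_left₀ (abs_nonneg _) (hK.2.1 z) _

set_option maxHeartbeats 1000000 in
/-- The energy inequality for the power `w ^ (m + 1)`, with the right-hand side controlled by the
good terms. -/
theorem exists_energy_le {α : ℝ} {m : ℕ} (hm : Odd m) (hα : 0 < α + 1 / ((m + 3 : ℕ) : ℝ))
    {Lam T Q : ℝ} (hLam : 0 ≤ Lam) (hT : 0 ≤ T) (hQ : 0 ≤ Q) {η : ℝ} (hη : 0 < η) :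
    ∃ C, 0 ≤ C ∧ ∀ (γ lam T' : ℝ) (w : SpaceTime → ℝ) (G H : SpaceTime → Plane), 0 < γ → γ ≤ 1 →
      0 < α + γ → T' ≤ T → WeakFlow α γ lam Lam T' Q w G H → ∀ a b, 0 < a → a ≤ b → b < T' →
      cellIntegral (fun z => w z ^ (m + 1)) b + (m + 1) *
        (lam * m * (∫ z in unitCell ×ˢ Ioo a b, w z ^ (m - 1) * ‖G z‖ ^ 2) +
          ∫ z in unitCell ×ˢ Ioo a b, |w z| ^ (m + 3)) ≤
      cellIntegral (fun z => w z ^ (m + 1)) a +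
        η * ((∫ z in unitCell ×ˢ Ioo a b, |w z| ^ (m + 3)) +
          (∫ z in unitCell ×ˢ Ioo a b, ‖G z‖ ^ 2) +
          (∫ z in unitCell ×ˢ Ioo a b, |w z| ^ 4)) + C := by
  have hm1 : 1 ≤ m := hm.pos
  have hα4 : 0 < α + 1 / 4 := by
    have : 1 / ((m + 3 : ℕ) : ℝ) ≤ 1 / 4 := by
      apply one_div_le_one_div_of_le (by norm_num)
      have : (4 : ℕ) ≤ m + 3 := by omega
      exact_mod_cast this
    linarith
  obtain ⟨C₁, hC₁0, hC₁⟩ := exists_incrBound hα4 hLam hT hQ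
  set Z := ∑' n, scale n ^ (α + 1 / ((m + 3 : ℕ) : ℝ)) with hZ
  have hZ0 : 0 ≤ Z := tsum_nonneg fun n => scale_rpow_nonneg _ _
  -- The total factor in front of the moduli in `energy_le`, made positive.
  set N := (m + 1) * (3 * Q * (1 + Z)) + 1 with hN
  have hN0 : 0 < N := by positivity
  -- The degree `k + m ≤ m + 2` is one below that of the good term. The extra `1 + C₁` compensates
  -- for `S` being `C₁` times the energy.
  obtain ⟨C, hC0, hC⟩ := exists_product_modulus (q := m + 3) (by omega) hT
    (η := η / (N * (1 + C₁))) (by positivity)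
  refine ⟨η + N * C, by positivity, fun γ lam T' w G H hγ hγ1 hαγ hT' hf a b ha hab hb => ?_⟩
  obtain ⟨K, hK0, hK⟩ := hf.exists_holderBdd hγ
  have hD := tendsto_setIntegral_cyl_left (κ := a / 2) (by positivity)
    (hf.sqInt (a - a / 2) b (by linarith) hb)
  have hP := fun q => tendsto_setIntegral_cyl_left (κ := a / 2) (by positivity)
    (hf.integrableOn_pow hγ q (a - a / 2) b)
  -- The shifted products see times slightly before `a`, so the moduli live on the window `(a - κ,
  -- b)`; the loss disappears as `κ` tends to zero.
  refine ge_of_tendsto' ((((((hP (m + 3)).add hD).add (hP 4)).const_mul η).const_add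
    (cellIntegral (fun z => w z ^ (m + 1)) a)).add_const (η + N * C)) fun n => ?_
  set κ := a / 2 / ((n : ℝ) + 1) with hκ
  have hκ0 : 0 < κ := by positivity
  have hκa : κ < a := by
    have : κ ≤ a / 2 := div_le_self (by positivity) (by linarith [n.cast_nonneg (α := ℝ)])
    linarith
  set D := ∫ z in unitCell ×ˢ Ioo (a - κ) b, ‖G z‖ ^ 2
  set K₄ := ∫ z in unitCell ×ˢ Ioo (a - κ) b, |w z| ^ 4
  set P := ∫ z in unitCell ×ˢ Ioo (a - κ) b, |w z| ^ (m + 3)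
  have hD0 : 0 ≤ D := integral_nonneg fun z => by positivity
  have hK₄0 : 0 ≤ K₄ := integral_nonneg fun z => by positivity
  have hP0 : 0 ≤ P := integral_nonneg fun z => by positivity
  have hI := hC₁ γ lam T' w G H hγ hγ1 hαγ hT' hf (a - κ) b (by linarith) (by linarith) hb
  set S := C₁ * (D + K₄ + 1) with hS
  have hS0 : 0 ≤ S := by positivity
  set X := η / (N * (1 + C₁)) * (P + S) + C with hX
  have hX0 : 0 ≤ X := by positivity
  have key := hf.energy_le hγ hγ1 hαγ hLam hQ hm ha hab hb hκ0
    (β := fun _ => η / (N * (1 + C₁)) * P + C)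
    (c := fun _ n => scale n ^ (1 / ((m + 3 : ℕ) : ℝ)) * X) (fun k hk r hr => by
      simp only [chi_mul_timeCutOff_pow]
      exact hC w K (a - κ) b (-r) (a + r) (b + r) S k m hK.1 hf.per_w hK.2.1 (by linarith)
        (by linarith) (by omega) hS0 hI
        (fun t ht => ⟨by linarith [ht.1, hr.1], by linarith [ht.2, hr.2]⟩)
        (fun t ht => ⟨by linarith [ht.1, hr.1], by linarith [ht.2, hr.2]⟩))
    (fun k _ => summable_scale_rpow_mul' hα _)
  refine key.trans ?_
  rw [tsum_scale_rpow_mul, Finset.sum_const, Finset.card_range, nsmul_eq_mul, ← hZ]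
  have h1 : η / (N * (1 + C₁)) * P + C ≤ X := by
    have : 0 ≤ η / (N * (1 + C₁)) * S := by positivity
    rw [hX]; linarith
  have h2 : N * X = η / (1 + C₁) * (P + S) + N * C := by rw [hX]; field_simp
  have h3 : ((m : ℝ) + 1) * (Q * (((3 : ℕ) : ℝ) * (η / (N * (1 + C₁)) * P + C + X * Z))) ≤ N * X := by
    calc _ ≤ ((m : ℝ) + 1) * (Q * (((3 : ℕ) : ℝ) * (X + X * Z))) := by gcongr
      _ = ((m : ℝ) + 1) * (3 * Q * (1 + Z)) * X := by push_cast; ring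
      _ ≤ N * X := by rw [hN]; linarith
  have h4 : η / (1 + C₁) * (P + S) ≤ η * (P + D + K₄ + 1) := by
    rw [div_mul_eq_mul_div, div_le_iff₀ (by positivity), hS, mul_assoc]
    refine mul_le_mul_of_nonneg_left ?_ hη.le
    nlinarith [mul_nonneg hC₁0 hP0]
  linarith

/-- The a priori bound for weak flows at positive times. -/
theorem exists_cellIntegral_pow_le {p : ℕ} (hp : Even p) (hp2 : 2 ≤ p) {α : ℝ}
    (hα : 0 < α + 1 / ((p + 2 : ℕ) : ℝ)) {lam Lam T Q : ℝ} (hlam : 0 < lam) (hLam : 0 ≤ Lam)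
    (hT : 0 ≤ T) (hQ : 0 ≤ Q) :
    ∃ C, 0 ≤ C ∧ ∀ (γ T' : ℝ) (w : SpaceTime → ℝ) (G H : SpaceTime → Plane), 0 < γ → γ ≤ 1 →
      0 < α + γ → T' ≤ T → WeakFlow α γ lam Lam T' Q w G H → ∀ a b, 0 < a → a ≤ b → b < T' →
      cellIntegral (fun z => w z ^ p) b ≤
        cellIntegral (fun z => w z ^ p) a + C * (1 + cellIntegral (fun z => w z ^ 2) a) := by
  have hα4 : 0 < α + 1 / ((1 + 3 : ℕ) : ℝ) := by
    have : 1 / ((p + 2 : ℕ) : ℝ) ≤ 1 / ((1 + 3 : ℕ) : ℝ) := by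
      apply one_div_le_one_div_of_le (by norm_num)
      have : (1 + 3 : ℕ) ≤ p + 2 := by omega
      exact_mod_cast this
    linarith
  obtain ⟨m, rfl⟩ : ∃ m, p = m + 1 := ⟨p - 1, by omega⟩
  have hm : Odd m := by
    rcases Nat.even_or_odd m with h | h
    · exact absurd hp (Nat.not_even_iff_odd.2 h.add_one)
    · exact h
  have hme : Even (m - 1) := by
    obtain ⟨j, rfl⟩ := hm
    simp
  set ν := min lam 1 with hν
  have hν0 : 0 < ν := by positivity
  -- The case `p = 2`, where the good terms are the ones that bound the increments. With `ν / 2` the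
  -- right side is absorbed and at least `ν * (D + K₄)` remains.
  obtain ⟨C₂, hC₂0, hC₂⟩ := exists_energy_le odd_one hα4 hLam hT hQ (η := ν / 2) (by positivity)
  -- Here `η = 1` suffices: the term `P` is absorbed by `(m + 1) * P`, while `D` and `K₄` are
  -- already bounded by the second moment. The weighted gradient term is only used to be
  -- nonnegative.
  obtain ⟨C₃, hC₃0, hC₃⟩ := exists_energy_le hm hα hLam hT hQ (η := 1) one_pos
  refine ⟨(1 + C₂) / ν + C₃, by positivity, fun γ T' w G H hγ hγ1 hαγ hT' hf a b ha hab hb => ?_⟩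
  have e2 := hC₂ γ lam T' w G H hγ hγ1 hαγ hT' hf a b ha hab hb
  have e3 := hC₃ γ lam T' w G H hγ hγ1 hαγ hT' hf a b ha hab hb
  simp only [Nat.sub_self, pow_zero, one_mul, Nat.cast_one, Nat.reduceAdd] at e2
  set D := ∫ z in unitCell ×ˢ Ioo a b, ‖G z‖ ^ 2
  set K₄ := ∫ z in unitCell ×ˢ Ioo a b, |w z| ^ 4
  set P := ∫ z in unitCell ×ˢ Ioo a b, |w z| ^ (m + 3)
  set E := ∫ z in unitCell ×ˢ Ioo a b, w z ^ (m - 1) * ‖G z‖ ^ 2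
  have hD0 : 0 ≤ D := integral_nonneg fun z => by positivity
  have hK₄0 : 0 ≤ K₄ := integral_nonneg fun z => by positivity
  have hP0 : 0 ≤ P := integral_nonneg fun z => by positivity
  have hE0 : 0 ≤ E := integral_nonneg fun z => mul_nonneg (hme.pow_nonneg _) (by positivity)
  have hF0 : ∀ t, 0 ≤ cellIntegral (fun z => w z ^ 2) t := fun t =>
    integral_nonneg fun x => by positivity
  have h1 : ν * D ≤ lam * D := mul_le_mul_of_nonneg_right (min_le_left _ _) hD0
  have h2 : ν * K₄ ≤ K₄ := by
    simpa using mul_le_mul_of_nonneg_right (min_le_right lam 1) hK₄0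
  have h3 : ν * (D + K₄) ≤ cellIntegral (fun z => w z ^ 2) a + C₂ := by
    have := hF0 b
    linarith [mul_nonneg hν0.le hD0, mul_nonneg hν0.le hK₄0]
  have h4 : D + K₄ ≤ (cellIntegral (fun z => w z ^ 2) a + C₂) / ν := by
    rw [le_div_iff₀ hν0]; linarith
  have h5 : (0 : ℝ) ≤ m * P := by positivity
  have h6 : 0 ≤ ((m : ℝ) + 1) * (lam * m * E) := by positivity
  have h7 : (cellIntegral (fun z => w z ^ 2) a + C₂) / ν ≤
      (1 + C₂) / ν * (1 + cellIntegral (fun z => w z ^ 2) a) := by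
    rw [div_mul_eq_mul_div]
    gcongr
    nlinarith [hF0 a, mul_nonneg hC₂0 (hF0 a)]
  have h8 : C₃ ≤ C₃ * (1 + cellIntegral (fun z => w z ^ 2) a) := by
    nlinarith [mul_nonneg hC₃0 (hF0 a)]
  rw [one_mul, mul_add] at e3
  linarith

/-! ### Reduction of the problem to weak flows -/

lemma continuous_of_parabolic_holder {E : Type*} [SeminormedAddCommGroup E] {F : SpaceTime → E}
    {K θ : ℝ} (hθ : 0 < θ)
    (hF : ∀ z z', parabolicSize (z - z') ≤ 1 → ‖F z - F z'‖ ≤ K * parabolicSize (z - z') ^ θ) :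
    Continuous F := by
  rw [continuous_iff_continuousAt]
  intro z
  have hc : Continuous fun z' => parabolicSize (z' - z) := by
    unfold parabolicSize; fun_prop
  have h0 : parabolicSize (z - z) = 0 := by simp [parabolicSize]
  rw [ContinuousAt, tendsto_iff_norm_sub_tendsto_zero]
  have hlim : Tendsto (fun z' => K * parabolicSize (z' - z) ^ θ) (𝓝 z) (𝓝 0) := by
    have := ((hc.rpow_const fun _ => Or.inr hθ.le).tendsto z).const_mul K
    simpa only [h0, Real.zero_rpow hθ.ne', mul_zero] using this
  refine squeeze_zero' (Eventually.of_forall fun _ => norm_nonneg _) ?_ hlim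
  have : ∀ᶠ z' in 𝓝 z, parabolicSize (z' - z) < 1 :=
    hc.tendsto z |>.eventually (gt_mem_nhds (by rw [h0]; exact one_pos))
  filter_upwards [this] with z' hz'
  exact hF z' z hz'.le

lemma parabolicSize_eq_zero {z : SpaceTime} (h : parabolicSize z = 0) : z = 0 := by
  unfold parabolicSize at h
  have h1 := norm_nonneg z.1
  have h2 := Real.sqrt_nonneg |z.2|
  have h3 : ‖z.1‖ = 0 := by linarith
  have h4 : √|z.2| = 0 := by linarith
  ext1
  · simpa using h3
  · simpa [Real.sqrt_eq_zero (abs_nonneg _)] using h4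

lemma bounds_of_parHolderNorm_le_one {γ T : ℝ} {f : SpaceTime → ℝ} (h : parHolderNorm γ T f ≤ 1) :
    (∀ z ∈ slab T, |f z| ≤ 1) ∧
    ∀ z ∈ slab T, ∀ z' ∈ slab T, |f z - f z'| ≤ parabolicSize (z - z') ^ γ := by
  unfold parHolderNorm at h
  refine ⟨fun z hz => ?_, fun z hz z' hz' => ?_⟩
  · have h1 := (le_iSup₂ (f := fun z (_ : z ∈ slab T) => ENNReal.ofReal |f z|) z hz).trans
      (le_add_self.trans h)
    rwa [ENNReal.ofReal_le_one] at h1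
  · have h1 := (le_iSup₂ (f := fun z' (_ : z' ∈ slab T) =>
      ENNReal.ofReal (|f z - f z'| / parabolicSize (z - z') ^ γ)) z' hz').trans
      ((le_iSup₂ (f := fun z (_ : z ∈ slab T) => ⨆ z' ∈ slab T,
        ENNReal.ofReal (|f z - f z'| / parabolicSize (z - z') ^ γ)) z hz).trans
        (le_self_add.trans h))
    rw [ENNReal.ofReal_le_one] at h1
    rcases (parabolicSize_nonneg (z - z')).eq_or_lt with h0 | h0
    · rw [sub_eq_zero.1 (parabolicSize_eq_zero h0.symm), sub_self, abs_zero]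
      exact Real.rpow_nonneg (parabolicSize_nonneg _) _
    · rwa [div_le_one (Real.rpow_pos_of_pos h0 _)] at h1

/-- The projection of a point to the slab `ℝ² × [0, T]`. -/
def slabProj (T : ℝ) (z : SpaceTime) : SpaceTime := (z.1, max 0 (min z.2 T))

lemma slabProj_mem {T : ℝ} (hT : 0 ≤ T) (z : SpaceTime) : slabProj T z ∈ slab T :=
  ⟨le_max_left _ _, max_le hT (min_le_right _ _)⟩

lemma slabProj_of_mem {T : ℝ} {z : SpaceTime} (hz : z ∈ slab T) : slabProj T z = z := by
  have h1 : 0 ≤ z.2 ∧ z.2 ≤ T := hz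
  rw [slabProj, min_eq_left h1.2, max_eq_right h1.1]

/-- Clamping the time to `[0, T]` is a contraction, so freezing the function outside the interval
preserves its Hölder constant. -/
lemma parabolicSize_slabProj_sub_le (T : ℝ) (z z' : SpaceTime) :
    parabolicSize (slabProj T z - slabProj T z') ≤ parabolicSize (z - z') := by
  have h : |max 0 (min z.2 T) - max 0 (min z'.2 T)| ≤ |z.2 - z'.2| :=
    (abs_max_sub_max_le_max _ _ _ _).trans (by
      rw [sub_self, abs_zero, max_eq_right (abs_nonneg _)]
      refine (abs_min_sub_min_le_max _ _ _ _).trans ?_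
      rw [sub_self, abs_zero, max_eq_left (abs_nonneg _)])
  exact add_le_add le_rfl (Real.sqrt_le_sqrt h)

/-- Functions in `C^γ(𝕋² × [0, T])` extend to all times. -/
lemma MemParHolder.exists_extension {γ T : ℝ} (hγ : 0 < γ) (hγ1 : γ ≤ 1) (hT : 0 ≤ T)
    {w : SpaceTime → ℝ} (hw : MemParHolder γ T w) :
    ∃ v, Per v ∧ (∀ z ∈ slab T, v z = w z) ∧ ∃ K, 0 ≤ K ∧ HolderBdd γ K v := by
  -- A single smooth approximation at distance one shows that `w` itself is bounded and Hölder
  -- continuous.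
  obtain ⟨f, hf, hfp, hfw⟩ := hw.approx 1 one_pos
  obtain ⟨hb, hh⟩ := bounds_of_parHolderNorm_le_one hfw.le
  have hfP : Per f := fun k z => by
    have := hfp k z.1 z.2
    rwa [show (z.1 + latticeVec k, z.2) = z + (latticeVec k, 0) by ext1 <;> simp] at this
  obtain ⟨B, hB0, hB⟩ := exists_bound_of_per hfP hf.continuous (isCompact_Icc (a := 0) (b := T))
  have hfd : Per (fderiv ℝ f) := fun k z => by
    have e : (fun z => f (z + (latticeVec k, 0))) = f := funext (hfP k)
    rw [← fderiv_comp_add_right, e]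
  obtain ⟨L, hL0, hL⟩ := exists_bound_of_per hfd (hf.continuous_fderiv (by simp))
    (isCompact_Icc (a := 0) (b := T))
  have hconv : Convex ℝ (slab T) := (convex_Icc (0 : ℝ) T).linear_preimage (LinearMap.snd ℝ Plane ℝ)
  -- At parabolic distance at least one the supremum bound suffices; below one the parabolic size
  -- dominates the norm and the Lipschitz bound applies.
  have hfl : ∀ z ∈ slab T, ∀ z' ∈ slab T, |f z - f z'| ≤
      (2 * B + L) * parabolicSize (z - z') ^ γ := by
    intro z hz z' hz'
    have hps := parabolicSize_nonneg (z - z')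
    rcases le_total 1 (parabolicSize (z - z')) with h | h
    · have h1 : 1 ≤ parabolicSize (z - z') ^ γ := Real.one_le_rpow h hγ.le
      have h2 : |f z - f z'| ≤ B + B := (abs_sub _ _).trans (add_le_add (hB z hz) (hB z' hz'))
      nlinarith
    · have h1 : parabolicSize (z - z') ≤ parabolicSize (z - z') ^ γ := by
        simpa using Real.rpow_le_rpow_of_exponent_ge' hps h hγ.le hγ1
      have h2 := hconv.norm_image_sub_le_of_norm_fderiv_le (𝕜 := ℝ) (f := f)
        (fun y _ => (hf.differentiable (by simp)).differentiableAt) (fun y hy => hL y hy) hz' hz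
      have h3 : ‖z - z'‖ ≤ parabolicSize (z - z') := by
        have q1 := norm_nonneg (z - z').1
        have q2 := Real.sqrt_nonneg |(z - z').2|
        have q3 : √|(z - z').2| ≤ 1 := by
          unfold parabolicSize at h; linarith
        have q4 : |(z - z').2| ≤ √|(z - z').2| := by
          have := Real.mul_self_sqrt (abs_nonneg (z - z').2)
          nlinarith
        rw [Prod.norm_def, max_le_iff]
        unfold parabolicSize
        exact ⟨by linarith, by rw [Real.norm_eq_abs]; linarith⟩
      rw [← Real.norm_eq_abs]
      calc _ ≤ L * ‖z - z'‖ := h2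
        _ ≤ L * parabolicSize (z - z') ^ γ := mul_le_mul_of_nonneg_left (h3.trans h1) hL0
        _ ≤ _ := mul_le_mul_of_nonneg_right (by linarith) (Real.rpow_nonneg hps _)
  have hhold : ∀ z z', |w (slabProj T z) - w (slabProj T z')| ≤
      (2 * B + L + 1) * parabolicSize (z - z') ^ γ := by
    intro z z'
    have hm := slabProj_mem hT z
    have hm' := slabProj_mem hT z'
    have h1 := hfl _ hm _ hm'
    have h2 := hh _ hm _ hm'
    have h3 := Real.rpow_le_rpow (parabolicSize_nonneg _) (parabolicSize_slabProj_sub_le T z z') hγ.le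
    have h4 : |w (slabProj T z) - w (slabProj T z')| ≤
        |f (slabProj T z) - f (slabProj T z')| + |w (slabProj T z) - f (slabProj T z) -
          (w (slabProj T z') - f (slabProj T z'))| := by
      refine le_trans (le_of_eq ?_) (abs_add_le _ _)
      congr 1; ring
    nlinarith
  refine ⟨fun z => w (slabProj T z), fun k z => ?_, fun z hz => congrArg w (slabProj_of_mem hz),
    2 * B + L + 1, by positivity,
    continuous_of_parabolic_holder hγ fun z z' _ => hhold z z', fun z => ?_, hhold⟩
  · have h := slabProj_mem hT z
    have := hw.periodic k z.1 _ h
    simpa [slabProj] using this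
  · have h := slabProj_mem hT z
    have h1 := hb _ h
    have h2 := hB _ h
    rw [Real.norm_eq_abs] at h2
    have h3 : |w (slabProj T z)| ≤ |f (slabProj T z)| + |w (slabProj T z) - f (slabProj T z)| := by
      refine le_trans (le_of_eq ?_) (abs_add_le _ _)
      congr 1; ring
    linarith

lemma isOpen_openSlab (T : ℝ) : IsOpen (openSlab T) := isOpen_Ioo.preimage continuous_snd

lemma IsWeakSpatialGradient.locallyIntegrableOn {T : ℝ} {w : SpaceTime → ℝ} {G : SpaceTime → Plane}
    (hG : IsWeakSpatialGradient T w G) : LocallyIntegrableOn G (openSlab T) := by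
  rw [locallyIntegrableOn_iff (isOpen_openSlab T).isLocallyClosed]
  intro K hK hKc
  have : IsFiniteMeasure (volume.restrict K) := ⟨by simpa using hKc.measure_lt_top⟩
  exact (hG.memLp K hKc hK).integrable (by norm_num)

lemma integrable_inner_mul {U : Set SpaceTime} {G : SpaceTime → Plane}
    (hG : LocallyIntegrableOn G U) {φ : SpaceTime → ℝ} (hφ : Continuous φ)
    (hc : HasCompactSupport φ) (hU : tsupport φ ⊆ U) (v : Plane) :
    Integrable fun z => inner ℝ (G z) v * φ z := by
  have h1 := hG.integrableOn_compact_subset hU hc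
  obtain ⟨B, hB⟩ := hφ.bounded_above_of_compact_support hc
  have h2 : IntegrableOn (fun z => inner ℝ (G z) v * φ z) (tsupport φ) := by
    refine Integrable.mul_bdd (c := B) (h1.inner_const v) hφ.aestronglyMeasurable
      (ae_of_all _ hB)
  refine (integrableOn_iff_integrable_of_support_subset fun z hz => ?_).1 h2
  exact subset_tsupport _ (right_ne_zero_of_mul hz)

/-- The weak gradient of a periodic function is periodic. -/
lemma IsWeakSpatialGradient.ae_periodic {T : ℝ} {w v : SpaceTime → ℝ} {G : SpaceTime → Plane}
    (hG : IsWeakSpatialGradient T w G) (hv : Per v) (hvw : ∀ z ∈ openSlab T, v z = w z)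
    (k : Fin 2 → ℤ) : ∀ᵐ z, z ∈ openSlab T → G (z + (latticeVec k, 0)) = G z := by
  set κ : SpaceTime := (latticeVec k, 0) with hκ
  have hU := isOpen_openSlab T
  have hmem : ∀ z, z + κ ∈ openSlab T ↔ z ∈ openSlab T := fun z => by simp [openSlab, hκ]
  have hloc := hG.locallyIntegrableOn
  have hloc' : LocallyIntegrableOn (fun z => G (z + κ)) (openSlab T) := by
    rw [locallyIntegrableOn_iff hU.isLocallyClosed]
    intro K hK hKc
    have h1 : IntegrableOn G ((fun z => z + κ) '' K) := by
      refine hloc.integrableOn_compact_subset ?_ (hKc.image (continuous_add_const κ))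
      rintro _ ⟨z, hz, rfl⟩
      exact (hmem z).2 (hK hz)
    have := (measurePreserving_add_right volume κ).integrableOn_image
      (measurableEmbedding_addRight κ) (f := G) (s := K)
    exact this.1 h1
  have hv0 : ∀ φ : TestFn, tsupport φ ⊆ openSlab T → ∀ e : Plane,
      ∫ z, v z * fderiv ℝ φ z (e, 0) = - ∫ z, inner ℝ (G z) e * φ z := by
    intro φ hφ e
    rw [← hG.integral_eq φ hφ e]
    refine integral_congr_ae (ae_of_all _ fun z => ?_)
    by_cases hz : z ∈ openSlab T
    · simp only [hvw z hz]
    · have : fderiv ℝ φ z = 0 := by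
        by_contra h
        exact hz (hφ (support_fderiv_subset ℝ h))
      simp [this]
  -- Translating test functions shows that the translate of `G` is also a weak gradient of the same
  -- periodic function; the two agree by the fundamental lemma of the calculus of variations.
  have hcomp : ∀ e : Plane, ∀ᵐ z, z ∈ openSlab T → inner ℝ (G (z + κ) - G z) e = (0 : ℝ) := by
    intro e
    refine hU.ae_eq_zero_of_integral_contDiff_smul_eq_zero ?_ fun φ hφ hc hs => ?_
    · rw [locallyIntegrableOn_iff hU.isLocallyClosed]
      intro K hK hKc
      exact Integrable.inner_const (IntegrableOn.sub (hloc'.integrableOn_compact_subset hK hKc)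
        (hloc.integrableOn_compact_subset hK hKc)) e
    · have i1 := integrable_inner_mul hloc' hφ.continuous hc hs e
      have i2 := integrable_inner_mul hloc hφ.continuous hc hs e
      have e0 : ∀ z, φ z • inner ℝ (G (z + κ) - G z) e =
          inner ℝ (G (z + κ)) e * φ z - inner ℝ (G z) e * φ z := fun z => by
        rw [inner_sub_left, smul_eq_mul]; ring
      simp_rw [e0]
      rw [integral_sub i1 i2, sub_eq_zero]
      have hφ' : ContDiff ℝ (⊤ : ℕ∞) fun z => φ (z - κ) := hφ.comp (contDiff_id.sub contDiff_const)
      have hc' : HasCompactSupport fun z => φ (z - κ) :=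
        hc.comp_homeomorph (Homeomorph.subRight κ)
      have hs' : tsupport (fun z => φ (z - κ)) ⊆ openSlab T := by
        have : tsupport (fun z => φ (z - κ)) = (Homeomorph.subRight κ) ⁻¹' tsupport φ :=
          tsupport_comp_eq_preimage φ (Homeomorph.subRight κ)
        rw [this]
        intro z hz
        have := hs hz
        rw [← hmem] at this
        simpa using this
      have h1 := hv0 (TestFn.of φ hφ hc) hs e
      have h2 := hv0 (TestFn.of _ hφ' hc') hs' e
      simp only [TestFn.of_apply] at h1 h2
      have h3 : ∫ z, inner ℝ (G (z + κ)) e * φ z = ∫ z, inner ℝ (G z) e * φ (z - κ) := by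
        rw [← integral_add_right_eq_self (fun z => inner ℝ (G z) e * φ (z - κ)) κ]
        simp
      rw [h3, ← neg_inj]
      rw [← h1, ← h2]
      simp only [TestFn.coe_of]
      rw [← integral_add_right_eq_self (fun z => v z * fderiv ℝ (fun z => φ (z - κ)) z (e, 0)) κ]
      refine integral_congr_ae (ae_of_all _ fun z => ?_)
      simp only
      rw [hv k z, ← fderiv_comp_add_right]
      simp only [add_sub_cancel_right]
  filter_upwards [hcomp (EuclideanSpace.single 0 1), hcomp (EuclideanSpace.single 1 1)] with z h0 h1 hz
  rw [← sub_eq_zero]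
  ext i
  fin_cases i
  · simpa [EuclideanSpace.inner_single_right] using h0 hz
  · simpa [EuclideanSpace.inner_single_right] using h1 hz

/-- The weak gradient of a periodic function has a measurable, exactly periodic version. -/
lemma IsWeakSpatialGradient.exists_periodic {T : ℝ} {w v : SpaceTime → ℝ} {G₀ : SpaceTime → Plane}
    (hG : IsWeakSpatialGradient T w G₀) (hv : Per v) (hvw : ∀ z ∈ openSlab T, v z = w z) :
    ∃ G : SpaceTime → Plane, Measurable G ∧ Per G ∧ ∀ᵐ z, z ∈ openSlab T → G z = G₀ z := by
  have hm := hG.locallyIntegrableOn.aestronglyMeasurable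
  set G₁ := hm.mk G₀ with hG₁
  have hG₁m : Measurable G₁ := hm.stronglyMeasurable_mk.measurable
  have hae : ∀ᵐ z, z ∈ openSlab T → G₁ z = G₀ z := by
    rw [← ae_restrict_iff' (isOpen_openSlab T).measurableSet]
    filter_upwards [hm.ae_eq_mk] with z hz using hz.symm
  set κ : SpaceTime → Fin 2 → ℤ := fun z i => ⌊z.1 i⌋ with hκ
  have hκm : Measurable κ := measurable_pi_lambda _ fun i =>
    Int.measurable_floor.comp ((measurable_coord i).comp measurable_fst)
  -- The value is read off at the representative of `z` in the unit cell. This is exactly periodic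
  -- and, as there are countably many lattice vectors, still almost everywhere correct.
  refine ⟨fun z => G₁ (z - (latticeVec (κ z), 0)), ?_, fun k z => ?_, ?_⟩
  · refine hG₁m.comp (measurable_id.sub ((Measurable.prodMk ?_ measurable_const)))
    exact (measurable_of_countable latticeVec).comp hκm
  · have h1 : κ (z + (latticeVec k, 0)) = κ z + k := by
      ext i; simp [hκ, latticeVec]
    have h2 : latticeVec (κ z + k) = latticeVec (κ z) + latticeVec k := by
      ext i; simp [latticeVec]
    simp only [h1, h2]
    congr 1
    ext1 <;> simp
  · have h1 : ∀ᵐ z, ∀ k : Fin 2 → ℤ, z ∈ openSlab T → G₀ (z + (latticeVec k, 0)) = G₀ z :=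
      ae_all_iff.2 fun k => hG.ae_periodic hv hvw k
    have h2 : ∀ᵐ z, ∀ k : Fin 2 → ℤ, z + (latticeVec k, 0) ∈ openSlab T →
        G₁ (z + (latticeVec k, 0)) = G₀ (z + (latticeVec k, 0)) :=
      ae_all_iff.2 fun k => (measurePreserving_add_right volume
        ((latticeVec k, 0) : SpaceTime)).quasiMeasurePreserving.ae hae
    filter_upwards [h1, h2] with z h1 h2 hz
    have e : z - (latticeVec (κ z), 0) = z + (latticeVec (-κ z), 0) := by
      rw [sub_eq_add_neg]
      congr 1
      ext1
      · ext i; simp [latticeVec]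
      · simp
    simp only [e]
    rw [h2 (-κ z) (by simpa [openSlab] using hz), h1 _ hz]

lemma fderiv_testFn_eq_zero {φ : TestFn} {U : Set SpaceTime} (hφ : tsupport φ ⊆ U) {z : SpaceTime}
    (hz : z ∉ U) : fderiv ℝ φ z = 0 := by
  by_contra h
  exact hz (hφ (support_fderiv_subset ℝ h))

lemma testFn_eq_zero {φ : TestFn} {U : Set SpaceTime} (hφ : tsupport φ ⊆ U) {z : SpaceTime}
    (hz : z ∉ U) : φ z = 0 := by
  by_contra h
  exact hz (hφ (subset_tsupport _ h))

set_option maxHeartbeats 1000000 in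
/-- Weak solutions of the equation with oscillating coefficients are weak flows. -/
theorem exists_weakFlow : ∃ C, 0 < C ∧ ∀ (α γ lam Lam T T' M θ ε : ℝ)
    (A : SpaceTime → (Plane →L[ℝ] Plane)) (X₁ X₂ X₃ : Distr) (w : SpaceTime → ℝ),
    -1 ≤ α → 0 < γ → γ ≤ 1 → 0 < T' → T' ≤ T → 0 < M → 0 < θ → IsCoefficientField θ lam Lam A →
    MemNegHolder α X₁ → MemNegHolder α X₂ → MemNegHolder α X₃ →
    negHolderNorm α {z | z.2 ∈ Ioo (-1) (T + 1)} X₁ < ENNReal.ofReal M →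
    negHolderNorm α {z | z.2 ∈ Ioo (-1) (T + 1)} X₂ < ENNReal.ofReal M →
    negHolderNorm α {z | z.2 ∈ Ioo (-1) (T + 1)} X₃ < ENNReal.ofReal M →
    MemParHolder γ T' w → IsWeakSolution α T' (oscillating A ε) X₁ X₂ X₃ w →
    ∃ (v : SpaceTime → ℝ) (G H : SpaceTime → Plane),
      WeakFlow α γ lam Lam T' (3 * C * M) v G H ∧ ∀ z ∈ slab T', v z = w z := by
  obtain ⟨C, hC, hpair⟩ := exists_productPairing_const
  refine ⟨C, hC, fun α γ lam Lam T T' M θ ε A X₁ X₂ X₃ w hα hγ hγ1 hT' hTT hM hθ hA hX₁ hX₂ hX₃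
    hM₁ hM₂ hM₃ hw hsol => ?_⟩
  have hT : 0 < T := hT'.trans_le hTT
  obtain ⟨v, hvp, hvw, K, hK0, hvK⟩ := hw.exists_extension hγ hγ1 hT'.le
  obtain ⟨G₀, hG₀, hweak⟩ := hsol
  have hsub : openSlab T' ⊆ slab T' := fun z hz => ⟨hz.1.le, hz.2.le⟩
  have hvw' : ∀ z ∈ openSlab T', v z = w z := fun z hz => hvw z (hsub hz)
  obtain ⟨G, hGm, hGp, hGae⟩ := hG₀.exists_periodic hvp hvw'
  obtain ⟨L, hL⟩ := hA.holder
  have hAc : Continuous (oscillating A ε) :=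
    (continuous_of_parabolic_holder hθ hL).comp (by fun_prop)
  have hvφ : ∀ φ : TestFn, tsupport φ ⊆ openSlab T' → ∀ (n : ℕ) (z : SpaceTime),
      w z ^ n * φ z = v z ^ n * φ z := fun φ hφ n z => by
    by_cases hz : z ∈ openSlab T'
    · rw [hvw' z hz]
    · rw [testFn_eq_zero hφ hz, mul_zero, mul_zero]
  have hvd : ∀ φ : TestFn, tsupport φ ⊆ openSlab T' → ∀ (e z : SpaceTime),
      w z * fderiv ℝ φ z e = v z * fderiv ℝ φ z e := fun φ hφ e z => by
    by_cases hz : z ∈ openSlab T'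
    · rw [hvw' z hz]
    · rw [fderiv_testFn_eq_zero hφ hz, zero_apply, mul_zero, mul_zero]
  -- The products are formed with `w`, which is arbitrary outside the slab, but only their
  -- restriction to the support of `φ` matters, where `w` agrees with the continuous extension `v`.
  have hbound : ∀ (n : ℕ) (X : Distr) (φ : TestFn) (ℓ B : ℝ), MemNegHolder α X →
      negHolderNorm α {z | z.2 ∈ Ioo (-1) (T + 1)} X < ENNReal.ofReal M →
      tsupport φ ⊆ openSlab T' → HasProductPairing α (fun z => w z ^ n) X φ ℓ →
      ModBound α (fun z => v z ^ n * φ z) B → |ℓ| ≤ C * M * B := by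
    intro n X φ ℓ B hX hXM hφ hℓ ⟨β, b, hβ, hb, hs, hB⟩
    refine (hpair α M T X _ (fun z => v z ^ n * φ z) φ ℓ b hα hM hT hX hXM hℓ (hvφ φ hφ n)
      ((hvK.1.pow n).mul φ.contDiff.continuous) φ.hasCompactSupport.mul_left (fun z hz => ?_)
      hb hs).trans ?_
    · have := hsub (hφ (subset_tsupport _ (right_ne_zero_of_mul hz)))
      exact ⟨this.1, this.2.trans hTT⟩
    · exact mul_le_mul_of_nonneg_left (by linarith) (by positivity)
  -- The flux is the one part of the data that is not periodic; measurability comes from the Hölder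
  -- continuity of `A`, the bounds from its ellipticity.
  refine ⟨v, G, fun z => oscillating A ε z (G z), ⟨hvp, ⟨K, hK0, hvK.2.2⟩, ⟨K, hvK.2.1⟩, hGm, ?_, hGp,
    fun z => ?_, fun z => hA.elliptic _ _, fun a b ha hb => ?_, fun φ hφ e => ?_,
    fun φ hφ B₂ B₁ B₀ h₂ h₁ h₀ => ?_⟩, hvw⟩
  · exact isBoundedBilinearMap_apply.continuous.measurable.comp (hAc.measurable.prodMk hGm)
  · exact (ContinuousLinearMap.le_opNorm _ _).trans
      (mul_le_mul_of_nonneg_right (hA.bounded _) (norm_nonneg _))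
  · set S : Set SpaceTime := Metric.closedBall (0 : Plane) 2 ×ˢ Icc a b with hS
    have hSc : IsCompact S := (isCompact_closedBall _ _).prod isCompact_Icc
    have hSs : S ⊆ openSlab T' := fun z hz => ⟨ha.trans_le hz.2.1, hz.2.2.trans_lt hb⟩
    have h1 := (hG₀.memLp S hSc hSs).integrable_norm_pow (by norm_num)
    have h2 : unitCell ×ˢ Ioo a b ⊆ S := by
      refine prod_mono (fun x hx => ?_) Ioo_subset_Icc_self
      rw [mem_closedBall_zero_iff]
      refine (norm_le_of_coord zero_le_one fun i => ?_).trans (by norm_num)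
      rw [abs_le]
      exact ⟨by linarith [(hx i).1], (hx i).2.le⟩
    have h3 : IntegrableOn (fun z => ‖G₀ z‖ ^ 2) (unitCell ×ˢ Ioo a b) :=
      IntegrableOn.mono_set (show IntegrableOn _ S by simpa [IntegrableOn] using h1) h2
    refine Integrable.congr h3 ?_
    rw [EventuallyEq, ae_restrict_iff' (measurableSet_cyl a b)]
    filter_upwards [hGae] with z hz hz'
    rw [hz (hSs (h2 hz'))]
  · rw [← integral_congr_ae (ae_of_all _ (hvd φ hφ (e, 0))), hG₀.integral_eq φ hφ e]
    congr 1
    refine integral_congr_ae ?_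
    filter_upwards [hGae] with z hz
    by_cases h : z ∈ openSlab T'
    · rw [hz h]
    · rw [testFn_eq_zero hφ h, mul_zero, mul_zero]
  · obtain ⟨ℓ₁, ℓ₂, hℓ₁, hℓ₂, heq⟩ := hweak φ hφ
    have e1 := integral_congr_ae (μ := volume) (ae_of_all _ (hvd φ hφ (0, 1)))
    have e2 := integral_congr_ae (μ := volume) (ae_of_all _ (hvφ φ hφ 3))
    have e3 : ∫ z, fderiv ℝ φ z (oscillating A ε z (G₀ z), 0) =
        ∫ z, inner ℝ (sgrad φ z) (oscillating A ε z (G z)) := by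
      refine integral_congr_ae ?_
      filter_upwards [hGae] with z hz
      rw [inner_sgrad]
      by_cases h : z ∈ openSlab T'
      · rw [hz h]
      · rw [fderiv_testFn_eq_zero hφ h, zero_apply,
          zero_apply]
    rw [e1, e2, e3] at heq
    have b1 := hbound 2 X₁ φ ℓ₁ B₂ hX₁ hM₁ hφ hℓ₁ h₂
    have b2 := hbound 1 X₂ φ ℓ₂ B₁ hX₂ hM₂ hφ (by simpa using hℓ₂) (by simpa using h₁)
    -- The third distribution is treated as a product with `w ^ 0`.
    have b3 := hbound 0 X₃ φ (X₃ φ) B₀ hX₃ hM₃ hφ (by simpa using hasProductPairing_one (α := α) (X := X₃) φ)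
      (by simpa using h₀)
    have c1 := le_of_abs_le b1
    have c2 := neg_le_of_abs_le b2
    have c3 := le_of_abs_le b3
    -- The last term has coefficient one instead of three; nonnegativity allows the common factor `3
    -- * C * M`.
    have c4 : 0 ≤ C * M * B₀ := (abs_nonneg _).trans b3
    linarith

/-! ### From moments to norms, and the conclusion. -/

/-- Expand one factor of `(x + c) ^ p`: both `x ^ (p - 1)` and `max x 1 ^ 2` are at most `(x + c) ^
(p - 1)`, the latter because `p - 1 ≥ 2`. This converts a quadratic excess in the `p`-th moment into
an additive constant in the norm. -/
lemma add_pow_ge_of_sq {p : ℕ} (hp : 3 ≤ p) {x c : ℝ} (hx : 0 ≤ x) (hc : 1 ≤ c) :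
    x ^ p + c * max x 1 ^ 2 ≤ (x + c) ^ p := by
  obtain ⟨n, rfl⟩ : ∃ n, p = n + 1 := ⟨p - 1, by omega⟩
  have hc0 : 0 ≤ c := by linarith
  have h1 : x ^ n ≤ (x + c) ^ n := pow_le_pow_left₀ hx (by linarith) n
  have h2 : max x 1 ^ 2 ≤ (x + c) ^ n := by
    have h3 : max x 1 ≤ x + c := max_le (by linarith) (by linarith)
    calc _ ≤ (x + c) ^ 2 := pow_le_pow_left₀ (by positivity) h3 2
      _ ≤ _ := pow_le_pow_right₀ (by linarith) (by omega)
  rw [pow_succ' (x + c), add_mul, pow_succ' x]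
  exact add_le_add (mul_le_mul_of_nonneg_left h1 hx) (mul_le_mul_of_nonneg_left h2 hc0)

/-- The second moment on the torus is controlled by the `p`-th one. -/
lemma cellIntegral_sq_le {w : SpaceTime → ℝ} (hw : Continuous w) {B : ℝ} (hB : ∀ z, |w z| ≤ B)
    {p : ℕ} (hp : Even p) (hp2 : 2 ≤ p) (t : ℝ) {x s : ℝ} (hx : 0 ≤ x)
    (hxp : cellIntegral (fun z => w z ^ p) t = x ^ p) (hs : s = max x 1) :
    cellIntegral (fun z => w z ^ 2) t ≤ ((volume unitCell).toReal + 1) * s ^ 2 := by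
  have hfin : IsFiniteMeasure (volume.restrict unitCell) := ⟨by simpa using volume_unitCell_lt_top⟩
  have hs1 : 1 ≤ s := hs ▸ le_max_right _ _
  have hxs : x ≤ s := hs ▸ le_max_left _ _
  have hs0 : 0 < s := by linarith
  have hi : ∀ n, IntegrableOn (fun y : Plane => w (y, t) ^ n) unitCell := fun n =>
    Integrable.of_bound ((hw.comp (by fun_prop)).pow n).aestronglyMeasurable (B ^ n)
      (ae_of_all _ fun y => by
        rw [norm_pow]
        exact pow_le_pow_left₀ (norm_nonneg _) (hB _) n)
  -- Split at `|y| = s`. Taking `s ≥ 1` rather than the norm itself avoids division by zero.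
  have hpt : ∀ y : ℝ, y ^ 2 ≤ s ^ 2 + y ^ p * (s ^ (p - 2))⁻¹ := by
    intro y
    have h0 := hp.pow_nonneg y
    rcases le_total |y| s with h | h
    · have h1 := pow_le_pow_left₀ (abs_nonneg y) h 2
      rw [sq_abs] at h1
      have : 0 ≤ y ^ p * (s ^ (p - 2))⁻¹ := by positivity
      linarith
    · have h1 := pow_le_pow_left₀ hs0.le h (p - 2)
      have h2 : y ^ p = y ^ 2 * |y| ^ (p - 2) := by
        rw [← hp.pow_abs, ← sq_abs, ← pow_add]
        congr 1; omega
      have h3 : y ^ 2 ≤ y ^ p * (s ^ (p - 2))⁻¹ := by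
        rw [← div_eq_mul_inv, le_div_iff₀ (by positivity), h2]
        exact mul_le_mul_of_nonneg_left h1 (sq_nonneg _)
      nlinarith [sq_nonneg s]
  have hic : IntegrableOn (fun _ : Plane => s ^ 2) unitCell :=
    integrableOn_const volume_unitCell_lt_top.ne
  have hip : IntegrableOn (fun y : Plane => w (y, t) ^ p * (s ^ (p - 2))⁻¹) unitCell :=
    (hi p).mul_const _
  have his : IntegrableOn (fun y : Plane => s ^ 2 + w (y, t) ^ p * (s ^ (p - 2))⁻¹) unitCell :=
    hic.add hip
  calc cellIntegral (fun z => w z ^ 2) t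
      ≤ ∫ y in unitCell, (s ^ 2 + w (y, t) ^ p * (s ^ (p - 2))⁻¹) :=
        integral_mono (hi 2) his fun y => hpt _
    _ = (volume unitCell).toReal * s ^ 2 + x ^ p * (s ^ (p - 2))⁻¹ := by
        rw [integral_add hic hip, integral_mul_const, setIntegral_const, smul_eq_mul]
        rw [← hxp]
        rfl
    _ ≤ (volume unitCell).toReal * s ^ 2 + s ^ 2 := by
        have h1 : x ^ p ≤ s ^ 2 * s ^ (p - 2) := by
          rw [← pow_add, show 2 + (p - 2) = p by omega]
          exact pow_le_pow_left₀ hx hxs p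
        have h2 : x ^ p * (s ^ (p - 2))⁻¹ ≤ s ^ 2 := by
          rw [← div_eq_mul_inv, div_le_iff₀ (by positivity)]
          exact h1
        linarith
    _ = _ := by ring

lemma torusLpNorm_eq {w v : SpaceTime → ℝ} (hv : Continuous v) {B : ℝ} (hB : ∀ z, |v z| ≤ B)
    {p : ℕ} (hp : Even p) (hp0 : p ≠ 0) {t : ℝ} (hvw : ∀ x : Plane, v (x, t) = w (x, t)) :
    torusLpNorm p w t = ENNReal.ofReal (cellIntegral (fun z => v z ^ p) t ^ ((p : ℝ)⁻¹)) := by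
  have hfin : IsFiniteMeasure (volume.restrict unitCell) := ⟨by simpa using volume_unitCell_lt_top⟩
  have hm : MemLp (fun x : Plane => v (x, t)) (p : ℝ≥0∞) (volume.restrict unitCell) :=
    MemLp.of_bound (hv.comp (by fun_prop)).aestronglyMeasurable B (ae_of_all _ fun x => hB _)
  unfold torusLpNorm
  simp only [← hvw]
  rw [hm.eLpNorm_eq_integral_rpow_norm (by exact_mod_cast hp0) (ENNReal.natCast_ne_top p)]
  simp only [ENNReal.toReal_natCast, Real.rpow_natCast, cellIntegral, Real.norm_eq_abs, hp.pow_abs]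

theorem theorem3p3 :
    ∃ p₀ : ℕ, ∀ p : ℕ, Even p → p₀ ≤ p →
    ∃ α₀ : ℝ, 0 < α₀ ∧ ∀ α : ℝ, -α₀ < α → α < 0 →
    ∀ lam Lam T M : ℝ, 0 < lam → lam ≤ Lam → 0 < T → 0 < M →
    ∃ C : ℝ, 0 < C ∧
    ∀ (θ : ℝ) (A : SpaceTime → (Plane →L[ℝ] Plane)), θ ∈ Set.Ioo (0 : ℝ) 1 →
      IsCoefficientField θ lam Lam A →
    ∀ ε γ T' : ℝ, ε ∈ Set.Ioc (0 : ℝ) 1 → γ ∈ Set.Ioo (-α) 1 → T' ∈ Set.Ioc 0 T →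
    ∀ X₁ X₂ X₃ : Distr,
      MemNegHolder α X₁ → MemNegHolder α X₂ → MemNegHolder α X₃ →
      negHolderNorm α {z | z.2 ∈ Set.Ioo (-1) (T + 1)} X₁ < ENNReal.ofReal M →
      negHolderNorm α {z | z.2 ∈ Set.Ioo (-1) (T + 1)} X₂ < ENNReal.ofReal M →
      negHolderNorm α {z | z.2 ∈ Set.Ioo (-1) (T + 1)} X₃ < ENNReal.ofReal M →
    ∀ w : SpaceTime → ℝ, MemParHolder γ T' w →
      IsWeakSolution α T' (oscillating A ε) X₁ X₂ X₃ w →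
      (⨆ t ∈ Set.Icc 0 T', torusLpNorm p w t) ≤ torusLpNorm p w 0 + ENNReal.ofReal C := by
  -- The threshold on `α` is the exponent of the modulus for products of degree `p + 1`. The final
  -- step asks for `p ≥ 3`, and `4` is the first even such integer.
  refine ⟨4, fun p hp hp4 => ⟨1 / ((p + 2 : ℕ) : ℝ), by positivity, fun α hα hα0 lam Lam T M hlam
    hlL hT hM => ?_⟩⟩
  have hp0 : p ≠ 0 := by omega
  have hα1 : -1 ≤ α := by
    have : 1 / ((p + 2 : ℕ) : ℝ) ≤ 1 := by
      rw [div_le_one (by positivity)]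
      exact_mod_cast (by omega : 1 ≤ p + 2)
    linarith
  obtain ⟨C₁, hC₁, hflow⟩ := exists_weakFlow
  obtain ⟨C₂, hC₂, hbound⟩ := exists_cellIntegral_pow_le hp (by omega) (α := α) (by linarith) hlam
    (hlam.le.trans hlL) hT.le (Q := 3 * C₁ * M) (by positivity)
  set V := (volume unitCell).toReal with hV
  -- `V + 1` bounds the second moment in units of `max x 1 ^ 2`, one more accounts for the constant
  -- term, and the leading `1` ensures `c ≥ 1`.
  set c := 1 + C₂ * (V + 2) with hc
  have hc1 : 1 ≤ c := by
    have : 0 ≤ C₂ * (V + 2) := by positivity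
    linarith
  refine ⟨c, by positivity, fun θ A hθ hA ε γ T' _ hγ hT' X₁ X₂ X₃ hX₁ hX₂ hX₃ hM₁ hM₂ hM₃ w hw
    hsol => ?_⟩
  have hγ0 : 0 < γ := by linarith [hγ.1]
  obtain ⟨v, G, H, hf, hvw⟩ := hflow α γ lam Lam T T' M θ ε A X₁ X₂ X₃ w hα1 hγ0 hγ.2.le hT'.1
    hT'.2 hM hθ.1 hA hX₁ hX₂ hX₃ hM₁ hM₂ hM₃ hw hsol
  obtain ⟨K, hK0, hK⟩ := hf.exists_holderBdd hγ0
  have hF : ∀ n, Continuous (cellIntegral fun z => v z ^ n) := fun n => by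
    obtain ⟨L, -, hL⟩ := exists_holderBdd_pow (γ := γ) hK0 n
    exact (hL v hK).continuous_cellIntegral hγ0
  have hF0 : ∀ t, 0 ≤ cellIntegral (fun z => v z ^ p) t := fun t =>
    integral_nonneg fun x => hp.pow_nonneg _
  set R := cellIntegral (fun z => v z ^ p) 0 + C₂ * (1 + cellIntegral (fun z => v z ^ 2) 0) with hR
  -- The equation gives information only for `0 < a ≤ b < T'`. Continuity of the moments in time
  -- lets `a` tend to `0` and, in the next step, extends the bound to both endpoints.
  have hopen : ∀ b ∈ Ioo 0 T', cellIntegral (fun z => v z ^ p) b ≤ R := by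
    intro b hb
    have hlim := ((hF p).add (((hF 2).const_add 1).const_mul C₂)).tendsto 0
    refine ge_of_tendsto (hlim.mono_left (nhdsWithin_le_nhds (s := Ioi 0))) ?_
    filter_upwards [Ioo_mem_nhdsGT hb.1] with a ha
    exact hbound γ T' v G H hγ0 hγ.2.le (by linarith [hγ.1]) hT'.2 hf a b ha.1 ha.2.le hb.2
  have hclosed : ∀ b ∈ Icc 0 T', cellIntegral (fun z => v z ^ p) b ≤ R := by
    rw [← closure_Ioo hT'.1.ne]
    exact fun b hb => closure_minimal hopen (isClosed_le (hF p) continuous_const) hb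
  set x := cellIntegral (fun z => v z ^ p) 0 ^ ((p : ℝ)⁻¹) with hx
  have hx0 : 0 ≤ x := Real.rpow_nonneg (hF0 0) _
  have hxp : cellIntegral (fun z => v z ^ p) 0 = x ^ p := (Real.rpow_inv_natCast_pow (hF0 0) hp0).symm
  have hsq := cellIntegral_sq_le hK.1 hK.2.1 hp (by omega) 0 hx0 hxp rfl
  -- The second moment is at most a multiple of `max x 1 ^ 2`, so the excess over `x ^ p` fits under
  -- the `p`-th power of `x + c`.
  have hRle : R ≤ (x + c) ^ p := by
    refine le_trans ?_ (add_pow_ge_of_sq (by omega) hx0 hc1)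
    rw [hR, hxp]
    have h1 : 1 ≤ max x 1 ^ 2 := one_le_pow₀ (le_max_right _ _)
    have h2 : C₂ * (1 + cellIntegral (fun z => v z ^ 2) 0) ≤ C₂ * ((V + 2) * max x 1 ^ 2) := by
      refine mul_le_mul_of_nonneg_left ?_ hC₂
      linarith
    have h3 : 0 ≤ max x 1 ^ 2 := by positivity
    rw [hc]
    linarith
  have hslab : ∀ t ∈ Icc 0 T', ∀ y : Plane, v (y, t) = w (y, t) := fun t ht y => hvw _ ht
  refine iSup₂_le fun t ht => ?_
  rw [torusLpNorm_eq hK.1 hK.2.1 hp hp0 (hslab t ht),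
    torusLpNorm_eq hK.1 hK.2.1 hp hp0 (hslab 0 ⟨le_rfl, hT'.1.le⟩), ← hx,
    ← ENNReal.ofReal_add hx0 (by positivity)]
  refine ENNReal.ofReal_le_ofReal ?_
  rw [Real.rpow_inv_le_iff_of_pos (hF0 t) (by positivity) (by positivity), Real.rpow_natCast]
  exact (hclosed t ht).trans hRle

end
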